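/- **Setting.** Let $n,d\ge 1$. The unknown system is $x_{t+1}=A_*x_t+B_*u_t+w_t$, $x_0=0$, $x_t\in\mathbb R^n$, $u_t\in\mathbb R^d$, $\Theta_*^\top=[A_*\ B_*]$, $z_t=(x_t,u_t)$, with i.i.d. noise $w_t\sim\mathcal N(0,\sigma_w^2I)$, $\sigma_w>0$, independent of the past and of the random numbers used by the algorithm. The cost is $c_t=x_t^\top Qx_t+u_t^\top Ru_t$, where $Q,R$ are known positive definite matrices with $\|Q\|,\|R\|<\bar\alpha$ and $\sigma_{\min}(Q),\sigma_{\min}(R)>\underline\alpha>0$. For a stabilizable $\Theta^\top=[A\ B]$ let $P(\Theta)$ be the positive definite solution of the Riccati equation $P=A^\top PA+Q-A^\top PB(R+B^\top PB)^{-1}B^\top PA$, let $K(\Theta)=-(R+B^\top P(\Theta)B)^{-1}B^\top P(\Theta)A$, and let $J(\Theta)$ be the optimal average expected cost, i.e. the limit as $N\to\infty$ of $1/N$ times the least expected cost of $N$ steps over all causal policies. $\Theta$ is $(\kappa,\gamma)$-stabilizable if $\|K(\Theta)\|\le\kappa$ and $A+BK(\Theta)=HLH^{-1}$ with $H\succ0$,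 $\|L\|\le1-\gamma$ and $\|H\|\|H^{-1}\|\le\kappa$. Fix $\kappa\ge1$, $0<\gamma\le1$, $S$. A Borel set $\mathcal S$ of $(\kappa,\gamma)$-stabilizable systems with $\|\Theta\|_F\le S$ is known, and $\Theta_*$ is an interior point of $\mathcal S$. The regret is $R_T=\sum_{t=0}^T(c_t-J(\Theta_*))$. **Algorithm (TSAC)** with horizon $T$, $\delta\in(0,1)$ and exploration length $T_w$. Put $\mu=(1+\kappa^2)X_s^2$ with $X_s=(12\kappa^2+2\kappa\sqrt2)\gamma^{-1}\sigma_w\sqrt{2n\log(n(T-T_w)/\delta)}$, $V_t=\mu I+\sum_{s<t}z_sz_s^\top$, $\hat\Theta_t=V_t^{-1}\sum_{s<t}z_sx_{s+1}^\top$ and $\beta_t=\sigma_w\sqrt{2n\log\big(\det(V_t)^{1/2}/(\delta\det(\mu I)^{1/2})\big)}+\sqrt\mu\,S$. At the times $t$ that are multiples of $\tau_0=\lceil2\gamma^{-1}\log(2\kappa\sqrt2)\rceil$, a model $\tilde\Theta$ is drawn by rejection sampling: fresh matrices $\eta\in\mathbb R^{(n+d)\times n}$ with independent standard normal entries are drawn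 until $\hat\Theta_t+\beta_tV_t^{-1/2}\eta\in\mathcal S$. In the following $\tau_0$ steps the input is $u_t=K(\tilde\Theta)x_t+\nu_t$ with independent $\nu_t\sim\mathcal N(0,2\kappa^2\sigma_w^2I)$ if $t\le T_w$, and $u_t=K(\tilde\Theta)x_t$ if $t>T_w$. **Theorem.** There are constants $C,k,m$ that depend only on $\kappa,\gamma,\underline\alpha,\bar\alpha,S,\sigma_w$ such that the following holds for all $n,d,Q,R,\mathcal S,\Theta_*$ as above, all $\delta\in(0,1)$, all $T_0\in\mathbb R$ (for instance any polynomial in $\log(1/\delta),\sigma_w^{-1},n,d,\bar\alpha,\gamma^{-1},\kappa$), all $c>0$ and all real sequences $\varepsilon_T\to0$. 1. Let $T_w=\max\big(T_0,\,c(\sqrt T\log T)^{1+\varepsilon_T}\big)$. Then for all large enough $T$, with probability at least $1-10\delta$, $$R_T\le C\,(n+d)^{n+d}\sqrt{T\log(1/\delta)}\;(\log T)^k\,(\sqrt T\log T)^{|\varepsilon_T|}.$$ In particular $R_T=\tilde O\big((n+d)^{n+d}\sqrt{T\log(1/\delta)}\big)$ whenever $(\sqrt T\log T)^{|\varepsilon_T|}$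 is at most a power of $\log T$, e.g. for $\varepsilon_T=0$. 2. Suppose that $A_*+B_*K(\Theta_*)$ is non-singular and that $(\log T)^{\varepsilon_T}\to\infty$, and let $T_w=\max\big(T_0,\,c(\log T)^{1+\varepsilon_T}\big)$. Then for all large enough $T$, with probability at least $1-10\delta$, $$R_T\le C\,(n+d)^m\sqrt{T\log(1/\delta)}\;(\log T)^k,$$ that is, $R_T=\tilde O\big(\mathrm{poly}(n,d)\sqrt{T\log(1/\delta)}\big)$. Here "large enough" may depend on all the data that are fixed before $T$. -/

import Mathlib

open Matrix MeasureTheory ProbabilityTheory Filter Topology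
open scoped Matrix.Norms.L2Operator NNReal ENNReal

namespace TSAC

noncomputable section

/-- A linear system `(A, B)` with state dimension `n` and input dimension `d`, stored as the
`(n + d) × n` matrix `Θ` with `Θᵀ = [A  B]`. -/
abbrev Sys (n d : ℕ) : Type := Matrix (Fin n ⊕ Fin d) (Fin n) ℝ

/-- The state matrix `A` of `Θᵀ = [A  B]`. -/
def Sys.A {n d : ℕ} (Θ : Sys n d) : Matrix (Fin n) (Fin n) ℝ := (Matrix.toRows₁ Θ)ᵀ

/-- The input matrix `B` of `Θᵀ = [A  B]`. -/
def Sys.B {n d : ℕ} (Θ : Sys n d) : Matrix (Fin n) (Fin d) ℝ := (Matrix.toRows₂ Θ)ᵀ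

/-- The Frobenius norm `√tr(Θᵀ Θ)`. -/
def Sys.frob {n d : ℕ} (Θ : Sys n d) : ℝ := √((Θᵀ * Θ).trace)

/-- `P` is a positive definite solution of the discrete algebraic Riccati equation. -/
def IsDARESolution {n d : ℕ} (Q : Matrix (Fin n) (Fin n) ℝ) (R : Matrix (Fin d) (Fin d) ℝ)
    (Θ : Sys n d) (P : Matrix (Fin n) (Fin n) ℝ) : Prop :=
  P.PosDef ∧
    P = Θ.Aᵀ * P * Θ.A + Q - Θ.Aᵀ * P * Θ.B * (R + Θ.Bᵀ * P * Θ.B)⁻¹ * Θ.Bᵀ * P * Θ.A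

open Classical in
/-- `P(Θ)`: the positive definite solution of the Riccati equation. For positive definite `Q`, `R`
there is at most one, and there is one if and only if `Θ` is stabilizable. -/
def riccati {n d : ℕ} (Q : Matrix (Fin n) (Fin n) ℝ) (R : Matrix (Fin d) (Fin d) ℝ)
    (Θ : Sys n d) : Matrix (Fin n) (Fin n) ℝ :=
  if h : ∃ P, IsDARESolution Q R Θ P then h.choose else 0

/-- `K(Θ) = -(R + Bᵀ P(Θ) B)⁻¹ Bᵀ P(Θ) A`: the gain of the optimal controller of `Θ`. -/
def gain {n d : ℕ} (Q : Matrix (Fin n) (Fin n) ℝ) (R : Matrix (Fin d) (Fin d) ℝ)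
    (Θ : Sys n d) : Matrix (Fin d) (Fin n) ℝ :=
  -((R + Θ.Bᵀ * riccati Q R Θ * Θ.B)⁻¹ * Θ.Bᵀ * riccati Q R Θ * Θ.A)

/-- The optimal closed-loop matrix `A + B K(Θ)` of `Θ`. -/
def closedLoop {n d : ℕ} (Q : Matrix (Fin n) (Fin n) ℝ) (R : Matrix (Fin d) (Fin d) ℝ)
    (Θ : Sys n d) : Matrix (Fin n) (Fin n) ℝ :=
  Θ.A + Θ.B * gain Q R Θ

/-- `(κ, γ)`-stabilizability: `‖K(Θ)‖ ≤ κ` and `A + B K(Θ) = H L H⁻¹` with `H ≻ 0`,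
`‖L‖ ≤ 1 - γ`, `‖H‖ ‖H⁻¹‖ ≤ κ` (spectral norms). If the Riccati equation had no positive definite
solution, then `K(Θ)` would be the junk value `0` and `A = H L H⁻¹` would be stable for `0 < γ`, so
that there is a solution after all: the junk value never occurs here. -/
def IsStabilizable {n d : ℕ} (Q : Matrix (Fin n) (Fin n) ℝ) (R : Matrix (Fin d) (Fin d) ℝ)
    (κ γ : ℝ) (Θ : Sys n d) : Prop :=
  ‖gain Q R Θ‖ ≤ κ ∧
    ∃ H L : Matrix (Fin n) (Fin n) ℝ, H.PosDef ∧ closedLoop Q R Θ = H * L * H⁻¹ ∧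
      ‖L‖ ≤ 1 - γ ∧ ‖H‖ * ‖H⁻¹‖ ≤ κ

/-- The quadratic cost `xᵀ Q x + uᵀ R u` of one time step. -/
def stepCost {n d : ℕ} (Q : Matrix (Fin n) (Fin n) ℝ) (R : Matrix (Fin d) (Fin d) ℝ)
    (x : Fin n → ℝ) (u : Fin d → ℝ) : ℝ :=
  x ⬝ᵥ (Q *ᵥ x) + u ⬝ᵥ (R *ᵥ u)

/-! ### The optimal average expected cost -/

/-- A causal policy: the input at time `t` is a measurable function of the states
`x₀, …, x_t`. -/
structure Policy (n d : ℕ) where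
  act : (t : ℕ) → (Fin (t + 1) → Fin n → ℝ) → Fin d → ℝ
  measurable_act : ∀ t, Measurable (act t)

/-- The states `x₀, …, x_t` when the system `Θ` is run with the policy `π` from `x₀ = 0`, under the
noise sequence `w`: `x_{t+1} = A x_t + B u_t + w_t`. -/
def Policy.history {n d : ℕ} (π : Policy n d) (Θ : Sys n d) (w : ℕ → Fin n → ℝ) :
    (t : ℕ) → Fin (t + 1) → Fin n → ℝ
  | 0 => fun _ => 0
  | t + 1 =>
    let h := π.history Θ w t
    Fin.snoc (α := fun _ => Fin n → ℝ) h
      (Θ.A *ᵥ h (Fin.last t) + Θ.B *ᵥ π.act t h + w t)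

/-- The law of an i.i.d. sequence of `N(0, σ² I)` vectors. -/
def noiseLaw (n : ℕ) (σ : ℝ) : Measure (ℕ → Fin n → ℝ) :=
  Measure.infinitePi fun _ => Measure.pi fun _ => gaussianReal 0 (Real.toNNReal (σ ^ 2))

/-- The expected cost of the first `N` time steps under the policy `π`. -/
def Policy.expectedCost {n d : ℕ} (π : Policy n d) (Q : Matrix (Fin n) (Fin n) ℝ)
    (R : Matrix (Fin d) (Fin d) ℝ) (σ : ℝ) (Θ : Sys n d) (N : ℕ) : ℝ≥0∞ :=
  ∫⁻ w, ∑ t ∈ Finset.range N, ENNReal.ofReal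
    (stepCost Q R (π.history Θ w t (Fin.last t)) (π.act t (π.history Θ w t))) ∂(noiseLaw n σ)

/-- `J(Θ)`: the limit, as the horizon `N` grows, of the least expected cost per time step over all
causal policies. The limit exists for stabilizable `Θ`; it is written as an upper limit. -/
def optAvgCost {n d : ℕ} (Q : Matrix (Fin n) (Fin n) ℝ) (R : Matrix (Fin d) (Fin d) ℝ) (σ : ℝ)
    (Θ : Sys n d) : ℝ :=
  (limsup (fun N : ℕ => (⨅ π : Policy n d, π.expectedCost Q R σ Θ N) / (N : ℝ≥0∞))
    atTop).toReal

/-! ### The random inputs of a run -/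

/-- Labels of the scalar random variables that drive a run: the coordinates of the process noise
`w_t`, of the exploration noise `ν_t`, and the entries of the `j`-th candidate Gaussian matrix of
the `i`-th Thompson sampling step. -/
inductive NoiseIdx (n d : ℕ) : Type
  | w (t : ℕ) (r : Fin n)
  | ν (t : ℕ) (r : Fin d)
  | η (i j : ℕ) (r : Fin n ⊕ Fin d) (s : Fin n)

/-- The variances: `w_t ∼ N(0, σ² I)`, `ν_t ∼ N(0, 2 κ² σ² I)`, and standard normal entries for the
sampling matrices. -/
def noiseVar {n d : ℕ} (κ σ : ℝ) : NoiseIdx n d → ℝ≥0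
  | .w _ _ => Real.toNNReal (σ ^ 2)
  | .ν _ _ => Real.toNNReal (2 * κ ^ 2 * σ ^ 2)
  | .η _ _ _ _ => 1

/-- All the driving random variables are independent centred Gaussians. In particular `w_t` is
`N(0, σ² I)` given the `σ`-algebra `𝓕_t` generated by `w₀, …, w_{t-1}` and the random numbers of the
algorithm, for which `x_t` and `u_t` are measurable. -/
structure IsNoise {n d : ℕ} (κ σ : ℝ) {Ω : Type*} [MeasurableSpace Ω] (P : Measure Ω)
    (ξ : NoiseIdx n d → Ω → ℝ) : Prop where
  indep : iIndepFun ξ P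
  law : ∀ a, HasLaw (ξ a) (gaussianReal 0 (noiseVar κ σ a)) P

/-! ### The algorithm -/

/-- The data of a run of the algorithm: the true system `Θs`, the cost matrices, the set `M` of
admissible models, `κ`, `γ`, the bound `S` on the Frobenius norm of the models, the noise level `σ`,
the confidence parameter `δ`, the regularizer `μ` and the length `Tw` of the exploration phase. -/
structure Setup (n d : ℕ) where
  Θs : Sys n d
  Q : Matrix (Fin n) (Fin n) ℝ
  R : Matrix (Fin d) (Fin d) ℝ
  M : Set (Sys n d)
  κ : ℝ
  γ : ℝ
  S : ℝ
  σ : ℝ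
  δ : ℝ
  μ : ℝ
  Tw : ℝ

/-- What is known just before acting at time `t`: the state `x_t`, the design matrix
`V_t = μ I + ∑_{s < t} z_s z_sᵀ`, the matrix `Y_t = ∑_{s < t} z_s x_{s+1}ᵀ`, and the most recently
sampled model. -/
structure RunState (n d : ℕ) where
  x : Fin n → ℝ
  V : Matrix (Fin n ⊕ Fin d) (Fin n ⊕ Fin d) ℝ
  Y : Sys n d
  model : Sys n d

namespace Setup

variable {n d : ℕ} (p : Setup n d)

/-- The number of time steps for which each sampled policy is kept: `2 γ⁻¹ log(2 κ √2)`, rounded up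
to an integer. -/
def τ₀ : ℕ := ⌈2 * p.γ⁻¹ * Real.log (2 * p.κ * √2)⌉₊

/-- The confidence radius
`β = σ √(2 n log(det(V)^{1/2} / (δ det(μ I)^{1/2}))) + √μ S`. -/
def β (V : Matrix (Fin n ⊕ Fin d) (Fin n ⊕ Fin d) ℝ) : ℝ :=
  p.σ * √(2 * n * Real.log (√V.det /
      (p.δ * √(p.μ • (1 : Matrix (Fin n ⊕ Fin d) (Fin n ⊕ Fin d) ℝ)).det)))
    + √p.μ * p.S

/-- The perturbed estimate `V⁻¹ Y + β V^{-1/2} η`, where `V⁻¹ Y` is the regularized least squares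
estimate. -/
def candidate (V : Matrix (Fin n ⊕ Fin d) (Fin n ⊕ Fin d) ℝ) (Y η : Sys n d) : Sys n d :=
  V⁻¹ * Y + p.β V • (cfc (fun v : ℝ => (√v)⁻¹) V * η)

/-- Rejection sampling: the first of the candidates, drawn with the independent Gaussian matrices
`η 0, η 1, …`, that belongs to the model set `M`. -/
def sample (V : Matrix (Fin n ⊕ Fin d) (Fin n ⊕ Fin d) ℝ) (Y : Sys n d) (η : ℕ → Sys n d) :
    Sys n d :=
  p.candidate V Y (η (sInf {j | p.candidate V Y (η j) ∈ p.M}))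

/-- The model in use at time `t`: a fresh sample at the multiples of `τ₀`, the previous one at other
times. -/
def currentModel (ω : NoiseIdx n d → ℝ) (t : ℕ) (s : RunState n d) : Sys n d :=
  if p.τ₀ ∣ t then p.sample s.V s.Y (fun j => Matrix.of fun r c => ω (.η (t / p.τ₀) j r c))
  else s.model

/-- The input at time `t`: `K(Θ̃) x_t + ν_t` for `t ≤ Tw` and `K(Θ̃) x_t` for `t > Tw`. -/
def input (ω : NoiseIdx n d → ℝ) (t : ℕ) (s : RunState n d) : Fin d → ℝ :=
  gain p.Q p.R (p.currentModel ω t s) *ᵥ s.x + (if (t : ℝ) ≤ p.Tw then fun r => ω (.ν t r) else 0)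

/-- One time step: the input is applied to the true system, `x_{t+1} = A x_t + B u_t + w_t`, and the
regression data are updated with `z_t = (x_t, u_t)`. -/
def step (ω : NoiseIdx n d → ℝ) (t : ℕ) (s : RunState n d) : RunState n d :=
  let u := p.input ω t s
  let z : Fin n ⊕ Fin d → ℝ := Sum.elim s.x u
  let x' : Fin n → ℝ := p.Θs.A *ᵥ s.x + p.Θs.B *ᵥ u + fun r => ω (.w t r)
  { x := x'
    V := s.V + Matrix.vecMulVec z z
    Y := s.Y + Matrix.vecMulVec z x'
    model := p.currentModel ω t s }

/-- The run of the algorithm, from `x₀ = 0`, `V₀ = μ I` and the estimate `0`, as a function of the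
driving random numbers `ω`. -/
def run (ω : NoiseIdx n d → ℝ) : ℕ → RunState n d
  | 0 => { x := 0, V := p.μ • (1 : Matrix (Fin n ⊕ Fin d) (Fin n ⊕ Fin d) ℝ), Y := 0, model := 0 }
  | t + 1 => p.step ω t (run ω t)

/-- The regret `R_T = ∑_{t=0}^T (c_t - J(Θs))`. -/
def regret (ω : NoiseIdx n d → ℝ) (T : ℕ) : ℝ :=
  ∑ t ∈ Finset.range (T + 1),
    (stepCost p.Q p.R (p.run ω t).x (p.input ω t (p.run ω t)) - optAvgCost p.Q p.R p.σ p.Θs)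

end Setup

/-- The high-probability bound on the state after the exploration phase,
`X_s = (12 κ² + 2 κ √2) γ⁻¹ σ √(2 n log(n (T - Tw) / δ))`. -/
def stateBound (n : ℕ) (κ γ σ δ T Tw : ℝ) : ℝ :=
  (12 * κ ^ 2 + 2 * κ * √2) * γ⁻¹ * σ * √(2 * n * Real.log (n * (T - Tw) / δ))

/-- The algorithm with horizon `T`: the regularizer is `μ = (1 + κ²) X_s²`. -/
def tsac {n d : ℕ} (Q : Matrix (Fin n) (Fin n) ℝ) (R : Matrix (Fin d) (Fin d) ℝ)
    (M : Set (Sys n d)) (κ γ S σ : ℝ) (Θs : Sys n d) (δ : ℝ) (T : ℕ) (Tw : ℝ) : Setup n d :=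
  { Θs := Θs, Q := Q, R := R, M := M, κ := κ, γ := γ, S := S, σ := σ, δ := δ
    μ := (1 + κ ^ 2) * stateBound n κ γ σ δ T Tw ^ 2
    Tw := Tw }

/-- With probability at least `1 - 10 δ`, the regret of the algorithm with horizon `T` and
exploration phase of length `Tw` is at most `b`, whatever probability space carries the noise. -/
def RegretLE {n d : ℕ} (Q : Matrix (Fin n) (Fin n) ℝ) (R : Matrix (Fin d) (Fin d) ℝ)
    (M : Set (Sys n d)) (κ γ S σ : ℝ) (Θs : Sys n d) (δ : ℝ) (T : ℕ) (Tw b : ℝ) : Prop :=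
  ∀ (Ω : Type*) [MeasurableSpace Ω] (P : Measure Ω) [IsProbabilityMeasure P]
    (ξ : NoiseIdx n d → Ω → ℝ), IsNoise κ σ P ξ →
    ENNReal.ofReal (1 - 10 * δ) ≤
      P {ω | (tsac Q R M κ γ S σ Θs δ T Tw).regret (fun a => ξ a ω) T ≤ b}

/-- The standing assumptions on the problem: the known cost matrices are positive definite with
`‖Q‖, ‖R‖ < αhi` and least eigenvalues greater than `αlo`; the model set `M` is a Borel set of
`(κ, γ)`-stabilizable systems of Frobenius norm at most `S`; and the true system is an interior
point of `M`. -/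
structure Admissible {n d : ℕ} (κ γ αlo αhi S : ℝ) (Q : Matrix (Fin n) (Fin n) ℝ)
    (R : Matrix (Fin d) (Fin d) ℝ) (M : Set (Sys n d)) (Θs : Sys n d) : Prop where
  Q_posDef : Q.PosDef
  R_posDef : R.PosDef
  Q_lt : ‖Q‖ < αhi
  R_lt : ‖R‖ < αhi
  lt_Q : (Q - αlo • (1 : Matrix (Fin n) (Fin n) ℝ)).PosDef
  lt_R : (R - αlo • (1 : Matrix (Fin d) (Fin d) ℝ)).PosDef
  measurable_M : MeasurableSet[borel (Sys n d)] M
  stabilizable : ∀ Θ ∈ M, IsStabilizable Q R κ γ Θ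
  bounded : ∀ Θ ∈ M, Θ.frob ≤ S
  mem : Θs ∈ interior M

end

end TSAC

/-!
The horizon `T` may be taken large in terms of all the fixed data, `δ` and the dimensions included. Hence every
constant is absorbed by a factor `log T`, and probabilities of order `δ` may be bounded by the inequalities of
Markov and Chebyshev. What has to be proved is that the regret is of order `√T` up to powers of `log T` (and, for
general systems, of the stated power of `√T log T`).

*Reduction.* `regretLE_of_law` transfers the question to the product measure of the noise, and `runM` modifies the
algorithm by using the gain only for models in the given set, which makes every quantity measurable. The run is not
changed on the event that the rejection sampling ends, which has large probability because a finite net of targets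
is hit in every epoch (`Hits`). Conditional expectations do not appear: the sign of any set of Gaussian coordinates
may be flipped (`measurePreserving_flipOn`), so a lower or upper bound for the sum of a function and its flipped
version gives one for its integral (`two_mul_lintegral_le_of_measurePreserving`).

*Control theory.* Value iteration gives the Riccati solution (`exists_isDARESolution`), the optimal gain is
Lipschitz on the set of stabilizable models (`exists_lipschitz_gain`), and the optimal average cost is at least
`σ² tr P` (`optAvgCost_ge`). Completing the square (`stepCost_add_qf`) then bounds the regret by two sums of
martingale differences, of order `√T`, plus the sum of the squared deviations of the inputs from the optimal ones
(`Setup.regret_le`, `Constants.regret_le`). No optimism of the sampled models is needed.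

*Stability.* Let `E` be the error of a sampled model. The self-normalized bound `law_stoppedConf_gt_le` gives
`tr (Eᵀ V E) ≤ b²` with `b` of logarithmic size. By compactness (`exists_triangular_lower_bound`) at most `n + d`
epochs can have an error that matters at the states met there, which bounds the state deterministically
(`exists_stateBound`); the two bounds feed each other in `Constants.good`.

*Information.* After the exploration phase the squared error of a sampled model is at most `b² tr V⁻¹`. In the
exploration phase the injected noise gives `tr V⁻¹ ≲ 1 / T_w` (`exists_exploration`, `exists_law_epochInfo_le`), so
the regret is at most of order `√T + T_w + T / T_w`, which settles the first part. If the optimal closed loop is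
non-singular, the randomness of the sampled model itself excites every direction: a perturbation `g uᵀ` of the model
changes the gain visibly (`exists_selfExploration`), and so `z_{t+1}` has a component of relative size `tr V⁻¹` in
the weakest direction of `V` (`le_visibility_add_flip`). The elliptical potential turns this into
`∑ (tr V⁻¹)² = O(log T)` (`exists_law_sum_trace_sq_ge_le`), and by the Cauchy-Schwarz inequality `∑ tr V⁻¹` is of
order `√T`. In the second part the exploration phase, longer than any multiple of `log T`, only serves to bring the
sampled models close to the true one.
-/

set_option linter.unusedSectionVars false

namespace TSAC
/-! ### Euclidean norms and quadratic forms -/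

section LinearAlgebra

variable {ι κ' : Type*} [Fintype ι] [Fintype κ'] [DecidableEq ι] [DecidableEq κ']

/-- The Euclidean norm of a vector stored as a plain function. -/
noncomputable def nrm {ι : Type*} [Fintype ι] (x : ι → ℝ) : ℝ := √(x ⬝ᵥ x)

lemma dot_self_nonneg (x : ι → ℝ) : 0 ≤ x ⬝ᵥ x := by
  simpa [dotProduct] using Finset.sum_nonneg fun i _ => mul_self_nonneg (x i)

lemma nrm_nonneg (x : ι → ℝ) : 0 ≤ nrm x := Real.sqrt_nonneg _

lemma nrm_sq (x : ι → ℝ) : nrm x ^ 2 = x ⬝ᵥ x := Real.sq_sqrt (dot_self_nonneg x)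

lemma nrm_eq_norm (x : ι → ℝ) : nrm x = ‖WithLp.toLp 2 x‖ := by
  rw [EuclideanSpace.norm_eq, nrm]
  congr 1
  simp [dotProduct, pow_two]

lemma nrm_add_le (x y : ι → ℝ) : nrm (x + y) ≤ nrm x + nrm y := by
  simpa only [nrm_eq_norm, WithLp.toLp_add] using norm_add_le (WithLp.toLp 2 x) (WithLp.toLp 2 y)

lemma nrm_sub_le (x y : ι → ℝ) : nrm (x - y) ≤ nrm x + nrm y := by
  simpa only [nrm_eq_norm, WithLp.toLp_sub] using norm_sub_le (WithLp.toLp 2 x) (WithLp.toLp 2 y)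

lemma nrm_smul (c : ℝ) (x : ι → ℝ) : nrm (c • x) = |c| * nrm x := by
  simpa only [nrm_eq_norm, WithLp.toLp_smul, Real.norm_eq_abs] using norm_smul c (WithLp.toLp 2 x)

@[simp] lemma nrm_zero : nrm (0 : ι → ℝ) = 0 := by simp [nrm]

lemma nrm_eq_zero {x : ι → ℝ} (h : nrm x = 0) : x = 0 := by
  rw [nrm_eq_norm, norm_eq_zero] at h
  simpa using h

lemma nrm_sum_le {α : Type*} (s : Finset α) (f : α → ι → ℝ) :
    nrm (∑ a ∈ s, f a) ≤ ∑ a ∈ s, nrm (f a) := by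
  simpa only [nrm_eq_norm, WithLp.toLp_sum] using norm_sum_le s fun a => WithLp.toLp 2 (f a)

lemma abs_dot_le (x y : ι → ℝ) : |x ⬝ᵥ y| ≤ nrm x * nrm y := by
  have h := abs_real_inner_le_norm (WithLp.toLp 2 y) (WithLp.toLp 2 x)
  rw [EuclideanSpace.inner_toLp_toLp, ← nrm_eq_norm, ← nrm_eq_norm] at h
  simpa [mul_comm] using h

lemma sq_apply_le (x : ι → ℝ) (i : ι) : x i ^ 2 ≤ nrm x ^ 2 := by
  rw [nrm_sq, dotProduct, pow_two]
  exact Finset.single_le_sum (f := fun i => x i * x i) (fun i _ => mul_self_nonneg _)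
    (Finset.mem_univ i)

lemma abs_apply_le (x : ι → ℝ) (i : ι) : |x i| ≤ nrm x :=
  abs_le_of_sq_le_sq (sq_apply_le x i) (nrm_nonneg x)

lemma nrm_le_sum (x : ι → ℝ) : nrm x ≤ ∑ i, |x i| := by
  rw [nrm]
  refine Real.sqrt_le_iff.2 ⟨Finset.sum_nonneg fun _ _ => abs_nonneg _, ?_⟩
  have := Finset.sum_sq_le_sq_sum_of_nonneg (s := Finset.univ) (f := fun i => |x i|)
    (fun i _ => abs_nonneg _)
  simpa [dotProduct, ← pow_two] using this

lemma nrm_le_of_abs_le (x : ι → ℝ) {c : ℝ} (h : ∀ i, |x i| ≤ c) :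
    nrm x ≤ Fintype.card ι * c := by
  refine (nrm_le_sum x).trans ?_
  simpa using Finset.sum_le_card_nsmul Finset.univ (fun i => |x i|) c fun i _ => h i

lemma nrm_mulVec_le (A : Matrix κ' ι ℝ) (x : ι → ℝ) : nrm (A *ᵥ x) ≤ ‖A‖ * nrm x := by
  rw [nrm_eq_norm, nrm_eq_norm]
  exact l2_opNorm_mulVec A (WithLp.toLp 2 x)

lemma opNorm_le (A : Matrix κ' ι ℝ) {c : ℝ} (hc : 0 ≤ c)
    (h : ∀ x, nrm (A *ᵥ x) ≤ c * nrm x) : ‖A‖ ≤ c := by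
  rw [l2_opNorm_def]
  refine ContinuousLinearMap.opNorm_le_bound _ hc fun x => ?_
  have := h x.ofLp
  rw [nrm_eq_norm, nrm_eq_norm] at this
  exact this

lemma norm_transpose_eq (A : Matrix κ' ι ℝ) : ‖Aᵀ‖ = ‖A‖ := by
  have := l2_opNorm_conjTranspose A
  rwa [conjTranspose_eq_transpose_of_trivial] at this

lemma norm_mul_le' {m : Type*} [Fintype m] [DecidableEq m] (A : Matrix m κ' ℝ)
    (B : Matrix κ' ι ℝ) : ‖A * B‖ ≤ ‖A‖ * ‖B‖ := l2_opNorm_mul A B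

lemma norm_vecMulVec_le (u : κ' → ℝ) (v : ι → ℝ) : ‖vecMulVec u v‖ ≤ nrm u * nrm v := by
  refine opNorm_le _ (mul_nonneg (nrm_nonneg _) (nrm_nonneg _)) fun x => ?_
  rw [vecMulVec_mulVec, op_smul_eq_smul, nrm_smul, mul_comm, mul_assoc]
  exact mul_le_mul_of_nonneg_left (abs_dot_le v x) (nrm_nonneg _)

/-- The quadratic form `xᵀ V x`. -/
def qf {ι : Type*} [Fintype ι] (V : Matrix ι ι ℝ) (x : ι → ℝ) : ℝ := x ⬝ᵥ (V *ᵥ x)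

lemma abs_qf_le (V : Matrix ι ι ℝ) (x : ι → ℝ) : |qf V x| ≤ ‖V‖ * nrm x ^ 2 := by
  refine (abs_dot_le _ _).trans ?_
  nlinarith [nrm_mulVec_le V x, nrm_nonneg x]

lemma qf_le (V : Matrix ι ι ℝ) (x : ι → ℝ) : qf V x ≤ ‖V‖ * nrm x ^ 2 :=
  (le_abs_self _).trans (abs_qf_le V x)

lemma dot_mulVec_comm {V : Matrix ι ι ℝ} (hV : Vᵀ = V) (x y : ι → ℝ) :
    x ⬝ᵥ (V *ᵥ y) = y ⬝ᵥ (V *ᵥ x) := by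
  rw [dotProduct_mulVec, ← mulVec_transpose, hV, dotProduct_comm]

lemma qf_add {V : Matrix ι ι ℝ} (hV : Vᵀ = V) (x y : ι → ℝ) :
    qf V (x + y) = qf V x + 2 * (x ⬝ᵥ (V *ᵥ y)) + qf V y := by
  simp only [qf, mulVec_add, dotProduct_add, add_dotProduct, dot_mulVec_comm hV y x]
  ring

lemma qf_smul (V : Matrix ι ι ℝ) (c : ℝ) (x : ι → ℝ) : qf V (c • x) = c ^ 2 * qf V x := by
  simp only [qf, mulVec_smul, dotProduct_smul, smul_dotProduct, smul_eq_mul]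
  ring

lemma transpose_eq_of_posDef {V : Matrix ι ι ℝ} (hV : V.PosDef) : Vᵀ = V := by
  simpa [Matrix.IsHermitian] using hV.isHermitian

lemma qf_pos {V : Matrix ι ι ℝ} (hV : V.PosDef) {x : ι → ℝ} (hx : x ≠ 0) : 0 < qf V x := by
  simpa [qf] using hV.dotProduct_mulVec_pos hx

lemma qf_nonneg {V : Matrix ι ι ℝ} (hV : V.PosDef) (x : ι → ℝ) : 0 ≤ qf V x := by
  simpa [qf] using hV.posSemidef.dotProduct_mulVec_nonneg x

lemma posDef_of_qf {V : Matrix ι ι ℝ} (hV : Vᵀ = V) (h : ∀ x, x ≠ 0 → 0 < qf V x) :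
    V.PosDef := by
  refine Matrix.PosDef.of_dotProduct_mulVec_pos ?_ fun x hx => by simpa [qf] using h x hx
  simpa [Matrix.IsHermitian] using hV

lemma qf_add_le {V : Matrix ι ι ℝ} (hV : V.PosDef) (x y : ι → ℝ) :
    qf V (x + y) ≤ 2 * qf V x + 2 * qf V y := by
  have h1 := qf_add (transpose_eq_of_posDef hV) x y
  have h2 := qf_add (transpose_eq_of_posDef hV) x (-y)
  have h3 := qf_nonneg hV (x + -y)
  have h4 : qf V (-y) = qf V y := by simp [qf, mulVec_neg]
  have h5 : x ⬝ᵥ (V *ᵥ (-y)) = -(x ⬝ᵥ (V *ᵥ y)) := by simp [mulVec_neg]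
  rw [h2, h4, h5] at h3
  linarith

lemma sq_dot_mulVec_le {V : Matrix ι ι ℝ} (hV : V.PosDef) (x y : ι → ℝ) :
    (x ⬝ᵥ (V *ᵥ y)) ^ 2 ≤ qf V x * qf V y := by
  have h : ∀ t : ℝ, 0 ≤ qf V y * (t * t) + 2 * (x ⬝ᵥ (V *ᵥ y)) * t + qf V x := fun t => by
    have h1 := qf_nonneg hV (x + t • y)
    rw [qf_add (transpose_eq_of_posDef hV), qf_smul, mulVec_smul, dotProduct_smul,
      smul_eq_mul] at h1
    linarith
  have := discrim_le_zero h
  rw [discrim] at this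
  nlinarith

lemma isUnit_det_of_posDef {V : Matrix ι ι ℝ} (hV : V.PosDef) : IsUnit V.det :=
  hV.det_pos.ne'.isUnit

lemma sq_dot_le_qf_inv {V : Matrix ι ι ℝ} (hV : V.PosDef) (x y : ι → ℝ) :
    (x ⬝ᵥ y) ^ 2 ≤ qf V⁻¹ x * qf V y := by
  have h := sq_dot_mulVec_le hV.inv x (V *ᵥ y)
  have hq : qf V⁻¹ (V *ᵥ y) = qf V y := by
    rw [qf, mulVec_mulVec, nonsing_inv_mul _ (isUnit_det_of_posDef hV), one_mulVec, qf,
      dotProduct_comm]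
  rwa [mulVec_mulVec, nonsing_inv_mul _ (isUnit_det_of_posDef hV), one_mulVec, hq] at h

lemma qf_single (V : Matrix ι ι ℝ) (r : ι) : qf V (Pi.single r 1) = V r r := by
  simp [qf]

/-- The trace of the inverse controls the inverse of the least eigenvalue. -/
lemma dot_self_le_trace_inv {V : Matrix ι ι ℝ} (hV : V.PosDef) (x : ι → ℝ) :
    x ⬝ᵥ x ≤ V⁻¹.trace * qf V x := by
  rw [dotProduct, Matrix.trace, Finset.sum_mul]
  refine Finset.sum_le_sum fun r _ => ?_
  have h := sq_dot_le_qf_inv hV (Pi.single r 1) x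
  rw [qf_single] at h
  simpa [pow_two] using h

/-! ### Rank-one updates -/

lemma posDef_add_vecMulVec {V : Matrix ι ι ℝ} (hV : V.PosDef) (z : ι → ℝ) :
    (V + vecMulVec z z).PosDef := by
  refine hV.add_posSemidef ?_
  simpa using posSemidef_vecMulVec_self_star z

lemma qf_vecMulVec (z x : ι → ℝ) : qf (vecMulVec z z) x = (z ⬝ᵥ x) ^ 2 := by
  rw [qf, vecMulVec_mulVec, op_smul_eq_smul, dotProduct_smul, smul_eq_mul, dotProduct_comm x z,
    pow_two]

/-- The Sherman–Morrison formula. -/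
lemma inv_add_vecMulVec {V : Matrix ι ι ℝ} (hV : V.PosDef) (z : ι → ℝ) :
    (V + vecMulVec z z)⁻¹ =
      V⁻¹ - (1 + qf V⁻¹ z)⁻¹ • vecMulVec (V⁻¹ *ᵥ z) (V⁻¹ *ᵥ z) := by
  have hq := qf_nonneg hV.inv z
  have hVt : V⁻¹ᵀ = V⁻¹ := transpose_eq_of_posDef hV.inv
  have hu := isUnit_det_of_posDef hV
  apply inv_eq_right_inv
  have e1 : V * vecMulVec (V⁻¹ *ᵥ z) (V⁻¹ *ᵥ z) = vecMulVec z (V⁻¹ *ᵥ z) := by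
    rw [mul_vecMulVec, mulVec_mulVec, mul_nonsing_inv _ hu, one_mulVec]
  have e2 : vecMulVec z z * V⁻¹ = vecMulVec z (V⁻¹ *ᵥ z) := by
    rw [vecMulVec_mul, ← mulVec_transpose, hVt]
  have e3 : vecMulVec z z * vecMulVec (V⁻¹ *ᵥ z) (V⁻¹ *ᵥ z) =
      qf V⁻¹ z • vecMulVec z (V⁻¹ *ᵥ z) := by
    rw [vecMulVec_mul_vecMulVec, qf, vecMulVec_smul]
  rw [add_mul, mul_sub, mul_sub, mul_nonsing_inv _ hu, Matrix.mul_smul, Matrix.mul_smul, e1, e2, e3, smul_smul]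
  have : (1 + qf V⁻¹ z)⁻¹ * qf V⁻¹ z = 1 - (1 + qf V⁻¹ z)⁻¹ := by field_simp; ring
  rw [this, sub_smul, one_smul]
  abel

lemma qf_inv_add_vecMulVec {V : Matrix ι ι ℝ} (hV : V.PosDef) (z x : ι → ℝ) :
    qf (V + vecMulVec z z)⁻¹ x =
      qf V⁻¹ x - (1 + qf V⁻¹ z)⁻¹ * ((V⁻¹ *ᵥ z) ⬝ᵥ x) ^ 2 := by
  rw [inv_add_vecMulVec hV, ← qf_vecMulVec]
  simp [qf, sub_mulVec, smul_mulVec]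

lemma qf_inv_add_vecMulVec_le {V : Matrix ι ι ℝ} (hV : V.PosDef) (z x : ι → ℝ) :
    qf (V + vecMulVec z z)⁻¹ x ≤ qf V⁻¹ x := by
  rw [qf_inv_add_vecMulVec hV]
  have hq := qf_nonneg hV.inv z
  have : 0 ≤ (1 + qf V⁻¹ z)⁻¹ * ((V⁻¹ *ᵥ z) ⬝ᵥ x) ^ 2 := by positivity
  linarith

lemma qf_inv_update_self {V : Matrix ι ι ℝ} (hV : V.PosDef) (z : ι → ℝ) :
    qf (V + vecMulVec z z)⁻¹ z = qf V⁻¹ z / (1 + qf V⁻¹ z) := by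
  have hq := qf_nonneg hV.inv z
  rw [qf_inv_add_vecMulVec hV, dotProduct_comm, ← qf]
  field_simp
  ring

lemma trace_inv_add_vecMulVec {V : Matrix ι ι ℝ} (hV : V.PosDef) (z : ι → ℝ) :
    (V + vecMulVec z z)⁻¹.trace = V⁻¹.trace - nrm (V⁻¹ *ᵥ z) ^ 2 / (1 + qf V⁻¹ z) := by
  rw [inv_add_vecMulVec hV, trace_sub, trace_smul, trace_vecMulVec, nrm_sq, smul_eq_mul]
  ring

lemma det_add_vecMulVec {V : Matrix ι ι ℝ} (hV : V.PosDef) (z : ι → ℝ) :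
    (V + vecMulVec z z).det = V.det * (1 + qf V⁻¹ z) := by
  have h := det_add_replicateCol_mul_replicateRow (ι := Unit) (isUnit_det_of_posDef hV) z z
  rw [vecMulVec_eq Unit, h]
  congr 1
  simp [det_unique, Matrix.mul_apply, qf, dotProduct, mulVec, Finset.sum_mul, Finset.mul_sum,
    mul_assoc]
  exact Finset.sum_comm

lemma trace_inv_pos [Nonempty ι] {V : Matrix ι ι ℝ} (hV : V.PosDef) : 0 < V⁻¹.trace :=
  hV.inv.trace_pos

lemma det_le_trace_pow {V : Matrix ι ι ℝ} (hV : V.PosDef) :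
    V.det ≤ V.trace ^ Fintype.card ι := by
  rw [hV.isHermitian.det_eq_prod_eigenvalues, hV.isHermitian.trace_eq_sum_eigenvalues]
  simp only [RCLike.ofReal_real_eq_id, id]
  rw [← Finset.card_univ, ← Finset.prod_const]
  refine Finset.prod_le_prod (fun i _ => (hV.eigenvalues_pos i).le) fun i _ => ?_
  exact Finset.single_le_sum (f := hV.isHermitian.eigenvalues)
    (fun i _ => (hV.eigenvalues_pos i).le) (Finset.mem_univ i)

/-! ### The weighted Frobenius form -/

/-- `tr(Eᵀ V E)`, the sum of the quadratic forms of the columns of `E`. -/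
def wf {ι κ' : Type*} [Fintype ι] [Fintype κ'] (V : Matrix ι ι ℝ) (E : Matrix ι κ' ℝ) : ℝ :=
  ∑ c, qf V (fun r => E r c)

lemma wf_nonneg {V : Matrix ι ι ℝ} (hV : V.PosDef) (E : Matrix ι κ' ℝ) : 0 ≤ wf V E :=
  Finset.sum_nonneg fun _ _ => qf_nonneg hV _

lemma wf_add_le {V : Matrix ι ι ℝ} (hV : V.PosDef) (E F : Matrix ι κ' ℝ) :
    wf V (E + F) ≤ 2 * wf V E + 2 * wf V F := by
  simp only [wf, Finset.mul_sum, ← Finset.sum_add_distrib]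
  exact Finset.sum_le_sum fun c _ => qf_add_le hV _ _

/-- The squared Frobenius norm. -/
def fsq {ι κ' : Type*} [Fintype ι] [Fintype κ'] (E : Matrix ι κ' ℝ) : ℝ := ∑ r, ∑ c, E r c ^ 2

lemma fsq_nonneg (E : Matrix ι κ' ℝ) : 0 ≤ fsq E :=
  Finset.sum_nonneg fun _ _ => Finset.sum_nonneg fun _ _ => sq_nonneg _

lemma fsq_eq_sum_dot (E : Matrix ι κ' ℝ) :
    fsq E = ∑ c, (fun r => E r c) ⬝ᵥ (fun r => E r c) := by
  rw [fsq, Finset.sum_comm]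
  simp [dotProduct, pow_two]

lemma fsq_le_trace_inv_mul_wf {V : Matrix ι ι ℝ} (hV : V.PosDef) (E : Matrix ι κ' ℝ) :
    fsq E ≤ V⁻¹.trace * wf V E := by
  rw [fsq_eq_sum_dot, wf, Finset.mul_sum]
  exact Finset.sum_le_sum fun c _ => dot_self_le_trace_inv hV _

lemma nrm_transpose_mulVec_sq_le (E : Matrix ι κ' ℝ) (z : ι → ℝ) :
    nrm (Eᵀ *ᵥ z) ^ 2 ≤ fsq E * nrm z ^ 2 := by
  rw [fsq_eq_sum_dot, nrm_sq (Eᵀ *ᵥ z), dotProduct, Finset.sum_mul]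
  refine Finset.sum_le_sum fun c _ => ?_
  have h := abs_dot_le (fun r => E r c) z
  have e : (Eᵀ *ᵥ z) c = (fun r => E r c) ⬝ᵥ z := rfl
  rw [e, ← nrm_sq, ← pow_two, ← mul_pow, sq_le_sq]
  exact h.trans (le_abs_self _)

lemma norm_sq_le_fsq (E : Matrix ι κ' ℝ) : ‖E‖ ^ 2 ≤ fsq E := by
  have : ‖E‖ ≤ √(fsq E) := by
    rw [← norm_transpose_eq]
    refine opNorm_le _ (Real.sqrt_nonneg _) fun z => ?_
    rw [← Real.sqrt_sq (nrm_nonneg z), ← Real.sqrt_mul (fsq_nonneg E)]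
    exact Real.le_sqrt_of_sq_le (nrm_transpose_mulVec_sq_le E z)
  calc ‖E‖ ^ 2 ≤ √(fsq E) ^ 2 := by gcongr
    _ = fsq E := Real.sq_sqrt (fsq_nonneg E)

end LinearAlgebra

/-! ### The Riccati equation -/

section Riccati

variable {n d : ℕ}

lemma dot_transpose_mulVec {m k : ℕ} (B : Matrix (Fin m) (Fin k) ℝ) (y : Fin k → ℝ)
    (w : Fin m → ℝ) : y ⬝ᵥ (Bᵀ *ᵥ w) = (B *ᵥ y) ⬝ᵥ w := by
  rw [mulVec_transpose, dotProduct_comm, ← dotProduct_mulVec, dotProduct_comm]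

lemma dot_sumElim (x x' : Fin n → ℝ) (u u' : Fin d → ℝ) :
    Sum.elim x u ⬝ᵥ Sum.elim x' u' = x ⬝ᵥ x' + u ⬝ᵥ u' := by
  simp [dotProduct, Fintype.sum_sum_type]

lemma nrm_sumElim_sq (x : Fin n → ℝ) (u : Fin d → ℝ) :
    nrm (Sum.elim x u) ^ 2 = nrm x ^ 2 + nrm u ^ 2 := by
  simp only [nrm_sq, dot_sumElim]

lemma nrm_sumElim_le (x : Fin n → ℝ) (u : Fin d → ℝ) :
    nrm (Sum.elim x u) ≤ nrm x + nrm u := by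
  refine abs_le_of_sq_le_sq ?_ (add_nonneg (nrm_nonneg x) (nrm_nonneg u)) |> (le_abs_self _).trans
  rw [nrm_sumElim_sq]
  nlinarith [mul_nonneg (nrm_nonneg x) (nrm_nonneg u)]

lemma nrm_right_le (z : Fin n ⊕ Fin d → ℝ) : nrm (z ∘ Sum.inr) ≤ nrm z := by
  refine abs_le_of_sq_le_sq ?_ (nrm_nonneg z) |> (le_abs_self _).trans
  conv_rhs => rw [← Sum.elim_comp_inl_inr z, nrm_sumElim_sq]
  nlinarith [sq_nonneg (nrm (z ∘ Sum.inl))]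

lemma Sys.mulVec_add_mulVec (Θ : Sys n d) (x : Fin n → ℝ) (u : Fin d → ℝ) :
    Θ.A *ᵥ x + Θ.B *ᵥ u = Θᵀ *ᵥ Sum.elim x u := by
  ext i
  simp [Sys.A, Sys.B, mulVec, dotProduct, Fintype.sum_sum_type, toRows₁, toRows₂]

lemma Sys.norm_A_le (Θ : Sys n d) : ‖Θ.A‖ ≤ ‖Θ‖ := by
  refine opNorm_le _ (norm_nonneg _) fun x => ?_
  have h := nrm_mulVec_le Θᵀ (Sum.elim x 0)
  rw [← Sys.mulVec_add_mulVec, mulVec_zero, add_zero, norm_transpose_eq] at h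
  refine h.trans (mul_le_mul_of_nonneg_left ?_ (norm_nonneg _))
  simpa using nrm_sumElim_le x (0 : Fin d → ℝ)

lemma Sys.norm_B_le (Θ : Sys n d) : ‖Θ.B‖ ≤ ‖Θ‖ := by
  refine opNorm_le _ (norm_nonneg _) fun x => ?_
  have h := nrm_mulVec_le Θᵀ (Sum.elim 0 x)
  rw [← Sys.mulVec_add_mulVec, mulVec_zero, zero_add, norm_transpose_eq] at h
  refine h.trans (mul_le_mul_of_nonneg_left ?_ (norm_nonneg _))
  simpa using nrm_sumElim_le (0 : Fin n → ℝ) x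

lemma Sys.A_sub (Θ₁ Θ₂ : Sys n d) : Sys.A (Θ₁ - Θ₂) = Θ₁.A - Θ₂.A := rfl

lemma Sys.B_sub (Θ₁ Θ₂ : Sys n d) : Sys.B (Θ₁ - Θ₂) = Θ₁.B - Θ₂.B := rfl

/-- One step of value iteration: the right-hand side of the Riccati equation. -/
noncomputable def ricStep (Q : Matrix (Fin n) (Fin n) ℝ) (R : Matrix (Fin d) (Fin d) ℝ)
    (Θ : Sys n d) (P : Matrix (Fin n) (Fin n) ℝ) : Matrix (Fin n) (Fin n) ℝ :=
  Θ.Aᵀ * P * Θ.A + Q - Θ.Aᵀ * P * Θ.B * (R + Θ.Bᵀ * P * Θ.B)⁻¹ * Θ.Bᵀ * P * Θ.A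

/-- The greedy gain with respect to the value function `xᵀ P x`. -/
noncomputable def greedy (R : Matrix (Fin d) (Fin d) ℝ) (Θ : Sys n d)
    (P : Matrix (Fin n) (Fin n) ℝ) : Matrix (Fin d) (Fin n) ℝ :=
  -((R + Θ.Bᵀ * P * Θ.B)⁻¹ * Θ.Bᵀ * P * Θ.A)

variable {Q : Matrix (Fin n) (Fin n) ℝ} {R : Matrix (Fin d) (Fin d) ℝ}

lemma posDef_add_conj {m : ℕ} (hR : R.PosDef) {P : Matrix (Fin m) (Fin m) ℝ} (hP : P.PosSemidef)
    (B : Matrix (Fin m) (Fin d) ℝ) : (R + Bᵀ * P * B).PosDef := by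
  refine hR.add_posSemidef ?_
  simpa using hP.conjTranspose_mul_mul_same B

lemma greedy_spec (hR : R.PosDef) (Θ : Sys n d) {P : Matrix (Fin n) (Fin n) ℝ}
    (hP : P.PosSemidef) :
    (R + Θ.Bᵀ * P * Θ.B) * greedy R Θ P = -(Θ.Bᵀ * P * Θ.A) := by
  have hu := isUnit_det_of_posDef (posDef_add_conj hR hP Θ.B)
  rw [greedy, Matrix.mul_neg, ← Matrix.mul_assoc, ← Matrix.mul_assoc, ← Matrix.mul_assoc,
    mul_nonsing_inv _ hu, Matrix.one_mul]

/-- Completion of the square in the Bellman equation. -/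
lemma stepCost_add_qf (hR : R.PosDef) (Θ : Sys n d) {P : Matrix (Fin n) (Fin n) ℝ}
    (hP : P.PosSemidef) (x : Fin n → ℝ) (u : Fin d → ℝ) :
    stepCost Q R x u + qf P (Θ.A *ᵥ x + Θ.B *ᵥ u) =
      qf (ricStep Q R Θ P) x + qf (R + Θ.Bᵀ * P * Θ.B) (u - greedy R Θ P *ᵥ x) := by
  have hPt : Pᵀ = P := by simpa [Matrix.IsHermitian] using hP.isHermitian
  have hG := posDef_add_conj hR hP Θ.B
  have hK := greedy_spec hR Θ hP
  set G := R + Θ.Bᵀ * P * Θ.B with hGdef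
  set K := greedy R Θ P with hKdef
  have e1 : qf G (u - K *ᵥ x) =
      qf G u + 2 * (u ⬝ᵥ ((Θ.Bᵀ * P * Θ.A) *ᵥ x)) - (K *ᵥ x) ⬝ᵥ ((Θ.Bᵀ * P * Θ.A) *ᵥ x) := by
    have h := qf_add (transpose_eq_of_posDef hG) u (-(K *ᵥ x))
    have h2 : G *ᵥ (K *ᵥ x) = -((Θ.Bᵀ * P * Θ.A) *ᵥ x) := by
      rw [mulVec_mulVec, hK, neg_mulVec]
    rw [← sub_eq_add_neg] at h
    rw [h, mulVec_neg, h2, neg_neg]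
    simp only [qf, mulVec_neg, h2, neg_neg, neg_dotProduct]
    ring
  have e2 : qf G u = u ⬝ᵥ (R *ᵥ u) + qf P (Θ.B *ᵥ u) := by
    rw [qf, hGdef, add_mulVec, dotProduct_add, ← mulVec_mulVec, ← mulVec_mulVec,
      dot_transpose_mulVec, qf]
  have e3 : u ⬝ᵥ ((Θ.Bᵀ * P * Θ.A) *ᵥ x) = (Θ.A *ᵥ x) ⬝ᵥ (P *ᵥ (Θ.B *ᵥ u)) := by
    rw [dot_mulVec_comm hPt, ← mulVec_mulVec, ← mulVec_mulVec, dot_transpose_mulVec]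
  have e4 : qf (ricStep Q R Θ P) x =
      qf P (Θ.A *ᵥ x) + qf Q x + (K *ᵥ x) ⬝ᵥ ((Θ.Bᵀ * P * Θ.A) *ᵥ x) := by
    have : ricStep Q R Θ P = Θ.Aᵀ * P * Θ.A + Q + (Θ.Bᵀ * P * Θ.A)ᵀ * K := by
      rw [hKdef, greedy, ricStep, Matrix.mul_neg, ← sub_eq_add_neg]
      simp only [transpose_mul, transpose_transpose, hPt, Matrix.mul_assoc]
    rw [this, qf, add_mulVec, add_mulVec, dotProduct_add, dotProduct_add]
    have a1 : x ⬝ᵥ ((Θ.Aᵀ * P * Θ.A) *ᵥ x) = qf P (Θ.A *ᵥ x) := by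
      rw [← mulVec_mulVec, ← mulVec_mulVec, dot_transpose_mulVec, qf]
    have a2 : x ⬝ᵥ (((Θ.Bᵀ * P * Θ.A)ᵀ * K) *ᵥ x) =
        (K *ᵥ x) ⬝ᵥ ((Θ.Bᵀ * P * Θ.A) *ᵥ x) := by
      rw [← mulVec_mulVec, dot_transpose_mulVec, dotProduct_comm]
    rw [a1, a2, qf, qf]
  rw [e1, e2, e3, e4, stepCost, qf_add hPt, qf, qf, qf]
  ring

lemma greedy_riccati (Θ : Sys n d) : greedy R Θ (riccati Q R Θ) = gain Q R Θ := rfl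

/-! #### Existence of the Riccati solution -/

lemma ricStep_posSemidef (hQ : Q.PosDef) (hR : R.PosDef) (Θ : Sys n d)
    {P : Matrix (Fin n) (Fin n) ℝ} (hP : P.PosSemidef) : (ricStep Q R Θ P).PosSemidef := by
  have hPt : Pᵀ = P := by simpa [Matrix.IsHermitian] using hP.isHermitian
  have hG := posDef_add_conj hR hP Θ.B
  refine Matrix.PosSemidef.of_dotProduct_mulVec_nonneg ?_ fun x => ?_
  · have h1 : (R + Θ.Bᵀ * P * Θ.B)⁻¹ᵀ = (R + Θ.Bᵀ * P * Θ.B)⁻¹ := transpose_eq_of_posDef hG.inv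
    simp only [Matrix.IsHermitian, conjTranspose_eq_transpose_of_trivial, ricStep, transpose_sub,
      transpose_add, transpose_mul, transpose_transpose, hPt, transpose_eq_of_posDef hQ, h1]
    simp only [Matrix.mul_assoc]
  · have h := stepCost_add_qf (Q := Q) hR Θ hP x (greedy R Θ P *ᵥ x)
    have h0 : qf (R + Θ.Bᵀ * P * Θ.B) (greedy R Θ P *ᵥ x - greedy R Θ P *ᵥ x) = 0 := by
      simp [qf]
    have h1 := qf_nonneg hQ x
    have h2 := qf_nonneg hR (greedy R Θ P *ᵥ x)
    have h3 : 0 ≤ qf P (Θ.A *ᵥ x + Θ.B *ᵥ (greedy R Θ P *ᵥ x)) := by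
      simpa [qf] using hP.dotProduct_mulVec_nonneg (Θ.A *ᵥ x + Θ.B *ᵥ (greedy R Θ P *ᵥ x))
    rw [h0, add_zero, stepCost] at h
    simp only [qf] at h h1 h2 h3 ⊢
    simpa using (by linarith : 0 ≤ x ⬝ᵥ (ricStep Q R Θ P *ᵥ x))

lemma qf_ricStep_le (hR : R.PosDef) (Θ : Sys n d) {P : Matrix (Fin n) (Fin n) ℝ}
    (hP : P.PosSemidef) (x : Fin n → ℝ) (u : Fin d → ℝ) :
    qf (ricStep Q R Θ P) x ≤ stepCost Q R x u + qf P (Θ.A *ᵥ x + Θ.B *ᵥ u) := by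
  rw [stepCost_add_qf hR Θ hP]
  linarith [qf_nonneg (posDef_add_conj hR hP Θ.B) (u - greedy R Θ P *ᵥ x)]

/-- Value iteration is monotone: the greedy input for `P'` is available for `P` too. -/
lemma ricStep_mono (hR : R.PosDef) (Θ : Sys n d) {P P' : Matrix (Fin n) (Fin n) ℝ}
    (hP : P.PosSemidef) (hP' : P'.PosSemidef) (h : ∀ x, qf P x ≤ qf P' x) (x : Fin n → ℝ) :
    qf (ricStep Q R Θ P) x ≤ qf (ricStep Q R Θ P') x := by
  refine (qf_ricStep_le hR Θ hP x (greedy R Θ P' *ᵥ x)).trans ?_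
  have h' := stepCost_add_qf (Q := Q) hR Θ hP' x (greedy R Θ P' *ᵥ x)
  rw [sub_self] at h'
  have h0 : qf (R + Θ.Bᵀ * P' * Θ.B) 0 = 0 := by simp [qf]
  rw [h0, add_zero] at h'
  rw [← h']
  linarith [h (Θ.A *ᵥ x + Θ.B *ᵥ (greedy R Θ P' *ᵥ x))]

/-- If the value iteration from `0` is bounded above by a quadratic form, it increases to a positive
definite solution of the Riccati equation. -/
lemma exists_isDARESolution (hQ : Q.PosDef) (hR : R.PosDef) (Θ : Sys n d) (X : (Fin n → ℝ) → ℝ)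
    (hX0 : ∀ x, 0 ≤ X x) (hX : ∀ x, qf Q x + X (Θ.A *ᵥ x) ≤ X x) :
    ∃ P, IsDARESolution Q R Θ P := by
  -- the value iterates increase, and they are bounded by `X`: the input `0` is always available
  set p : ℕ → Matrix (Fin n) (Fin n) ℝ := fun k => (ricStep Q R Θ)^[k] 0 with hp
  have hsucc : ∀ k, p (k + 1) = ricStep Q R Θ (p k) := fun k =>
    Function.iterate_succ_apply' _ _ _
  have hpsd : ∀ k, (p k).PosSemidef := fun k => by
    induction k with
    | zero => exact Matrix.PosSemidef.zero
    | succ k ih => rw [hsucc]; exact ricStep_posSemidef hQ hR Θ ih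
  have hmono : ∀ k x, qf (p k) x ≤ qf (p (k + 1)) x := fun k => by
    induction k with
    | zero =>
      intro x
      have : qf (p 0) x = 0 := by simp [hp, qf]
      rw [this]
      simpa [qf] using (hpsd 1).dotProduct_mulVec_nonneg x
    | succ k ih =>
      intro x
      rw [hsucc, hsucc (k + 1)]
      exact ricStep_mono hR Θ (hpsd _) (hpsd _) ih x
  have hbdd : ∀ k x, qf (p k) x ≤ X x := fun k => by
    induction k with
    | zero => intro x; simpa [hp, qf] using hX0 x
    | succ k ih =>
      intro x
      rw [hsucc]
      refine (qf_ricStep_le hR Θ (hpsd k) x 0).trans ?_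
      simp only [stepCost, mulVec_zero, dotProduct_zero, add_zero]
      have := hX x
      have := ih (Θ.A *ᵥ x)
      simp only [qf] at *
      linarith
  have hq : ∀ x, ∃ l, Tendsto (fun k => qf (p k) x) atTop (𝓝 l) := fun x =>
    ⟨_, tendsto_atTop_ciSup (monotone_nat_of_le_succ fun k => hmono k x)
      ⟨X x, by rintro _ ⟨k, rfl⟩; exact hbdd k x⟩⟩
  -- polarization turns convergence of the quadratic forms into convergence of the entries
  have hent : ∀ i j, ∃ l, Tendsto (fun k => p k i j) atTop (𝓝 l) := fun i j => by
    obtain ⟨l1, h1⟩ := hq (Pi.single i 1 + Pi.single j 1)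
    obtain ⟨l2, h2⟩ := hq (Pi.single i 1)
    obtain ⟨l3, h3⟩ := hq (Pi.single j 1)
    refine ⟨(l1 - l2 - l3) / 2, (((h1.sub h2).sub h3).div_const 2).congr fun k => ?_⟩
    have ht : (p k)ᵀ = p k := by simpa [Matrix.IsHermitian] using (hpsd k).isHermitian
    rw [qf_add ht]
    simp
    ring
  choose l hl using hent
  have hlim : Tendsto p atTop (𝓝 (Matrix.of l)) :=
    tendsto_pi_nhds.2 fun i => tendsto_pi_nhds.2 fun j => hl i j
  have hqlim : ∀ x, Tendsto (fun k => qf (p k) x) atTop (𝓝 (qf (Matrix.of l) x)) := fun x => by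
    have : Continuous fun P : Matrix (Fin n) (Fin n) ℝ => qf P x := by
      unfold qf; fun_prop
    exact (this.tendsto _).comp hlim
  have hsym : (Matrix.of l)ᵀ = Matrix.of l := by
    refine tendsto_nhds_unique ((continuous_id.matrix_transpose.tendsto _).comp hlim) ?_
    refine hlim.congr fun k => ?_
    have ht : (p k)ᵀ = p k := by simpa [Matrix.IsHermitian] using (hpsd k).isHermitian
    exact ht.symm
  -- the limit dominates the first iterate `Q`
  have hpd : (Matrix.of l).PosDef := by
    refine posDef_of_qf hsym fun x hx => (qf_pos hQ hx).trans_le ?_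
    have h1 : qf (p 1) x = qf Q x := by
      have : p 1 = Q := by rw [hsucc 0]; simp [hp, ricStep]
      rw [this]
    rw [← h1]
    exact (monotone_nat_of_le_succ fun k => hmono k x).ge_of_tendsto (hqlim x) 1
  refine ⟨Matrix.of l, hpd, ?_⟩
  -- the limit is a fixed point because the value iteration is continuous at positive definite `P`
  have hcont : ContinuousAt (ricStep Q R Θ) (Matrix.of l) := by
    have hdet : (R + Θ.Bᵀ * Matrix.of l * Θ.B).det ≠ 0 :=
      (posDef_add_conj hR hpd.posSemidef Θ.B).det_pos.ne'
    have hinv : ContinuousAt (fun P : Matrix (Fin n) (Fin n) ℝ => (R + Θ.Bᵀ * P * Θ.B)⁻¹)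
        (Matrix.of l) := by
      simp only [Matrix.inv_def, Ring.inverse_eq_inv']
      have c1 : Continuous fun P : Matrix (Fin n) (Fin n) ℝ => (R + Θ.Bᵀ * P * Θ.B).det :=
        Continuous.matrix_det (by fun_prop)
      have c2 : Continuous fun P : Matrix (Fin n) (Fin n) ℝ => (R + Θ.Bᵀ * P * Θ.B).adjugate :=
        Continuous.matrix_adjugate (by fun_prop)
      exact (c1.continuousAt.inv₀ hdet).smul c2.continuousAt
    have hmul : ∀ {a b c : ℕ} {f : Matrix (Fin n) (Fin n) ℝ → Matrix (Fin a) (Fin b) ℝ}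
        {g : Matrix (Fin n) (Fin n) ℝ → Matrix (Fin b) (Fin c) ℝ},
        ContinuousAt f (Matrix.of l) → ContinuousAt g (Matrix.of l) →
        ContinuousAt (fun P => f P * g P) (Matrix.of l) := by
      intro a b c f g hf hg
      have hc : Continuous fun q : Matrix (Fin a) (Fin b) ℝ × Matrix (Fin b) (Fin c) ℝ =>
        q.1 * q.2 := continuous_fst.matrix_mul continuous_snd
      exact hc.continuousAt.comp (hf.prodMk hg)
    unfold ricStep
    have c1 : Continuous fun P : Matrix (Fin n) (Fin n) ℝ => Θ.Aᵀ * P * Θ.B := by fun_prop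
    have c2 : Continuous fun P : Matrix (Fin n) (Fin n) ℝ => Θ.Aᵀ * P * Θ.A + Q := by fun_prop
    exact c2.continuousAt.sub (hmul (hmul (hmul (hmul c1.continuousAt hinv) continuousAt_const)
      continuousAt_id) continuousAt_const)
  refine tendsto_nhds_unique (hlim.comp (tendsto_add_atTop_nat 1)) ?_
  refine (hcont.tendsto.comp hlim).congr fun k => ?_
  exact (hsucc k).symm

end Riccati

/-! ### Perturbation of the optimal controller -/

section Perturbation

variable {n d : ℕ} {Q : Matrix (Fin n) (Fin n) ℝ} {R : Matrix (Fin d) (Fin d) ℝ} {κ γ : ℝ}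

lemma inv_norm_le {m : ℕ} {G : Matrix (Fin m) (Fin m) ℝ} (hG : G.PosDef) {α : ℝ} (hα : 0 < α)
    (h : ∀ x, α * nrm x ^ 2 ≤ qf G x) : ‖G⁻¹‖ ≤ 1 / α := by
  refine opNorm_le _ (by positivity) fun y => ?_
  have h1 := h (G⁻¹ *ᵥ y)
  have h2 : qf G (G⁻¹ *ᵥ y) = (G⁻¹ *ᵥ y) ⬝ᵥ y := by
    rw [qf, mulVec_mulVec, mul_nonsing_inv _ (isUnit_det_of_posDef hG), one_mulVec]
  rw [h2] at h1
  have h3 := (le_abs_self _).trans (abs_dot_le (G⁻¹ *ᵥ y) y)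
  rcases (nrm_nonneg (G⁻¹ *ᵥ y)).eq_or_lt with h0 | h0
  · rw [← h0]; exact mul_nonneg (by positivity) (nrm_nonneg y)
  · rw [one_div, ← div_eq_inv_mul, le_div_iff₀ hα]
    nlinarith

lemma IsStabilizable.norm_pow_le {Θ : Sys n d}
    (h : IsStabilizable Q R κ γ Θ) (k : ℕ) : ‖closedLoop Q R Θ ^ k‖ ≤ κ * (1 - γ) ^ k := by
  obtain ⟨-, H, L, hH, hC, hL, hHH⟩ := h
  have hu := isUnit_det_of_posDef hH
  have hk : closedLoop Q R Θ ^ k = H * L ^ k * H⁻¹ := by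
    rw [hC]
    induction k with
    | zero => simp [mul_nonsing_inv _ hu]
    | succ k ih =>
      rw [pow_succ, ih, pow_succ]
      calc H * L ^ k * H⁻¹ * (H * L * H⁻¹) = H * L ^ k * (H⁻¹ * H) * L * H⁻¹ := by
            simp only [Matrix.mul_assoc]
        _ = _ := by rw [nonsing_inv_mul _ hu, Matrix.mul_one]; simp only [Matrix.mul_assoc]
  rw [hk]
  rcases Nat.eq_zero_or_pos k with rfl | hk0
  · have : ‖H * H⁻¹‖ ≤ ‖H‖ * ‖H⁻¹‖ := norm_mul_le' _ _
    simpa using this.trans hHH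
  have h1 : ‖L ^ k‖ ≤ (1 - γ) ^ k :=
    (norm_pow_le' L hk0).trans (pow_le_pow_left₀ (norm_nonneg _) hL k)
  calc ‖H * L ^ k * H⁻¹‖ ≤ ‖H‖ * ‖L ^ k‖ * ‖H⁻¹‖ :=
        (norm_mul_le' _ _).trans
          (mul_le_mul_of_nonneg_right (norm_mul_le' _ _) (norm_nonneg _))
    _ = (‖H‖ * ‖H⁻¹‖) * ‖L ^ k‖ := by ring
    _ ≤ κ * (1 - γ) ^ k := by
        have : 0 ≤ κ := (by positivity : 0 ≤ ‖H‖ * ‖H⁻¹‖).trans hHH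
        gcongr

/-- The Riccati equation has a positive definite solution for every stabilizable system: were there
none, the gain would be `0` and the state matrix itself stable, so that value iteration converges. -/
lemma IsStabilizable.isDARESolution (hQ : Q.PosDef) (hR : R.PosDef) (hγ : 0 < γ) (hγ' : γ ≤ 1)
    {Θ : Sys n d} (h : IsStabilizable Q R κ γ Θ) : IsDARESolution Q R Θ (riccati Q R Θ) := by
  have hex : ∃ P, IsDARESolution Q R Θ P := by
    -- without a solution, `riccati` takes its default value `0`, and so does the gain
    by_contra hne
    obtain ⟨-, H, L, hH, hC, hL, -⟩ := h
    have hu := isUnit_det_of_posDef hH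
    have hA : closedLoop Q R Θ = Θ.A := by
      simp [closedLoop, gain, riccati, dif_neg hne]
    rw [hA] at hC
    -- the quadratic form `c ‖H⁻¹ x‖²` is a Lyapunov function
    set c := ‖Q‖ * ‖H‖ ^ 2 / γ with hc
    have hc0 : 0 ≤ c := by positivity
    refine hne (exists_isDARESolution hQ hR Θ (fun x => c * nrm (H⁻¹ *ᵥ x) ^ 2)
      (fun x => by positivity) fun x => ?_)
    have h1 : H⁻¹ *ᵥ (Θ.A *ᵥ x) = L *ᵥ (H⁻¹ *ᵥ x) := by
      rw [hC, mulVec_mulVec, mulVec_mulVec]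
      congr 1
      rw [← Matrix.mul_assoc, ← Matrix.mul_assoc, nonsing_inv_mul _ hu, Matrix.one_mul]
    have h2 : nrm (L *ᵥ (H⁻¹ *ᵥ x)) ≤ (1 - γ) * nrm (H⁻¹ *ᵥ x) :=
      (nrm_mulVec_le _ _).trans (mul_le_mul_of_nonneg_right hL (nrm_nonneg _))
    have h3 : nrm x ≤ ‖H‖ * nrm (H⁻¹ *ᵥ x) := by
      have := nrm_mulVec_le H (H⁻¹ *ᵥ x)
      rwa [mulVec_mulVec, mul_nonsing_inv _ hu, one_mulVec] at this
    have h4 : qf Q x ≤ c * γ * nrm (H⁻¹ *ᵥ x) ^ 2 := by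
      refine (qf_le Q x).trans ?_
      have : c * γ = ‖Q‖ * ‖H‖ ^ 2 := by rw [hc]; field_simp
      rw [this, mul_assoc, ← mul_pow]
      exact mul_le_mul_of_nonneg_left (pow_le_pow_left₀ (nrm_nonneg _) h3 2) (norm_nonneg _)
    have h5 : nrm (L *ᵥ (H⁻¹ *ᵥ x)) ^ 2 ≤ (1 - γ) * nrm (H⁻¹ *ᵥ x) ^ 2 := by
      have := pow_le_pow_left₀ (nrm_nonneg _) h2 2
      rw [mul_pow] at this
      refine this.trans (mul_le_mul_of_nonneg_right ?_ (sq_nonneg _))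
      nlinarith
    simp only [h1]
    nlinarith [mul_le_mul_of_nonneg_left h5 hc0]
  rw [riccati, dif_pos hex]
  exact hex.choose_spec

/-- The properties of the optimal controller of a stabilizable system on which the perturbation
estimates rest: the Riccati equation and the formula for the gain, written without inverses, and the
uniform exponential stability of the closed loop. -/
structure OptData (Q : Matrix (Fin n) (Fin n) ℝ) (R : Matrix (Fin d) (Fin d) ℝ) (κ γ : ℝ)
    (Θ : Sys n d) (P : Matrix (Fin n) (Fin n) ℝ) (K : Matrix (Fin d) (Fin n) ℝ)
    (C : Matrix (Fin n) (Fin n) ℝ) : Prop where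
  posDef : P.PosDef
  C_eq : C = Θ.A + Θ.B * K
  P_eq : P = Q + Θ.Aᵀ * P * C
  K_eq : R * K + Θ.Bᵀ * P * C = 0
  K_le : ‖K‖ ≤ κ
  C_pow_le : ∀ k, ‖C ^ k‖ ≤ κ * (1 - γ) ^ k

lemma IsStabilizable.optData (hQ : Q.PosDef) (hR : R.PosDef) (hγ : 0 < γ)
    (hγ' : γ ≤ 1) {Θ : Sys n d} (h : IsStabilizable Q R κ γ Θ) :
    OptData Q R κ γ Θ (riccati Q R Θ) (gain Q R Θ) (closedLoop Q R Θ) := by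
  have hP := h.isDARESolution hQ hR hγ hγ'
  refine ⟨hP.1, rfl, ?_, ?_, h.1, h.norm_pow_le⟩
  · conv_lhs => rw [hP.2]
    rw [closedLoop, gain, Matrix.mul_add, Matrix.mul_neg, Matrix.mul_neg]
    simp only [Matrix.mul_assoc]
    abel
  · have := greedy_spec hR Θ hP.1.posSemidef
    rw [greedy_riccati, Matrix.add_mul] at this
    rw [closedLoop, Matrix.mul_add, ← Matrix.mul_assoc (Θ.Bᵀ * _), add_comm (_ * Θ.A), ← add_assoc,
      this, neg_add_cancel]

/-- The solution of the Stein equation `X = C₂ᵀ X C₁ + E` is bounded by `E`. -/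
lemma stein_norm_le (hκ : 1 ≤ κ) (hγ : 0 < γ) (hγ' : γ ≤ 1) {X E C₁ C₂ : Matrix (Fin n) (Fin n) ℝ}
    (h₁ : ∀ k, ‖C₁ ^ k‖ ≤ κ * (1 - γ) ^ k) (h₂ : ∀ k, ‖C₂ ^ k‖ ≤ κ * (1 - γ) ^ k)
    (h : X = C₂ᵀ * X * C₁ + E) : ‖X‖ ≤ κ ^ 2 / γ * ‖E‖ := by
  have hg : 0 ≤ 1 - γ := by linarith
  have hg1 : 1 - γ < 1 := by linarith
  have hterm : ∀ (k : ℕ) (Y : Matrix (Fin n) (Fin n) ℝ),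
      ‖(C₂ᵀ) ^ k * Y * C₁ ^ k‖ ≤ κ ^ 2 * (1 - γ) ^ k * ‖Y‖ := fun k Y => by
    have e : ‖(C₂ᵀ) ^ k‖ = ‖C₂ ^ k‖ := by rw [← transpose_pow, norm_transpose_eq]
    have hp : (1 - γ) ^ k ≤ 1 := pow_le_one₀ hg (by linarith)
    have hp0 : 0 ≤ (1 - γ) ^ k := pow_nonneg hg k
    calc ‖(C₂ᵀ) ^ k * Y * C₁ ^ k‖ ≤ ‖C₂ ^ k‖ * ‖Y‖ * ‖C₁ ^ k‖ := by
          rw [← e]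
          exact (norm_mul_le _ _).trans (mul_le_mul_of_nonneg_right (norm_mul_le _ _)
            (norm_nonneg _))
      _ ≤ (κ * (1 - γ) ^ k) * ‖Y‖ * (κ * 1) := by
          have := h₂ k
          have h1 : ‖C₁ ^ k‖ ≤ κ * 1 := (h₁ k).trans (by gcongr)
          gcongr
      _ = _ := by ring
  -- iterate the equation; the remaining power of `C₂ᵀ`, `C₁` tends to `0`
  have hsum : ∀ N : ℕ, X = (C₂ᵀ) ^ N * X * C₁ ^ N +
      ∑ k ∈ Finset.range N, (C₂ᵀ) ^ k * E * C₁ ^ k := fun N => by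
    induction N with
    | zero => simp
    | succ N ih =>
      rw [Finset.sum_range_succ]
      conv_lhs => rw [ih, h]
      rw [mul_add, add_mul, pow_succ (C₂ᵀ), pow_succ' C₁]
      simp only [mul_assoc]
      abel
  have hbound : ∀ N : ℕ, ‖X‖ ≤ κ ^ 2 * ‖X‖ * (1 - γ) ^ N + κ ^ 2 / γ * ‖E‖ := fun N => by
    calc ‖X‖ ≤ ‖(C₂ᵀ) ^ N * X * C₁ ^ N‖ + ‖∑ k ∈ Finset.range N, (C₂ᵀ) ^ k * E * C₁ ^ k‖ := by
          conv_lhs => rw [hsum N]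
          exact norm_add_le _ _
      _ ≤ κ ^ 2 * (1 - γ) ^ N * ‖X‖ + ∑ k ∈ Finset.range N, κ ^ 2 * (1 - γ) ^ k * ‖E‖ :=
          add_le_add (hterm N X) (norm_sum_le_of_le _ fun k _ => hterm k E)
      _ ≤ _ := by
          have hgeo : ∑ k ∈ Finset.range N, (1 - γ) ^ k ≤ 1 / γ := by
            have h1 := (summable_geometric_of_lt_one hg hg1).sum_le_tsum (Finset.range N)
              fun k _ => pow_nonneg hg k
            rw [tsum_geometric_of_lt_one hg hg1, sub_sub_cancel, ← one_div] at h1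
            exact h1
          have : ∑ k ∈ Finset.range N, κ ^ 2 * (1 - γ) ^ k * ‖E‖ ≤ κ ^ 2 / γ * ‖E‖ := by
            calc _ = κ ^ 2 * ‖E‖ * ∑ k ∈ Finset.range N, (1 - γ) ^ k := by
                  rw [Finset.mul_sum]; exact Finset.sum_congr rfl fun k _ => by ring
              _ ≤ κ ^ 2 * ‖E‖ * (1 / γ) := by gcongr
              _ = _ := by ring
          linarith
  have hlim : Tendsto (fun N : ℕ => κ ^ 2 * ‖X‖ * (1 - γ) ^ N + κ ^ 2 / γ * ‖E‖) atTop
      (𝓝 (κ ^ 2 * ‖X‖ * 0 + κ ^ 2 / γ * ‖E‖)) :=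
    ((tendsto_pow_atTop_nhds_zero_of_lt_one hg hg1).const_mul _).add_const _
  have := ge_of_tendsto' hlim hbound
  simpa using this

lemma OptData.norm_C_le (hκ : 1 ≤ κ) (hγ : 0 < γ) {Θ : Sys n d}
    {P : Matrix (Fin n) (Fin n) ℝ} {K : Matrix (Fin d) (Fin n) ℝ} {C : Matrix (Fin n) (Fin n) ℝ}
    (h : OptData Q R κ γ Θ P K C) : ‖C‖ ≤ κ := by
  have := h.C_pow_le 1
  rw [pow_one, pow_one] at this
  nlinarith

variable {Θ₁ Θ₂ : Sys n d} {P₁ P₂ C₁ C₂ : Matrix (Fin n) (Fin n) ℝ}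
  {K₁ K₂ : Matrix (Fin d) (Fin n) ℝ}

/-- The Lyapunov form of the Riccati equation: `P` is the cost matrix of the optimal gain. -/
lemma OptData.P_eq_cost (h : OptData Q R κ γ Θ₁ P₁ K₁ C₁) :
    P₁ = C₁ᵀ * P₁ * C₁ + (Q + K₁ᵀ * R * K₁) := by
  have h2 : K₁ᵀ * R * K₁ = -(K₁ᵀ * (Θ₁.Bᵀ * P₁ * C₁)) := by
    rw [Matrix.mul_assoc, eq_neg_of_add_eq_zero_left h.K_eq, Matrix.mul_neg]
  conv_lhs => rw [h.P_eq]
  rw [h2]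
  conv_rhs => enter [1]; rw [h.C_eq, transpose_add, transpose_mul, ← h.C_eq]
  simp only [Matrix.add_mul, Matrix.mul_assoc]
  abel

lemma OptData.norm_P_le (hκ : 1 ≤ κ) (hγ : 0 < γ) (hγ' : γ ≤ 1)
    (h : OptData Q R κ γ Θ₁ P₁ K₁ C₁) : ‖P₁‖ ≤ κ ^ 2 / γ * (‖Q‖ + κ ^ 2 * ‖R‖) := by
  refine (stein_norm_le hκ hγ hγ' h.C_pow_le h.C_pow_le (h.P_eq_cost)).trans ?_
  have h1 : ‖K₁ᵀ * R * K₁‖ ≤ κ ^ 2 * ‖R‖ := by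
    calc ‖K₁ᵀ * R * K₁‖ ≤ ‖K₁ᵀ‖ * ‖R‖ * ‖K₁‖ := (norm_mul_le' _ _).trans
          (mul_le_mul_of_nonneg_right (norm_mul_le' _ _) (norm_nonneg _))
      _ ≤ κ * ‖R‖ * κ := by rw [norm_transpose_eq]; have := h.K_le; gcongr
      _ = _ := by ring
  have h2 := norm_add_le Q (K₁ᵀ * R * K₁)
  have h3 : 0 ≤ κ ^ 2 / γ := by positivity
  exact mul_le_mul_of_nonneg_left (by linarith) h3

lemma OptData.qf_ge (hR : R.PosDef) (h : OptData Q R κ γ Θ₁ P₁ K₁ C₁)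
    (x : Fin n → ℝ) : qf Q x ≤ qf P₁ x := by
  conv_rhs => rw [h.P_eq_cost]
  have e1 : ∀ {m k : ℕ} (N : Matrix (Fin m) (Fin k) ℝ) (W : Matrix (Fin m) (Fin m) ℝ)
      (y : Fin k → ℝ), qf (Nᵀ * W * N) y = qf W (N *ᵥ y) := fun N W y => by
    rw [qf, ← mulVec_mulVec, ← mulVec_mulVec, dot_transpose_mulVec, qf]
  have e2 : ∀ (V W : Matrix (Fin n) (Fin n) ℝ), qf (V + W) x = qf V x + qf W x := fun V W => by
    simp [qf, add_mulVec]
  rw [e2, e2, e1, e1]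
  have := qf_nonneg h.posDef (C₁ *ᵥ x)
  have := qf_nonneg hR (K₁ *ᵥ x)
  linarith

/-- The difference of two Riccati solutions, in terms of the closed-loop errors
`(A₂ - A₁) + (B₂ - B₁) Kᵢ`. -/
lemma OptData.P_sub_eq (hR : R.PosDef) (hQ : Q.PosDef) (h₁ : OptData Q R κ γ Θ₁ P₁ K₁ C₁)
    (h₂ : OptData Q R κ γ Θ₂ P₂ K₂ C₂) :
    P₁ - P₂ = C₂ᵀ * (P₁ - P₂) * C₁ +
      (-((Θ₂.A - Θ₁.A + (Θ₂.B - Θ₁.B) * K₂)ᵀ * P₁ * C₁) -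
        C₂ᵀ * P₂ * (Θ₂.A - Θ₁.A + (Θ₂.B - Θ₁.B) * K₁)) := by
  have hP₂ : P₂ᵀ = P₂ := transpose_eq_of_posDef h₂.posDef
  have hRt : Rᵀ = R := transpose_eq_of_posDef hR
  have hQt : Qᵀ = Q := transpose_eq_of_posDef hQ
  have a1 : C₂ᵀ * P₁ * C₁ = P₁ - Q - K₂ᵀ * (R * K₁) +
      (Θ₂.A - Θ₁.A + (Θ₂.B - Θ₁.B) * K₂)ᵀ * P₁ * C₁ := by
    have e1 : P₁ - Q = Θ₁.Aᵀ * P₁ * C₁ := by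
      conv_lhs => rw [h₁.P_eq]
      abel
    have e2 : R * K₁ = -(Θ₁.Bᵀ * P₁ * C₁) := eq_neg_of_add_eq_zero_left h₁.K_eq
    rw [e1, e2, h₂.C_eq]
    simp only [transpose_add, transpose_sub, transpose_mul, Matrix.add_mul, Matrix.sub_mul,
      Matrix.mul_neg, Matrix.mul_assoc]
    abel
  have a2 : C₂ᵀ * P₂ * C₁ = P₂ - Q - K₂ᵀ * (R * K₁) -
      C₂ᵀ * P₂ * (Θ₂.A - Θ₁.A + (Θ₂.B - Θ₁.B) * K₁) := by
    have e1 : P₂ - Q = C₂ᵀ * P₂ * Θ₂.A := by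
      have := congrArg Matrix.transpose h₂.P_eq
      simp only [transpose_add, transpose_mul, transpose_transpose, hP₂, hQt] at this
      conv_lhs => rw [this]
      rw [Matrix.mul_assoc]
      abel
    have e2 : K₂ᵀ * R = -(C₂ᵀ * P₂ * Θ₂.B) := by
      have := congrArg Matrix.transpose h₂.K_eq
      simp only [transpose_add, transpose_mul, transpose_transpose, hP₂, hRt,
        transpose_zero] at this
      rw [Matrix.mul_assoc]
      exact eq_neg_of_add_eq_zero_left this
    rw [e1, ← Matrix.mul_assoc, e2, h₁.C_eq]
    simp only [Matrix.mul_add, Matrix.mul_sub, Matrix.sub_mul, Matrix.neg_mul, Matrix.mul_assoc]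
    abel
  rw [Matrix.mul_sub, Matrix.sub_mul, a1, a2]
  abel

/-- The difference of two optimal gains. The first two terms are controlled by the closed-loop
errors; the last one is not, and it is the source of self-exploration. -/
lemma OptData.K_sub_eq (h₁ : OptData Q R κ γ Θ₁ P₁ K₁ C₁) (h₂ : OptData Q R κ γ Θ₂ P₂ K₂ C₂) :
    (R + Θ₁.Bᵀ * P₁ * Θ₁.B) * (K₁ - K₂) =
      Θ₁.Bᵀ * P₁ * (Θ₂.A - Θ₁.A + (Θ₂.B - Θ₁.B) * K₂) - Θ₁.Bᵀ * (P₁ - P₂) * C₂ +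
        (Θ₂.B - Θ₁.B)ᵀ * P₂ * C₂ := by
  have e1 : R * K₁ = -(Θ₁.Bᵀ * P₁ * C₁) := eq_neg_of_add_eq_zero_left h₁.K_eq
  have e2 : R * K₂ = -(Θ₂.Bᵀ * P₂ * C₂) := eq_neg_of_add_eq_zero_left h₂.K_eq
  have e3 : (R + Θ₁.Bᵀ * P₁ * Θ₁.B) * (K₁ - K₂) = R * K₁ - R * K₂ +
      Θ₁.Bᵀ * P₁ * Θ₁.B * (K₁ - K₂) := by
    rw [Matrix.add_mul, Matrix.mul_sub]
  have hC₂ : Θ₁.Bᵀ * P₁ * C₂ = Θ₁.Bᵀ * P₁ * (Θ₂.A + Θ₂.B * K₂) := by rw [h₂.C_eq]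
  rw [e3, e1, e2, h₁.C_eq]
  simp only [Matrix.mul_add, Matrix.mul_sub, Matrix.sub_mul, transpose_sub] at hC₂ ⊢
  simp only [Matrix.mul_assoc] at hC₂ ⊢
  rw [hC₂]
  abel

end Perturbation

section Perturbation

variable {n d : ℕ} {Q : Matrix (Fin n) (Fin n) ℝ} {R : Matrix (Fin d) (Fin d) ℝ} {κ γ : ℝ}
variable {Θ₁ Θ₂ : Sys n d} {P₁ P₂ C₁ C₂ : Matrix (Fin n) (Fin n) ℝ}
  {K₁ K₂ : Matrix (Fin d) (Fin n) ℝ}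

/-- The closed-loop error `(A₂ - A₁) + (B₂ - B₁) K`. -/
noncomputable def clErr (Θ₁ Θ₂ : Sys n d) (K : Matrix (Fin d) (Fin n) ℝ) : Matrix (Fin n) (Fin n) ℝ :=
  Θ₂.A - Θ₁.A + (Θ₂.B - Θ₁.B) * K

lemma norm_clErr_le (Θ₁ Θ₂ : Sys n d) {K : Matrix (Fin d) (Fin n) ℝ} (hK : ‖K‖ ≤ κ) :
    ‖clErr Θ₁ Θ₂ K‖ ≤ (1 + κ) * ‖Θ₂ - Θ₁‖ := by
  have h1 := Sys.norm_A_le (Θ₂ - Θ₁)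
  have h2 := Sys.norm_B_le (Θ₂ - Θ₁)
  rw [Sys.A_sub] at h1
  rw [Sys.B_sub] at h2
  have h3 := norm_mul_le' (Θ₂.B - Θ₁.B) K
  have h4 := norm_add_le (Θ₂.A - Θ₁.A) ((Θ₂.B - Θ₁.B) * K)
  have h5 : ‖Θ₂.B - Θ₁.B‖ * ‖K‖ ≤ ‖Θ₂ - Θ₁‖ * κ :=
    mul_le_mul h2 hK (norm_nonneg _) (norm_nonneg _)
  rw [clErr]
  linarith

lemma norm_mul₃_le {a b c e : ℕ} (X : Matrix (Fin a) (Fin b) ℝ) (Y : Matrix (Fin b) (Fin c) ℝ)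
    (Z : Matrix (Fin c) (Fin e) ℝ) {x y z : ℝ} (hx : ‖X‖ ≤ x) (hy : ‖Y‖ ≤ y) (hz : ‖Z‖ ≤ z) :
    ‖X * Y * Z‖ ≤ x * y * z := by
  have hx0 := (norm_nonneg X).trans hx
  have hy0 := (norm_nonneg Y).trans hy
  calc ‖X * Y * Z‖ ≤ ‖X‖ * ‖Y‖ * ‖Z‖ := (norm_mul_le' _ _).trans
        (mul_le_mul_of_nonneg_right (norm_mul_le' _ _) (norm_nonneg _))
    _ ≤ x * y * z := by gcongr

lemma OptData.norm_P_sub_le (hQ : Q.PosDef) (hR : R.PosDef) (hκ : 1 ≤ κ) (hγ : 0 < γ)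
    (hγ' : γ ≤ 1) (h₁ : OptData Q R κ γ Θ₁ P₁ K₁ C₁) (h₂ : OptData Q R κ γ Θ₂ P₂ K₂ C₂) {p : ℝ}
    (hp₁ : ‖P₁‖ ≤ p) (hp₂ : ‖P₂‖ ≤ p) :
    ‖P₁ - P₂‖ ≤ κ ^ 2 / γ * (p * κ) * (‖clErr Θ₁ Θ₂ K₁‖ + ‖clErr Θ₁ Θ₂ K₂‖) := by
  refine (stein_norm_le hκ hγ hγ' h₁.C_pow_le h₂.C_pow_le (h₁.P_sub_eq hR hQ h₂)).trans ?_
  have e1 := norm_mul₃_le (clErr Θ₁ Θ₂ K₂)ᵀ P₁ C₁ (norm_transpose_eq _).le hp₁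
    (h₁.norm_C_le hκ hγ)
  have e2 := norm_mul₃_le C₂ᵀ P₂ (clErr Θ₁ Θ₂ K₁)
    ((norm_transpose_eq _).le.trans (h₂.norm_C_le hκ hγ)) hp₂ le_rfl
  have e3 := norm_sub_le (-((clErr Θ₁ Θ₂ K₂)ᵀ * P₁ * C₁)) (C₂ᵀ * P₂ * clErr Θ₁ Θ₂ K₁)
  rw [norm_neg] at e3
  rw [mul_assoc (κ ^ 2 / γ)]
  have e4 : 0 ≤ κ ^ 2 / γ := by positivity
  refine mul_le_mul_of_nonneg_left ?_ e4
  refine e3.trans ((add_le_add e1 e2).trans_eq ?_)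
  ring

lemma qf_conj_add_ge {α : ℝ} (hRα : ∀ x, α * nrm x ^ 2 ≤ qf R x)
    {P : Matrix (Fin n) (Fin n) ℝ} (hP : P.PosDef) (B : Matrix (Fin n) (Fin d) ℝ) (x : Fin d → ℝ) :
    α * nrm x ^ 2 ≤ qf (R + Bᵀ * P * B) x := by
  have e : qf (R + Bᵀ * P * B) x = qf R x + qf P (B *ᵥ x) := by
    rw [qf, add_mulVec, dotProduct_add, ← mulVec_mulVec, ← mulVec_mulVec, dot_transpose_mulVec, qf,
      qf]
  rw [e]
  linarith [hRα x, qf_nonneg hP (B *ᵥ x)]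

/-- Up to the closed-loop errors, the difference of two optimal gains is the part of the error of the
input matrix that the closed loop passes on. -/
lemma OptData.norm_K_sub_le (hQ : Q.PosDef) (hR : R.PosDef) (hκ : 1 ≤ κ) (hγ : 0 < γ)
    (hγ' : γ ≤ 1) {α : ℝ} (hα : 0 < α) (hRα : ∀ x, α * nrm x ^ 2 ≤ qf R x)
    (h₁ : OptData Q R κ γ Θ₁ P₁ K₁ C₁) (h₂ : OptData Q R κ γ Θ₂ P₂ K₂ C₂) {p S : ℝ}
    (hp₁ : ‖P₁‖ ≤ p) (hp₂ : ‖P₂‖ ≤ p) (hS : ‖Θ₁‖ ≤ S) :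
    ‖K₁ - K₂ - (R + Θ₁.Bᵀ * P₁ * Θ₁.B)⁻¹ * ((Θ₂.B - Θ₁.B)ᵀ * P₂ * C₂)‖ ≤
      1 / α * (S * p + S * (κ ^ 2 / γ * (p * κ)) * κ) *
        (‖clErr Θ₁ Θ₂ K₁‖ + ‖clErr Θ₁ Θ₂ K₂‖) := by
  have hG := posDef_add_conj hR h₁.posDef.posSemidef Θ₁.B
  have hu := isUnit_det_of_posDef hG
  have hGi := inv_norm_le hG hα (qf_conj_add_ge hRα h₁.posDef Θ₁.B)
  set G := R + Θ₁.Bᵀ * P₁ * Θ₁.B with hGdef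
  set F := ‖clErr Θ₁ Θ₂ K₁‖ + ‖clErr Θ₁ Θ₂ K₂‖ with hF
  have hB : ‖Θ₁.Bᵀ‖ ≤ S := (norm_transpose_eq _).le.trans ((Sys.norm_B_le Θ₁).trans hS)
  have hS0 := (norm_nonneg _).trans hB
  have hp0 := (norm_nonneg _).trans hp₁
  have hF0 : 0 ≤ F := by positivity
  have hF2 : ‖clErr Θ₁ Θ₂ K₂‖ ≤ F := by rw [hF]; linarith [norm_nonneg (clErr Θ₁ Θ₂ K₁)]
  have e : K₁ - K₂ - G⁻¹ * ((Θ₂.B - Θ₁.B)ᵀ * P₂ * C₂) =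
      G⁻¹ * (Θ₁.Bᵀ * P₁ * clErr Θ₁ Θ₂ K₂ - Θ₁.Bᵀ * (P₁ - P₂) * C₂) := by
    have h := congrArg (G⁻¹ * ·) (h₁.K_sub_eq h₂)
    simp only [← hGdef] at h
    rw [← Matrix.mul_assoc, nonsing_inv_mul _ hu, Matrix.one_mul] at h
    rw [h, Matrix.mul_add, clErr]
    abel
  rw [e]
  have e1 := norm_mul₃_le Θ₁.Bᵀ P₁ (clErr Θ₁ Θ₂ K₂) hB hp₁ hF2
  have e2 := norm_mul₃_le Θ₁.Bᵀ (P₁ - P₂) C₂ hB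
    (h₁.norm_P_sub_le hQ hR hκ hγ hγ' h₂ hp₁ hp₂) (h₂.norm_C_le hκ hγ)
  have e3 := norm_sub_le (Θ₁.Bᵀ * P₁ * clErr Θ₁ Θ₂ K₂) (Θ₁.Bᵀ * (P₁ - P₂) * C₂)
  rw [mul_assoc]
  refine (norm_mul_le' _ _).trans (mul_le_mul hGi ?_ (norm_nonneg _) (by positivity))
  refine e3.trans ((add_le_add e1 e2).trans_eq ?_)
  rw [← hF]
  ring

/-- On the stabilizable systems of bounded norm, the optimal gain and the optimal closed loop are
Lipschitz functions of the system. -/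
lemma exists_lipschitz_gain (hQ : Q.PosDef) (hR : R.PosDef) (hκ : 1 ≤ κ) (hγ : 0 < γ)
    (hγ' : γ ≤ 1) {α : ℝ} (hα : 0 < α) (hRα : ∀ x, α * nrm x ^ 2 ≤ qf R x) {S : ℝ} (hS : 0 ≤ S) :
    ∃ Λ > 0, ∀ Θ₁ Θ₂ : Sys n d, IsStabilizable Q R κ γ Θ₁ → IsStabilizable Q R κ γ Θ₂ →
      ‖Θ₁‖ ≤ S → ‖Θ₂‖ ≤ S → ‖gain Q R Θ₁ - gain Q R Θ₂‖ ≤ Λ * ‖Θ₁ - Θ₂‖ ∧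
        ‖closedLoop Q R Θ₁ - closedLoop Q R Θ₂‖ ≤ Λ * ‖Θ₁ - Θ₂‖ := by
  set p := κ ^ 2 / γ * (‖Q‖ + κ ^ 2 * ‖R‖) with hp
  have hp0 : 0 ≤ p := by positivity
  set c₁ := 1 / α * (S * p + S * (κ ^ 2 / γ * (p * κ)) * κ) with hc₁
  have hc₁0 : 0 ≤ c₁ := by positivity
  set Λ₀ := c₁ * (2 * (1 + κ)) + 1 / α * (p * κ) with hΛ₀
  have hΛ₀0 : 0 ≤ Λ₀ := by positivity
  refine ⟨Λ₀ + (S * Λ₀ + (1 + κ)), by positivity, fun Θ₁ Θ₂ hs₁ hs₂ hS₁ hS₂ => ?_⟩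
  have h₁ := hs₁.optData hQ hR hγ hγ'
  have h₂ := hs₂.optData hQ hR hγ hγ'
  have hp₁ := h₁.norm_P_le hκ hγ hγ'
  have hp₂ := h₂.norm_P_le hκ hγ hγ'
  have hK := h₁.norm_K_sub_le hQ hR hκ hγ hγ' hα hRα h₂ hp₁ hp₂ hS₁
  have hG := posDef_add_conj hR h₁.posDef.posSemidef Θ₁.B
  have hGi := inv_norm_le hG hα (qf_conj_add_ge hRα h₁.posDef Θ₁.B)
  set K₁ := gain Q R Θ₁
  set K₂ := gain Q R Θ₂
  set C₁ := closedLoop Q R Θ₁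
  set C₂ := closedLoop Q R Θ₂
  have hF₁ := norm_clErr_le Θ₁ Θ₂ h₁.K_le
  have hF₂ := norm_clErr_le Θ₁ Θ₂ h₂.K_le
  rw [norm_sub_rev] at hF₁ hF₂
  set δ := ‖Θ₁ - Θ₂‖ with hδ
  have hδ0 : 0 ≤ δ := norm_nonneg _
  have hB : ‖(Θ₂.B - Θ₁.B)ᵀ‖ ≤ δ := by
    rw [norm_transpose_eq, ← Sys.B_sub, hδ, norm_sub_rev]
    exact Sys.norm_B_le _
  have e1 := norm_mul₃_le _ _ _ hB hp₂ (h₂.norm_C_le hκ hγ)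
  have e2 : ‖(R + Θ₁.Bᵀ * riccati Q R Θ₁ * Θ₁.B)⁻¹ *
      ((Θ₂.B - Θ₁.B)ᵀ * riccati Q R Θ₂ * C₂)‖ ≤ 1 / α * (δ * p * κ) :=
    (norm_mul_le' _ _).trans (mul_le_mul hGi e1 (norm_nonneg _) (by positivity))
  have hKL : ‖K₁ - K₂‖ ≤ Λ₀ * δ := by
    have := norm_add_le (K₁ - K₂ - (R + Θ₁.Bᵀ * riccati Q R Θ₁ * Θ₁.B)⁻¹ *
      ((Θ₂.B - Θ₁.B)ᵀ * riccati Q R Θ₂ * C₂)) ((R + Θ₁.Bᵀ * riccati Q R Θ₁ * Θ₁.B)⁻¹ *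
      ((Θ₂.B - Θ₁.B)ᵀ * riccati Q R Θ₂ * C₂))
    rw [sub_add_cancel] at this
    have h3 : c₁ * (‖clErr Θ₁ Θ₂ K₁‖ + ‖clErr Θ₁ Θ₂ K₂‖) ≤ c₁ * (2 * (1 + κ) * δ) :=
      mul_le_mul_of_nonneg_left (by linarith) hc₁0
    refine this.trans ((add_le_add (hK.trans h3) e2).trans_eq ?_)
    rw [hΛ₀]
    ring
  refine ⟨hKL.trans (mul_le_mul_of_nonneg_right ?_ hδ0), ?_⟩
  · have : 0 ≤ S * Λ₀ + (1 + κ) := by positivity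
    linarith
  have hC : C₁ - C₂ = Θ₁.B * (K₁ - K₂) - clErr Θ₁ Θ₂ K₂ := by
    rw [h₁.C_eq, h₂.C_eq, clErr]
    simp only [Matrix.mul_sub, Matrix.sub_mul]
    abel
  rw [hC]
  have e4 := norm_sub_le (Θ₁.B * (K₁ - K₂)) (clErr Θ₁ Θ₂ K₂)
  have e5 : ‖Θ₁.B * (K₁ - K₂)‖ ≤ S * (Λ₀ * δ) := (norm_mul_le' _ _).trans
    (mul_le_mul ((Sys.norm_B_le Θ₁).trans hS₁) hKL (norm_nonneg _) hS)
  nlinarith [mul_nonneg hΛ₀0 hδ0]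

lemma nrm_sq_le_qf_inv {m : ℕ} {G : Matrix (Fin m) (Fin m) ℝ} (hG : G.PosDef) {c : ℝ}
    (hc : ‖G‖ ≤ c) (x : Fin m → ℝ) : nrm x ^ 2 ≤ c * qf G⁻¹ x := by
  have hc0 := (norm_nonneg _).trans hc
  have hq0 := qf_nonneg hG.inv x
  have e1 := sq_dot_le_qf_inv hG x x
  rw [← nrm_sq] at e1
  have e2 := (qf_le G x).trans (mul_le_mul_of_nonneg_right hc (sq_nonneg _))
  rcases (sq_nonneg (nrm x)).eq_or_lt with h0 | h0
  · rw [← h0]; positivity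
  · have e3 := mul_le_mul_of_nonneg_left e2 hq0
    refine le_of_mul_le_mul_right ?_ h0
    nlinarith

/-- A matrix close to a non-singular one has a lower bound that does not depend on the matrix. -/
lemma nrm_vecMul_ge {m : ℕ} {P C C₀ : Matrix (Fin m) (Fin m) ℝ} {α : ℝ}
    (hPα : ∀ x, α * nrm x ^ 2 ≤ qf P x) (hP : P.PosDef) (hU : IsUnit C₀)
    (hC : ‖C - C₀‖ ≤ 1 / (2 * (‖C₀⁻¹‖ + 1))) (g : Fin m → ℝ) :
    α / (2 * (‖C₀⁻¹‖ + 1)) * nrm g ≤ nrm (g ᵥ* (P * C)) := by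
  set b := ‖C₀⁻¹‖ + 1 with hb
  have hb0 : 0 < b := by positivity
  have hg0 := nrm_nonneg g
  have hPg : α * nrm g ≤ nrm (P *ᵥ g) := by
    rcases hg0.eq_or_lt with h0 | h0
    · rw [← h0, mul_zero]; exact nrm_nonneg _
    · have e1 := hPα g
      have e2 := (le_abs_self _).trans (abs_dot_le g (P *ᵥ g))
      rw [qf] at e1
      nlinarith
  have hwe : g ᵥ* (P * C) = Cᵀ *ᵥ (P *ᵥ g) := by
    rw [← vecMul_vecMul, ← mulVec_transpose, ← mulVec_transpose, transpose_eq_of_posDef hP]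
  rw [hwe]
  set y := P *ᵥ g
  set w := Cᵀ *ᵥ y with hw
  have hy0 := nrm_nonneg y
  have e1 : nrm y ≤ b * nrm (C₀ᵀ *ᵥ y) := by
    have hd : IsUnit C₀.det := (Matrix.isUnit_iff_isUnit_det _).1 hU
    have e := nrm_mulVec_le (C₀⁻¹)ᵀ (C₀ᵀ *ᵥ y)
    rw [mulVec_mulVec, ← transpose_mul, mul_nonsing_inv _ hd, transpose_one, one_mulVec,
      norm_transpose_eq] at e
    nlinarith [nrm_nonneg (C₀ᵀ *ᵥ y)]
  have e2 : nrm (C₀ᵀ *ᵥ y) ≤ nrm w + 1 / (2 * b) * nrm y := by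
    have e : C₀ᵀ *ᵥ y = w - (C - C₀)ᵀ *ᵥ y := by
      rw [hw, transpose_sub, sub_mulVec]; abel
    have e3 := nrm_mulVec_le (C - C₀)ᵀ y
    rw [norm_transpose_eq] at e3
    rw [e]
    refine (nrm_sub_le _ _).trans ?_
    nlinarith
  have e3 : nrm y ≤ 2 * b * nrm w := by
    have e4 : b * (1 / (2 * b) * nrm y) = nrm y / 2 := by field_simp
    nlinarith [mul_le_mul_of_nonneg_left e2 hb0.le]
  rw [div_mul_eq_mul_div, div_le_iff₀ (by positivity)]
  linarith

/-- The scalar bookkeeping of self-exploration: a bound for `g v²`, where `v` is the size of the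
input part of a direction of size `u`, gives one for `g u²`. -/
lemma mul_sq_le_of_le_add {g u v a b k c : ℝ} (hk : 0 ≤ k) (hg : 0 ≤ g)
    (hu : 0 ≤ u) (hv : 0 ≤ v) (ha : 0 ≤ a) (hb : 0 ≤ b) (hgu : g * u ≤ 1) (hvu : v ≤ u)
    (hua : u ≤ a + (1 + k) * v) (hgv : g * v ^ 2 ≤ c * (a + b)) :
    g * u ^ 2 ≤ (a + b) * (2 + k + (1 + k) ^ 2 * c) := by
  have hgv1 : g * v ≤ 1 := (mul_le_mul_of_nonneg_left hvu hg).trans hgu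
  calc g * u ^ 2 = (g * u) * u := by ring
    _ ≤ (g * u) * (a + (1 + k) * v) := by gcongr
    _ = (g * u) * a + (g * v) * ((1 + k) * u) := by ring
    _ ≤ 1 * a + (g * v) * ((1 + k) * (a + (1 + k) * v)) := by gcongr
    _ = a + (1 + k) * (g * v) * a + (1 + k) ^ 2 * (g * v ^ 2) := by ring
    _ ≤ a + (1 + k) * 1 * a + (1 + k) ^ 2 * (c * (a + b)) := by gcongr
    _ ≤ (a + b) * (2 + k + (1 + k) ^ 2 * c) := by nlinarith

set_option maxHeartbeats 800000 in
/-- Self-exploration. Let two models near `Θ₀` differ by a matrix of rank one in the direction `u`. If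
the optimal closed loop of `Θ₀` is non-singular, then their optimal gains cannot both make the
direction `u` invisible in `z = (x, K x)`: one of the vectors `u₁ + Kᵢᵀ u₂` is bounded below. -/
lemma exists_selfExploration (hQ : Q.PosDef) (hR : R.PosDef) (hκ : 1 ≤ κ) (hγ : 0 < γ)
    (hγ' : γ ≤ 1) {α : ℝ} (hα : 0 < α) (hRα : ∀ x, α * nrm x ^ 2 ≤ qf R x)
    (hQα : ∀ x, α * nrm x ^ 2 ≤ qf Q x) {S : ℝ} (hS : 0 ≤ S) {Θ₀ : Sys n d}
    (hs₀ : IsStabilizable Q R κ γ Θ₀) (hS₀ : ‖Θ₀‖ ≤ S) (hU : IsUnit (closedLoop Q R Θ₀)) :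
    ∃ r > 0, ∃ c > 0, ∀ Θ₁ Θ₂ : Sys n d, IsStabilizable Q R κ γ Θ₁ → IsStabilizable Q R κ γ Θ₂ →
      ‖Θ₁‖ ≤ S → ‖Θ₂‖ ≤ S → ‖Θ₂ - Θ₀‖ ≤ r →
      ∀ (u : Fin n ⊕ Fin d → ℝ) (g : Fin n → ℝ), Θ₂ - Θ₁ = vecMulVec u g → nrm g * nrm u ≤ 1 →
      c * (nrm g * nrm u ^ 2) ≤
        nrm (u ∘ Sum.inl + (u ∘ Sum.inr) ᵥ* gain Q R Θ₁) +
        nrm (u ∘ Sum.inl + (u ∘ Sum.inr) ᵥ* gain Q R Θ₂) := by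
  obtain ⟨Λ, hΛ, hlip⟩ := exists_lipschitz_gain (n := n) hQ hR hκ hγ hγ' hα hRα hS
  set p := κ ^ 2 / γ * (‖Q‖ + κ ^ 2 * ‖R‖) with hp
  have hp0 : 0 ≤ p := by positivity
  set c₁ := 1 / α * (S * p + S * (κ ^ 2 / γ * (p * κ)) * κ) with hc₁
  have hc₁0 : 0 ≤ c₁ := by positivity
  set C₀ := closedLoop Q R Θ₀ with hC₀
  set b := ‖C₀⁻¹‖ + 1 with hb
  have hb0 : 0 < b := by positivity
  set gm := ‖R‖ + S * p * S + 1 with hgm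
  have hgm0 : 0 < gm := by positivity
  -- the bound for `‖g‖ ‖u₂‖²`
  set c₂ := 2 * b * gm / α * (1 + c₁) with hc₂
  have hc₂0 : 0 ≤ c₂ := by positivity
  refine ⟨1 / (2 * b * Λ), by positivity, 1 / ((2 + κ) + (1 + κ) ^ 2 * c₂), by positivity, ?_⟩
  intro Θ₁ Θ₂ hs₁ hs₂ hS₁ hS₂ hr u g hug hgu
  have h₁ := hs₁.optData hQ hR hγ hγ'
  have h₂ := hs₂.optData hQ hR hγ hγ'
  have hp₁ := h₁.norm_P_le hκ hγ hγ'
  have hp₂ := h₂.norm_P_le hκ hγ hγ'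
  have hK := h₁.norm_K_sub_le hQ hR hκ hγ hγ' hα hRα h₂ hp₁ hp₂ hS₁
  have hG := posDef_add_conj hR h₁.posDef.posSemidef Θ₁.B
  have hCC := (hlip Θ₂ Θ₀ hs₂ hs₀ hS₂ hS₀).2
  set P₁ := riccati Q R Θ₁
  set P₂ := riccati Q R Θ₂
  set K₁ := gain Q R Θ₁
  set K₂ := gain Q R Θ₂
  set C₂ := closedLoop Q R Θ₂
  rw [← hC₀] at hCC
  rw [← hp, ← hc₁] at hK
  rw [← hp] at hp₁ hp₂
  clear_value P₁ P₂ K₁ K₂ C₂ b c₁ c₂ p gm C₀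
  set u₁ := u ∘ Sum.inl with hu₁
  set u₂ := u ∘ Sum.inr with hu₂
  set f₁ := u₁ + u₂ ᵥ* K₁ with hf₁
  set f₂ := u₁ + u₂ ᵥ* K₂ with hf₂
  have hΔA : Θ₂.A - Θ₁.A = vecMulVec g u₁ := by
    rw [← Sys.A_sub, hug]
    ext i j
    simp [Sys.A, toRows₁, vecMulVec_apply, hu₁, mul_comm]
  have hΔB : Θ₂.B - Θ₁.B = vecMulVec g u₂ := by
    rw [← Sys.B_sub, hug]
    ext i j
    simp [Sys.B, toRows₂, vecMulVec_apply, hu₂, mul_comm]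
  have hcl : ∀ K : Matrix (Fin d) (Fin n) ℝ, clErr Θ₁ Θ₂ K = vecMulVec g (u₁ + u₂ ᵥ* K) :=
    fun K => by rw [clErr, hΔA, hΔB, vecMulVec_mul, vecMulVec_add]
  have hF₁ : ‖clErr Θ₁ Θ₂ K₁‖ ≤ nrm g * nrm f₁ := by rw [hcl]; exact norm_vecMulVec_le _ _
  have hF₂ : ‖clErr Θ₁ Θ₂ K₂‖ ≤ nrm g * nrm f₂ := by rw [hcl]; exact norm_vecMulVec_le _ _
  set G := R + Θ₁.Bᵀ * P₁ * Θ₁.B with hGdef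
  set w := g ᵥ* (P₂ * C₂) with hw
  set Err := K₁ - K₂ - G⁻¹ * ((Θ₂.B - Θ₁.B)ᵀ * P₂ * C₂) with hErr
  have hB3 : (Θ₂.B - Θ₁.B)ᵀ * P₂ * C₂ = vecMulVec u₂ w := by
    rw [hΔB, transpose_vecMulVec, Matrix.mul_assoc, vecMulVec_mul]
  -- `K₁ - K₂` has rank one with row `w` up to `Err`, and `u₂` reads off its row
  have hdiff : qf G⁻¹ u₂ • w = f₁ - f₂ - u₂ ᵥ* Err := by
    have : K₁ - K₂ = Err + vecMulVec (G⁻¹ *ᵥ u₂) w := by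
      rw [hErr, hB3, mul_vecMulVec]; abel
    have h2 : f₁ - f₂ = u₂ ᵥ* (K₁ - K₂) := by rw [hf₁, hf₂, vecMul_sub]; abel
    rw [h2, this, vecMul_add, add_sub_cancel_left, vecMul_vecMulVec, qf]
  have hvm : ∀ {a e : ℕ} (y : Fin a → ℝ) (X : Matrix (Fin a) (Fin e) ℝ),
      nrm (y ᵥ* X) ≤ ‖X‖ * nrm y := fun y X => by
    rw [← mulVec_transpose, ← norm_transpose_eq X]; exact nrm_mulVec_le _ _
  have hg0 := nrm_nonneg g
  have hf₁0 := nrm_nonneg f₁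
  have hf₂0 := nrm_nonneg f₂
  have hu0 := nrm_nonneg u
  have hu₂0 := nrm_nonneg u₂
  have hu₂u : nrm u₂ ≤ nrm u := nrm_right_le u
  have hgu₂ : nrm g * nrm u₂ ≤ 1 := (mul_le_mul_of_nonneg_left hu₂u hg0).trans hgu
  have hErr_le : ‖Err‖ ≤ c₁ * (nrm g * (nrm f₁ + nrm f₂)) :=
    hK.trans (mul_le_mul_of_nonneg_left (by linarith) hc₁0)
  have hq0 : 0 ≤ qf G⁻¹ u₂ := qf_nonneg hG.inv u₂
  have hmain : qf G⁻¹ u₂ * nrm w ≤ (1 + c₁) * (nrm f₁ + nrm f₂) := by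
    have e1 : qf G⁻¹ u₂ * nrm w = nrm (f₁ - f₂ - u₂ ᵥ* Err) := by
      rw [← hdiff, nrm_smul, abs_of_nonneg hq0]
    have e2 := nrm_sub_le (f₁ - f₂) (u₂ ᵥ* Err)
    have e3 := nrm_sub_le f₁ f₂
    have e4 : nrm (u₂ ᵥ* Err) ≤ c₁ * (nrm f₁ + nrm f₂) := by
      refine (hvm u₂ Err).trans ((mul_le_mul_of_nonneg_right hErr_le hu₂0).trans ?_)
      have : c₁ * (nrm g * (nrm f₁ + nrm f₂)) * nrm u₂ =
          c₁ * (nrm f₁ + nrm f₂) * (nrm g * nrm u₂) := by ring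
      rw [this]
      exact mul_le_of_le_one_right (by positivity) hgu₂
    rw [e1]
    linarith
  -- `w` is `g` sent through `P₂ C₂`, which is bounded below as `C₂` is close to `C₀`
  have hwg : α / (2 * b) * nrm g ≤ nrm w := by
    rw [hw, hb]
    exact nrm_vecMul_ge (fun x => (hQα x).trans (h₂.qf_ge hR x)) h₂.posDef hU
      ((hCC.trans (mul_le_mul_of_nonneg_left hr hΛ.le)).trans_eq
        (by rw [hb]; field_simp)) g
  have hu₂q : nrm u₂ ^ 2 ≤ gm * qf G⁻¹ u₂ := by
    have hGn : ‖G‖ ≤ gm := by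
      have hB : ‖Θ₁.B‖ ≤ S := (Sys.norm_B_le Θ₁).trans hS₁
      have e1 := norm_mul₃_le Θ₁.Bᵀ P₁ Θ₁.B ((norm_transpose_eq _).le.trans hB) hp₁ hB
      have e2 := norm_add_le R (Θ₁.Bᵀ * P₁ * Θ₁.B)
      rw [hgm, hGdef]; linarith
    exact nrm_sq_le_qf_inv hG hGn u₂
  have hu₂g : nrm g * nrm u₂ ^ 2 ≤ c₂ * (nrm f₁ + nrm f₂) := by
    have e1 : nrm g ≤ 2 * b / α * nrm w := by
      rw [div_mul_eq_mul_div, div_le_iff₀ (by positivity)] at hwg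
      rw [div_mul_eq_mul_div, le_div_iff₀ hα]
      linarith
    calc nrm g * nrm u₂ ^ 2 ≤ (2 * b / α * nrm w) * (gm * qf G⁻¹ u₂) :=
          mul_le_mul e1 hu₂q (sq_nonneg _) (mul_nonneg (by positivity) (nrm_nonneg _))
      _ = 2 * b * gm / α * (qf G⁻¹ u₂ * nrm w) := by ring
      _ ≤ 2 * b * gm / α * ((1 + c₁) * (nrm f₁ + nrm f₂)) :=
          mul_le_mul_of_nonneg_left hmain (by positivity)
      _ = _ := by rw [hc₂]; ring
  -- `u₁` is determined by `f₁` and `u₂`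
  have hu_le : nrm u ≤ nrm f₁ + (1 + κ) * nrm u₂ := by
    have e1 : u₁ = f₁ - u₂ ᵥ* K₁ := by rw [hf₁]; abel
    have e2 : nrm u₁ ≤ nrm f₁ + κ * nrm u₂ := by
      rw [e1]
      refine (nrm_sub_le _ _).trans ?_
      have := (hvm u₂ K₁).trans (mul_le_mul_of_nonneg_right h₁.K_le hu₂0)
      linarith
    have e3 := nrm_sumElim_le u₁ u₂
    rw [Sum.elim_comp_inl_inr] at e3
    linarith
  rw [one_div_mul_eq_div, div_le_iff₀ (by positivity)]
  exact mul_sq_le_of_le_add (by linarith) hg0 hu0 hu₂0 hf₁0 hf₂0 hgu hu₂u hu_le hu₂g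

end Perturbation

/-! ### Symmetry and independence in product spaces -/

section ProductSpaces

/-- If `G ≤ F + F ∘ f` for a measure-preserving map `f`, then `∫ G ≤ 2 ∫ F`. With a reflection for
`f` this replaces conditioning on the variables that `f` leaves fixed. -/
lemma lintegral_le_two_mul_of_measurePreserving {Ω : Type*} [MeasurableSpace Ω] {μ : Measure Ω}
    {f : Ω → Ω} (hf : MeasurePreserving f μ μ) {F G : Ω → ℝ≥0∞} (hF : Measurable F)
    (h : ∀ ω, G ω ≤ F ω + F (f ω)) : ∫⁻ ω, G ω ∂μ ≤ 2 * ∫⁻ ω, F ω ∂μ := by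
  calc ∫⁻ ω, G ω ∂μ ≤ ∫⁻ ω, F ω + F (f ω) ∂μ := lintegral_mono h
    _ = ∫⁻ ω, F ω ∂μ + ∫⁻ ω, F (f ω) ∂μ := lintegral_add_left hF _
    _ = 2 * ∫⁻ ω, F ω ∂μ := by rw [hf.lintegral_comp hF, two_mul]

/-- If `F + F ∘ f ≤ 2 G` for a measure-preserving map `f`, then `∫ F ≤ ∫ G`: a one-step
supermartingale inequality without conditional expectations. -/
lemma two_mul_lintegral_le_of_measurePreserving {Ω : Type*} [MeasurableSpace Ω] {μ : Measure Ω}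
    {f : Ω → Ω} (hf : MeasurePreserving f μ μ) {F G : Ω → ℝ≥0∞} (hF : Measurable F)
    (h : ∀ ω, F ω + F (f ω) ≤ 2 * G ω) : ∫⁻ ω, F ω ∂μ ≤ ∫⁻ ω, G ω ∂μ := by
  have h1 : 2 * ∫⁻ ω, F ω ∂μ ≤ 2 * ∫⁻ ω, G ω ∂μ := by
    calc 2 * ∫⁻ ω, F ω ∂μ = ∫⁻ ω, F ω ∂μ + ∫⁻ ω, F (f ω) ∂μ := by
          rw [hf.lintegral_comp hF, two_mul]
      _ = ∫⁻ ω, F ω + F (f ω) ∂μ := (lintegral_add_left hF _).symm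
      _ ≤ ∫⁻ ω, 2 * G ω ∂μ := lintegral_mono h
      _ = 2 * ∫⁻ ω, G ω ∂μ := lintegral_const_mul' _ _ (by simp)
  exact (ENNReal.mul_le_mul_iff_right (by simp) (by simp)).1 h1

lemma integral_eq_zero_of_measurePreserving {Ω : Type*} [MeasurableSpace Ω] {μ : Measure Ω}
    {f : Ω → Ω} (hf : MeasurePreserving f μ μ) {F : Ω → ℝ} (hF : Measurable F)
    (h : ∀ ω, F (f ω) = -F ω) : ∫ ω, F ω ∂μ = 0 := by
  have h1 : ∫ ω, F (f ω) ∂μ = ∫ ω, F ω ∂μ := by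
    conv_rhs => rw [← hf.map_eq]
    rw [integral_map hf.aemeasurable hF.aestronglyMeasurable]
  simp only [h, integral_neg] at h1
  linarith

variable {ι : Type*} {X : ι → Type*} [∀ i, MeasurableSpace (X i)]

lemma measurePreserving_infinitePi_map {μ : ∀ i, Measure (X i)} [∀ i, IsProbabilityMeasure (μ i)]
    {f : ∀ i, X i → X i} (hf : ∀ i, Measurable (f i)) (hμ : ∀ i, (μ i).map (f i) = μ i) :
    MeasurePreserving (fun (ω : ∀ i, X i) i => f i (ω i)) (Measure.infinitePi μ)
      (Measure.infinitePi μ) := by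
  refine ⟨by fun_prop, ?_⟩
  rw [Measure.infinitePi_map_pi μ hf]
  congr 1
  exact funext hμ

open Classical in
/-- The reflection that changes the signs of the coordinates in `A`. -/
noncomputable def flipOn (A : Set ι) (ω : ι → ℝ) : ι → ℝ := fun a => if a ∈ A then -ω a else ω a

lemma flipOn_of_mem {A : Set ι} {a : ι} (h : a ∈ A) (ω : ι → ℝ) : flipOn A ω a = -ω a :=
  if_pos h

lemma flipOn_of_notMem {A : Set ι} {a : ι} (h : a ∉ A) (ω : ι → ℝ) : flipOn A ω a = ω a :=
  if_neg h

/-- Independent centred Gaussians are symmetric in each coordinate separately. -/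
lemma measurePreserving_flipOn {v : ι → ℝ≥0} (A : Set ι) :
    MeasurePreserving (flipOn A) (Measure.infinitePi fun i => gaussianReal 0 (v i))
      (Measure.infinitePi fun i => gaussianReal 0 (v i)) := by
  classical
  refine measurePreserving_infinitePi_map (X := fun _ => ℝ)
    (f := fun i x => if i ∈ A then -x else x) (fun i => ?_) fun i => ?_
  · by_cases h : i ∈ A <;> simp only [h, if_true, if_false] <;> fun_prop
  · by_cases h : i ∈ A
    · simp only [h, if_true]
      rw [gaussianReal_map_neg, neg_zero]
    · simp only [h, if_false]
      exact Measure.map_id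

lemma comp_flipOn_of_dependsOn {β : Type*} {I A : Set ι} {f : (ι → ℝ) → β} (hf : DependsOn f I)
    (h : Disjoint I A) (ω : ι → ℝ) : f (flipOn A ω) = f ω :=
  hf fun _ hi => flipOn_of_notMem (Set.disjoint_left.1 h hi) ω

variable {μ : ι → Measure ℝ} [∀ i, IsProbabilityMeasure (μ i)]

lemma measurable_iSup_comap_of_dependsOn {β : Type*} [MeasurableSpace β] {I : Set ι}
    {f : (ι → ℝ) → β} (hf : Measurable f) (hI : DependsOn f I) :
    Measurable[⨆ i ∈ I, MeasurableSpace.comap (fun ω : ι → ℝ => ω i) inferInstance] f := by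
  classical
  -- coordinates outside `I` may be set to `0`
  have e : f = f ∘ fun ω i => if i ∈ I then ω i else 0 := by
    funext ω
    exact hI fun i hi => by simp [hi]
  rw [e]
  refine hf.comp (@measurable_pi_lambda _ _ _ (_) _ _ fun i => ?_)
  by_cases h : i ∈ I
  · simp only [h, if_true]
    exact Measurable.mono (comap_measurable fun ω : ι → ℝ => ω i)
      (le_iSup₂_of_le i h le_rfl) le_rfl
  · simp only [h, if_false]
    exact measurable_const

lemma indep_of_disjoint {I J : Set ι} (h : Disjoint I J) :
    Indep (⨆ i ∈ I, MeasurableSpace.comap (fun ω : ι → ℝ => ω i) inferInstance)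
      (⨆ i ∈ J, MeasurableSpace.comap (fun ω : ι → ℝ => ω i) inferInstance)
      (Measure.infinitePi μ) := by
  refine indep_iSup_of_disjoint (fun i => (measurable_pi_apply i).comap_le) ?_ h
  exact iIndepFun_infinitePi (P := μ) (X := fun _ x => x) fun _ => measurable_id

/-- Functions of disjoint sets of coordinates are independent. -/
lemma indepFun_of_dependsOn {β β' : Type*} [MeasurableSpace β] [MeasurableSpace β'] {I J : Set ι}
    (h : Disjoint I J) {f : (ι → ℝ) → β} {g : (ι → ℝ) → β'} (hf : Measurable f)
    (hg : Measurable g) (hfI : DependsOn f I) (hgJ : DependsOn g J) :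
    IndepFun f g (Measure.infinitePi μ) := by
  rw [IndepFun_iff_Indep]
  exact indep_of_indep_of_le_left (indep_of_indep_of_le_right (indep_of_disjoint h)
    (measurable_iSup_comap_of_dependsOn hg hgJ).comap_le)
    (measurable_iSup_comap_of_dependsOn hf hfI).comap_le

lemma lintegral_mul_of_dependsOn {I J : Set ι} (h : Disjoint I J) {f g : (ι → ℝ) → ℝ≥0∞}
    (hf : Measurable f) (hg : Measurable g) (hfI : DependsOn f I) (hgJ : DependsOn g J) :
    ∫⁻ ω, f ω * g ω ∂(Measure.infinitePi μ) =
      (∫⁻ ω, f ω ∂(Measure.infinitePi μ)) * ∫⁻ ω, g ω ∂(Measure.infinitePi μ) :=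
  lintegral_mul_eq_lintegral_mul_lintegral_of_indepFun hf hg
    (indepFun_of_dependsOn h hf hg hfI hgJ)

end ProductSpaces

/-! ### Moments of Gaussian variables -/

section Gaussian

lemma integral_sq_gaussianReal (v : ℝ≥0) : ∫ x, x ^ 2 ∂(gaussianReal 0 v) = v := by
  have h := variance_id_gaussianReal (μ := 0) (v := v)
  rw [variance_eq_integral (by fun_prop)] at h
  simpa using h

lemma integrable_sq_gaussianReal (v : ℝ≥0) : Integrable (fun x : ℝ => x ^ 2) (gaussianReal 0 v) :=
  (memLp_id_gaussianReal (μ := 0) (v := v) 2).integrable_sq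

lemma lintegral_sq_gaussianReal (v : ℝ≥0) :
    ∫⁻ x, ENNReal.ofReal (x ^ 2) ∂(gaussianReal 0 v) = v := by
  rw [← ofReal_integral_eq_lintegral_ofReal (integrable_sq_gaussianReal v)
    (ae_of_all _ fun x => sq_nonneg x), integral_sq_gaussianReal]
  simp

/-- `E[wᵀ P w] = v tr P` when `E[wᵢ wⱼ] = v δᵢⱼ`. -/
lemma integral_qf_of_cov {Ω : Type*} [MeasurableSpace Ω] {μ : Measure Ω} {m : ℕ}
    {w : Ω → Fin m → ℝ} {v : ℝ} (hint : ∀ i j, Integrable (fun ω => w ω i * w ω j) μ)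
    (hcov : ∀ i j, ∫ ω, w ω i * w ω j ∂μ = if i = j then v else 0)
    (P : Matrix (Fin m) (Fin m) ℝ) :
    Integrable (fun ω => qf P (w ω)) μ ∧ ∫ ω, qf P (w ω) ∂μ = v * P.trace := by
  have e : ∀ ω, qf P (w ω) = ∑ i, ∑ j, P i j * (w ω i * w ω j) := fun ω => by
    simp only [qf, dotProduct, mulVec, Finset.mul_sum]
    exact Finset.sum_congr rfl fun i _ => Finset.sum_congr rfl fun j _ => by ring
  have hi : ∀ i j, Integrable (fun ω => P i j * (w ω i * w ω j)) μ := fun i j =>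
    (hint i j).const_mul _
  simp only [e]
  refine ⟨integrable_finsetSum _ fun i _ => integrable_finsetSum _ fun j _ => hi i j, ?_⟩
  rw [integral_finsetSum _ fun i _ => integrable_finsetSum _ fun j _ => hi i j]
  simp only [integral_finsetSum _ fun j _ => hi _ j, integral_const_mul, hcov]
  simp [Matrix.trace, Finset.mul_sum, mul_comm]

lemma gaussianReal_abs_ge_le (v : ℝ≥0) {t : ℝ} (ht : 0 ≤ t) :
    (gaussianReal 0 v) {x | t ≤ |x|} ≤ ENNReal.ofReal (2 * Real.exp (-t ^ 2 / (2 * v))) := by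
  have h : HasSubgaussianMGF id v (gaussianReal 0 v) := by
    refine ⟨fun s => integrable_exp_mul_gaussianReal s, fun s => ?_⟩
    rw [mgf_id_gaussianReal]
    simp
  have h1 := h.measure_ge_le ht
  have h2 := h.neg.measure_ge_le ht
  have hsub : {x : ℝ | t ≤ |x|} ⊆ {x | t ≤ id x} ∪ {x | t ≤ (-id) x} := fun x hx => by
    rcases le_abs.1 (show t ≤ |x| from hx) with h | h
    · exact Or.inl h
    · exact Or.inr h
  refine (measure_mono hsub).trans ((measure_union_le _ _).trans ?_)
  rw [two_mul, ENNReal.ofReal_add (Real.exp_pos _).le (Real.exp_pos _).le]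
  refine add_le_add ?_ ?_ <;>
  · rw [← ofReal_measureReal]
    exact ENNReal.ofReal_le_ofReal (by assumption)

lemma gaussianReal_pos_of_isOpen {v : ℝ≥0} (hv : v ≠ 0) {U : Set ℝ} (hU : IsOpen U)
    (hne : U.Nonempty) : 0 < gaussianReal 0 v U := by
  have : (gaussianReal 0 v).IsOpenPosMeasure :=
    (gaussianReal_absolutelyContinuous' 0 hv).isOpenPosMeasure
  exact hU.measure_pos _ hne

end Gaussian

/-! ### The optimal average cost -/

section AverageCost

variable {n d : ℕ} {Q : Matrix (Fin n) (Fin n) ℝ} {R : Matrix (Fin d) (Fin d) ℝ}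

/-- The state at time `t` under the policy `π`. -/
noncomputable def Policy.state (π : Policy n d) (Θ : Sys n d) (t : ℕ) (w : ℕ → Fin n → ℝ) :
    Fin n → ℝ := π.history Θ w t (Fin.last t)

/-- The input at time `t` under the policy `π`. -/
noncomputable def Policy.input (π : Policy n d) (Θ : Sys n d) (t : ℕ) (w : ℕ → Fin n → ℝ) :
    Fin d → ℝ := π.act t (π.history Θ w t)

/-- The expected cost of time step `t` under the policy `π`. -/
noncomputable def Policy.meanCost (π : Policy n d) (Q : Matrix (Fin n) (Fin n) ℝ)
    (R : Matrix (Fin d) (Fin d) ℝ) (σ : ℝ) (Θ : Sys n d) (t : ℕ) : ℝ≥0∞ :=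
  ∫⁻ w, ENNReal.ofReal (stepCost Q R (π.state Θ t w) (π.input Θ t w)) ∂(noiseLaw n σ)

/-- The expectation of the value function `xᵀ P x` at time `t` under the policy `π`. -/
noncomputable def Policy.meanValue (π : Policy n d) (P : Matrix (Fin n) (Fin n) ℝ) (σ : ℝ)
    (Θ : Sys n d) (t : ℕ) : ℝ≥0∞ :=
  ∫⁻ w, ENNReal.ofReal (qf P (π.state Θ t w)) ∂(noiseLaw n σ)

lemma Policy.state_succ (π : Policy n d) (Θ : Sys n d) (t : ℕ) (w : ℕ → Fin n → ℝ) :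
    π.state Θ (t + 1) w = (Θ.A *ᵥ π.state Θ t w + Θ.B *ᵥ π.input Θ t w) + w t := by
  simp [Policy.state, Policy.input, Policy.history]

lemma Policy.history_congr (π : Policy n d) (Θ : Sys n d) {w w' : ℕ → Fin n → ℝ} (t : ℕ)
    (h : ∀ s < t, w s = w' s) : π.history Θ w t = π.history Θ w' t := by
  induction t with
  | zero => rfl
  | succ t ih =>
    simp only [Policy.history]
    rw [ih fun s hs => h s (hs.trans t.lt_succ_self), h t t.lt_succ_self]

lemma measurable_mulVec_const {Ω : Type*} [MeasurableSpace Ω] {m k : ℕ}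
    (A : Matrix (Fin m) (Fin k) ℝ) {f : Ω → Fin k → ℝ} (hf : Measurable f) :
    Measurable fun ω => A *ᵥ f ω := by
  have : Continuous fun x : Fin k → ℝ => A *ᵥ x := by fun_prop
  exact this.measurable.comp hf

lemma measurable_qf {Ω : Type*} [MeasurableSpace Ω] {m : ℕ} (P : Matrix (Fin m) (Fin m) ℝ)
    {f : Ω → Fin m → ℝ} (hf : Measurable f) : Measurable fun ω => qf P (f ω) := by
  have : Continuous fun x : Fin m → ℝ => qf P x := by unfold qf; fun_prop
  exact this.measurable.comp hf

lemma Policy.measurable_history (π : Policy n d) (Θ : Sys n d) (t : ℕ) :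
    Measurable fun w => π.history Θ w t := by
  induction t with
  | zero => exact measurable_const
  | succ t ih =>
    refine measurable_pi_lambda _ fun i => ?_
    refine Fin.lastCases ?_ (fun i => ?_) i
    · simp only [Policy.history, Fin.snoc_last]
      exact ((measurable_mulVec_const _ ((measurable_pi_apply _).comp ih)).add
        (measurable_mulVec_const _ ((π.measurable_act t).comp ih))).add (measurable_pi_apply t)
    · simp only [Policy.history, Fin.snoc_castSucc]
      exact (measurable_pi_apply i).comp ih

lemma Policy.measurable_state (π : Policy n d) (Θ : Sys n d) (t : ℕ) :
    Measurable (π.state Θ t) := (measurable_pi_apply _).comp (π.measurable_history Θ t)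

lemma Policy.measurable_input (π : Policy n d) (Θ : Sys n d) (t : ℕ) :
    Measurable (π.input Θ t) := (π.measurable_act t).comp (π.measurable_history Θ t)

lemma stepCost_eq (x : Fin n → ℝ) (u : Fin d → ℝ) : stepCost Q R x u = qf Q x + qf R u := rfl

lemma Policy.expectedCost_eq (π : Policy n d) (σ : ℝ) (Θ : Sys n d) (N : ℕ) :
    π.expectedCost Q R σ Θ N = ∑ t ∈ Finset.range N, π.meanCost Q R σ Θ t := by
  rw [Policy.expectedCost, lintegral_finsetSum]
  · rfl
  · intro t _
    exact ((measurable_qf Q (π.measurable_state Θ t)).add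
      (measurable_qf R (π.measurable_input Θ t))).ennreal_ofReal

instance (n : ℕ) (σ : ℝ) : IsProbabilityMeasure (noiseLaw n σ) := by
  unfold noiseLaw; infer_instance

open Classical in
/-- Reversing the noise of time `t` alone preserves the law of the noise. -/
lemma measurePreserving_neg_noise (n : ℕ) (σ : ℝ) (t : ℕ) :
    MeasurePreserving (fun (w : ℕ → Fin n → ℝ) s => if s = t then -w s else w s) (noiseLaw n σ)
      (noiseLaw n σ) := by
  refine measurePreserving_infinitePi_map (X := fun _ : ℕ => Fin n → ℝ)
    (f := fun s x => if s = t then -x else x) (fun s => ?_) fun s => ?_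
  · by_cases h : s = t <;> simp only [h, if_true, if_false] <;> fun_prop
  · by_cases h : s = t
    · simp only [h, if_true]
      have := (measurePreserving_pi (fun _ : Fin n => gaussianReal 0 (Real.toNNReal (σ ^ 2)))
        (fun _ : Fin n => gaussianReal 0 (Real.toNNReal (σ ^ 2))) (f := fun _ x => -x)
        fun _ => ⟨measurable_neg, by rw [gaussianReal_map_neg, neg_zero]⟩).map_eq
      exact this
    · simp only [h, if_false]
      exact Measure.map_id

lemma lintegral_qf_noise {P : Matrix (Fin n) (Fin n) ℝ} (hP : P.PosDef) (σ : ℝ) (t : ℕ) :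
    ∫⁻ w, ENNReal.ofReal (qf P (w t)) ∂(noiseLaw n σ) = ENNReal.ofReal (σ ^ 2 * P.trace) := by
  classical
  set v := Real.toNNReal (σ ^ 2) with hv
  have hv' : (v : ℝ) = σ ^ 2 := Real.coe_toNNReal _ (sq_nonneg σ)
  set ν : Measure (Fin n → ℝ) := Measure.pi fun _ => gaussianReal 0 v with hν
  have hmap : (noiseLaw n σ).map (fun w => w t) = ν := Measure.infinitePi_map_eval _ t
  have hcoord : ∀ i, ν.map (fun x => x i) = gaussianReal 0 v := fun i =>
    (measurePreserving_eval (fun _ : Fin n => gaussianReal 0 v) i).map_eq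
  have hL : ∀ i, MemLp (fun x : Fin n → ℝ => x i) 2 ν := fun i => by
    have h := memLp_id_gaussianReal (μ := 0) (v := v) 2
    rw [← hcoord i] at h
    exact h.comp_of_map (measurable_pi_apply i).aemeasurable
  have hint : ∀ i j, Integrable (fun x : Fin n → ℝ => x i * x j) ν := fun i j =>
    (hL i).integrable_mul (hL j)
  have hcov : ∀ i j, ∫ x, x i * x j ∂ν = if i = j then (v : ℝ) else 0 := fun i j => by
    by_cases hij : i = j
    · subst hij
      have h : ∫ y, y ^ 2 ∂(ν.map fun x => x i) = ∫ x, (x i) ^ 2 ∂ν :=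
        integral_map (measurable_pi_apply i).aemeasurable (by fun_prop)
      rw [hcoord, integral_sq_gaussianReal] at h
      simp only [if_true, ← pow_two, ← h]
    · rw [if_neg hij]
      have hmp := measurePreserving_pi (fun _ : Fin n => gaussianReal 0 v)
        (fun _ : Fin n => gaussianReal 0 v) (f := fun k x => if k = i then -x else x) fun k => by
          by_cases h : k = i
          · simp only [h, if_true]
            exact ⟨measurable_neg, by rw [gaussianReal_map_neg, neg_zero]⟩
          · simp only [h, if_false]
            exact MeasurePreserving.id _
      refine integral_eq_zero_of_measurePreserving hmp (by fun_prop) fun x => ?_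
      simp [Ne.symm hij]
  have h := integral_qf_of_cov (μ := ν) (w := fun x => x) hint hcov P
  have e : ∫⁻ w, ENNReal.ofReal (qf P (w t)) ∂(noiseLaw n σ) =
      ∫⁻ x, ENNReal.ofReal (qf P x) ∂ν := by
    have hm : Measurable fun x : Fin n → ℝ => ENNReal.ofReal (qf P x) :=
      (measurable_qf P measurable_id).ennreal_ofReal
    rw [← hmap, lintegral_map hm (measurable_pi_apply t)]
  rw [e, ← ofReal_integral_eq_lintegral_ofReal h.1 (ae_of_all _ fun x => qf_nonneg hP x), h.2, hv']

/-- The noise of time `t` is independent of the state and input of time `t`, so it adds `σ² tr P` to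
the expected value; independence enters through the reflection of `w_t`. -/
lemma Policy.meanValue_succ (π : Policy n d) {P : Matrix (Fin n) (Fin n) ℝ} (hP : P.PosDef)
    (σ : ℝ) (Θ : Sys n d) (t : ℕ) :
    π.meanValue P σ Θ (t + 1) =
      ∫⁻ w, ENNReal.ofReal (qf P (Θ.A *ᵥ π.state Θ t w + Θ.B *ᵥ π.input Θ t w)) ∂(noiseLaw n σ) +
        ENNReal.ofReal (σ ^ 2 * P.trace) := by
  classical
  set a : (ℕ → Fin n → ℝ) → Fin n → ℝ :=
    fun w => Θ.A *ᵥ π.state Θ t w + Θ.B *ᵥ π.input Θ t w with ha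
  have ham : Measurable a := (measurable_mulVec_const _ (π.measurable_state Θ t)).add
    (measurable_mulVec_const _ (π.measurable_input Θ t))
  have hwm : Measurable fun w : ℕ → Fin n → ℝ => w t := measurable_pi_apply t
  set f : (ℕ → Fin n → ℝ) → ℕ → Fin n → ℝ := fun w s => if s = t then -w s else w s with hf
  have haf : ∀ w, a (f w) = a w := fun w => by
    have : π.history Θ (f w) t = π.history Θ w t :=
      π.history_congr Θ t fun s hs => by simp [hf, hs.ne]
    simp only [ha, Policy.state, Policy.input, this]
  set F : (ℕ → Fin n → ℝ) → ℝ≥0∞ := fun w => ENNReal.ofReal (qf P (a w + w t)) with hF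
  set G : (ℕ → Fin n → ℝ) → ℝ≥0∞ := fun w => ENNReal.ofReal (qf P (a w)) +
    ENNReal.ofReal (qf P (w t)) with hG
  have hFm : Measurable F := (measurable_qf P (ham.add hwm)).ennreal_ofReal
  -- the parallelogram identity
  have key : ∀ w, F w + F (f w) = 2 * G w := fun w => by
    have h0 := fun x => qf_nonneg hP x
    have e1 := qf_add (transpose_eq_of_posDef hP) (a w) (w t)
    have e2 := qf_add (transpose_eq_of_posDef hP) (a w) (-w t)
    have e3 : qf P (-w t) = qf P (w t) := by simp [qf, mulVec_neg]
    have e4 : (f w) t = -w t := by simp [hf]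
    simp only [hF, hG, haf, e4]
    rw [← ENNReal.ofReal_add (h0 _) (h0 _), ← ENNReal.ofReal_add (h0 _) (h0 _),
      show (2 : ℝ≥0∞) = ENNReal.ofReal 2 by simp, ← ENNReal.ofReal_mul (by norm_num), e1, e2, e3]
    congr 1
    simp only [mulVec_neg, dotProduct_neg]
    ring
  have hmp := measurePreserving_neg_noise n σ t
  have h1 : ∫⁻ w, F w ∂(noiseLaw n σ) = ∫⁻ w, G w ∂(noiseLaw n σ) := by
    refine le_antisymm (two_mul_lintegral_le_of_measurePreserving hmp hFm fun w => (key w).le) ?_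
    have := lintegral_le_two_mul_of_measurePreserving hmp hFm (G := fun w => 2 * G w)
      fun w => (key w).ge
    rw [lintegral_const_mul' _ _ (by simp)] at this
    exact (ENNReal.mul_le_mul_iff_right (by simp) (by simp)).1 this
  have h2 : π.meanValue P σ Θ (t + 1) = ∫⁻ w, F w ∂(noiseLaw n σ) := by
    simp only [Policy.meanValue, π.state_succ, hF, ha]
  rw [h2, h1, hG, lintegral_add_left (measurable_qf P ham).ennreal_ofReal, lintegral_qf_noise hP]

/-- The Bellman inequality: by completion of the square no input does better than the optimal gain. -/
lemma Policy.meanValue_add_le (π : Policy n d) (hQ : Q.PosDef) (hR : R.PosDef) {Θ : Sys n d}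
    {P : Matrix (Fin n) (Fin n) ℝ} (hP : IsDARESolution Q R Θ P) (σ : ℝ) (t : ℕ) :
    π.meanValue P σ Θ t + ENNReal.ofReal (σ ^ 2 * P.trace) ≤
      π.meanCost Q R σ Θ t + π.meanValue P σ Θ (t + 1) := by
  rw [π.meanValue_succ hP.1, ← add_assoc]
  refine add_le_add_left ?_ _
  rw [Policy.meanCost, ← lintegral_add_left]
  · refine lintegral_mono fun w => ?_
    have h := stepCost_add_qf (Q := Q) hR Θ hP.1.posSemidef (π.state Θ t w) (π.input Θ t w)
    rw [show ricStep Q R Θ P = P from hP.2.symm] at h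
    have h1 := qf_nonneg (posDef_add_conj hR hP.1.posSemidef Θ.B)
      (π.input Θ t w - greedy R Θ P *ᵥ π.state Θ t w)
    have h2 : 0 ≤ stepCost Q R (π.state Θ t w) (π.input Θ t w) :=
      add_nonneg (qf_nonneg hQ _) (qf_nonneg hR _)
    rw [← ENNReal.ofReal_add h2 (qf_nonneg hP.1 _)]
    exact ENNReal.ofReal_le_ofReal (by linarith)
  · exact ((measurable_qf Q (π.measurable_state Θ t)).add
      (measurable_qf R (π.measurable_input Θ t))).ennreal_ofReal

/-- The Bellman inequality, summed over time. -/
lemma Policy.mul_le_cost_add (π : Policy n d) (hQ : Q.PosDef) (hR : R.PosDef) {Θ : Sys n d}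
    {P : Matrix (Fin n) (Fin n) ℝ} (hP : IsDARESolution Q R Θ P) (σ : ℝ) (t : ℕ) :
    t * ENNReal.ofReal (σ ^ 2 * P.trace) ≤
      ∑ s ∈ Finset.range t, π.meanCost Q R σ Θ s + π.meanValue P σ Θ t := by
  induction t with
  | zero => simp
  | succ t ih =>
    rw [Finset.sum_range_succ, Nat.cast_succ, add_mul, one_mul, add_assoc]
    calc _ ≤ ∑ s ∈ Finset.range t, π.meanCost Q R σ Θ s + π.meanValue P σ Θ t +
          ENNReal.ofReal (σ ^ 2 * P.trace) := add_le_add_left ih _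
      _ ≤ _ := by
          rw [add_assoc]
          exact add_le_add_right (π.meanValue_add_le hQ hR hP σ t) _

/-- The policy that applies the optimal gain. -/
noncomputable def gainPolicy (K : Matrix (Fin d) (Fin n) ℝ) : Policy n d where
  act t h := K *ᵥ h (Fin.last t)
  measurable_act t := measurable_mulVec_const K (measurable_pi_apply (Fin.last t))

/-- For the optimal gain the Bellman inequality is an equality. -/
lemma gainPolicy_cost_le (hQ : Q.PosDef) (hR : R.PosDef) {Θ : Sys n d}
    {P : Matrix (Fin n) (Fin n) ℝ} (hP : IsDARESolution Q R Θ P) (σ : ℝ) (N : ℕ) :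
    ∑ s ∈ Finset.range N, (gainPolicy (greedy R Θ P)).meanCost Q R σ Θ s +
      (gainPolicy (greedy R Θ P)).meanValue P σ Θ N ≤ N * ENNReal.ofReal (σ ^ 2 * P.trace) := by
  set π := gainPolicy (greedy R Θ P) with hπ
  induction N with
  | zero => simp [Policy.meanValue, Policy.state, Policy.history, qf]
  | succ t ih =>
    rw [Finset.sum_range_succ, Nat.cast_succ, add_mul, one_mul, add_assoc]
    have hstep : π.meanCost Q R σ Θ t + π.meanValue P σ Θ (t + 1) ≤
        π.meanValue P σ Θ t + ENNReal.ofReal (σ ^ 2 * P.trace) := by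
      rw [π.meanValue_succ hP.1, ← add_assoc]
      refine add_le_add_left ?_ _
      rw [Policy.meanCost, ← lintegral_add_left]
      · refine lintegral_mono fun w => ?_
        have hu : π.input Θ t w = greedy R Θ P *ᵥ π.state Θ t w := rfl
        have h := stepCost_add_qf (Q := Q) hR Θ hP.1.posSemidef (π.state Θ t w) (π.input Θ t w)
        rw [show ricStep Q R Θ P = P from hP.2.symm] at h
        have h1 : qf (R + Θ.Bᵀ * P * Θ.B) (π.input Θ t w - greedy R Θ P *ᵥ π.state Θ t w) = 0 := by
          rw [hu, sub_self]; simp [qf]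
        have h2 : 0 ≤ stepCost Q R (π.state Θ t w) (π.input Θ t w) :=
          add_nonneg (qf_nonneg hQ _) (qf_nonneg hR _)
        rw [← ENNReal.ofReal_add h2 (qf_nonneg hP.1 _)]
        exact ENNReal.ofReal_le_ofReal (by linarith)
      · exact ((measurable_qf Q (π.measurable_state Θ t)).add
          (measurable_qf R (π.measurable_input Θ t))).ennreal_ofReal
    calc _ ≤ ∑ s ∈ Finset.range t, π.meanCost Q R σ Θ s +
          (π.meanValue P σ Θ t + ENNReal.ofReal (σ ^ 2 * P.trace)) := add_le_add_right hstep _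
      _ ≤ _ := by
          rw [← add_assoc]
          exact add_le_add_left ih _

lemma Policy.meanValue_le (π : Policy n d) (hR : R.PosDef) {α : ℝ} (hα : 0 < α)
    (hQα : ∀ x, α * nrm x ^ 2 ≤ qf Q x) (P : Matrix (Fin n) (Fin n) ℝ) (σ : ℝ) (Θ : Sys n d)
    (t : ℕ) : π.meanValue P σ Θ t ≤ ENNReal.ofReal (‖P‖ / α) * π.meanCost Q R σ Θ t := by
  rw [Policy.meanValue, Policy.meanCost, ← lintegral_const_mul' _ _ (by simp)]
  refine lintegral_mono fun w => ?_
  rw [← ENNReal.ofReal_mul (by positivity)]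
  refine ENNReal.ofReal_le_ofReal ((qf_le _ _).trans ?_)
  rw [div_mul_eq_mul_div, le_div_iff₀ hα, mul_assoc, stepCost_eq]
  refine mul_le_mul_of_nonneg_left ?_ (norm_nonneg P)
  linarith [hQα (π.state Θ t w), qf_nonneg hR (π.input Θ t w)]

/-- A policy of low total cost has, in every window of `m` of the first `m²` steps, a time at which
the state is small, and up to which the Bellman inequality bounds its cost from below. -/
lemma Policy.cost_ge (π : Policy n d) (hQ : Q.PosDef) (hR : R.PosDef) {α : ℝ} (hα : 0 < α)
    (hQα : ∀ x, α * nrm x ^ 2 ≤ qf Q x) {Θ : Sys n d} {P : Matrix (Fin n) (Fin n) ℝ}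
    (hP : IsDARESolution Q R Θ P) (σ : ℝ) {m : ℕ} (hm : 0 < m) :
    ((m * m - m : ℕ) : ℝ≥0∞) * ENNReal.ofReal (σ ^ 2 * P.trace) ≤ π.expectedCost Q R σ Θ (m * m) +
      ENNReal.ofReal (‖P‖ / α) * (m * ENNReal.ofReal (σ ^ 2 * P.trace)) := by
  set J := ENNReal.ofReal (σ ^ 2 * P.trace) with hJ
  set c := ENNReal.ofReal (‖P‖ / α)
  rw [π.expectedCost_eq]
  rcases le_total (((m * m : ℕ) : ℝ≥0∞) * J)
    (∑ t ∈ Finset.range (m * m), π.meanCost Q R σ Θ t) with h | h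
  · refine le_add_right (le_trans ?_ h)
    gcongr
    exact Nat.sub_le _ _
  -- the cheapest of the last `m` steps
  obtain ⟨t, ht, hmin⟩ := Finset.exists_min_image (Finset.Ico (m * m - m) (m * m))
    (fun t => π.meanCost Q R σ Θ t) ⟨m * m - m, by
      rw [Finset.mem_Ico]; exact ⟨le_rfl, Nat.sub_lt (Nat.mul_pos hm hm) hm⟩⟩
  rw [Finset.mem_Ico] at ht
  have h1 : (m : ℝ≥0∞) * π.meanCost Q R σ Θ t ≤ ((m * m : ℕ) : ℝ≥0∞) * J := by
    refine le_trans ?_ h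
    refine le_trans ?_ (Finset.sum_le_sum_of_subset (s := Finset.Ico (m * m - m) (m * m))
      fun s hs => Finset.mem_range.2 (Finset.mem_Ico.1 hs).2)
    have := Finset.card_nsmul_le_sum (Finset.Ico (m * m - m) (m * m))
      (fun t => π.meanCost Q R σ Θ t) _ hmin
    rw [Nat.card_Ico, Nat.sub_sub_self (Nat.le_mul_self m), nsmul_eq_mul] at this
    exact this
  have h2 : π.meanCost Q R σ Θ t ≤ m * J := by
    rw [Nat.cast_mul, mul_assoc] at h1
    exact (ENNReal.mul_le_mul_iff_right (by simpa using hm.ne') (by simp)).1 h1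
  calc ((m * m - m : ℕ) : ℝ≥0∞) * J ≤ t * J := by gcongr; exact ht.1
    _ ≤ ∑ s ∈ Finset.range t, π.meanCost Q R σ Θ s + π.meanValue P σ Θ t :=
        π.mul_le_cost_add hQ hR hP σ t
    _ ≤ _ := by
        refine add_le_add ?_ ?_
        · exact Finset.sum_le_sum_of_subset (Finset.range_mono ht.2.le)
        · exact (π.meanValue_le hR hα hQα P σ Θ t).trans (by gcongr)

/-- The optimal average cost is at least `σ² tr P(Θ)`. -/
lemma optAvgCost_ge (hQ : Q.PosDef) (hR : R.PosDef) {α : ℝ} (hα : 0 < α)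
    (hQα : ∀ x, α * nrm x ^ 2 ≤ qf Q x) {Θ : Sys n d} {P : Matrix (Fin n) (Fin n) ℝ}
    (hP : IsDARESolution Q R Θ P) (σ : ℝ) : σ ^ 2 * P.trace ≤ optAvgCost Q R σ Θ := by
  set j := σ ^ 2 * P.trace with hj
  have hj0 : 0 ≤ j := mul_nonneg (sq_nonneg σ) hP.1.posSemidef.trace_nonneg
  set V : ℕ → ℝ≥0∞ := fun N => ⨅ π : Policy n d, π.expectedCost Q R σ Θ N with hV
  have hVle : ∀ N, V N ≤ N * ENNReal.ofReal j := fun N => by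
    refine (iInf_le _ (gainPolicy (greedy R Θ P))).trans ?_
    rw [Policy.expectedCost_eq]
    exact le_self_add.trans (gainPolicy_cost_le hQ hR hP σ N)
  -- `optAvgCost` is the real value of a limit superior, which has to be finite
  have hfin : limsup (fun N : ℕ => V N / (N : ℝ≥0∞)) atTop ≠ ⊤ := by
    refine ne_top_of_le_ne_top ENNReal.ofReal_ne_top (limsup_le_of_le (a := ENNReal.ofReal j)
      (h := ?_))
    filter_upwards [eventually_gt_atTop 0] with N hN
    exact ENNReal.div_le_of_le_mul (by rw [mul_comm]; exact hVle N)
  rw [optAvgCost]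
  refine (ENNReal.ofReal_le_iff_le_toReal hfin).1 ?_
  set c := ‖P‖ / α with hc
  have hc0 : 0 ≤ c := by positivity
  refine le_of_forall_lt fun b hb => ?_
  obtain ⟨j', hj'0, rfl⟩ : ∃ j' : ℝ, 0 ≤ j' ∧ b = ENNReal.ofReal j' :=
    ⟨b.toReal, ENNReal.toReal_nonneg, (ENNReal.ofReal_toReal hb.ne_top).symm⟩
  have hjj : j' < j := (ENNReal.ofReal_lt_ofReal_iff_of_nonneg hj'0).1 hb
  obtain ⟨j'', h1, h2⟩ := exists_between hjj
  refine lt_of_lt_of_le ((ENNReal.ofReal_lt_ofReal_iff_of_nonneg hj'0).2 h1) ?_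
  refine le_limsup_of_frequently_le ?_
  rw [frequently_atTop]
  intro N₀
  obtain ⟨m₀, hm₀⟩ := exists_nat_ge ((1 + c) * j / (j - j''))
  -- the terminal value costs only a multiple of `m`, out of the `m²` steps
  set m := max (max m₀ N₀) 1 with hm
  have hm1 : 1 ≤ m := le_max_right _ _
  refine ⟨m * m, ((le_max_right m₀ N₀).trans (le_max_left _ _)).trans (Nat.le_mul_self m), ?_⟩
  have hmR : (1 : ℝ) ≤ m := by exact_mod_cast hm1
  have hmm : (1 + c) * j ≤ m * (j - j'') := by
    have : (m₀ : ℝ) ≤ m := by exact_mod_cast (le_max_left m₀ N₀).trans (le_max_left _ _)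
    rw [div_le_iff₀ (by linarith)] at hm₀
    nlinarith
  rw [ENNReal.le_div_iff_mul_le (Or.inl (by simp; omega))
    (Or.inl (ENNReal.natCast_ne_top _))]
  refine le_iInf fun π => ?_
  have h := π.cost_ge hQ hR hα hQα hP σ (m := m) hm1
  rw [← hj, ← hc, ← tsub_le_iff_right] at h
  refine le_trans ?_ h
  have e1 : ((m * m - m : ℕ) : ℝ≥0∞) = ENNReal.ofReal (m * m - m) := by
    rw [← ENNReal.ofReal_natCast, Nat.cast_sub (Nat.le_mul_self m), Nat.cast_mul]
  have hmm0 : (0 : ℝ) ≤ m * m - m := by nlinarith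
  have hj''0 : 0 ≤ j'' := by linarith
  have hm0 : (0 : ℝ) ≤ m := by linarith
  rw [e1, ← ENNReal.ofReal_natCast m, ← ENNReal.ofReal_natCast (m * m),
    ← ENNReal.ofReal_mul hm0, ← ENNReal.ofReal_mul hc0, ← ENNReal.ofReal_mul hmm0,
    ← ENNReal.ofReal_sub _ (by positivity), ← ENNReal.ofReal_mul hj''0]
  refine ENNReal.ofReal_le_ofReal ?_
  push_cast
  nlinarith

end AverageCost

/-! ### Inverse square roots and measurability of matrix functions -/

section MatrixFunctions

variable {ι κ' : Type*} [Fintype ι] [Fintype κ'] [DecidableEq ι] [DecidableEq κ']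

/-- The inverse square root `V^{-1/2}` of a positive definite matrix. -/
noncomputable abbrev invSqrt {ι : Type*} [Fintype ι] [DecidableEq ι] (V : Matrix ι ι ℝ) :
    Matrix ι ι ℝ := cfc (fun v : ℝ => (√v)⁻¹) V

lemma spectrum_subset_Ioi {V : Matrix ι ι ℝ} (hV : V.PosDef) : spectrum ℝ V ⊆ Set.Ioi 0 := by
  rw [hV.isHermitian.spectrum_real_eq_range_eigenvalues]
  rintro _ ⟨i, rfl⟩
  exact hV.eigenvalues_pos i

lemma continuousOn_inv_sqrt : ContinuousOn (fun v : ℝ => (√v)⁻¹) (Set.Ioi 0) :=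
  Real.continuous_sqrt.continuousOn.inv₀ fun _ hv => (Real.sqrt_pos.2 hv).ne'

lemma transpose_invSqrt (V : Matrix ι ι ℝ) : (invSqrt V)ᵀ = invSqrt V := by
  have : IsSelfAdjoint (invSqrt V) := cfc_predicate _ V
  rw [IsSelfAdjoint, star_eq_conjTranspose, conjTranspose_eq_transpose_of_trivial] at this
  exact this

lemma invSqrt_mul_self_mul {V : Matrix ι ι ℝ} (hV : V.PosDef) :
    invSqrt V * V * invSqrt V = 1 := by
  have hs := spectrum_subset_Ioi hV
  have hsa : IsSelfAdjoint V := hV.isHermitian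
  have hc : ContinuousOn (fun v : ℝ => (√v)⁻¹) (spectrum ℝ V) := continuousOn_inv_sqrt.mono hs
  have e1 : invSqrt V * V = cfc (fun v : ℝ => (√v)⁻¹ * v) V := by
    rw [cfc_mul (fun v : ℝ => (√v)⁻¹) (fun v => v) V hc continuousOn_id, cfc_id' ℝ V]
  rw [e1, ← cfc_mul (fun v : ℝ => (√v)⁻¹ * v) (fun v => (√v)⁻¹) V (hc.mul continuousOn_id) hc,
    ← cfc_const_one ℝ V]
  refine cfc_congr fun v hv => ?_
  have hv0 : 0 < v := hs hv
  have h2 : √v ≠ 0 := (Real.sqrt_pos.2 hv0).ne'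
  have h3 : √v * √v = v := Real.mul_self_sqrt hv0.le
  field_simp
  linarith

lemma invSqrt_mul_invSqrt {V : Matrix ι ι ℝ} (hV : V.PosDef) :
    invSqrt V * invSqrt V = V⁻¹ := by
  have h := invSqrt_mul_self_mul hV
  rw [Matrix.mul_assoc] at h
  have h2 : V * invSqrt V * invSqrt V = 1 := mul_eq_one_comm.1 h
  rw [Matrix.mul_assoc] at h2
  exact (inv_eq_right_inv h2).symm

lemma qf_inv_eq_nrm {V : Matrix ι ι ℝ} (hV : V.PosDef) (z : ι → ℝ) :
    qf V⁻¹ z = nrm (invSqrt V *ᵥ z) ^ 2 := by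
  rw [nrm_sq, qf, ← invSqrt_mul_invSqrt hV, ← mulVec_mulVec, dotProduct_mulVec,
    ← mulVec_transpose, transpose_invSqrt]

/-- In the `V`-weighted norm, `V^{-1/2} η` is as large as `η` in the Frobenius norm. -/
lemma wf_invSqrt_mul {V : Matrix ι ι ℝ} (hV : V.PosDef) (η : Matrix ι κ' ℝ) :
    wf V (invSqrt V * η) = fsq η := by
  rw [wf, fsq_eq_sum_dot]
  refine Finset.sum_congr rfl fun c _ => ?_
  have e : (fun r => (invSqrt V * η) r c) = invSqrt V *ᵥ fun r => η r c := rfl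
  rw [e, qf, mulVec_mulVec, dotProduct_comm, dotProduct_mulVec, ← mulVec_transpose,
    mulVec_mulVec, transpose_invSqrt, ← Matrix.mul_assoc, invSqrt_mul_self_mul hV, one_mulVec]

/-- Matrices carry the Borel σ-algebra. -/
instance matrixMeasurableSpace {ι κ' : Type*} : MeasurableSpace (Matrix ι κ' ℝ) := borel _

instance matrixBorelSpace {ι κ' : Type*} : BorelSpace (Matrix ι κ' ℝ) := ⟨rfl⟩

lemma matrix_measurableSpace_eq :
    (matrixMeasurableSpace : MeasurableSpace (Matrix ι κ' ℝ)) =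
      (MeasurableSpace.pi : MeasurableSpace (ι → κ' → ℝ)) :=
  (BorelSpace.measurable_eq (α := ι → κ' → ℝ)).symm

variable {Ω : Type*} [MeasurableSpace Ω]

lemma measurable_matrix {f : Ω → Matrix ι κ' ℝ} (h : ∀ i j, Measurable fun ω => f ω i j) :
    Measurable f := by
  rw [matrix_measurableSpace_eq]
  exact measurable_pi_lambda _ fun i => measurable_pi_lambda _ fun j => h i j

lemma measurable_entry {f : Ω → Matrix ι κ' ℝ} (hf : Measurable f) (i : ι) (j : κ') :
    Measurable fun ω => f ω i j := by
  have : Continuous fun A : Matrix ι κ' ℝ => A i j := by fun_prop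
  exact this.measurable.comp hf

lemma measurable_matrix_mul {m : Type*} [Fintype m] {f : Ω → Matrix ι κ' ℝ}
    {g : Ω → Matrix κ' m ℝ} (hf : Measurable f) (hg : Measurable g) :
    Measurable fun ω => f ω * g ω := by
  classical
  refine measurable_matrix fun i j => ?_
  simp only [Matrix.mul_apply]
  exact Finset.measurable_sum _ fun k _ => (measurable_entry hf i k).mul (measurable_entry hg k j)

lemma measurable_matrix_mulVec {f : Ω → Matrix ι κ' ℝ} {g : Ω → κ' → ℝ} (hf : Measurable f)
    (hg : Measurable g) : Measurable fun ω => f ω *ᵥ g ω := by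
  refine measurable_pi_lambda _ fun i => ?_
  simp only [mulVec, dotProduct]
  exact Finset.measurable_sum _ fun k _ =>
    (measurable_entry hf i k).mul ((measurable_pi_apply k).comp hg)

lemma measurable_dot {f g : Ω → ι → ℝ} (hf : Measurable f) (hg : Measurable g) :
    Measurable fun ω => f ω ⬝ᵥ g ω := by
  simp only [dotProduct]
  exact Finset.measurable_sum _ fun k _ =>
    ((measurable_pi_apply k).comp hf).mul ((measurable_pi_apply k).comp hg)

lemma measurable_nrm {f : Ω → ι → ℝ} (hf : Measurable f) : Measurable fun ω => nrm (f ω) :=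
  (measurable_dot hf hf).sqrt

lemma measurable_matrix_add {f g : Ω → Matrix ι κ' ℝ} (hf : Measurable f) (hg : Measurable g) :
    Measurable fun ω => f ω + g ω :=
  measurable_matrix fun i j => (measurable_entry hf i j).add (measurable_entry hg i j)

lemma measurable_matrix_smul {c : Ω → ℝ} {f : Ω → Matrix ι κ' ℝ} (hc : Measurable c)
    (hf : Measurable f) : Measurable fun ω => c ω • f ω :=
  measurable_matrix fun i j => hc.mul (measurable_entry hf i j)

lemma measurable_vecMulVec {f : Ω → ι → ℝ} {g : Ω → κ' → ℝ} (hf : Measurable f)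
    (hg : Measurable g) : Measurable fun ω => vecMulVec (f ω) (g ω) :=
  measurable_matrix fun i j =>
    ((measurable_pi_apply i).comp hf).mul ((measurable_pi_apply j).comp hg)

lemma measurable_matrix_det {f : Ω → Matrix ι ι ℝ} (hf : Measurable f) :
    Measurable fun ω => (f ω).det := by
  have : Continuous fun A : Matrix ι ι ℝ => A.det := by fun_prop
  exact this.measurable.comp hf

lemma measurable_matrix_inv {f : Ω → Matrix ι ι ℝ} (hf : Measurable f) :
    Measurable fun ω => (f ω)⁻¹ := by
  have h : Continuous fun A : Matrix ι ι ℝ => A.adjugate := by fun_prop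
  simp only [Matrix.inv_def, Ring.inverse_eq_inv']
  exact measurable_matrix_smul (measurable_matrix_det hf).inv (h.measurable.comp hf)

lemma measurable_matrix_qf {f : Ω → Matrix ι ι ℝ} {g : Ω → ι → ℝ} (hf : Measurable f)
    (hg : Measurable g) : Measurable fun ω => qf (f ω) (g ω) :=
  measurable_dot hg (measurable_matrix_mulVec hf hg)

lemma measurable_matrix_trace {f : Ω → Matrix ι ι ℝ} (hf : Measurable f) :
    Measurable fun ω => (f ω).trace := by
  simp only [Matrix.trace, diag_apply]
  exact Finset.measurable_sum _ fun k _ => measurable_entry hf k k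

lemma measurable_invSqrt {f : Ω → Matrix ι ι ℝ} (hf : Measurable f) (hpd : ∀ ω, (f ω).PosDef) :
    Measurable fun ω => invSqrt (f ω) := by
  have hc : ContinuousOn (fun V : Matrix ι ι ℝ => invSqrt V) {V | V.PosDef} := by
    refine ContinuousOn.cfc_of_mem_nhdsSet (s := Set.Ioi 0) (fun v : ℝ => (√v)⁻¹)
      (isOpen_Ioi.mem_nhdsSet.2 ?_) continuousOn_id (fun V hV => hV.isHermitian)
      continuousOn_inv_sqrt
    exact Set.iUnion₂_subset fun V hV => spectrum_subset_Ioi hV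
  have hm : Measurable fun ω => (⟨f ω, hpd ω⟩ : {V : Matrix ι ι ℝ | V.PosDef}) :=
    hf.subtype_mk
  exact (continuousOn_iff_continuous_domRestrict.1 hc).measurable.comp hm

end MatrixFunctions

/-! ### The run with the gain restricted to the model set -/

namespace Setup

variable {n d : ℕ} (p : Setup n d)

open Classical in
/-- The optimal gain on the model set and `0` elsewhere. Unlike `gain` itself, which depends on a
choice where the Riccati equation has no solution, this is visibly measurable. -/
noncomputable def gainM (Θ : Sys n d) : Matrix (Fin d) (Fin n) ℝ :=
  if Θ ∈ p.M then gain p.Q p.R Θ else 0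

/-- The input, with `gainM` in place of `gain`. -/
noncomputable def inputM (ω : NoiseIdx n d → ℝ) (t : ℕ) (s : RunState n d) : Fin d → ℝ :=
  p.gainM (p.currentModel ω t s) *ᵥ s.x + (if (t : ℝ) ≤ p.Tw then fun r => ω (.ν t r) else 0)

/-- The vector `z_t = (x_t, u_t)`, with `gainM` in place of `gain`. -/
noncomputable def zOf (ω : NoiseIdx n d → ℝ) (t : ℕ) (s : RunState n d) : Fin n ⊕ Fin d → ℝ :=
  Sum.elim s.x (p.inputM ω t s)

/-- The process noise `w_t`. -/
def wv (ω : NoiseIdx n d → ℝ) (t : ℕ) : Fin n → ℝ := fun r => ω (.w t r)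

/-- One time step, with `gainM` in place of `gain`. -/
noncomputable def stepM (ω : NoiseIdx n d → ℝ) (t : ℕ) (s : RunState n d) : RunState n d :=
  let z := p.zOf ω t s
  let x' := p.Θsᵀ *ᵥ z + wv ω t
  { x := x'
    V := s.V + vecMulVec z z
    Y := s.Y + vecMulVec z x'
    model := p.currentModel ω t s }

/-- The run of the algorithm, with `gainM` in place of `gain`. -/
noncomputable def runM (ω : NoiseIdx n d → ℝ) : ℕ → RunState n d
  | 0 => { x := 0, V := p.μ • (1 : Matrix (Fin n ⊕ Fin d) (Fin n ⊕ Fin d) ℝ), Y := 0, model := 0 }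
  | t + 1 => p.stepM ω t (runM ω t)

/-- The state `x_t`. -/
noncomputable def X (ω : NoiseIdx n d → ℝ) (t : ℕ) : Fin n → ℝ := (p.runM ω t).x

/-- The design matrix `V_t`. -/
noncomputable def V (ω : NoiseIdx n d → ℝ) (t : ℕ) : Matrix (Fin n ⊕ Fin d) (Fin n ⊕ Fin d) ℝ :=
  (p.runM ω t).V

/-- The matrix `Y_t`. -/
noncomputable def Y (ω : NoiseIdx n d → ℝ) (t : ℕ) : Sys n d := (p.runM ω t).Y

/-- The model used at time `t`. -/
noncomputable def mdl (ω : NoiseIdx n d → ℝ) (t : ℕ) : Sys n d := p.currentModel ω t (p.runM ω t)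

/-- The input `u_t`. -/
noncomputable def U (ω : NoiseIdx n d → ℝ) (t : ℕ) : Fin d → ℝ := p.inputM ω t (p.runM ω t)

/-- The vector `z_t = (x_t, u_t)`. -/
noncomputable def Z (ω : NoiseIdx n d → ℝ) (t : ℕ) : Fin n ⊕ Fin d → ℝ := p.zOf ω t (p.runM ω t)

/-- The exploration noise, `0` after the exploration phase. -/
noncomputable def nuv (ω : NoiseIdx n d → ℝ) (t : ℕ) : Fin d → ℝ :=
  if (t : ℝ) ≤ p.Tw then fun r => ω (.ν t r) else 0

/-- The `j`-th candidate noise matrix of the `i`-th sampling step. -/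
def etaM (ω : NoiseIdx n d → ℝ) (i j : ℕ) : Sys n d := Matrix.of fun r c => ω (.η i j r c)

variable (ω : NoiseIdx n d → ℝ) (t : ℕ)

lemma Z_eq : p.Z ω t = Sum.elim (p.X ω t) (p.U ω t) := rfl

lemma U_eq : p.U ω t = p.gainM (p.mdl ω t) *ᵥ p.X ω t + p.nuv ω t := rfl

lemma X_zero : p.X ω 0 = 0 := rfl

lemma X_succ : p.X ω (t + 1) = p.Θsᵀ *ᵥ p.Z ω t + wv ω t := rfl

lemma V_zero : p.V ω 0 = p.μ • (1 : Matrix (Fin n ⊕ Fin d) (Fin n ⊕ Fin d) ℝ) := rfl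

lemma V_succ : p.V ω (t + 1) = p.V ω t + vecMulVec (p.Z ω t) (p.Z ω t) := rfl

lemma Y_zero : p.Y ω 0 = 0 := rfl

lemma Y_succ : p.Y ω (t + 1) = p.Y ω t + vecMulVec (p.Z ω t) (p.X ω (t + 1)) := rfl

lemma mdl_of_dvd (h : p.τ₀ ∣ t) :
    p.mdl ω t = p.sample (p.V ω t) (p.Y ω t) (fun j => etaM ω (t / p.τ₀) j) := if_pos h

lemma mdl_succ_of_not_dvd (h : ¬p.τ₀ ∣ t + 1) : p.mdl ω (t + 1) = p.mdl ω t := if_neg h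

/-- As long as the models stay in the model set, the two runs agree. -/
lemma run_eq_runM (h : ∀ s < t, p.mdl ω s ∈ p.M) : p.run ω t = p.runM ω t := by
  induction t with
  | zero => rfl
  | succ t ih =>
    have ih' := ih fun s hs => h s (hs.trans t.lt_succ_self)
    have hin : p.input ω t (p.runM ω t) = p.U ω t := by
      have hm := h t t.lt_succ_self
      rw [U_eq, gainM, if_pos hm]
      rfl
    rw [run, runM, ih', step, stepM, hin]
    simp only [Sys.mulVec_add_mulVec]
    rfl

lemma input_eq (h : p.mdl ω t ∈ p.M) : p.input ω t (p.runM ω t) = p.U ω t := by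
  rw [U_eq, gainM, if_pos h]
  rfl

lemma V_posDef (hμ : 0 < p.μ) : (p.V ω t).PosDef := by
  induction t with
  | zero => rw [V_zero]; exact Matrix.PosDef.one.smul hμ
  | succ t ih => rw [V_succ]; exact posDef_add_vecMulVec ih _

/-! #### Dependence on the driving noise -/

/-- The labels `w_s` with `s < a`, `ν_s` with `s < b`, and `η_i` with `i τ < c`. -/
def past (n d : ℕ) (τ a b c : ℕ) : Set (NoiseIdx n d)
  | .w s _ => s < a
  | .ν s _ => s < b
  | .η i _ _ _ => i * τ < c

lemma past_mono {τ a b c a' b' c' : ℕ} (ha : a ≤ a') (hb : b ≤ b') (hc : c ≤ c') :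
    past n d τ a b c ⊆ past n d τ a' b' c' := by
  rintro (⟨s, r⟩ | ⟨s, r⟩ | ⟨i, j, r, s⟩) h
  · exact lt_of_lt_of_le (show s < a from h) ha
  · exact lt_of_lt_of_le (show s < b from h) hb
  · exact lt_of_lt_of_le (show i * τ < c from h) hc

lemma currentModel_congr {ω ω' : NoiseIdx n d → ℝ} (s : RunState n d)
    (h : ∀ a ∈ past n d p.τ₀ t (t + 1) (t + 1), ω a = ω' a) :
    p.currentModel ω t s = p.currentModel ω' t s := by
  rw [currentModel, currentModel]
  split_ifs with hd
  · congr 1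
    funext j
    ext r c
    refine h (.η (t / p.τ₀) j r c) ?_
    change t / p.τ₀ * p.τ₀ < t + 1
    rw [Nat.div_mul_cancel hd]
    exact t.lt_succ_self
  · rfl

lemma inputM_congr {ω ω' : NoiseIdx n d → ℝ} (s : RunState n d)
    (h : ∀ a ∈ past n d p.τ₀ t (t + 1) (t + 1), ω a = ω' a) :
    p.inputM ω t s = p.inputM ω' t s := by
  rw [inputM, inputM, p.currentModel_congr t s h]
  congr 1
  split_ifs with ht
  · funext r
    exact h (.ν t r) t.lt_succ_self
  · rfl

/-- The run up to time `t` is determined by the noise of the earlier times. -/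
lemma dependsOn_runM : DependsOn (fun ω => p.runM ω t) (past n d p.τ₀ t t t) := by
  induction t with
  | zero => intro ω ω' _; rfl
  | succ t ih =>
    intro ω ω' h
    have h1 : p.runM ω t = p.runM ω' t := ih fun a ha =>
      h a (past_mono t.le_succ t.le_succ t.le_succ ha)
    have h2 : ∀ a ∈ past n d p.τ₀ t (t + 1) (t + 1), ω a = ω' a := fun a ha =>
      h a (past_mono t.le_succ le_rfl le_rfl ha)
    have h3 : wv ω t = wv ω' t := funext fun r => h (.w t r) t.lt_succ_self
    simp only [runM, stepM, zOf, h1, p.inputM_congr t _ h2, p.currentModel_congr t _ h2, h3]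

lemma dependsOn_mdl : DependsOn (fun ω => p.mdl ω t) (past n d p.τ₀ t (t + 1) (t + 1)) := by
  intro ω ω' h
  have h1 : p.runM ω t = p.runM ω' t := p.dependsOn_runM t fun a ha =>
    h a (past_mono le_rfl t.le_succ t.le_succ ha)
  simp only [mdl, h1, p.currentModel_congr t _ h]

lemma dependsOn_Z : DependsOn (fun ω => p.Z ω t) (past n d p.τ₀ t (t + 1) (t + 1)) := by
  intro ω ω' h
  have h1 : p.runM ω t = p.runM ω' t := p.dependsOn_runM t fun a ha =>
    h a (past_mono le_rfl t.le_succ t.le_succ ha)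
  simp only [Z, zOf, h1, p.inputM_congr t _ h]

lemma dependsOn_V : DependsOn (fun ω => p.V ω t) (past n d p.τ₀ t t t) := by
  intro ω ω' h
  simp only [V, p.dependsOn_runM t h]

/-- `V_{t+1}` does not involve `w_t`. -/
lemma dependsOn_V_succ : DependsOn (fun ω => p.V ω (t + 1)) (past n d p.τ₀ t (t + 1) (t + 1)) := by
  intro ω ω' h
  have h1 := p.dependsOn_V t fun a ha => h a (past_mono le_rfl t.le_succ t.le_succ ha)
  have h2 := p.dependsOn_Z t h
  simp only at h1 h2 ⊢
  rw [V_succ, V_succ, h1, h2]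

lemma dependsOn_X : DependsOn (fun ω => p.X ω t) (past n d p.τ₀ t t t) := by
  intro ω ω' h
  simp only [X, p.dependsOn_runM t h]

lemma dependsOn_Y : DependsOn (fun ω => p.Y ω t) (past n d p.τ₀ t t t) := by
  intro ω ω' h
  simp only [Y, p.dependsOn_runM t h]

/-! #### Measurability -/

variable {p}

/-- Rejection sampling is measurable. -/
lemma measurable_rejection {Ω E : Type*} [MeasurableSpace Ω] [MeasurableSpace E] {M : Set E}
    (hM : MeasurableSet M) {f : ℕ → Ω → E} (hf : ∀ j, Measurable (f j)) :
    Measurable fun ω => f (sInf {j | f j ω ∈ M}) ω := by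
  have hN : Measurable fun ω => sInf {j | f j ω ∈ M} := by
    refine measurable_to_countable' fun j => ?_
    have e : (fun ω => sInf {j | f j ω ∈ M}) ⁻¹' {j} =
        (f j ⁻¹' M ∩ ⋂ i < j, (f i ⁻¹' M)ᶜ) ∪ (if j = 0 then ⋂ i, (f i ⁻¹' M)ᶜ else ∅) := by
      ext ω
      simp only [Set.mem_preimage, Set.mem_singleton_iff, Set.mem_union, Set.mem_inter_iff,
        Set.mem_iInter, Set.mem_compl_iff]
      -- `sInf ∅ = 0`, hence the extra set at `j = 0`
      by_cases hne : {j | f j ω ∈ M}.Nonempty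
      · have hlast : ω ∉ (if j = 0 then ⋂ i, (f i ⁻¹' M)ᶜ else (∅ : Set Ω)) := by
          obtain ⟨i, hi⟩ := hne
          split_ifs
          · simp only [Set.mem_iInter, Set.mem_compl_iff, not_forall]
            exact ⟨i, fun h => h hi⟩
          · exact fun h => h
        constructor
        · rintro rfl
          exact Or.inl ⟨Nat.sInf_mem hne, fun i hi h => Nat.notMem_of_lt_sInf hi h⟩
        · rintro (⟨h1, h2⟩ | h)
          · refine le_antisymm (Nat.sInf_le h1) ?_
            by_contra hlt
            exact h2 _ (not_le.1 hlt) (Nat.sInf_mem hne)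
          · exact absurd h hlast
      · rw [Set.not_nonempty_iff_eq_empty] at hne
        have hno : ∀ i, f i ω ∉ M := fun i hi => by
          have : i ∈ {j | f j ω ∈ M} := hi
          rw [hne] at this
          exact this
        rw [hne, Nat.sInf_empty]
        constructor
        · rintro rfl
          right
          simp only [if_true, Set.mem_iInter, Set.mem_compl_iff]
          exact fun i hi => hno i hi
        · rintro (⟨h1, -⟩ | h)
          · exact absurd h1 (hno j)
          · by_contra hj
            rw [if_neg (Ne.symm hj)] at h
            exact h
    rw [e]
    refine MeasurableSet.union ((hf j hM).inter (MeasurableSet.biInter (Set.to_countable _)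
      fun i _ => (hf i hM).compl)) ?_
    split_ifs
    · exact MeasurableSet.iInter fun i => (hf i hM).compl
    · exact MeasurableSet.empty
  have hF : Measurable fun q : ℕ × Ω => f q.1 q.2 := measurable_from_prod_countable_right hf
  exact hF.comp (hN.prodMk measurable_id)

/-- The facts about the setup on which measurability of the run rests. -/
structure MeasurableSetup (p : Setup n d) : Prop where
  M : MeasurableSet p.M
  gainM : Measurable p.gainM
  μ_pos : 0 < p.μ

lemma measurable_β (p : Setup n d) {Ω : Type*} [MeasurableSpace Ω]
    {f : Ω → Matrix (Fin n ⊕ Fin d) (Fin n ⊕ Fin d) ℝ} (hf : Measurable f) :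
    Measurable fun ω => p.β (f ω) := by
  unfold β
  exact ((((Real.measurable_log.comp ((measurable_matrix_det hf).sqrt.div_const _)).const_mul
    _).sqrt).const_mul _).add_const _

lemma measurable_wv : Measurable fun ω : NoiseIdx n d → ℝ => wv ω t :=
  measurable_pi_lambda _ fun r => measurable_pi_apply (NoiseIdx.w t r)

lemma measurable_nuv : Measurable fun ω : NoiseIdx n d → ℝ => p.nuv ω t := by
  unfold nuv
  split_ifs
  · exact measurable_pi_lambda _ fun r => measurable_pi_apply (NoiseIdx.ν t r)
  · exact measurable_const

lemma measurable_etaM (i j : ℕ) : Measurable fun ω : NoiseIdx n d → ℝ => etaM ω i j :=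
  measurable_matrix fun r c => measurable_pi_apply (NoiseIdx.η i j r c)

namespace MeasurableSetup

lemma mdl_aux (h : p.MeasurableSetup) (hV : Measurable fun ω => p.V ω t) (hY : Measurable fun ω => p.Y ω t)
    (hm : Measurable fun ω => (p.runM ω t).model) : Measurable fun ω => p.mdl ω t := by
  by_cases hd : p.τ₀ ∣ t
  · simp only [p.mdl_of_dvd _ t hd]
    refine measurable_rejection (f := fun j ω =>
      p.candidate (p.V ω t) (p.Y ω t) (etaM ω (t / p.τ₀) j)) h.M fun j => ?_
    exact measurable_matrix_add (measurable_matrix_mul (measurable_matrix_inv hV) hY)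
      (measurable_matrix_smul (p.measurable_β hV) (measurable_matrix_mul
        (measurable_invSqrt hV fun ω => p.V_posDef ω t h.μ_pos) (measurable_etaM _ j)))
  · simp only [mdl, currentModel, if_neg hd]
    exact hm

lemma run_aux (h : p.MeasurableSetup) : Measurable (fun ω => p.X ω t) ∧ Measurable (fun ω => p.V ω t) ∧
    Measurable (fun ω => p.Y ω t) ∧ Measurable (fun ω => (p.runM ω t).model) := by
  have hU : ∀ t, Measurable (fun ω => p.X ω t) → Measurable (fun ω => p.mdl ω t) →
      Measurable fun ω => p.U ω t := fun t hX hm => by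
    simp only [p.U_eq]
    exact (measurable_matrix_mulVec (h.gainM.comp hm) hX).add (measurable_nuv t)
  induction t with
  | zero => exact ⟨measurable_const, measurable_const, measurable_const, measurable_const⟩
  | succ t ih =>
    obtain ⟨hX, hV, hY, hm⟩ := ih
    have hmd := h.mdl_aux t hV hY hm
    have hZ : Measurable fun ω => p.Z ω t := by
      refine measurable_pi_lambda _ fun i => ?_
      rcases i with i | i
      · exact (measurable_pi_apply i).comp hX
      · exact (measurable_pi_apply i).comp (hU t hX hmd)
    have hX' : Measurable fun ω => p.X ω (t + 1) := by
      simp only [p.X_succ]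
      exact (measurable_matrix_mulVec measurable_const hZ).add (measurable_wv t)
    refine ⟨hX', ?_, ?_, hmd⟩
    · simp only [p.V_succ]
      exact measurable_matrix_add hV (measurable_vecMulVec hZ hZ)
    · simp only [p.Y_succ]
      exact measurable_matrix_add hY (measurable_vecMulVec hZ hX')

lemma X (h : p.MeasurableSetup) : Measurable fun ω => p.X ω t := (h.run_aux t).1

lemma V (h : p.MeasurableSetup) : Measurable fun ω => p.V ω t := (h.run_aux t).2.1

lemma Y (h : p.MeasurableSetup) : Measurable fun ω => p.Y ω t := (h.run_aux t).2.2.1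

lemma mdl (h : p.MeasurableSetup) : Measurable fun ω => p.mdl ω t :=
  h.mdl_aux t (h.V t) (h.Y t) (h.run_aux t).2.2.2

lemma U (h : p.MeasurableSetup) : Measurable fun ω => p.U ω t := by
  simp only [p.U_eq]
  exact (measurable_matrix_mulVec (h.gainM.comp (h.mdl t)) (h.X t)).add (measurable_nuv t)

lemma Z (h : p.MeasurableSetup) : Measurable fun ω => p.Z ω t := by
  refine measurable_pi_lambda _ fun i => ?_
  rcases i with i | i
  · exact (measurable_pi_apply i).comp (h.X t)
  · exact (measurable_pi_apply i).comp (h.U t)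

end MeasurableSetup

end Setup

/-! ### A deterministic bound on the state -/

section Triangular

variable {ι κ' : Type*} [Fintype ι] [Fintype κ'] [DecidableEq ι] [DecidableEq κ']

/-- If `E_j y_i = 0` for `i < j` and `E_j y_j ≠ 0`, then the `y_j` are linearly independent. -/
lemma linearIndependent_of_triangular {m : ℕ} {y : Fin m → ι → ℝ} {E : Fin m → Matrix κ' ι ℝ}
    (h0 : ∀ i j, i < j → E j *ᵥ y i = 0) (h1 : ∀ j, E j *ᵥ y j ≠ 0) : LinearIndependent ℝ y := by
  rw [Fintype.linearIndependent_iff]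
  intro c hc
  by_contra! hne
  obtain ⟨i₀, hi₀⟩ := hne
  obtain ⟨j, hj, hmax⟩ := (Finset.univ.filter fun i => c i ≠ 0).exists_max_image id
    ⟨i₀, by simp [hi₀]⟩
  simp only [Finset.mem_filter, Finset.mem_univ, true_and, id] at hj hmax
  have h2 : E j *ᵥ (∑ i, c i • y i) = c j • (E j *ᵥ y j) := by
    rw [mulVec_sum, Finset.sum_eq_single j]
    · rw [mulVec_smul]
    · intro i _ hij
      rw [mulVec_smul]
      rcases lt_or_gt_of_ne hij with h | h
      · rw [h0 i j h, smul_zero]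
      · have : c i = 0 := by
          by_contra hci
          exact absurd (hmax i hci) (not_le.2 h)
        rw [this, zero_smul]
    · simp
  rw [hc, mulVec_zero] at h2
  rcases smul_eq_zero.1 h2.symm with h | h
  · exact hj h
  · exact h1 j h

/-- A quantitative form of the previous lemma, by compactness. -/
lemma exists_triangular_lower_bound (e₀ : ℝ) {ρ : ℝ} (hρ : 0 < ρ) :
    ∃ ε > 0, ∀ (y : Fin (Fintype.card ι + 1) → ι → ℝ)
      (E : Fin (Fintype.card ι + 1) → Matrix κ' ι ℝ),
      (∀ j, nrm (y j) ≤ 1) → (∀ j, ‖E j‖ ≤ e₀) → (∀ j, ρ ≤ nrm (E j *ᵥ y j)) →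
      ∃ i j, i < j ∧ ε ≤ nrm (E j *ᵥ y i) := by
  set m := Fintype.card ι + 1 with hm
  -- the admissible pairs form a compact set, on which the continuous function `g` has no zero: the
  -- dimension does not allow `m` linearly independent vectors
  let F := (Fin m → ι → ℝ) × (Fin m → Matrix κ' ι ℝ)
  have hcn : ∀ i j : Fin m, Continuous fun q : F => nrm (q.2 j *ᵥ q.1 i) := by
    intro i j
    unfold nrm
    have h1 : Continuous fun q : F => q.2 j *ᵥ q.1 i :=
      Continuous.matrix_mulVec ((continuous_apply j).comp continuous_snd)
        ((continuous_apply i).comp continuous_fst)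
    exact (Continuous.dotProduct h1 h1).sqrt
  let K : Set F := ((Set.univ.pi fun _ => Metric.closedBall 0 1) ×ˢ
    (Set.univ.pi fun _ => Metric.closedBall 0 e₀)) ∩ {q | ∀ j, ρ ≤ nrm (q.2 j *ᵥ q.1 j)}
  have hK : IsCompact K := by
    refine IsCompact.inter_right ((isCompact_univ_pi fun _ => isCompact_closedBall _ _).prod
      (isCompact_univ_pi fun _ => isCompact_closedBall _ _)) ?_
    simp only [Set.ofPred_forall]
    exact isClosed_iInter fun j => isClosed_le continuous_const (hcn j j)
  let g : F → ℝ := fun q => ∑ i, ∑ j, if i < j then nrm (q.2 j *ᵥ q.1 i) else 0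
  have hg : Continuous g := by
    refine continuous_finsetSum _ fun i _ => continuous_finsetSum _ fun j _ => ?_
    split_ifs
    · exact hcn i j
    · exact continuous_const
  have hterm : ∀ (q : F) i j, 0 ≤ if i < j then nrm (q.2 j *ᵥ q.1 i) else 0 := by
    intro q i j
    split_ifs
    · exact nrm_nonneg _
    · exact le_rfl
  have hpos : ∀ q ∈ K, 0 < g q := by
    intro q hq
    refine lt_of_le_of_ne (Finset.sum_nonneg fun i _ => Finset.sum_nonneg fun j _ =>
      hterm q i j) fun h0 => ?_
    have hz : ∀ i j, i < j → q.2 j *ᵥ q.1 i = 0 := by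
      intro i j hij
      have h1 := (Finset.sum_eq_zero_iff_of_nonneg fun i _ => Finset.sum_nonneg fun j _ =>
        hterm q i j).1 h0.symm i (Finset.mem_univ _)
      have h2 := (Finset.sum_eq_zero_iff_of_nonneg fun j _ => hterm q i j).1 h1 j
        (Finset.mem_univ _)
      rw [if_pos hij] at h2
      exact nrm_eq_zero h2
    have hne : ∀ j, q.2 j *ᵥ q.1 j ≠ 0 := by
      intro j hj
      have := hq.2 j
      rw [hj, nrm_zero] at this
      linarith
    have := (linearIndependent_of_triangular hz hne).fintype_card_le_finrank
    rw [Module.finrank_fintype_fun_eq_card, Fintype.card_fin] at this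
    omega
  have hmem : ∀ (y : Fin m → ι → ℝ) (E : Fin m → Matrix κ' ι ℝ), (∀ j, nrm (y j) ≤ 1) →
      (∀ j, ‖E j‖ ≤ e₀) → (∀ j, ρ ≤ nrm (E j *ᵥ y j)) → (y, E) ∈ K := by
    intro y E hy hE hyE
    refine ⟨⟨fun j _ => ?_, fun j _ => ?_⟩, hyE⟩
    · rw [mem_closedBall_zero_iff, pi_norm_le_iff_of_nonneg zero_le_one]
      exact fun i => (abs_apply_le _ i).trans (hy j)
    · rw [mem_closedBall_zero_iff]
      exact hE j
  rcases K.eq_empty_or_nonempty with he | hne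
  · refine ⟨1, one_pos, fun y E hy hE hyE => ?_⟩
    have := hmem y E hy hE hyE
    rw [he] at this
    exact absurd this (Set.notMem_empty _)
  obtain ⟨q₀, hq₀, hmin⟩ := hK.exists_isMinOn hne hg.continuousOn
  refine ⟨g q₀ / (2 * (m * m)), div_pos (hpos q₀ hq₀) (by positivity), fun y E hy hE hyE => ?_⟩
  by_contra! hcon
  have hin := hmem y E hy hE hyE
  have h1 : g q₀ ≤ g (y, E) := hmin hin
  have h2 : g (y, E) ≤ ∑ _i : Fin m, ∑ _j : Fin m, g q₀ / (2 * (m * m)) := by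
    refine Finset.sum_le_sum fun i _ => Finset.sum_le_sum fun j _ => ?_
    split_ifs with hij
    · exact (hcon i j hij).le
    · exact div_nonneg (hpos q₀ hq₀).le (by positivity)
  have h3 : ∑ _i : Fin m, ∑ _j : Fin m, g q₀ / (2 * ((m : ℝ) * m)) = g q₀ / 2 := by
    simp only [Finset.sum_const, Finset.card_univ, Fintype.card_fin, nsmul_eq_mul]
    have : (m : ℝ) ≠ 0 := by rw [hm]; positivity
    field_simp
  have h4 := hpos q₀ hq₀
  linarith

/-- If each `E_j` is small on the earlier vectors `y_i`, then only few of the `y_j` can be such that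
`E_j y_j` is a sizeable multiple of `y_j`: at most as many as the dimension. -/
lemma exists_card_le_of_triangular {e₀ ρ : ℝ} (he : 0 < e₀) (hρ : 0 < ρ) :
    ∃ C > 0, ∀ (b : ℝ) (B : Finset ℕ) (y : ℕ → ι → ℝ) (E : ℕ → Matrix κ' ι ℝ), 0 ≤ b →
      (∀ k ∈ B, ‖E k‖ ≤ e₀) → (∀ i ∈ B, ∀ j ∈ B, i < j → nrm (E j *ᵥ y i) ≤ b) →
      (∀ k ∈ B, ρ * nrm (y k) + C * b < nrm (E k *ᵥ y k)) → B.card ≤ Fintype.card ι := by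
  obtain ⟨ε, hε, hmain⟩ := exists_triangular_lower_bound (ι := ι) (κ' := κ') e₀ hρ
  refine ⟨e₀ / ε, div_pos he hε, fun b B y E hb hE hlow hbad => ?_⟩
  by_contra! hcard
  let f : Fin (Fintype.card ι + 1) → ℕ := fun i => B.orderEmbOfFin rfl (Fin.castLE hcard i)
  have hfB : ∀ i, f i ∈ B := fun i => B.orderEmbOfFin_mem rfl _
  have hf : StrictMono f := fun i j hij => (B.orderEmbOfFin rfl).strictMono hij
  have hpos : ∀ k ∈ B, e₀ / ε * b < e₀ * nrm (y k) ∧ 0 < nrm (y k) := by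
    intro k hk
    have h1 := hbad k hk
    have h2 : nrm (E k *ᵥ y k) ≤ e₀ * nrm (y k) :=
      (nrm_mulVec_le _ _).trans (mul_le_mul_of_nonneg_right (hE k hk) (nrm_nonneg _))
    have h3 := nrm_nonneg (y k)
    have h4 : 0 ≤ e₀ / ε * b := by positivity
    refine ⟨by nlinarith, lt_of_le_of_ne h3 fun h0 => ?_⟩
    rw [← h0] at h1 h2
    linarith
  -- apply the lower bound to the normalized vectors
  obtain ⟨i, j, hij, hle⟩ := hmain (fun i => (nrm (y (f i)))⁻¹ • y (f i)) (fun i => E (f i))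
    (fun j => by
      rw [nrm_smul, abs_of_nonneg (inv_nonneg.2 (nrm_nonneg _)),
        inv_mul_cancel₀ (hpos _ (hfB j)).2.ne'])
    (fun j => hE _ (hfB j))
    (fun j => by
      have h1 := hbad _ (hfB j)
      have h2 := (hpos _ (hfB j)).2
      have h4 : 0 ≤ e₀ / ε * b := by positivity
      rw [mulVec_smul, nrm_smul, abs_of_nonneg (inv_nonneg.2 (nrm_nonneg _)), inv_mul_eq_div,
        le_div_iff₀ h2]
      linarith)
  obtain ⟨h1, h2⟩ := hpos _ (hfB i)
  have h3 := hlow _ (hfB i) _ (hfB j) (hf hij)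
  rw [mulVec_smul, nrm_smul, abs_of_nonneg (inv_nonneg.2 (nrm_nonneg _)), inv_mul_eq_div,
    le_div_iff₀ h2] at hle
  have h4 : b < ε * nrm (y (f i)) := by
    rw [div_mul_eq_mul_div, div_lt_iff₀ hε] at h1
    nlinarith
  linarith

end Triangular

/-- A sequence that contracts except at few times stays bounded. -/
lemma le_of_contracting {a : ℕ → ℝ} {A N : ℝ} (hA : 1 ≤ A) (hN : 0 ≤ N) (h0 : a 0 ≤ 0)
    (B : Finset ℕ) {K : ℕ} (hgood : ∀ k < K, k ∉ B → a (k + 1) ≤ a k / 2 + N)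
    (hbad : ∀ k < K, a (k + 1) ≤ A * a k + A * N) (k : ℕ) (hk : k ≤ K) :
    a k ≤ (4 * A) ^ (B.filter (· < k)).card * (2 * N) := by
  induction k with
  | zero => exact h0.trans (by positivity)
  | succ k ih =>
    have ih := ih (by omega)
    have h1 : 1 ≤ (4 * A) ^ (B.filter (· < k)).card := one_le_pow₀ (by linarith)
    by_cases hkB : k ∈ B
    · have e : (B.filter (· < k + 1)).card = (B.filter (· < k)).card + 1 := by
        rw [← Finset.card_insert_of_notMem (a := k) (by simp)]
        congr 1
        ext i
        simp only [Finset.mem_filter, Finset.mem_insert]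
        constructor
        · rintro ⟨h, h'⟩
          rcases Nat.lt_succ_iff_lt_or_eq.1 h' with h'' | h''
          · exact Or.inr ⟨h, h''⟩
          · exact Or.inl h''
        · rintro (rfl | ⟨h, h'⟩)
          · exact ⟨hkB, Nat.lt_succ_self _⟩
          · exact ⟨h, by omega⟩
      rw [e, pow_succ]
      have h2 := hbad k (by omega)
      set G := (4 * A) ^ (B.filter (· < k)).card
      have h3 : A * a k ≤ A * (G * (2 * N)) := mul_le_mul_of_nonneg_left ih (by linarith)
      have h4 : A * N ≤ G * (A * N) := le_mul_of_one_le_left (by positivity) h1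
      have h5 : 0 ≤ G * (A * N) := by positivity
      nlinarith
    · have h2 := hgood k (by omega) hkB
      have e : B.filter (· < k + 1) = B.filter (· < k) := by
        ext i
        simp only [Finset.mem_filter]
        constructor
        · rintro ⟨h, h'⟩
          refine ⟨h, lt_of_le_of_ne (by omega) ?_⟩
          rintro rfl
          exact hkB h
        · rintro ⟨h, h'⟩
          exact ⟨h, by omega⟩
      rw [e]
      set G := (4 * A) ^ (B.filter (· < k)).card
      nlinarith

section StateBound

variable {n d : ℕ} {Q : Matrix (Fin n) (Fin n) ℝ} {R : Matrix (Fin d) (Fin d) ℝ} {κ γ : ℝ}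

/-- A perturbed linear recursion with a stable matrix. The induction carries all powers of `C`, as
`C` itself need not be a contraction. -/
lemma nrm_le_of_perturbed_recursion {C : Matrix (Fin n) (Fin n) ℝ} (hγ' : γ ≤ 1) (hγ : 0 < γ)
    (hκ : 1 ≤ κ) (hC : ∀ k, ‖C ^ k‖ ≤ κ * (1 - γ) ^ k) {x r : ℕ → Fin n → ℝ} {ρ : ℝ} {m : ℕ}
    (hx : ∀ j < m, x (j + 1) = C *ᵥ x j + r j) (hr : ∀ j < m, nrm (r j) ≤ ρ) :
    nrm (x m) ≤ κ * (1 - γ) ^ m * nrm (x 0) + m * (κ * ρ) := by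
  have key : ∀ j ≤ m, ∀ k, nrm (C ^ k *ᵥ x j) ≤
      κ * (1 - γ) ^ (k + j) * nrm (x 0) + j * (κ * ρ) := by
    intro j
    induction j with
    | zero =>
      intro _ k
      simpa using (nrm_mulVec_le _ _).trans
        (mul_le_mul_of_nonneg_right (hC k) (nrm_nonneg (x 0)))
    | succ j ih =>
      intro hj k
      have h1 := ih (by omega) (k + 1)
      have h2 : nrm (C ^ k *ᵥ r j) ≤ κ * ρ := by
        refine (nrm_mulVec_le _ _).trans (mul_le_mul ?_ (hr j (by omega)) (nrm_nonneg _)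
          (by linarith))
        refine (hC k).trans (mul_le_of_le_one_right (by linarith) ?_)
        exact pow_le_one₀ (by linarith) (by linarith)
      rw [hx j (by omega), mulVec_add, mulVec_mulVec, ← pow_succ]
      refine (nrm_add_le _ _).trans ?_
      rw [show k + (j + 1) = k + 1 + j by ring]
      push_cast
      linarith
  simpa using key m le_rfl 0

/-- The bound `C (b + L)` on the vectors `z_t = (x_t, u_t)` of a run of the system `Θs`, in which the
input is given up to `ν_t` by the gain of a model `θ_t` that changes only at the multiples of `τ`,
the noise is at most `L`, and `θ_t` predicts the data of the earlier epochs up to an error `b`. -/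
def StateBound (Q : Matrix (Fin n) (Fin n) ℝ) (R : Matrix (Fin d) (Fin d) ℝ) (κ γ S : ℝ) (τ : ℕ)
    (C : ℝ) : Prop :=
  ∀ (Θs : Sys n d) (x w : ℕ → Fin n → ℝ) (u ν : ℕ → Fin d → ℝ) (θ : ℕ → Sys n d)
    (b L : ℝ) (T : ℕ), ‖Θs‖ ≤ S → 0 ≤ b → 0 ≤ L → x 0 = 0 →
    (∀ t < T, x (t + 1) = Θsᵀ *ᵥ Sum.elim (x t) (u t) + w t) →
    (∀ t ≤ T, u t = gain Q R (θ t) *ᵥ x t + ν t) →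
    (∀ t < T, nrm (w t) ≤ L) → (∀ t ≤ T, nrm (ν t) ≤ L) →
    (∀ t ≤ T, IsStabilizable Q R κ γ (θ t) ∧ ‖θ t‖ ≤ S) →
    (∀ t ≤ T, θ t = θ (t / τ * τ)) →
    (∀ t ≤ T, ∀ s < t / τ * τ, nrm ((θ t - Θs)ᵀ *ᵥ Sum.elim (x s) (u s)) ≤ b) →
    ∀ t ≤ T, nrm (Sum.elim (x t) (u t)) ≤ C * (b + L)

/-- While the sampled models are stabilizable and predict the past data up to an error `b`, the
state and the input stay of the order of `b` plus the size of the noise: in all but at most `n + d`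
epochs the closed loop contracts. -/
lemma exists_stateBound (hκ : 1 ≤ κ) (hγ : 0 < γ) (hγ' : γ ≤ 1) {S : ℝ} (hS : 0 ≤ S)
    {τ : ℕ} (hτ : 0 < τ) (hτκ : κ * (1 - γ) ^ τ ≤ 1 / 8) :
    ∃ C > 0, StateBound Q R κ γ S τ C := by
  -- `A₁` and `A₂` bound the growth in one step and in one epoch; `ρ` is small enough that a
  -- relative prediction error `ρ` does not spoil the contraction by `1 / 8`
  set A₁ := S * (1 + κ) + S + 2 with hA₁
  have hA₁1 : 1 ≤ A₁ := by nlinarith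
  set A₂ := A₁ ^ τ with hA₂
  have hA₂1 : 1 ≤ A₂ := one_le_pow₀ hA₁1
  have hτ1 : (1 : ℝ) ≤ τ := by exact_mod_cast hτ
  set ρ := 1 / (8 * τ * κ * (1 + κ) * A₂) with hρ
  have hρ0 : 0 < ρ := by positivity
  obtain ⟨C₁, hC₁, hcard⟩ := exists_card_le_of_triangular (ι := Fin n ⊕ Fin d) (κ' := Fin n)
    (e₀ := 2 * S + 1) (by linarith) hρ0
  set A := A₂ + τ * κ * (S + 1 + C₁) + 1 with hA
  have hτκ0 : 0 ≤ τ * κ * (S + 1 + C₁) := by positivity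
  have hA1 : 1 ≤ A := by linarith
  refine ⟨(1 + κ) * A₂ * ((4 * A) ^ (n + d) * (2 * A) + 1), by positivity, ?_⟩
  intro Θs x w u ν θ b L T hΘs hb hL hx0 hx hu hw hν hθ hθτ hE
  let z : ℕ → Fin n ⊕ Fin d → ℝ := fun t => Sum.elim (x t) (u t)
  have hz : ∀ t ≤ T, nrm (z t) ≤ (1 + κ) * (nrm (x t) + L) := by
    intro t ht
    have h1 : nrm (u t) ≤ κ * nrm (x t) + L := by
      rw [hu t ht]
      refine (nrm_add_le _ _).trans (add_le_add ((nrm_mulVec_le _ _).trans ?_) (hν t ht))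
      exact mul_le_mul_of_nonneg_right (hθ t ht).1.1 (nrm_nonneg _)
    have h2 := nrm_sumElim_le (x t) (u t)
    nlinarith [nrm_nonneg (x t)]
  -- without any information on the model, the state grows by a factor of at most `A₁` per step
  have hcrude : ∀ t < T, nrm (x (t + 1)) + L ≤ A₁ * (nrm (x t) + L) := by
    intro t ht
    rw [hx t ht]
    have h1 : nrm (Θsᵀ *ᵥ z t) ≤ S * ((1 + κ) * (nrm (x t) + L)) := by
      refine (nrm_mulVec_le _ _).trans (mul_le_mul ?_ (hz t ht.le) (nrm_nonneg _) hS)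
      rwa [norm_transpose_eq]
    have h2 := nrm_add_le (Θsᵀ *ᵥ z t) (w t)
    have h3 := hw t ht
    have h4 := nrm_nonneg (x t)
    have : A₁ * (nrm (x t) + L) =
      S * ((1 + κ) * (nrm (x t) + L)) + S * (nrm (x t) + L) + 2 * (nrm (x t) + L) := by
      rw [hA₁]; ring
    rw [this]
    nlinarith [mul_nonneg hS (add_nonneg h4 hL)]
  have hgrow : ∀ s m, m ≤ τ → s + m ≤ T → nrm (x (s + m)) + L ≤ A₂ * (nrm (x s) + L) := by
    intro s m hm hsm
    have : nrm (x (s + m)) + L ≤ A₁ ^ m * (nrm (x s) + L) := by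
      clear hm
      induction m with
      | zero => simp
      | succ m ih =>
        have h1 := ih (by omega)
        have h2 := hcrude (s + m) (by omega)
        rw [← add_assoc, pow_succ]
        nlinarith
    refine this.trans (mul_le_mul_of_nonneg_right (pow_le_pow_right₀ hA₁1 hm) ?_)
    linarith [nrm_nonneg (x s)]
  -- an epoch is bad if the prediction error of its model is at some time `s` not small compared to
  -- `z_s`; as models predict the earlier data well, bad epochs produce a triangular family
  let bad : ℕ → Prop := fun k => ∃ s, k * τ ≤ s ∧ s < k * τ + τ ∧
    ρ * nrm (z s) + C₁ * b < nrm ((θ (k * τ) - Θs)ᵀ *ᵥ z s)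
  classical
  set B : Finset ℕ := (Finset.range (T / τ)).filter bad with hB
  have hBT : ∀ k < T / τ, k * τ + τ ≤ T := by
    intro k hk
    have := (Nat.le_div_iff_mul_le hτ).1 (Nat.succ_le_of_lt hk)
    rwa [Nat.succ_mul] at this
  have hBcard : B.card ≤ n + d := by
    have hch : ∀ k, ∃ s, bad k → (k * τ ≤ s ∧ s < k * τ + τ ∧
        ρ * nrm (z s) + C₁ * b < nrm ((θ (k * τ) - Θs)ᵀ *ᵥ z s)) := by
      intro k
      by_cases h : bad k
      · obtain ⟨s, hs⟩ := h
        exact ⟨s, fun _ => hs⟩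
      · exact ⟨0, fun h' => absurd h' h⟩
    choose f hf using hch
    have := hcard b B (fun k => z (f k)) (fun k => (θ (k * τ) - Θs)ᵀ) hb ?_ ?_ ?_
    · simpa using this
    · intro k hk
      have hkT := hBT k (Finset.mem_range.1 (Finset.mem_filter.1 hk).1)
      rw [norm_transpose_eq]
      have := norm_sub_le (θ (k * τ)) Θs
      have := (hθ (k * τ) (by omega)).2
      linarith
    · intro i hi j hj hij
      have hjT := hBT j (Finset.mem_range.1 (Finset.mem_filter.1 hj).1)
      have h1 := (hf i (Finset.mem_filter.1 hi).2).2.1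
      have h2 : i * τ + τ ≤ j * τ := by
        have := Nat.mul_le_mul_right τ (Nat.succ_le_of_lt hij)
        rwa [Nat.succ_mul] at this
      refine hE (j * τ) (by omega) _ ?_
      rw [Nat.mul_div_cancel _ hτ]
      omega
    · intro k hk
      exact (hf k (Finset.mem_filter.1 hk).2).2.2
  set N := A * (b + L) with hN
  have hN0 : 0 ≤ N := by positivity
  have hLN : L ≤ N := by nlinarith
  have ha := le_of_contracting (a := fun k => nrm (x (k * τ))) (A := A) (N := N) hA1 hN0
    (by simp [hx0, nrm_zero]) B (K := T / τ) ?_ ?_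
  · intro t ht
    have hdm := Nat.div_add_mod' t τ
    have hm := Nat.mod_lt t hτ
    have h1 := hgrow (t / τ * τ) (t % τ) hm.le (by omega)
    rw [hdm] at h1
    have h2 : nrm (x (t / τ * τ)) ≤ (4 * A) ^ (n + d) * (2 * N) := by
      refine (ha (t / τ) (Nat.div_le_div_right ht)).trans ?_
      refine mul_le_mul_of_nonneg_right (pow_le_pow_right₀ (by linarith) ?_) (by linarith)
      exact (Finset.card_filter_le _ _).trans hBcard
    refine (hz t ht).trans ?_
    have h3 : nrm (x (t / τ * τ)) + L ≤ ((4 * A) ^ (n + d) * (2 * A) + 1) * (b + L) := by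
      have : (4 * A) ^ (n + d) * (2 * N) = (4 * A) ^ (n + d) * (2 * A) * (b + L) := by
        rw [hN]; ring
      rw [this] at h2
      linarith
    have h4 : nrm (x t) + L ≤ A₂ * (((4 * A) ^ (n + d) * (2 * A) + 1) * (b + L)) :=
      h1.trans (mul_le_mul_of_nonneg_left h3 (by linarith))
    have h5 := mul_le_mul_of_nonneg_left h4 (show 0 ≤ 1 + κ by linarith)
    linarith
  · -- epochs without a large prediction error
    intro k hk hkB
    have hkT := hBT k hk
    have hgood : ∀ j < τ, nrm ((θ (k * τ) - Θs)ᵀ *ᵥ z (k * τ + j)) ≤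
        ρ * nrm (z (k * τ + j)) + C₁ * b := by
      intro j hj
      by_contra! hcon
      exact hkB (Finset.mem_filter.2 ⟨Finset.mem_range.2 hk, k * τ + j, by omega, by omega, hcon⟩)
    set θk := θ (k * τ) with hθk
    have hst := (hθ (k * τ) (by omega))
    have hdiv : ∀ j < τ, (k * τ + j) / τ * τ = k * τ := by
      intro j hj
      rw [mul_comm k τ, Nat.mul_add_div hτ, Nat.div_eq_of_lt hj, add_zero, mul_comm]
    -- the model replaces the true system, at the price of the prediction error
    have hrec := nrm_le_of_perturbed_recursion (C := closedLoop Q R θk) hγ' hγ hκ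
      hst.1.norm_pow_le (x := fun j => x (k * τ + j))
      (r := fun j => θk.B *ᵥ ν (k * τ + j) + w (k * τ + j) - (θk - Θs)ᵀ *ᵥ z (k * τ + j))
      (ρ := (S + 1) * L + C₁ * b + ρ * ((1 + κ) * (A₂ * (nrm (x (k * τ)) + L)))) (m := τ) ?_ ?_
    · simp only [add_zero] at hrec
      have e : (k + 1) * τ = k * τ + τ := by ring
      simp only [e]
      refine hrec.trans ?_
      have h1 : κ * (1 - γ) ^ τ * nrm (x (k * τ)) ≤ 1 / 8 * nrm (x (k * τ)) :=
        mul_le_mul_of_nonneg_right hτκ (nrm_nonneg _)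
      have h2 : (τ : ℝ) * (κ * (ρ * ((1 + κ) * (A₂ * (nrm (x (k * τ)) + L))))) =
          (nrm (x (k * τ)) + L) / 8 := by
        rw [hρ]; field_simp
      have h3 : (τ : ℝ) * (κ * ((S + 1) * L + C₁ * b +
          ρ * ((1 + κ) * (A₂ * (nrm (x (k * τ)) + L))))) =
          τ * κ * ((S + 1) * L + C₁ * b) + (nrm (x (k * τ)) + L) / 8 := by
        rw [← h2]; ring
      rw [h3]
      have h4 : τ * κ * ((S + 1) * L + C₁ * b) ≤ τ * κ * (S + 1 + C₁) * (b + L) := by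
        have : 0 ≤ τ * κ * ((S + 1) * b + C₁ * L) := by positivity
        nlinarith
      have h5 : N = A₂ * (b + L) + τ * κ * (S + 1 + C₁) * (b + L) + (b + L) := by
        rw [hN, hA]; ring
      have h6 : 0 ≤ A₂ * (b + L) := by positivity
      have h7 := nrm_nonneg (x (k * τ))
      linarith
    · intro j hj
      have e2 : θ (k * τ + j) = θk := by
        rw [hθτ (k * τ + j) (by omega), hdiv j hj]
      change x (k * τ + (j + 1)) = _
      rw [← add_assoc, hx _ (by omega)]
      change Θsᵀ *ᵥ z (k * τ + j) + _ = _
      have e3 : θkᵀ *ᵥ z (k * τ + j) =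
          closedLoop Q R θk *ᵥ x (k * τ + j) + θk.B *ᵥ ν (k * τ + j) := by
        rw [← Sys.mulVec_add_mulVec, hu _ (by omega), e2, closedLoop, add_mulVec, mulVec_add,
          mulVec_mulVec, add_assoc]
      rw [transpose_sub, sub_mulVec, e3]
      abel
    · intro j hj
      have h1 := hz (k * τ + j) (by omega)
      have h2 := hgrow (k * τ) j hj.le (by omega)
      have h3 : nrm (θk.B *ᵥ ν (k * τ + j)) ≤ S * L := by
        refine (nrm_mulVec_le _ _).trans (mul_le_mul ?_ (hν _ (by omega)) (nrm_nonneg _) hS)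
        exact (Sys.norm_B_le θk).trans hst.2
      have h4 := hgood j hj
      have h5 : ρ * nrm (z (k * τ + j)) ≤ ρ * ((1 + κ) * (A₂ * (nrm (x (k * τ)) + L))) := by
        refine mul_le_mul_of_nonneg_left (h1.trans ?_) hρ0.le
        exact mul_le_mul_of_nonneg_left h2 (by linarith)
      have h6 := hw (k * τ + j) (by omega)
      refine (nrm_sub_le _ _).trans ?_
      have h7 := nrm_add_le (θk.B *ᵥ ν (k * τ + j)) (w (k * τ + j))
      linarith
  · intro k hk
    have hkT := hBT k hk
    have h1 := hgrow (k * τ) τ le_rfl hkT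
    have e : (k + 1) * τ = k * τ + τ := by ring
    simp only [e]
    have h2 := nrm_nonneg (x (k * τ))
    have h3 : A₂ * (nrm (x (k * τ)) + L) ≤ A * (nrm (x (k * τ)) + N) := by
      refine mul_le_mul (by linarith) (by linarith) (by linarith) (by linarith)
    linarith

end StateBound

/-! ### The confidence ellipsoid -/

section WeightedForm

variable {ι κ' : Type*} [Fintype ι] [Fintype κ'] [DecidableEq ι] [DecidableEq κ']

lemma wf_add_add_wf_sub {V : Matrix ι ι ℝ} (hV : V.PosDef) (E F : Matrix ι κ' ℝ) :
    wf V (E + F) + wf V (E - F) = 2 * wf V E + 2 * wf V F := by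
  simp only [wf, Finset.mul_sum, ← Finset.sum_add_distrib]
  refine Finset.sum_congr rfl fun c _ => ?_
  have ht := transpose_eq_of_posDef hV
  have e1 := qf_add ht (fun r => E r c) (fun r => F r c)
  have e2 := qf_add ht (fun r => E r c) (-fun r => F r c)
  have e3 : qf V (-fun r => F r c) = qf V fun r => F r c := by
    rw [← neg_one_smul ℝ, qf_smul]; norm_num
  rw [e3, mulVec_neg, dotProduct_neg] at e2
  have e4 : (fun r => (E + F) r c) = (fun r => E r c) + fun r => F r c := rfl
  have e5 : (fun r => (E - F) r c) = (fun r => E r c) + -fun r => F r c := by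
    funext r; simp [sub_eq_add_neg]
  rw [e4, e5, e1, e2]
  ring

lemma wf_vecMulVec (V : Matrix ι ι ℝ) (z : ι → ℝ) (w : κ' → ℝ) :
    wf V (vecMulVec z w) = nrm w ^ 2 * qf V z := by
  rw [wf, nrm_sq, dotProduct, Finset.sum_mul]
  refine Finset.sum_congr rfl fun c _ => ?_
  have : (fun r => vecMulVec z w r c) = w c • z := by
    funext r; simp [vecMulVec_apply, mul_comm]
  rw [this, qf_smul, pow_two]

lemma wf_inv_mul {V : Matrix ι ι ℝ} (hV : V.PosDef) (E : Matrix ι κ' ℝ) :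
    wf V (V⁻¹ * E) = wf V⁻¹ E := by
  refine Finset.sum_congr rfl fun c _ => ?_
  have e : (fun r => (V⁻¹ * E) r c) = V⁻¹ *ᵥ fun r => E r c := rfl
  rw [e, qf, mulVec_mulVec, mul_nonsing_inv _ (isUnit_det_of_posDef hV), one_mulVec, qf,
    dotProduct_comm]

lemma wf_smul (V : Matrix ι ι ℝ) (c : ℝ) (E : Matrix ι κ' ℝ) : wf V (c • E) = c ^ 2 * wf V E := by
  rw [wf, wf, Finset.mul_sum]
  refine Finset.sum_congr rfl fun i _ => ?_
  rw [← qf_smul]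
  rfl

lemma wf_inv_add_vecMulVec_le {V : Matrix ι ι ℝ} (hV : V.PosDef) (z : ι → ℝ)
    (E : Matrix ι κ' ℝ) : wf (V + vecMulVec z z)⁻¹ E ≤ wf V⁻¹ E :=
  Finset.sum_le_sum fun _ _ => qf_inv_add_vecMulVec_le hV _ _

lemma measurable_wf {Ω : Type*} [MeasurableSpace Ω] {f : Ω → Matrix ι ι ℝ}
    {g : Ω → Matrix ι κ' ℝ} (hf : Measurable f) (hg : Measurable g) :
    Measurable fun ω => wf (f ω) (g ω) :=
  Finset.measurable_sum _ fun c _ => measurable_matrix_qf hf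
    (measurable_pi_lambda _ fun r => measurable_entry hg r c)

end WeightedForm

namespace Setup

variable {n d : ℕ} (p : Setup n d)

/-- The law of the driving noise. -/
noncomputable def law : Measure (NoiseIdx n d → ℝ) :=
  Measure.infinitePi fun a => gaussianReal 0 (noiseVar p.κ p.σ a)

instance : IsProbabilityMeasure p.law := by unfold law; infer_instance

lemma measurePreserving_flip (A : Set (NoiseIdx n d)) :
    MeasurePreserving (flipOn A) p.law p.law := measurePreserving_flipOn A

/-- The labels of `w_t`. -/
def noiseAt (n d t : ℕ) : Set (NoiseIdx n d) := Set.range (NoiseIdx.w t)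

lemma disjoint_past_noiseAt {τ t b c : ℕ} : Disjoint (past n d τ t b c) (noiseAt n d t) := by
  rw [Set.disjoint_right]
  rintro _ ⟨r, rfl⟩ h
  exact lt_irrefl t h

lemma wv_flip (ω : NoiseIdx n d → ℝ) (t : ℕ) : wv (flipOn (noiseAt n d t) ω) t = -wv ω t :=
  funext fun r => flipOn_of_mem (Set.mem_range_self r) ω

lemma dependsOn_wv (t : ℕ) : DependsOn (fun ω : NoiseIdx n d → ℝ => wv ω t) (noiseAt n d t) :=
  fun _ _ h => funext fun r => h _ ⟨r, rfl⟩

/-- `S_t = ∑_{s < t} z_s w_sᵀ`. -/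
noncomputable def noiseSum (ω : NoiseIdx n d → ℝ) (t : ℕ) : Sys n d :=
  p.Y ω t - (p.V ω t - p.μ • (1 : Matrix (Fin n ⊕ Fin d) (Fin n ⊕ Fin d) ℝ)) * p.Θs

lemma noiseSum_zero (ω : NoiseIdx n d → ℝ) : p.noiseSum ω 0 = 0 := by
  rw [noiseSum, Y_zero, V_zero, sub_self, Matrix.zero_mul, sub_zero]

lemma noiseSum_succ (ω : NoiseIdx n d → ℝ) (t : ℕ) :
    p.noiseSum ω (t + 1) = p.noiseSum ω t + vecMulVec (p.Z ω t) (wv ω t) := by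
  have e : vecMulVec (p.Z ω t) (p.Z ω t) * p.Θs = vecMulVec (p.Z ω t) (p.Θsᵀ *ᵥ p.Z ω t) := by
    rw [vecMulVec_mul, mulVec_transpose]
  rw [noiseSum, noiseSum, Y_succ, V_succ, X_succ, vecMulVec_add, Matrix.sub_mul, Matrix.sub_mul, Matrix.add_mul, e]
  abel

/-- The squared error `tr(S_tᵀ V_t⁻¹ S_t)` of the self-normalized noise. -/
noncomputable def conf (ω : NoiseIdx n d → ℝ) (t : ℕ) : ℝ := wf (p.V ω t)⁻¹ (p.noiseSum ω t)

lemma conf_zero (ω : NoiseIdx n d → ℝ) : p.conf ω 0 = 0 := by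
  rw [conf, noiseSum_zero]
  simp only [wf, qf, Matrix.zero_apply]
  refine Finset.sum_eq_zero fun c _ => ?_
  exact zero_dotProduct _

lemma qf_inv_V_le (hμ : 0 < p.μ) (ω : NoiseIdx n d → ℝ) (t : ℕ) (x : Fin n ⊕ Fin d → ℝ) :
    qf (p.V ω t)⁻¹ x ≤ p.μ⁻¹ * nrm x ^ 2 := by
  induction t with
  | zero =>
    have : (p.μ • (1 : Matrix (Fin n ⊕ Fin d) (Fin n ⊕ Fin d) ℝ))⁻¹ = p.μ⁻¹ • 1 := by
      apply inv_eq_right_inv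
      rw [Matrix.smul_mul, Matrix.one_mul, smul_smul, mul_inv_cancel₀ hμ.ne', one_smul]
    rw [V_zero, this, nrm_sq]
    simp [qf, smul_mulVec]
  | succ t ih =>
    rw [V_succ]
    exact (qf_inv_add_vecMulVec_le (p.V_posDef ω t hμ) _ _).trans ih

lemma wf_inv_V_le (hμ : 0 < p.μ) (ω : NoiseIdx n d → ℝ) (t : ℕ) (E : Sys n d) :
    wf (p.V ω t)⁻¹ E ≤ p.μ⁻¹ * fsq E := by
  rw [wf, fsq_eq_sum_dot, Finset.mul_sum]
  refine Finset.sum_le_sum fun c _ => ?_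
  rw [← nrm_sq]
  exact p.qf_inv_V_le hμ ω t _

/-- The error of the least squares estimate in the `V`-weighted norm. -/
lemma wf_estimate_sub_le (hμ : 0 < p.μ) (ω : NoiseIdx n d → ℝ) (t : ℕ) :
    wf (p.V ω t) ((p.V ω t)⁻¹ * p.Y ω t - p.Θs) ≤ 2 * p.conf ω t + 2 * p.μ * fsq p.Θs := by
  have hV := p.V_posDef ω t hμ
  have e : (p.V ω t)⁻¹ * p.Y ω t - p.Θs =
      (p.V ω t)⁻¹ * p.noiseSum ω t + (-p.μ) • ((p.V ω t)⁻¹ * p.Θs) := by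
    have h1 : (p.V ω t)⁻¹ * (p.V ω t * p.Θs) = p.Θs := by
      rw [← Matrix.mul_assoc, nonsing_inv_mul _ (isUnit_det_of_posDef hV), Matrix.one_mul]
    rw [noiseSum, Matrix.sub_mul, Matrix.mul_sub, Matrix.mul_sub, h1, Matrix.smul_mul, Matrix.one_mul,
      Matrix.mul_smul, neg_smul]
    abel
  rw [e]
  refine (wf_add_le hV _ _).trans ?_
  rw [wf_smul, wf_inv_mul hV, wf_inv_mul hV]
  have h2 := p.wf_inv_V_le hμ ω t p.Θs
  have h3 : (-p.μ) ^ 2 * wf (p.V ω t)⁻¹ p.Θs ≤ p.μ * fsq p.Θs := by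
    calc (-p.μ) ^ 2 * wf (p.V ω t)⁻¹ p.Θs ≤ (-p.μ) ^ 2 * (p.μ⁻¹ * fsq p.Θs) := by gcongr
      _ = p.μ * fsq p.Θs := by field_simp
  rw [conf]
  linarith

lemma sq_dot_Z_le_qf_V (hμ : 0 < p.μ) (ω : NoiseIdx n d → ℝ) {s t : ℕ} (hst : s < t)
    (x : Fin n ⊕ Fin d → ℝ) : (p.Z ω s ⬝ᵥ x) ^ 2 ≤ qf (p.V ω t) x := by
  induction t with
  | zero => exact absurd hst (Nat.not_lt_zero _)
  | succ t ih =>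
    have e : qf (p.V ω (t + 1)) x = qf (p.V ω t) x + (p.Z ω t ⬝ᵥ x) ^ 2 := by
      rw [V_succ, ← qf_vecMulVec, qf, add_mulVec, dotProduct_add]
      rfl
    rw [e]
    rcases Nat.lt_succ_iff_lt_or_eq.1 hst with h | rfl
    · nlinarith [ih h, sq_nonneg (p.Z ω t ⬝ᵥ x)]
    · nlinarith [qf_nonneg (p.V_posDef ω s hμ) x]

/-- A small error in the `V`-weighted norm means small prediction errors on the past data. -/
lemma nrm_transpose_mulVec_Z_sq_le (hμ : 0 < p.μ) (ω : NoiseIdx n d → ℝ) {s t : ℕ} (hst : s < t)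
    (E : Sys n d) : nrm (Eᵀ *ᵥ p.Z ω s) ^ 2 ≤ wf (p.V ω t) E := by
  rw [nrm_sq, dotProduct, wf]
  refine Finset.sum_le_sum fun c _ => ?_
  rw [← pow_two]
  have e : (Eᵀ *ᵥ p.Z ω s) c = p.Z ω s ⬝ᵥ fun r => E r c := dotProduct_comm _ _
  rw [e]
  exact p.sq_dot_Z_le_qf_V hμ ω hst _

/-! #### The elliptical potential -/

lemma log_det_succ (hμ : 0 < p.μ) (ω : NoiseIdx n d → ℝ) (t : ℕ) :
    Real.log (p.V ω (t + 1)).det =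
      Real.log (p.V ω t).det + Real.log (1 + qf (p.V ω t)⁻¹ (p.Z ω t)) := by
  have hV := p.V_posDef ω t hμ
  have hq := qf_nonneg hV.inv (p.Z ω t)
  rw [V_succ, det_add_vecMulVec hV, Real.log_mul hV.det_pos.ne' (by positivity)]

lemma trace_V_le {ζ : ℝ} (ω : NoiseIdx n d → ℝ) (t : ℕ)
    (h : ∀ s < t, nrm (p.Z ω s) ≤ ζ) : (p.V ω t).trace ≤ (n + d) * p.μ + t * ζ ^ 2 := by
  induction t with
  | zero =>
    rw [V_zero, trace_smul, trace_one]
    simp [mul_comm]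
  | succ t ih =>
    have h1 := ih fun s hs => h s (hs.trans t.lt_succ_self)
    have h2 := pow_le_pow_left₀ (nrm_nonneg _) (h t t.lt_succ_self) 2
    rw [V_succ, trace_add, trace_vecMulVec, ← nrm_sq]
    push_cast
    linarith

/-- The total information that `t` steps with `‖z_s‖ ≤ ζ` can bring. -/
noncomputable def potential (t : ℕ) (ζ : ℝ) : ℝ :=
  (n + d) * Real.log ((n + d) + t * ζ ^ 2 / p.μ)

lemma log_det_sub_le (hn : 1 ≤ n) (hμ : 0 < p.μ) {ζ : ℝ} (ω : NoiseIdx n d → ℝ) (t : ℕ)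
    (h : ∀ s < t, nrm (p.Z ω s) ≤ ζ) :
    Real.log (p.V ω t).det - Real.log (p.V ω 0).det ≤ p.potential t ζ := by
  have hV := p.V_posDef ω t hμ
  have hn' : (1 : ℝ) ≤ n := by exact_mod_cast hn
  have h1 : (p.V ω t).det ≤ ((n + d) * p.μ + t * ζ ^ 2) ^ (n + d) := by
    refine (det_le_trace_pow hV).trans ?_
    simp only [Fintype.card_sum, Fintype.card_fin]
    exact pow_le_pow_left₀ hV.posSemidef.trace_nonneg (p.trace_V_le ω t h) _
  have h0 : (p.V ω 0).det = p.μ ^ (n + d) := by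
    rw [V_zero, det_smul, det_one, mul_one]; simp
  have hpos : 0 < (n + d) * p.μ + t * ζ ^ 2 := by positivity
  have h2 := Real.log_le_log hV.det_pos h1
  rw [Real.log_pow] at h2
  rw [h0, Real.log_pow, potential]
  have e : (n + d : ℝ) + t * ζ ^ 2 / p.μ = ((n + d) * p.μ + t * ζ ^ 2) / p.μ := by
    field_simp
  rw [e, Real.log_div hpos.ne' hμ.ne']
  push_cast at h2 ⊢
  linarith

lemma potential_nonneg (hn : 1 ≤ n) (hμ : 0 < p.μ) (t : ℕ) (ζ : ℝ) : 0 ≤ p.potential t ζ := by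
  have hn' : (1 : ℝ) ≤ n := by exact_mod_cast hn
  have : 0 ≤ (t : ℝ) * ζ ^ 2 / p.μ := by positivity
  exact mul_nonneg (by positivity) (Real.log_nonneg (by linarith [Nat.cast_nonneg (α := ℝ) d]))

lemma potential_mono (hn : 1 ≤ n) (hμ : 0 < p.μ) {s t : ℕ} (hst : s ≤ t) (ζ : ℝ) :
    p.potential s ζ ≤ p.potential t ζ := by
  have hn' : (1 : ℝ) ≤ n := by exact_mod_cast hn
  have h1 : (s : ℝ) ≤ t := by exact_mod_cast hst
  have : 0 ≤ (s : ℝ) * ζ ^ 2 / p.μ := by positivity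
  unfold potential
  gcongr

/-! #### The adapted good event -/

/-- Up to time `t` the sampled models are admissible, `‖z_s‖ ≤ ζ`, and the self-normalized noise is
at most `a`. -/
def Good (ζ a : ℝ) (t : ℕ) : Set (NoiseIdx n d → ℝ) :=
  {ω | ∀ s ≤ t, p.mdl ω s ∈ p.M ∧ nrm (p.Z ω s) ≤ ζ ∧ p.conf ω s ≤ a}

variable {p}

lemma Good.anti {ζ a : ℝ} {s t : ℕ} (hst : s ≤ t) : p.Good ζ a t ⊆ p.Good ζ a s :=
  fun _ h r hr => h r (hr.trans hst)

variable (p)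

lemma dependsOn_noiseSum (t : ℕ) : DependsOn (fun ω => p.noiseSum ω t) (past n d p.τ₀ t t t) := by
  intro ω ω' h
  have h1 := p.dependsOn_V t h
  have h2 := p.dependsOn_Y t h
  simp only at h1 h2
  simp only [noiseSum, h1, h2]

lemma dependsOn_conf (t : ℕ) : DependsOn (fun ω => p.conf ω t) (past n d p.τ₀ t t t) := by
  intro ω ω' h
  have h1 := p.dependsOn_V t h
  have h2 := p.dependsOn_noiseSum t h
  simp only at h1 h2
  simp only [conf, h1, h2]

lemma dependsOn_Good (ζ a : ℝ) (t : ℕ) :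
    DependsOn (fun ω => ω ∈ p.Good ζ a t) (past n d p.τ₀ t (t + 1) (t + 1)) := by
  intro ω ω' h
  refine propext (forall₂_congr fun s hs => ?_)
  have hb : ∀ i ∈ past n d p.τ₀ s (s + 1) (s + 1), ω i = ω' i := fun i hi =>
    h i (past_mono hs (by omega) (by omega) hi)
  have h1 := p.dependsOn_mdl s hb
  have h2 := p.dependsOn_Z s hb
  have h3 := p.dependsOn_conf s fun i hi => h i (past_mono hs (by omega) (by omega) hi)
  simp only at h1 h2 h3
  rw [h1, h2, h3]

variable {p}

namespace MeasurableSetup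

lemma noiseSum (h : p.MeasurableSetup) (t : ℕ) : Measurable fun ω => p.noiseSum ω t := by
  have h1 : Measurable fun ω => (p.V ω t - p.μ • (1 : Matrix (Fin n ⊕ Fin d) (Fin n ⊕ Fin d) ℝ)) :=
    measurable_matrix fun i j => (measurable_entry (h.V t) i j).sub_const _
  have h2 := measurable_matrix_mul h1 (measurable_const (a := p.Θs))
  exact measurable_matrix fun i j =>
    (measurable_entry (h.Y t) i j).sub (measurable_entry h2 i j)

lemma conf (h : p.MeasurableSetup) (t : ℕ) : Measurable fun ω => p.conf ω t :=
  measurable_wf (measurable_matrix_inv (h.V t)) (h.noiseSum t)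

lemma Good (h : p.MeasurableSetup) (ζ a : ℝ) (t : ℕ) : MeasurableSet (p.Good ζ a t) := by
  have : p.Good ζ a t = ⋂ s ∈ Set.Iic t, ((fun ω => p.mdl ω s) ⁻¹' p.M ∩
      ({ω | nrm (p.Z ω s) ≤ ζ} ∩ {ω | p.conf ω s ≤ a})) := by
    ext ω
    simp [Setup.Good]
  rw [this]
  refine MeasurableSet.biInter (Set.to_countable _) fun s _ => ?_
  exact (h.mdl s h.M).inter ((measurableSet_le (measurable_nrm (h.Z s)) measurable_const).inter
    (measurableSet_le (h.conf s) measurable_const))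

end MeasurableSetup

/-! #### The self-normalized bound -/

/-- `E ‖w_t‖² = n σ²`. -/
lemma lintegral_nrm_wv_sq (p : Setup n d) (t : ℕ) :
    ∫⁻ ω, ENNReal.ofReal (nrm (wv ω t) ^ 2) ∂p.law = ENNReal.ofReal (n * p.σ ^ 2) := by
  have e : ∀ ω : NoiseIdx n d → ℝ, ENNReal.ofReal (nrm (wv ω t) ^ 2) =
      ∑ r, ENNReal.ofReal (ω (.w t r) ^ 2) := fun ω => by
    rw [nrm_sq, dotProduct, ENNReal.ofReal_sum_of_nonneg fun r _ => mul_self_nonneg _]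
    simp only [wv, pow_two]
  simp only [e]
  rw [lintegral_finsetSum _ fun r _ => by fun_prop]
  have h1 : ∀ r : Fin n, ∫⁻ ω, ENNReal.ofReal (ω (.w t r) ^ 2) ∂p.law =
      ENNReal.ofReal (p.σ ^ 2) := fun r => by
    have hm := measurePreserving_eval_infinitePi
      (fun a : NoiseIdx n d => gaussianReal 0 (noiseVar p.κ p.σ a)) (.w t r)
    have := hm.lintegral_comp (f := fun x : ℝ => ENNReal.ofReal (x ^ 2)) (by fun_prop)
    rw [lintegral_sq_gaussianReal] at this
    exact this
  simp only [h1, Finset.sum_const, Finset.card_univ, Fintype.card_fin, nsmul_eq_mul]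
  rw [ENNReal.ofReal_mul (by positivity), ENNReal.ofReal_natCast]

/-- The sign change of `w_t` cancels the cross term `2 tr(S_tᵀ V_{t+1}⁻¹ z_t w_tᵀ)`. -/
lemma conf_succ_add_flip_le (p : Setup n d) (hμ : 0 < p.μ) (ω : NoiseIdx n d → ℝ) (t : ℕ) :
    p.conf ω (t + 1) + p.conf (flipOn (noiseAt n d t) ω) (t + 1) ≤
      2 * (p.conf ω t + nrm (wv ω t) ^ 2 * Real.log (1 + qf (p.V ω t)⁻¹ (p.Z ω t))) := by
  have hV := p.V_posDef ω t hμ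
  have hV1 := p.V_posDef ω (t + 1) hμ
  have e1 : p.V (flipOn (noiseAt n d t) ω) (t + 1) = p.V ω (t + 1) :=
    comp_flipOn_of_dependsOn (p.dependsOn_V_succ t) disjoint_past_noiseAt ω
  have e2 : p.noiseSum (flipOn (noiseAt n d t) ω) t = p.noiseSum ω t :=
    comp_flipOn_of_dependsOn (p.dependsOn_noiseSum t) disjoint_past_noiseAt ω
  have e3 : p.Z (flipOn (noiseAt n d t) ω) t = p.Z ω t :=
    comp_flipOn_of_dependsOn (p.dependsOn_Z t) disjoint_past_noiseAt ω
  have e4 : vecMulVec (p.Z ω t) (-wv ω t) = -vecMulVec (p.Z ω t) (wv ω t) := by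
    ext i j; simp [vecMulVec_apply]
  have h2 : wf (p.V ω (t + 1))⁻¹ (p.noiseSum ω t) ≤ p.conf ω t := by
    rw [V_succ]
    exact wf_inv_add_vecMulVec_le hV _ _
  have h3 : qf (p.V ω (t + 1))⁻¹ (p.Z ω t) ≤ Real.log (1 + qf (p.V ω t)⁻¹ (p.Z ω t)) := by
    have hq := qf_nonneg hV.inv (p.Z ω t)
    rw [V_succ, qf_inv_update_self hV]
    have := Real.one_sub_inv_le_log_of_pos (show 0 < 1 + qf (p.V ω t)⁻¹ (p.Z ω t) by positivity)
    refine le_trans (le_of_eq ?_) this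
    field_simp
    ring
  rw [conf, conf, noiseSum_succ, noiseSum_succ, e1, e2, e3, wv_flip, e4, ← sub_eq_add_neg,
    wf_add_add_wf_sub hV1.inv, wf_vecMulVec]
  have h4 := mul_le_mul_of_nonneg_left h3 (sq_nonneg (nrm (wv ω t)))
  linarith

open Classical in
/-- The self-normalized noise, stopped when the run ceases to be good. -/
noncomputable def stoppedConf (p : Setup n d) (ζ a : ℝ) (ω : NoiseIdx n d → ℝ) : ℕ → ℝ
  | 0 => 0
  | t + 1 => if ω ∈ p.Good ζ a t then p.conf ω (t + 1) else stoppedConf p ζ a ω t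

lemma stoppedConf_eq (p : Setup n d) {ζ a : ℝ} {ω : NoiseIdx n d → ℝ} {t : ℕ}
    (h : ∀ s < t, ω ∈ p.Good ζ a s) : p.stoppedConf ζ a ω t = p.conf ω t := by
  cases t with
  | zero => rw [conf_zero]; rfl
  | succ t => rw [stoppedConf, if_pos (h t t.lt_succ_self)]

lemma stoppedConf_of_notMem (p : Setup n d) {ζ a : ℝ} {ω : NoiseIdx n d → ℝ} {t T : ℕ}
    (htT : t ≤ T) (h : ω ∉ p.Good ζ a t) : p.stoppedConf ζ a ω T = p.stoppedConf ζ a ω t := by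
  induction T, htT using Nat.le_induction with
  | base => rfl
  | succ T hT ih => rw [stoppedConf, if_neg fun h' => h (Good.anti hT h'), ih]

lemma dependsOn_stoppedConf (p : Setup n d) (ζ a : ℝ) (t : ℕ) :
    DependsOn (fun ω => p.stoppedConf ζ a ω t) (past n d p.τ₀ t t t) := by
  classical
  induction t with
  | zero => intro ω ω' _; rfl
  | succ t ih =>
    intro ω ω' h
    have h1 := p.dependsOn_Good ζ a t fun i hi =>
      h i (past_mono t.le_succ le_rfl le_rfl hi)
    have h2 := p.dependsOn_conf (t + 1) h
    have h3 := ih fun i hi => h i (past_mono t.le_succ t.le_succ t.le_succ hi)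
    simp only at h1 h2 h3
    simp only [stoppedConf, h2, h3]
    exact if_congr (iff_of_eq h1) rfl rfl

lemma MeasurableSetup.stoppedConf (h : p.MeasurableSetup) (ζ a : ℝ) (t : ℕ) :
    Measurable fun ω => p.stoppedConf ζ a ω t := by
  classical
  induction t with
  | zero => exact measurable_const
  | succ t ih => exact Measurable.ite (h.Good ζ a t) (h.conf (t + 1)) ih

/-- The elliptical potential lemma along a decreasing sequence of events. -/
lemma sum_indicator_log_le (p : Setup n d) (hn : 1 ≤ n) (hμ : 0 < p.μ) (ζ a : ℝ) (T : ℕ)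
    (ω : NoiseIdx n d → ℝ) :
    ∑ t ∈ Finset.range T, (p.Good ζ a t).indicator
      (fun ω => Real.log (1 + qf (p.V ω t)⁻¹ (p.Z ω t))) ω ≤ p.potential T ζ := by
  induction T with
  | zero => exact p.potential_nonneg hn hμ 0 ζ
  | succ T ih =>
    by_cases h : ω ∈ p.Good ζ a T
    · have e : ∑ t ∈ Finset.range (T + 1), (p.Good ζ a t).indicator
          (fun ω => Real.log (1 + qf (p.V ω t)⁻¹ (p.Z ω t))) ω =
          ∑ t ∈ Finset.range (T + 1), (Real.log (p.V ω (t + 1)).det - Real.log (p.V ω t).det) := by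
        refine Finset.sum_congr rfl fun t ht => ?_
        rw [Set.indicator_of_mem (Good.anti (Nat.lt_succ_iff.1 (Finset.mem_range.1 ht)) h),
          p.log_det_succ hμ]
        ring
      rw [e, Finset.sum_range_sub fun t => Real.log (p.V ω t).det]
      exact p.log_det_sub_le hn hμ ω _ fun s hs => (h s (Nat.lt_succ_iff.1 hs)).2.1
    · rw [Finset.sum_range_succ, Set.indicator_of_notMem h, add_zero]
      exact ih.trans (p.potential_mono hn hμ T.le_succ ζ)

lemma log_one_add_qf_nonneg (p : Setup n d) (hμ : 0 < p.μ) (ω : NoiseIdx n d → ℝ) (t : ℕ) :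
    0 ≤ Real.log (1 + qf (p.V ω t)⁻¹ (p.Z ω t)) :=
  Real.log_nonneg (by linarith [qf_nonneg (p.V_posDef ω t hμ).inv (p.Z ω t)])

lemma conf_nonneg (p : Setup n d) (hμ : 0 < p.μ) (ω : NoiseIdx n d → ℝ) (t : ℕ) :
    0 ≤ p.conf ω t := wf_nonneg (p.V_posDef ω t hμ).inv _

lemma stoppedConf_nonneg (p : Setup n d) (hμ : 0 < p.μ) (ζ a : ℝ) (ω : NoiseIdx n d → ℝ) (t : ℕ) :
    0 ≤ p.stoppedConf ζ a ω t := by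
  induction t with
  | zero => exact le_rfl
  | succ t ih =>
    rw [stoppedConf]
    split_ifs
    · exact p.conf_nonneg hμ ω _
    · exact ih

lemma measurable_log_one_add_qf (h : p.MeasurableSetup) (t : ℕ) :
    Measurable fun ω => Real.log (1 + qf (p.V ω t)⁻¹ (p.Z ω t)) :=
  Real.measurable_log.comp
    ((measurable_matrix_qf (measurable_matrix_inv (h.V t)) (h.Z t)).const_add 1)

/-- The stopped self-normalized noise grows in expectation only by the potential; the event of
goodness at time `t` and `z_t`, `V_t` do not involve `w_t`. -/
lemma lintegral_stoppedConf_succ_le (h : p.MeasurableSetup) (ζ a : ℝ) (t : ℕ) :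
    ∫⁻ ω, ENNReal.ofReal (p.stoppedConf ζ a ω (t + 1)) ∂p.law ≤
      ∫⁻ ω, ENNReal.ofReal (p.stoppedConf ζ a ω t) ∂p.law + ENNReal.ofReal (n * p.σ ^ 2) *
        ∫⁻ ω, ENNReal.ofReal ((p.Good ζ a t).indicator
          (fun ω => Real.log (1 + qf (p.V ω t)⁻¹ (p.Z ω t))) ω) ∂p.law := by
  classical
  set g : (NoiseIdx n d → ℝ) → ℝ := (p.Good ζ a t).indicator
    (fun ω => Real.log (1 + qf (p.V ω t)⁻¹ (p.Z ω t))) with hg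
  have hgm : Measurable g := (measurable_log_one_add_qf h t).indicator (h.Good ζ a t)
  have hg0 : ∀ ω, 0 ≤ g ω := fun ω =>
    Set.indicator_nonneg (fun ω _ => p.log_one_add_qf_nonneg h.μ_pos ω t) ω
  have hgd : DependsOn g (past n d p.τ₀ t (t + 1) (t + 1)) := by
    intro ω ω' hω
    have h1 := p.dependsOn_Good ζ a t hω
    have h2 := p.dependsOn_Z t hω
    have h3 := p.dependsOn_V t fun i hi => hω i (past_mono le_rfl t.le_succ t.le_succ hi)
    simp only at h1 h2 h3
    simp only [hg, Set.indicator, h2, h3]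
    exact if_congr (iff_of_eq h1) rfl rfl
  have hw : Measurable fun ω : NoiseIdx n d → ℝ => ENNReal.ofReal (nrm (wv ω t) ^ 2) :=
    ((measurable_nrm (measurable_wv t)).pow_const 2).ennreal_ofReal
  have hmul : ∫⁻ ω, ENNReal.ofReal (nrm (wv ω t) ^ 2) * ENNReal.ofReal (g ω) ∂p.law =
      ENNReal.ofReal (n * p.σ ^ 2) * ∫⁻ ω, ENNReal.ofReal (g ω) ∂p.law := by
    rw [← p.lintegral_nrm_wv_sq t]
    refine lintegral_mul_of_dependsOn (disjoint_past_noiseAt (t := t) (τ := p.τ₀) (b := t + 1)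
      (c := t + 1)).symm hw hgm.ennreal_ofReal ?_ ?_
    · intro ω ω' hω
      have := dependsOn_wv t hω
      simp only at this ⊢
      rw [this]
    · intro ω ω' hω
      simp only [hgd hω]
  rw [← hmul, ← lintegral_add_left (h.stoppedConf ζ a t).ennreal_ofReal]
  refine two_mul_lintegral_le_of_measurePreserving (p.measurePreserving_flip (noiseAt n d t))
    (h.stoppedConf ζ a (t + 1)).ennreal_ofReal fun ω => ?_
  have hs0 := p.stoppedConf_nonneg h.μ_pos ζ a
  rw [← ENNReal.ofReal_mul (sq_nonneg _), ← ENNReal.ofReal_add (hs0 ω t)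
    (mul_nonneg (sq_nonneg _) (hg0 ω)), ← ENNReal.ofReal_add (hs0 _ _) (hs0 _ _),
    show (2 : ℝ≥0∞) = ENNReal.ofReal 2 by simp, ← ENNReal.ofReal_mul zero_le_two]
  refine ENNReal.ofReal_le_ofReal ?_
  have e1 : (flipOn (noiseAt n d t) ω ∈ p.Good ζ a t) = (ω ∈ p.Good ζ a t) :=
    comp_flipOn_of_dependsOn (p.dependsOn_Good ζ a t) disjoint_past_noiseAt ω
  have e2 : p.stoppedConf ζ a (flipOn (noiseAt n d t) ω) t = p.stoppedConf ζ a ω t :=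
    comp_flipOn_of_dependsOn (p.dependsOn_stoppedConf ζ a t) disjoint_past_noiseAt ω
  by_cases hω : ω ∈ p.Good ζ a t
  · rw [stoppedConf, stoppedConf, if_pos hω, if_pos (e1.symm ▸ hω), hg,
      Set.indicator_of_mem hω, p.stoppedConf_eq fun s hs => Good.anti hs.le hω]
    exact p.conf_succ_add_flip_le h.μ_pos ω t
  · rw [stoppedConf, stoppedConf, if_neg hω, if_neg (e1.symm ▸ hω), e2, hg,
      Set.indicator_of_notMem hω]
    linarith

lemma lintegral_stoppedConf_le (h : p.MeasurableSetup) (hn : 1 ≤ n) (ζ a : ℝ) (T : ℕ) :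
    ∫⁻ ω, ENNReal.ofReal (p.stoppedConf ζ a ω T) ∂p.law ≤
      ENNReal.ofReal (n * p.σ ^ 2 * p.potential T ζ) := by
  set g : ℕ → (NoiseIdx n d → ℝ) → ℝ := fun t => (p.Good ζ a t).indicator
    (fun ω => Real.log (1 + qf (p.V ω t)⁻¹ (p.Z ω t))) with hg
  have hgm : ∀ t, Measurable (g t) := fun t =>
    (measurable_log_one_add_qf h t).indicator (h.Good ζ a t)
  have hg0 : ∀ t ω, 0 ≤ g t ω := fun t ω =>
    Set.indicator_nonneg (fun ω _ => p.log_one_add_qf_nonneg h.μ_pos ω t) ω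
  have h1 : ∫⁻ ω, ENNReal.ofReal (p.stoppedConf ζ a ω T) ∂p.law ≤ ENNReal.ofReal (n * p.σ ^ 2) *
      ∑ t ∈ Finset.range T, ∫⁻ ω, ENNReal.ofReal (g t ω) ∂p.law := by
    clear_value g
    subst hg
    induction T with
    | zero => simp [stoppedConf]
    | succ T ih =>
      rw [Finset.sum_range_succ, mul_add]
      exact (lintegral_stoppedConf_succ_le h ζ a T).trans (by gcongr)
  refine h1.trans ?_
  rw [← lintegral_finsetSum _ fun t _ => (hgm t).ennreal_ofReal,
    ENNReal.ofReal_mul (p := n * p.σ ^ 2) (by positivity)]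
  refine mul_le_mul_right (α := ℝ≥0∞) ?_ _
  calc ∫⁻ ω, ∑ t ∈ Finset.range T, ENNReal.ofReal (g t ω) ∂p.law
      ≤ ∫⁻ _, ENNReal.ofReal (p.potential T ζ) ∂p.law := by
        refine lintegral_mono fun ω => ?_
        rw [← ENNReal.ofReal_sum_of_nonneg fun t _ => hg0 t ω]
        exact ENNReal.ofReal_le_ofReal (p.sum_indicator_log_le hn h.μ_pos ζ a T ω)
    _ = ENNReal.ofReal (p.potential T ζ) := by simp

/-- The self-normalized noise exceeds `a` while the run is good only with probability of order
`1 / a`. -/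
lemma law_stoppedConf_gt_le (h : p.MeasurableSetup) (hn : 1 ≤ n) (ζ : ℝ) {a : ℝ} (ha : 0 < a)
    (T : ℕ) : p.law {ω | a < p.stoppedConf ζ a ω T} ≤
      ENNReal.ofReal (n * p.σ ^ 2 * p.potential T ζ / a) := by
  have h1 := meas_ge_le_lintegral_div (μ := p.law) (h.stoppedConf ζ a T).ennreal_ofReal.aemeasurable
    (ε := ENNReal.ofReal a) (by simpa using ha) ENNReal.ofReal_ne_top
  rw [ENNReal.ofReal_div_of_pos ha]
  refine le_trans (measure_mono ?_) (h1.trans (by gcongr; exact lintegral_stoppedConf_le h hn ζ a T))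
  intro ω hω
  exact ENNReal.ofReal_le_ofReal (le_of_lt hω)

/-- While the stopped noise is at most `a`, the true one is, as long as the run is good. -/
lemma conf_le_of_stoppedConf_le (p : Setup n d) {ζ a : ℝ} {ω : NoiseIdx n d → ℝ} {T : ℕ}
    (h : p.stoppedConf ζ a ω T ≤ a) {t : ℕ} (ht : t ≤ T) (hg : ∀ s < t, ω ∈ p.Good ζ a s) :
    p.conf ω t ≤ a := by
  by_contra! hc
  have h1 : ω ∉ p.Good ζ a t := fun h' => absurd (h' t le_rfl).2.2 (not_le.2 hc)
  rw [p.stoppedConf_of_notMem ht h1, p.stoppedConf_eq hg] at h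
  linarith

end Setup

/-! ### Rejection sampling succeeds -/

namespace Setup

variable {n d : ℕ} (p : Setup n d)

lemma β_ge (hσ : 0 ≤ p.σ) (V : Matrix (Fin n ⊕ Fin d) (Fin n ⊕ Fin d) ℝ) :
    √p.μ * p.S ≤ p.β V :=
  le_add_of_nonneg_left (mul_nonneg hσ (Real.sqrt_nonneg _))

/-- The radius `β` has the square root of the logarithm of a determinant, which the potential
bounds. -/
lemma β_sq_le (hμ : 0 < p.μ) (hδ : 0 < p.δ) {ℓ : ℝ} (hℓ : 0 ≤ ℓ) (ω : NoiseIdx n d → ℝ) (t : ℕ)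
    (h : Real.log (p.V ω t).det - Real.log (p.V ω 0).det ≤ ℓ) (hδ1 : p.δ ≤ 1) :
    p.β (p.V ω t) ^ 2 ≤ 2 * (p.σ ^ 2 * (2 * n * (ℓ / 2 + Real.log (1 / p.δ)))) +
      2 * (p.μ * p.S ^ 2) := by
  have hV := (p.V_posDef ω t hμ).det_pos
  have hV0 := (p.V_posDef ω 0 hμ).det_pos
  rw [V_zero] at h hV0
  have e : Real.log (√(p.V ω t).det / (p.δ * √(p.μ • (1 : Matrix (Fin n ⊕ Fin d)
      (Fin n ⊕ Fin d) ℝ)).det)) = (Real.log (p.V ω t).det - Real.log (p.μ • (1 : Matrix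
      (Fin n ⊕ Fin d) (Fin n ⊕ Fin d) ℝ)).det) / 2 + Real.log (1 / p.δ) := by
    rw [Real.log_div (Real.sqrt_pos.2 hV).ne' (mul_pos hδ (Real.sqrt_pos.2 hV0)).ne',
      Real.log_mul hδ.ne' (Real.sqrt_pos.2 hV0).ne', Real.log_sqrt hV.le, Real.log_sqrt hV0.le,
      one_div, Real.log_inv]
    ring
  have hlδ : 0 ≤ Real.log (1 / p.δ) := Real.log_nonneg (by rw [le_div_iff₀ hδ]; linarith)
  have h1 : √(2 * n * Real.log (√(p.V ω t).det / (p.δ * √(p.μ • (1 : Matrix (Fin n ⊕ Fin d)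
      (Fin n ⊕ Fin d) ℝ)).det))) ^ 2 ≤ 2 * n * (ℓ / 2 + Real.log (1 / p.δ)) := by
    have hle : 2 * n * Real.log (√(p.V ω t).det / (p.δ * √(p.μ • (1 : Matrix (Fin n ⊕ Fin d)
      (Fin n ⊕ Fin d) ℝ)).det)) ≤ 2 * n * (ℓ / 2 + Real.log (1 / p.δ)) := by
      rw [e]; gcongr
    calc _ ≤ √(2 * n * (ℓ / 2 + Real.log (1 / p.δ))) ^ 2 := by gcongr
      _ = _ := Real.sq_sqrt (by positivity)
  have h2 : √p.μ ^ 2 = p.μ := Real.sq_sqrt hμ.le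
  rw [β]
  refine (add_sq_le).trans ?_
  rw [mul_pow, mul_pow, h2, mul_add]
  have := mul_le_mul_of_nonneg_left h1 (sq_nonneg p.σ)
  linarith

/-- The noise matrix for which the perturbed estimate is the true system. -/
noncomputable def center (V : Matrix (Fin n ⊕ Fin d) (Fin n ⊕ Fin d) ℝ) (Y : Sys n d) : Sys n d :=
  (p.β V)⁻¹ • (invSqrt V * (V * (p.Θs - V⁻¹ * Y)))

lemma candidate_sub {V : Matrix (Fin n ⊕ Fin d) (Fin n ⊕ Fin d) ℝ} (hV : V.PosDef)
    (hβ : p.β V ≠ 0) (Y η : Sys n d) :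
    p.candidate V Y η - p.Θs = p.β V • (invSqrt V * (η - p.center V Y)) := by
  have e : invSqrt V * (invSqrt V * (V * (p.Θs - V⁻¹ * Y))) = p.Θs - V⁻¹ * Y := by
    rw [← Matrix.mul_assoc, invSqrt_mul_invSqrt hV, ← Matrix.mul_assoc,
      nonsing_inv_mul _ (isUnit_det_of_posDef hV), Matrix.one_mul]
  rw [candidate, center, Matrix.mul_sub, Matrix.mul_smul, e, smul_sub, smul_smul,
    mul_inv_cancel₀ hβ, one_smul]
  abel

lemma fsq_center {V : Matrix (Fin n ⊕ Fin d) (Fin n ⊕ Fin d) ℝ} (hV : V.PosDef) (Y : Sys n d) :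
    fsq (p.center V Y) = ((p.β V)⁻¹) ^ 2 * wf V (V⁻¹ * Y - p.Θs) := by
  have e1 : invSqrt V * (invSqrt V * (V * (p.Θs - V⁻¹ * Y))) = p.Θs - V⁻¹ * Y := by
    rw [← Matrix.mul_assoc, invSqrt_mul_invSqrt hV, ← Matrix.mul_assoc,
      nonsing_inv_mul _ (isUnit_det_of_posDef hV), Matrix.one_mul]
  have e2 : wf V (V⁻¹ * Y - p.Θs) = wf V (p.Θs - V⁻¹ * Y) := by
    rw [← neg_sub, ← neg_one_smul ℝ, wf_smul]; norm_num
  rw [e2, ← wf_invSqrt_mul hV, center, Matrix.mul_smul, wf_smul, e1]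

lemma wf_candidate_sub {V : Matrix (Fin n ⊕ Fin d) (Fin n ⊕ Fin d) ℝ} (hV : V.PosDef)
    (hβ : p.β V ≠ 0) (Y η : Sys n d) :
    wf V (p.candidate V Y η - p.Θs) = p.β V ^ 2 * fsq (η - p.center V Y) := by
  rw [p.candidate_sub hV hβ, wf_smul, wf_invSqrt_mul hV]

/-- If one of the first `T` candidates is admissible, then rejection sampling stops before `T`. -/
lemma exists_sample_eq {V : Matrix (Fin n ⊕ Fin d) (Fin n ⊕ Fin d) ℝ} {Y : Sys n d}
    {η : ℕ → Sys n d} {T : ℕ} (h : ∃ j < T, p.candidate V Y (η j) ∈ p.M) :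
    ∃ j < T, p.sample V Y η = p.candidate V Y (η j) ∧ p.sample V Y η ∈ p.M := by
  obtain ⟨j, hj, hM⟩ := h
  have hne : {j | p.candidate V Y (η j) ∈ p.M}.Nonempty := ⟨j, hM⟩
  exact ⟨_, lt_of_le_of_lt (Nat.sInf_le hM) hj, rfl, Nat.sInf_mem hne⟩

/-! #### The typical behaviour of the noise -/

open Classical in
/-- The labels of the noise variables that matter up to time `T`, at most `T` candidates being drawn
in each sampling step. -/
noncomputable def labels (n d T : ℕ) : Finset (NoiseIdx n d) :=
  ((Finset.range (T + 1) ×ˢ Finset.univ).image fun q : ℕ × Fin n => NoiseIdx.w q.1 q.2) ∪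
  ((Finset.range (T + 1) ×ˢ Finset.univ).image fun q : ℕ × Fin d => NoiseIdx.ν q.1 q.2) ∪
  (((Finset.range (T + 1) ×ˢ Finset.range T) ×ˢ Finset.univ).image
    fun q : (ℕ × ℕ) × (Fin n ⊕ Fin d) × Fin n => NoiseIdx.η q.1.1 q.1.2 q.2.1 q.2.2)

open Classical in
lemma w_mem_labels {T t : ℕ} (ht : t ≤ T) (r : Fin n) : NoiseIdx.w t r ∈ labels n d T := by
  simp [labels]; omega

open Classical in
lemma ν_mem_labels {T t : ℕ} (ht : t ≤ T) (r : Fin d) : NoiseIdx.ν t r ∈ labels n d T := by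
  simp [labels]; omega

open Classical in
lemma η_mem_labels {T k j : ℕ} (hk : k ≤ T) (hj : j < T) (r : Fin n ⊕ Fin d) (s : Fin n) :
    NoiseIdx.η k j r s ∈ labels n d T := by
  simp [labels]; omega

open Classical in
lemma card_labels_le (n d T : ℕ) :
    (labels n d T).card ≤ (T + 1) ^ 2 * (n + d + (n + d) * n) := by
  have h1 := Finset.card_image_le (s := (Finset.range (T + 1) ×ˢ (Finset.univ : Finset (Fin n))))
    (f := fun q : ℕ × Fin n => (NoiseIdx.w q.1 q.2 : NoiseIdx n d))
  have h2 := Finset.card_image_le (s := (Finset.range (T + 1) ×ˢ (Finset.univ : Finset (Fin d))))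
    (f := fun q : ℕ × Fin d => (NoiseIdx.ν q.1 q.2 : NoiseIdx n d))
  have h3 := Finset.card_image_le (s := ((Finset.range (T + 1) ×ˢ Finset.range T) ×ˢ
    (Finset.univ : Finset ((Fin n ⊕ Fin d) × Fin n))))
    (f := fun q : (ℕ × ℕ) × (Fin n ⊕ Fin d) × Fin n => NoiseIdx.η q.1.1 q.1.2 q.2.1 q.2.2)
  simp only [Finset.card_product, Finset.card_range, Finset.card_univ, Fintype.card_fin,
    Fintype.card_prod, Fintype.card_sum] at h1 h2 h3
  refine (Finset.card_union_le _ _).trans ((Nat.add_le_add (Finset.card_union_le _ _)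
    le_rfl).trans ((Nat.add_le_add (Nat.add_le_add h1 h2) h3).trans ?_))
  nlinarith [Nat.zero_le ((T + 1) * n), Nat.zero_le ((T + 1) * d), Nat.zero_le T,
    Nat.zero_le ((T + 1) * ((n + d) * n)), Nat.zero_le (T * ((T + 1) * n)),
    Nat.zero_le (T * ((T + 1) * d))]

/-- The event that the relevant noise variables are at most `L` in absolute value. -/
def NoiseLE (n d T : ℕ) (L : ℝ) : Set (NoiseIdx n d → ℝ) := {ω | ∀ a ∈ labels n d T, |ω a| ≤ L}

/-- The event that in each sampling step each point of `N` has one of the first `T` noise matrices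
in its `ε`-neighbourhood. -/
def Hits (n d T : ℕ) (ε : ℝ) (N : Set ((Fin n ⊕ Fin d) → Fin n → ℝ)) : Set (NoiseIdx n d → ℝ) :=
  {ω | ∀ k ≤ T, ∀ c ∈ N, ∃ j < T, ∀ r s, |ω (.η k j r s) - c r s| < ε}

/-- A union bound over the noise variables that matter. -/
lemma law_compl_NoiseLE_le (T : ℕ) {L : ℝ} (hL : 0 ≤ L) {v : ℝ}
    (hvar : ∀ a : NoiseIdx n d, (noiseVar p.κ p.σ a : ℝ) ≤ v)
    (hvar0 : ∀ a : NoiseIdx n d, 0 < (noiseVar p.κ p.σ a : ℝ)) :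
    p.law (NoiseLE n d T L)ᶜ ≤ ENNReal.ofReal
      (((T + 1) ^ 2 * (n + d + (n + d) * n) : ℕ) * (2 * Real.exp (-L ^ 2 / (2 * v)))) := by
  have hsub : (NoiseLE n d T L)ᶜ ⊆ ⋃ a ∈ labels n d T, {ω | L ≤ |ω a|} := by
    intro ω hω
    simp only [NoiseLE, Set.mem_compl_iff, Set.mem_ofPred_eq, not_forall, not_le] at hω
    obtain ⟨a, ha, h⟩ := hω
    exact Set.mem_biUnion (Finset.mem_coe.2 ha) h.le
  have hone : ∀ a : NoiseIdx n d, p.law {ω | L ≤ |ω a|} ≤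
      ENNReal.ofReal (2 * Real.exp (-L ^ 2 / (2 * v))) := by
    intro a
    have hm := measurePreserving_eval_infinitePi
      (fun a : NoiseIdx n d => gaussianReal 0 (noiseVar p.κ p.σ a)) a
    have hs : MeasurableSet {x : ℝ | L ≤ |x|} := measurableSet_le measurable_const (by fun_prop)
    have := hm.measure_preimage hs.nullMeasurableSet
    refine (this.le.trans (gaussianReal_abs_ge_le _ hL)).trans (ENNReal.ofReal_le_ofReal ?_)
    have h0 := hvar0 a
    have h1 := hvar a
    rw [neg_div, neg_div]
    gcongr
  calc p.law (NoiseLE n d T L)ᶜ ≤ ∑ a ∈ labels n d T, p.law {ω | L ≤ |ω a|} :=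
        (measure_mono hsub).trans (measure_biUnion_finset_le _ _)
    _ ≤ (labels n d T).card • ENNReal.ofReal (2 * Real.exp (-L ^ 2 / (2 * v))) :=
        Finset.sum_le_card_nsmul _ _ _ fun a _ => hone a
    _ ≤ _ := by
        rw [nsmul_eq_mul, ENNReal.ofReal_mul (q := 2 * Real.exp (-L ^ 2 / (2 * v))) (by positivity),
          ENNReal.ofReal_natCast]
        gcongr
        exact card_labels_le n d T

/-- The probability that a standard normal matrix is `ε`-close to `c`. -/
noncomputable def hitProb (ε : ℝ) (c : (Fin n ⊕ Fin d) → Fin n → ℝ) : ℝ≥0∞ :=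
  ∏ q : (Fin n ⊕ Fin d) × Fin n, gaussianReal 0 1 (Metric.ball (c q.1 q.2) ε)

lemma hitProb_pos {ε : ℝ} (hε : 0 < ε) (c : (Fin n ⊕ Fin d) → Fin n → ℝ) : 0 < hitProb ε c :=
  CanonicallyOrderedAdd.prod_pos.2 fun _ _ =>
    gaussianReal_pos_of_isOpen one_ne_zero Metric.isOpen_ball ⟨_, Metric.mem_ball_self hε⟩

lemma hitProb_le_one (ε : ℝ) (c : (Fin n ⊕ Fin d) → Fin n → ℝ) : hitProb ε c ≤ 1 :=
  Finset.prod_le_one' fun _ _ => prob_le_one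

lemma law_hit (ε : ℝ) (c : (Fin n ⊕ Fin d) → Fin n → ℝ) (k j : ℕ) :
    p.law {ω | ∀ r s, |ω (.η k j r s) - c r s| < ε} = hitProb ε c := by
  classical
  let f : (Fin n ⊕ Fin d) × Fin n → NoiseIdx n d := fun q => .η k j q.1 q.2
  have hf : Function.Injective f := by
    rintro ⟨r, s⟩ ⟨r', s'⟩ h
    simp only [f, NoiseIdx.η.injEq] at h
    rw [h.2.2.1, h.2.2.2]
  let t : NoiseIdx n d → Set ℝ
    | .η _ _ r s => Metric.ball (c r s) ε
    | _ => Set.univ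
  have e : {ω : NoiseIdx n d → ℝ | ∀ r s, |ω (.η k j r s) - c r s| < ε} =
      Set.pi (Finset.univ.image f) t := by
    ext ω
    simp only [Set.mem_ofPred_eq, Set.mem_pi, Finset.coe_image, Finset.coe_univ, Set.image_univ,
      Set.forall_mem_range, Prod.forall]
    rfl
  rw [e, law, Measure.infinitePi_pi _ (fun i _ => ?_), Finset.prod_image fun a _ b _ h => hf h]
  · rfl
  · cases i
    · exact MeasurableSet.univ
    · exact MeasurableSet.univ
    · exact measurableSet_ball

/-- The candidates of one sampling step are independent. -/
lemma law_no_hit (ε : ℝ) (c : (Fin n ⊕ Fin d) → Fin n → ℝ) (k T : ℕ) :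
    p.law {ω | ∀ j < T, ¬∀ r s, |ω (.η k j r s) - c r s| < ε} = (1 - hitProb ε c) ^ T := by
  have hms : ∀ j, MeasurableSet {ω : NoiseIdx n d → ℝ | ∀ r s, |ω (.η k j r s) - c r s| < ε} := by
    intro j
    simp only [Set.ofPred_forall]
    exact MeasurableSet.iInter fun r => MeasurableSet.iInter fun s =>
      measurableSet_lt (by fun_prop) measurable_const
  induction T with
  | zero => simp
  | succ T ih =>
    have hmT : MeasurableSet {ω : NoiseIdx n d → ℝ |
        ∀ j < T, ¬∀ r s, |ω (.η k j r s) - c r s| < ε} := by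
      simp only [Set.ofPred_forall]
      exact MeasurableSet.iInter fun j => MeasurableSet.iInter fun _ => (hms j).compl
    have e : {ω : NoiseIdx n d → ℝ | ∀ j < T + 1, ¬∀ r s, |ω (.η k j r s) - c r s| < ε} =
        {ω | ∀ j < T, ¬∀ r s, |ω (.η k j r s) - c r s| < ε} ∩
          {ω | ∀ r s, |ω (.η k T r s) - c r s| < ε}ᶜ := by
      ext ω
      simp only [Set.mem_ofPred_eq, Set.mem_inter_iff, Set.mem_compl_iff, Nat.lt_succ_iff_lt_or_eq]
      constructor
      · exact fun h => ⟨fun j hj => h j (Or.inl hj), h T (Or.inr rfl)⟩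
      · rintro ⟨h1, h2⟩ j (hj | rfl)
        · exact h1 j hj
        · exact h2
    let I : Set (NoiseIdx n d) := {a | ∃ j < T, ∃ r s, a = .η k j r s}
    let J : Set (NoiseIdx n d) := {a | ∃ r s, a = .η k T r s}
    have hIJ : Disjoint I J := by
      rw [Set.disjoint_left]
      rintro _ ⟨j, hj, r, s, rfl⟩ ⟨r', s', h⟩
      simp only [NoiseIdx.η.injEq] at h
      omega
    have e1 : (fun ω : NoiseIdx n d → ℝ => ∀ j < T, ¬∀ r s, |ω (.η k j r s) - c r s| < ε) ⁻¹'
      {True} = {ω | ∀ j < T, ¬∀ r s, |ω (.η k j r s) - c r s| < ε} := by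
      ext; simp only [Set.mem_preimage, Set.mem_singleton_iff, eq_iff_iff, iff_true]; rfl
    have e2 : (fun ω : NoiseIdx n d → ℝ => ¬∀ r s, |ω (.η k T r s) - c r s| < ε) ⁻¹'
      {True} = {ω | ∀ r s, |ω (.η k T r s) - c r s| < ε}ᶜ := by
      ext; simp only [Set.mem_preimage, Set.mem_singleton_iff, eq_iff_iff, iff_true]; rfl
    have hind := indepFun_of_dependsOn
      (μ := fun a : NoiseIdx n d => gaussianReal 0 (noiseVar p.κ p.σ a)) hIJ
      (f := fun ω => ∀ j < T, ¬∀ r s, |ω (.η k j r s) - c r s| < ε)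
      (g := fun ω => ¬∀ r s, |ω (.η k T r s) - c r s| < ε)
      (measurable_to_prop (by rw [e1]; exact hmT))
      (measurable_to_prop (by rw [e2]; exact (hms T).compl)) ?_ ?_
    · have := hind.measure_inter_preimage_eq_mul {True} {True} (by simp) (by simp)
      rw [e1, e2] at this
      rw [e]
      refine this.trans ?_
      rw [pow_succ, ← ih, ← p.law_hit ε c k T, ← prob_compl_eq_one_sub (hms T)]
      rfl
    · intro ω ω' h
      refine propext (forall₂_congr fun j hj => not_congr (forall₂_congr fun r s => ?_))
      rw [h _ ⟨j, hj, r, s, rfl⟩]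
    · intro ω ω' h
      refine propext (not_congr (forall₂_congr fun r s => ?_))
      rw [h _ ⟨r, s, rfl⟩]

/-- A union bound over the points of the net and the sampling steps. -/
lemma law_compl_Hits_le (T : ℕ) (ε : ℝ) (N : Finset ((Fin n ⊕ Fin d) → Fin n → ℝ)) :
    p.law (Hits n d T ε N)ᶜ ≤ ∑ c ∈ N, (T + 1) * (1 - hitProb ε c) ^ T := by
  have hsub : (Hits n d T ε N)ᶜ ⊆ ⋃ c ∈ N, ⋃ k ∈ Finset.range (T + 1),
      {ω | ∀ j < T, ¬∀ r s, |ω (.η k j r s) - c r s| < ε} := by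
    intro ω hω
    simp only [Hits, Set.mem_compl_iff, Set.mem_ofPred_eq, not_forall, not_exists, not_and] at hω
    obtain ⟨k, hk, c, hc, h⟩ := hω
    refine Set.mem_biUnion (Finset.mem_coe.2 (Finset.mem_coe.1 hc)) ?_
    refine Set.mem_biUnion (Finset.mem_coe.2 (Finset.mem_range.2 (Nat.lt_succ_of_le hk))) ?_
    intro j hj hall
    obtain ⟨r, s, hrs⟩ := h j hj
    exact hrs (hall r s)
  refine (measure_mono hsub).trans ((measure_biUnion_finset_le _ _).trans ?_)
  refine Finset.sum_le_sum fun c _ => (measure_biUnion_finset_le _ _).trans ?_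
  simp only [p.law_no_hit, Finset.sum_const, Finset.card_range, nsmul_eq_mul]
  push_cast
  exact le_rfl

/-- A finite `ε`-net of the matrices with Frobenius norm at most `ρ`. -/
lemma exists_net (n d : ℕ) {ε : ℝ} (hε : 0 < ε) (ρ : ℝ) :
    ∃ N : Finset ((Fin n ⊕ Fin d) → Fin n → ℝ), ∀ η : Sys n d, fsq η ≤ ρ ^ 2 →
      ∃ c ∈ N, ∀ r s, |η r s - c r s| < ε := by
  obtain ⟨N, -, hN, hcov⟩ := (isCompact_closedBall (0 : (Fin n ⊕ Fin d) → Fin n → ℝ)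
    |ρ|).finite_cover_balls hε
  refine ⟨hN.toFinset, fun η hη => ?_⟩
  let η' : (Fin n ⊕ Fin d) → Fin n → ℝ := fun r s => η r s
  have hmem : η' ∈ Metric.closedBall 0 |ρ| := by
    rw [mem_closedBall_zero_iff, pi_norm_le_iff_of_nonneg (abs_nonneg _)]
    intro r
    rw [pi_norm_le_iff_of_nonneg (abs_nonneg _)]
    intro s
    rw [Real.norm_eq_abs, ← sq_le_sq]
    refine le_trans ?_ hη
    exact (Finset.single_le_sum (f := fun s => η r s ^ 2) (fun _ _ => sq_nonneg _)
      (Finset.mem_univ s)).trans (Finset.single_le_sum (f := fun r => ∑ s, η r s ^ 2)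
      (fun _ _ => Finset.sum_nonneg fun _ _ => sq_nonneg _) (Finset.mem_univ r))
  obtain ⟨c, hc, hηc⟩ := Set.mem_iUnion₂.1 (hcov hmem)
  refine ⟨c, hN.mem_toFinset.2 hc, fun r s => ?_⟩
  have h1 : dist (η r s) (c r s) ≤ dist η' c :=
    (dist_le_pi_dist (η' r) (c r) s).trans (dist_le_pi_dist η' c r)
  rw [← Real.dist_eq]
  exact lt_of_le_of_lt h1 hηc

end Setup

/-! ### The run stays good -/

/-- Epochs have at least three steps: `2 γ⁻¹ log(2 κ √2) ≥ 3 log 2 > 2`. -/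
lemma two_lt_mul_log {κ γ : ℝ} (hκ : 1 ≤ κ) (hγ : 0 < γ) (hγ' : γ ≤ 1) :
    2 < 2 * γ⁻¹ * Real.log (2 * κ * √2) := by
  have h2 : (1 : ℝ) < √2 := Real.lt_sqrt_of_sq_lt (by norm_num)
  have hsq : √2 * √2 = (2 : ℝ) := Real.mul_self_sqrt (by norm_num)
  have h8 : Real.log (2 * √2) = 3 / 2 * Real.log 2 := by
    rw [Real.log_mul (by norm_num) (by positivity), Real.log_sqrt (by norm_num)]
    ring
  have h1 : 1 < Real.log (2 * κ * √2) := by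
    have := Real.log_two_gt_d9
    calc (1 : ℝ) < Real.log (2 * √2) := by rw [h8]; linarith
      _ ≤ Real.log (2 * κ * √2) := Real.log_le_log (by positivity) (by nlinarith)
  have h3 : 1 ≤ γ⁻¹ := (one_le_inv₀ hγ).2 hγ'
  nlinarith

namespace Setup

variable {n d : ℕ}

/-- The standing assumptions, for a setup. -/
structure Valid (p : Setup n d) : Prop where
  one_le_n : 1 ≤ n
  κ : 1 ≤ p.κ
  γ_pos : 0 < p.γ
  γ_le : p.γ ≤ 1
  σ_pos : 0 < p.σ
  δ_pos : 0 < p.δ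
  δ_lt : p.δ < 1
  S_pos : 0 < p.S
  stab : ∀ Θ ∈ p.M, IsStabilizable p.Q p.R p.κ p.γ Θ
  fsq_le : ∀ Θ ∈ p.M, fsq Θ ≤ p.S ^ 2
  mem : p.Θs ∈ p.M
  meas : p.MeasurableSetup

variable {p : Setup n d}

lemma Valid.three_le_τ₀ (hv : p.Valid) : 3 ≤ p.τ₀ := by
  have := two_lt_mul_log hv.κ hv.γ_pos hv.γ_le
  exact Nat.succ_le_of_lt (Nat.lt_ceil.2 (by exact_mod_cast this))

lemma Valid.contraction (hv : p.Valid) : p.κ * (1 - p.γ) ^ p.τ₀ ≤ 1 / 8 := by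
  have hκ := hv.κ
  have hγ := hv.γ_pos
  have hsq : √2 ^ 2 = (2 : ℝ) := Real.sq_sqrt (by norm_num)
  have h1 : 2 * p.γ⁻¹ * Real.log (2 * p.κ * √2) ≤ p.τ₀ := Nat.le_ceil _
  have h2 : (1 - p.γ) ^ p.τ₀ ≤ Real.exp (-p.γ) ^ p.τ₀ :=
    pow_le_pow_left₀ (by linarith [hv.γ_le]) (by linarith [Real.add_one_le_exp (-p.γ)]) _
  have h3 : Real.exp (-p.γ) ^ p.τ₀ ≤ (8 * p.κ ^ 2)⁻¹ := by
    rw [← Real.exp_nat_mul]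
    have e : (8 * p.κ ^ 2)⁻¹ = Real.exp (-(2 * Real.log (2 * p.κ * √2))) := by
      have : 2 * Real.log (2 * p.κ * √2) = Real.log (8 * p.κ ^ 2) := by
        rw [← Real.log_rpow (by positivity)]
        congr 1
        rw [Real.rpow_two]
        nlinarith
      rw [this, Real.exp_neg, Real.exp_log (by positivity)]
    rw [e]
    refine Real.exp_le_exp.2 ?_
    have : 2 * Real.log (2 * p.κ * √2) ≤ p.γ * p.τ₀ := by
      calc 2 * Real.log (2 * p.κ * √2) = p.γ * (2 * p.γ⁻¹ * Real.log (2 * p.κ * √2)) := by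
            field_simp
        _ ≤ _ := by gcongr
    linarith
  calc p.κ * (1 - p.γ) ^ p.τ₀ ≤ p.κ * (8 * p.κ ^ 2)⁻¹ := by gcongr; exact h2.trans h3
    _ = 1 / (8 * p.κ) := by field_simp
    _ ≤ 1 / 8 := by gcongr; linarith

lemma Valid.norm_le (hv : p.Valid) {Θ : Sys n d} (h : Θ ∈ p.M) : ‖Θ‖ ≤ p.S :=
  le_of_sq_le_sq ((norm_sq_le_fsq Θ).trans (hv.fsq_le Θ h)) hv.S_pos.le

lemma Valid.fsq_Θs (hv : p.Valid) : fsq p.Θs ≤ p.S ^ 2 := hv.fsq_le _ hv.mem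

lemma mdl_eq (p : Setup n d) (ω : NoiseIdx n d → ℝ) (k : ℕ) {m : ℕ} (hm : m < p.τ₀) :
    p.mdl ω (k * p.τ₀ + m) = p.mdl ω (k * p.τ₀) := by
  induction m with
  | zero => rfl
  | succ m ih =>
    rw [← add_assoc, mdl_succ_of_not_dvd, ih (by omega)]
    intro h
    rw [add_assoc, Nat.dvd_add_right (Dvd.intro_left k rfl)] at h
    exact absurd (Nat.le_of_dvd (by omega) h) (by omega)

lemma mdl_eq_div_mul (p : Setup n d) (hτ : 0 < p.τ₀) (ω : NoiseIdx n d → ℝ) (t : ℕ) :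
    p.mdl ω t = p.mdl ω (t / p.τ₀ * p.τ₀) := by
  conv_lhs => rw [← Nat.div_add_mod' t p.τ₀]
  exact p.mdl_eq ω _ (Nat.mod_lt t hτ)

lemma trace_inv_V_le (p : Setup n d) (hμ : 0 < p.μ) (ω : NoiseIdx n d → ℝ) (t : ℕ) :
    (p.V ω t)⁻¹.trace ≤ (n + d) / p.μ := by
  have h : ∀ r, (p.V ω t)⁻¹ r r ≤ p.μ⁻¹ := fun r => by
    have := p.qf_inv_V_le hμ ω t (Pi.single r 1)
    rwa [qf_single, nrm_sq, single_dotProduct, Pi.single_eq_same, mul_one, mul_one] at this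
  calc (p.V ω t)⁻¹.trace ≤ ∑ _r : Fin n ⊕ Fin d, p.μ⁻¹ := Finset.sum_le_sum fun r _ => h r
    _ = (n + d) / p.μ := by simp [div_eq_mul_inv]

/-- An upper bound for `β_t²`, `t ≤ T`, while `‖z_s‖ ≤ ζ`. -/
noncomputable def betaSq (p : Setup n d) (ζ : ℝ) (T : ℕ) : ℝ :=
  2 * (p.σ ^ 2 * (2 * n * (p.potential T ζ / 2 + Real.log (1 / p.δ)))) + 2 * (p.μ * p.S ^ 2)

lemma Valid.log_inv_δ_pos (hv : p.Valid) : 0 < Real.log (1 / p.δ) :=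
  Real.log_pos (by rw [lt_div_iff₀ hv.δ_pos]; linarith [hv.δ_lt])

lemma Valid.betaSq_nonneg (hv : p.Valid) (ζ : ℝ) (T : ℕ) : 0 ≤ p.betaSq ζ T := by
  have h1 := p.potential_nonneg hv.one_le_n hv.meas.μ_pos T ζ
  have h2 := hv.log_inv_δ_pos
  have h3 := hv.meas.μ_pos
  unfold betaSq
  positivity

lemma Valid.β_sq_le (hv : p.Valid) {ζ : ℝ} {ω : NoiseIdx n d → ℝ} {t T : ℕ} (htT : t ≤ T)
    (h : ∀ s < t, nrm (p.Z ω s) ≤ ζ) : p.β (p.V ω t) ^ 2 ≤ p.betaSq ζ T :=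
  p.β_sq_le hv.meas.μ_pos hv.δ_pos (p.potential_nonneg hv.one_le_n hv.meas.μ_pos T ζ) ω t
    ((p.log_det_sub_le hv.one_le_n hv.meas.μ_pos ω t h).trans
      (p.potential_mono hv.one_le_n hv.meas.μ_pos htT ζ)) hv.δ_lt.le

lemma Valid.β_pos (hv : p.Valid) (V : Matrix (Fin n ⊕ Fin d) (Fin n ⊕ Fin d) ℝ) : 0 < p.β V :=
  lt_of_lt_of_le (mul_pos (Real.sqrt_pos.2 hv.meas.μ_pos) hv.S_pos) (p.β_ge hv.σ_pos.le V)

lemma Valid.mul_le_β_sq (hv : p.Valid) (V : Matrix (Fin n ⊕ Fin d) (Fin n ⊕ Fin d) ℝ) :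
    p.μ * p.S ^ 2 ≤ p.β V ^ 2 := by
  have h := pow_le_pow_left₀ (mul_nonneg (Real.sqrt_nonneg _) hv.S_pos.le) (p.β_ge hv.σ_pos.le V) 2
  rwa [mul_pow, Real.sq_sqrt hv.meas.μ_pos.le] at h

lemma Valid.wf_estimate_sub_le (hv : p.Valid) {a : ℝ} {ω : NoiseIdx n d → ℝ} {t : ℕ}
    (hc : p.conf ω t ≤ a) :
    wf (p.V ω t) ((p.V ω t)⁻¹ * p.Y ω t - p.Θs) ≤ 2 * a + 2 * p.μ * p.S ^ 2 := by
  have h1 := p.wf_estimate_sub_le hv.meas.μ_pos ω t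
  have h2 := mul_le_mul_of_nonneg_left hv.fsq_Θs (show 0 ≤ 2 * p.μ by linarith [hv.meas.μ_pos])
  linarith

lemma Valid.fsq_center_le (hv : p.Valid) {a ρ : ℝ} {ω : NoiseIdx n d → ℝ} {t : ℕ}
    (hc : p.conf ω t ≤ a) (hρ : 2 * a + 2 * p.μ * p.S ^ 2 ≤ ρ ^ 2 * (p.μ * p.S ^ 2)) :
    fsq (p.center (p.V ω t) (p.Y ω t)) ≤ ρ ^ 2 := by
  rw [p.fsq_center (p.V_posDef ω t hv.meas.μ_pos), inv_pow, inv_mul_le_iff₀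
    (pow_pos (hv.β_pos _) 2)]
  have h1 := hv.wf_estimate_sub_le hc
  have h2 := mul_le_mul_of_nonneg_left (hv.mul_le_β_sq (p.V ω t)) (sq_nonneg ρ)
  linarith

lemma fsq_le_of_abs_le (E : Sys n d) {c : ℝ} (h : ∀ r s, |E r s| ≤ c) :
    fsq E ≤ (n + d) * n * c ^ 2 := by
  have : ∀ r s, E r s ^ 2 ≤ c ^ 2 := fun r s => sq_le_sq' (abs_le.1 (h r s)).1 (abs_le.1 (h r s)).2
  calc fsq E ≤ ∑ _r : Fin n ⊕ Fin d, ∑ _s : Fin n, c ^ 2 :=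
        Finset.sum_le_sum fun r _ => Finset.sum_le_sum fun s _ => this r s
    _ = (n + d) * n * c ^ 2 := by simp [mul_assoc]

lemma fsq_sub_le (E F : Sys n d) : fsq (E - F) ≤ 2 * fsq E + 2 * fsq F := by
  simp only [fsq, Finset.mul_sum, ← Finset.sum_add_distrib]
  refine Finset.sum_le_sum fun r _ => Finset.sum_le_sum fun s _ => ?_
  rw [Matrix.sub_apply]
  nlinarith [sq_nonneg (E r s + F r s)]

/-- The constants that govern a good run: the radius `r` of a ball around the true system in the
model set, the constant `C` of the state bound, the bound `a` on the self-normalized noise, the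
bound `L` on the noise variables, the weighted error `b` of the sampled models, the bound `ζ` on
`z_t`, and the radius `ρ` and the resolution `ε` of a net of noise matrices. -/
structure Constants (p : Setup n d) (r C a L b ζ ρ ε : ℝ) (T : ℕ) : Prop where
  ball : ∀ Θ : Sys n d, fsq (Θ - p.Θs) ≤ r ^ 2 → Θ ∈ p.M
  state : StateBound p.Q p.R p.κ p.γ p.S p.τ₀ C
  L_nonneg : 0 ≤ L
  b_nonneg : 0 ≤ b
  le_ρ : 2 * a + 2 * p.μ * p.S ^ 2 ≤ ρ ^ 2 * (p.μ * p.S ^ 2)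
  le_r : (n + d) / p.μ * (p.betaSq ζ T * ((n + d) * n * (2 * ε) ^ 2)) ≤ r ^ 2
  le_b : 2 * (p.betaSq ζ T * ((n + d) * n * L ^ 2)) + 2 * (2 * a + 2 * p.μ * p.S ^ 2) ≤ b ^ 2
  le_ζ : C * (b + (n + d) * L) ≤ ζ

variable {r C a L b ζ ρ ε : ℝ} {T : ℕ} {N : Set ((Fin n ⊕ Fin d) → Fin n → ℝ)}
  {ω : NoiseIdx n d → ℝ}

/-- Near the noise matrix that yields the true system there is a point of the net, and a candidate
that hits it is admissible. The accepted candidate need not be this one, but its noise matrix is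
bounded as well. -/
lemma Constants.sample_spec (hc : p.Constants r C a L b ζ ρ ε T) (hv : p.Valid)
    (hN : ∀ η : Sys n d, fsq η ≤ ρ ^ 2 → ∃ c ∈ N, ∀ r s, |η r s - c r s| < ε)
    (hL : ω ∈ NoiseLE n d T L) (hH : ω ∈ Hits n d T ε N) {k : ℕ} (hk : k * p.τ₀ ≤ T)
    (hconf : p.conf ω (k * p.τ₀) ≤ a) (hZ : ∀ s < k * p.τ₀, nrm (p.Z ω s) ≤ ζ) :
    p.mdl ω (k * p.τ₀) ∈ p.M ∧ wf (p.V ω (k * p.τ₀)) (p.mdl ω (k * p.τ₀) - p.Θs) ≤ b ^ 2 := by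
  set t := k * p.τ₀ with ht
  have hτ : 0 < p.τ₀ := by linarith [hv.three_le_τ₀]
  have hkT : k ≤ T := (Nat.le_mul_of_pos_right k hτ).trans hk
  have hμ := hv.meas.μ_pos
  have hV := p.V_posDef ω t hμ
  have hβ := hv.β_pos (p.V ω t)
  have hβ2 := hv.β_sq_le hk hZ
  have hcen := hv.fsq_center_le hconf hc.le_ρ
  have hm : p.mdl ω t = p.sample (p.V ω t) (p.Y ω t) (fun j => etaM ω k j) := by
    rw [p.mdl_of_dvd ω t (Dvd.intro_left k rfl), ht, Nat.mul_div_cancel _ hτ]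
  obtain ⟨c, hcN, hcc⟩ := hN _ hcen
  obtain ⟨j, hj, hjc⟩ := hH k hkT c hcN
  -- the candidate that hits the net is so close to the true system that it is accepted
  have hacc : p.candidate (p.V ω t) (p.Y ω t) (etaM ω k j) ∈ p.M := by
    refine hc.ball _ ?_
    refine (fsq_le_trace_inv_mul_wf hV _).trans (le_trans ?_ hc.le_r)
    rw [p.wf_candidate_sub hV hβ.ne']
    have h1 : fsq (etaM ω k j - p.center (p.V ω t) (p.Y ω t)) ≤ (n + d) * n * (2 * ε) ^ 2 := by
      refine fsq_le_of_abs_le _ fun r s => ?_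
      have h2 := hjc r s
      have h3 := hcc r s
      rw [Matrix.sub_apply]
      have e : etaM ω k j r s = ω (.η k j r s) := rfl
      rw [e, abs_le]
      rw [abs_lt] at h2 h3
      constructor <;> linarith
    have h0 := fsq_nonneg (etaM ω k j - p.center (p.V ω t) (p.Y ω t))
    exact mul_le_mul (p.trace_inv_V_le hμ ω t) (mul_le_mul hβ2 h1 h0 (hv.betaSq_nonneg ζ T))
      (mul_nonneg (sq_nonneg _) h0) (by positivity)
  obtain ⟨i, hi, he, hM⟩ := p.exists_sample_eq (η := fun j => etaM ω k j) ⟨j, hj, hacc⟩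
  rw [← hm] at he hM
  refine ⟨hM, ?_⟩
  rw [he, p.wf_candidate_sub hV hβ.ne']
  have h1 : fsq (etaM ω k i) ≤ (n + d) * n * L ^ 2 :=
    fsq_le_of_abs_le _ fun r s => hL _ (η_mem_labels hkT hi r s)
  have h2 : p.β (p.V ω t) ^ 2 * fsq (p.center (p.V ω t) (p.Y ω t)) =
      wf (p.V ω t) ((p.V ω t)⁻¹ * p.Y ω t - p.Θs) := by
    rw [p.fsq_center hV, inv_pow, mul_inv_cancel_left₀ (pow_pos hβ 2).ne']
  have h3 := hv.wf_estimate_sub_le hconf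
  calc p.β (p.V ω t) ^ 2 * fsq (etaM ω k i - p.center (p.V ω t) (p.Y ω t))
      ≤ p.β (p.V ω t) ^ 2 * (2 * fsq (etaM ω k i) + 2 * fsq (p.center (p.V ω t) (p.Y ω t))) :=
        mul_le_mul_of_nonneg_left (fsq_sub_le _ _) (sq_nonneg _)
    _ = 2 * (p.β (p.V ω t) ^ 2 * fsq (etaM ω k i)) +
        2 * (p.β (p.V ω t) ^ 2 * fsq (p.center (p.V ω t) (p.Y ω t))) := by ring
    _ ≤ 2 * (p.betaSq ζ T * ((n + d) * n * L ^ 2)) + 2 * (2 * a + 2 * p.μ * p.S ^ 2) := by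
        rw [h2]
        have := mul_le_mul hβ2 h1 (fsq_nonneg _) (hv.betaSq_nonneg ζ T)
        linarith
    _ ≤ b ^ 2 := hc.le_b

/-- If the noise is typical, then the run is good up to the horizon. -/
lemma Constants.good (hc : p.Constants r C a L b ζ ρ ε T) (hv : p.Valid)
    (hN : ∀ η : Sys n d, fsq η ≤ ρ ^ 2 → ∃ c ∈ N, ∀ r s, |η r s - c r s| < ε)
    (hL : ω ∈ NoiseLE n d T L) (hH : ω ∈ Hits n d T ε N) (hs : p.stoppedConf ζ a ω T ≤ a)
    (t : ℕ) (ht : t ≤ T) : ω ∈ p.Good ζ a t := by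
  have hτ : 0 < p.τ₀ := by linarith [hv.three_le_τ₀]
  have hμ := hv.meas.μ_pos
  induction t using Nat.strong_induction_on with
  | _ t ih =>
    have hg : ∀ s < t, ω ∈ p.Good ζ a s := fun s hs => ih s hs (by omega)
    -- the model at time `s` was sampled at the start of the epoch, from data that are good by
    -- induction
    have hmodel : ∀ s ≤ t, p.mdl ω s ∈ p.M ∧
        wf (p.V ω (s / p.τ₀ * p.τ₀)) (p.mdl ω s - p.Θs) ≤ b ^ 2 := by
      intro s hst
      have hle : s / p.τ₀ * p.τ₀ ≤ s := Nat.div_mul_le_self s p.τ₀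
      rw [p.mdl_eq_div_mul hτ ω s]
      refine hc.sample_spec hv hN hL hH (by omega) ?_ ?_
      · exact p.conf_le_of_stoppedConf_le hs (by omega) fun i hi => hg i (by omega)
      · exact fun i hi => (hg i (by omega) i le_rfl).2.1
    have hnL : 0 ≤ (n + d : ℝ) * L := mul_nonneg (by positivity) hc.L_nonneg
    have hnL' : (n : ℝ) * L ≤ (n + d) * L :=
      mul_le_mul_of_nonneg_right (by simp) hc.L_nonneg
    have hdL' : (d : ℝ) * L ≤ (n + d) * L :=
      mul_le_mul_of_nonneg_right (by simp) hc.L_nonneg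
    have hZ := hc.state p.Θs (p.X ω) (wv ω) (p.U ω) (p.nuv ω) (p.mdl ω) b ((n + d) * L) t
      (hv.norm_le hv.mem) hc.b_nonneg hnL (p.X_zero ω)
      (fun s _ => p.X_succ ω s)
      (fun s hs => by rw [U_eq, gainM, if_pos (hmodel s hs).1])
      (fun s hs => by
        refine (nrm_le_of_abs_le _ (c := L) fun i => hL _ (w_mem_labels (by omega) i)).trans ?_
        simpa using hnL')
      (fun s hs => by
        refine (nrm_le_of_abs_le _ (c := L) fun i => ?_).trans (by simpa using hdL')
        unfold nuv
        split_ifs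
        · exact hL _ (ν_mem_labels (by omega) i)
        · simpa using hc.L_nonneg)
      (fun s hs => ⟨hv.stab _ (hmodel s hs).1, hv.norm_le (hmodel s hs).1⟩)
      (fun s _ => p.mdl_eq_div_mul hτ ω s)
      (fun s hs i hi => by
        have h1 := p.nrm_transpose_mulVec_Z_sq_le hμ ω hi (p.mdl ω s - p.Θs)
        exact le_of_sq_le_sq (h1.trans (hmodel s hs).2) hc.b_nonneg)
    intro s hs'
    refine ⟨(hmodel s hs').1, (hZ s hs').trans hc.le_ζ, ?_⟩
    exact p.conf_le_of_stoppedConf_le hs (by omega) fun i hi => hg i (by omega)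

/-- In a good run the sampled models are close to the true system in the weighted norm. -/
lemma Constants.wf_mdl_sub_le (hc : p.Constants r C a L b ζ ρ ε T) (hv : p.Valid)
    (hN : ∀ η : Sys n d, fsq η ≤ ρ ^ 2 → ∃ c ∈ N, ∀ r s, |η r s - c r s| < ε)
    (hL : ω ∈ NoiseLE n d T L) (hH : ω ∈ Hits n d T ε N) (hs : p.stoppedConf ζ a ω T ≤ a)
    {t : ℕ} (ht : t ≤ T) : wf (p.V ω (t / p.τ₀ * p.τ₀)) (p.mdl ω t - p.Θs) ≤ b ^ 2 := by
  have hτ : 0 < p.τ₀ := by linarith [hv.three_le_τ₀]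
  have hle : t / p.τ₀ * p.τ₀ ≤ t := Nat.div_mul_le_self t p.τ₀
  have hg := hc.good hv hN hL hH hs t ht
  rw [p.mdl_eq_div_mul hτ ω t]
  exact (hc.sample_spec hv hN hL hH (by omega) (hg _ hle).2.2 fun i hi =>
    (hg i (by omega)).2.1).2

end Setup

/-! ### The regret decomposition and its martingale terms -/

namespace Setup

variable {n d : ℕ} {p : Setup n d}

/-- The increment `2 w_tᵀ P (A x_t + B u_t)` of the first martingale. -/
noncomputable def crossTerm (p : Setup n d) (ω : NoiseIdx n d → ℝ) (t : ℕ) : ℝ :=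
  2 * (wv ω t ⬝ᵥ (riccati p.Q p.R p.Θs *ᵥ (p.Θsᵀ *ᵥ p.Z ω t)))

/-- The increment `w_tᵀ P w_t - σ² tr P` of the second martingale. -/
noncomputable def noiseTerm (p : Setup n d) (ω : NoiseIdx n d → ℝ) (t : ℕ) : ℝ :=
  qf (riccati p.Q p.R p.Θs) (wv ω t) - p.σ ^ 2 * (riccati p.Q p.R p.Θs).trace

/-- The regret is at most the sum of two martingales and the cost of the deviations of the inputs
from the optimal ones. -/
lemma regret_le (hv : p.Valid) (hQ : p.Q.PosDef) (hR : p.R.PosDef) {α : ℝ} (hα : 0 < α)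
    (hQα : ∀ x, α * nrm x ^ 2 ≤ qf p.Q x) {ω : NoiseIdx n d → ℝ} {T : ℕ}
    (hM : ∀ t ≤ T, p.mdl ω t ∈ p.M) :
    p.regret ω T ≤ ∑ t ∈ Finset.range (T + 1), p.crossTerm ω t +
      ∑ t ∈ Finset.range (T + 1), p.noiseTerm ω t +
      ∑ t ∈ Finset.range (T + 1), qf (p.R + p.Θs.Bᵀ * riccati p.Q p.R p.Θs * p.Θs.B)
        (p.U ω t - gain p.Q p.R p.Θs *ᵥ p.X ω t) := by
  have hst := hv.stab _ hv.mem
  have hD := hst.isDARESolution hQ hR hv.γ_pos hv.γ_le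
  set P := riccati p.Q p.R p.Θs with hP
  have hJ := optAvgCost_ge hQ hR hα hQα hD p.σ
  -- completion of the square and `J ≥ σ² tr P`; the values `xᵀ P x` telescope
  have hstep : ∀ t ≤ T, stepCost p.Q p.R (p.run ω t).x (p.input ω t (p.run ω t)) -
      optAvgCost p.Q p.R p.σ p.Θs ≤ (qf P (p.X ω t) - qf P (p.X ω (t + 1))) + p.crossTerm ω t +
      p.noiseTerm ω t + qf (p.R + p.Θs.Bᵀ * P * p.Θs.B)
        (p.U ω t - gain p.Q p.R p.Θs *ᵥ p.X ω t) := by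
    intro t ht
    have e1 : p.run ω t = p.runM ω t := p.run_eq_runM ω t fun s hs => hM s (by omega)
    rw [e1, p.input_eq ω t (hM t ht)]
    change stepCost p.Q p.R (p.X ω t) (p.U ω t) - _ ≤ _
    have h1 := stepCost_add_qf (Q := p.Q) hR p.Θs hD.1.posSemidef (p.X ω t) (p.U ω t)
    have e2 : ricStep p.Q p.R p.Θs P = P := hD.2.symm
    rw [e2, hP, greedy_riccati, ← hP, Sys.mulVec_add_mulVec, ← Z_eq] at h1
    have h2 : qf P (p.X ω (t + 1)) = qf P (p.Θsᵀ *ᵥ p.Z ω t) + p.crossTerm ω t +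
        qf P (wv ω t) := by
      rw [X_succ, qf_add (transpose_eq_of_posDef hD.1), crossTerm, ← hP,
        dot_mulVec_comm (transpose_eq_of_posDef hD.1)]
    have h3 : p.noiseTerm ω t = qf P (wv ω t) - p.σ ^ 2 * P.trace := rfl
    linarith
  have htel := Finset.sum_range_sub' (fun t => qf P (p.X ω t)) (T + 1)
  have h0 : qf P (p.X ω 0) = 0 := by rw [X_zero]; simp [qf]
  have hend := qf_nonneg hD.1 (p.X ω (T + 1))
  refine (Finset.sum_le_sum fun t ht => hstep t (Nat.lt_succ_iff.1 (Finset.mem_range.1 ht))).trans ?_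
  rw [Finset.sum_add_distrib, Finset.sum_add_distrib, Finset.sum_add_distrib, htel]
  linarith

/-! #### The first martingale -/

/-- The first martingale, stopped when the run ceases to be good. -/
noncomputable def stoppedCross (p : Setup n d) (ζ a : ℝ) (ω : NoiseIdx n d → ℝ) (T : ℕ) : ℝ :=
  ∑ t ∈ Finset.range T, (p.Good ζ a t).indicator (fun ω => p.crossTerm ω t) ω

lemma measurable_crossTerm (h : p.MeasurableSetup) (t : ℕ) :
    Measurable fun ω => p.crossTerm ω t :=
  (measurable_dot (measurable_wv t) (measurable_matrix_mulVec measurable_const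
    (measurable_matrix_mulVec measurable_const (h.Z t)))).const_mul 2

lemma measurable_stoppedCross (h : p.MeasurableSetup) (ζ a : ℝ) (T : ℕ) :
    Measurable fun ω => p.stoppedCross ζ a ω T :=
  Finset.measurable_sum _ fun t _ => (measurable_crossTerm h t).indicator (h.Good ζ a t)

lemma dependsOn_stoppedCross (p : Setup n d) (ζ a : ℝ) (T : ℕ) :
    DependsOn (fun ω => p.stoppedCross ζ a ω T) (past n d p.τ₀ T T T) := by
  classical
  intro ω ω' h
  refine Finset.sum_congr rfl fun t ht => ?_
  have htT := Finset.mem_range.1 ht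
  have hb : ∀ i ∈ past n d p.τ₀ t (t + 1) (t + 1), ω i = ω' i := fun i hi =>
    h i (past_mono htT.le htT htT hi)
  have h1 := p.dependsOn_Good ζ a t hb
  have h2 := p.dependsOn_Z t hb
  have h3 : wv ω t = wv ω' t := funext fun r => h (.w t r) htT
  simp only at h1 h2
  simp only [Set.indicator, crossTerm, h2, h3]
  exact if_congr (iff_of_eq h1) rfl rfl

/-- The second moment of the first martingale: the sign change of `w_T` leaves the past fixed and
reverses the last increment, so that the increments are orthogonal. -/
lemma lintegral_stoppedCross_sq_le (hv : p.Valid) (ζ a : ℝ) (T : ℕ) :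
    ∫⁻ ω, ENNReal.ofReal (p.stoppedCross ζ a ω T ^ 2) ∂p.law ≤ ENNReal.ofReal
      (T * ((2 * (‖riccati p.Q p.R p.Θs‖ * (p.S * ζ))) ^ 2 * (n * p.σ ^ 2))) := by
  set c := (2 * (‖riccati p.Q p.R p.Θs‖ * (p.S * ζ))) ^ 2 with hc
  have h := hv.meas
  induction T with
  | zero => simp [stoppedCross]
  | succ T ih =>
    have hw : Measurable fun ω : NoiseIdx n d → ℝ => ENNReal.ofReal (nrm (wv ω T) ^ 2) :=
      ((measurable_nrm (measurable_wv T)).pow_const 2).ennreal_ofReal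
    have hm := ((measurable_stoppedCross h ζ a (T + 1)).pow_const 2).ennreal_ofReal
    have hmT := ((measurable_stoppedCross h ζ a T).pow_const 2).ennreal_ofReal
    have hstep : ∫⁻ ω, ENNReal.ofReal (p.stoppedCross ζ a ω (T + 1) ^ 2) ∂p.law ≤
        ∫⁻ ω, (ENNReal.ofReal (p.stoppedCross ζ a ω T ^ 2) +
          ENNReal.ofReal c * ENNReal.ofReal (nrm (wv ω T) ^ 2)) ∂p.law := by
      refine two_mul_lintegral_le_of_measurePreserving
        (p.measurePreserving_flip (noiseAt n d T)) hm fun ω => ?_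
      have e1 : (flipOn (noiseAt n d T) ω ∈ p.Good ζ a T) = (ω ∈ p.Good ζ a T) :=
        comp_flipOn_of_dependsOn (p.dependsOn_Good ζ a T) disjoint_past_noiseAt ω
      have e2 : p.stoppedCross ζ a (flipOn (noiseAt n d T) ω) T = p.stoppedCross ζ a ω T :=
        comp_flipOn_of_dependsOn (p.dependsOn_stoppedCross ζ a T) disjoint_past_noiseAt ω
      have e3 : p.Z (flipOn (noiseAt n d T) ω) T = p.Z ω T :=
        comp_flipOn_of_dependsOn (p.dependsOn_Z T) disjoint_past_noiseAt ω
      have e4 : p.crossTerm (flipOn (noiseAt n d T) ω) T = -p.crossTerm ω T := by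
        rw [crossTerm, wv_flip, e3, neg_dotProduct, crossTerm]
        ring
      set D := (p.Good ζ a T).indicator (fun ω => p.crossTerm ω T) ω with hD
      have e5 : (p.Good ζ a T).indicator (fun ω => p.crossTerm ω T)
          (flipOn (noiseAt n d T) ω) = -D := by
        by_cases hω : ω ∈ p.Good ζ a T
        · rw [hD, Set.indicator_of_mem hω, Set.indicator_of_mem (e1.symm ▸ hω), e4]
        · rw [hD, Set.indicator_of_notMem hω, Set.indicator_of_notMem (e1.symm ▸ hω), neg_zero]
      have hDle : D ^ 2 ≤ c * nrm (wv ω T) ^ 2 := by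
        by_cases hω : ω ∈ p.Good ζ a T
        · have h1 : |wv ω T ⬝ᵥ (riccati p.Q p.R p.Θs *ᵥ (p.Θsᵀ *ᵥ p.Z ω T))| ≤
              nrm (wv ω T) * (‖riccati p.Q p.R p.Θs‖ * (p.S * ζ)) := by
            refine (abs_dot_le _ _).trans (mul_le_mul_of_nonneg_left ?_ (nrm_nonneg _))
            refine (nrm_mulVec_le _ _).trans (mul_le_mul_of_nonneg_left ?_ (norm_nonneg _))
            refine (nrm_mulVec_le _ _).trans (mul_le_mul ?_ (hω T le_rfl).2.1 (nrm_nonneg _)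
              hv.S_pos.le)
            rw [norm_transpose_eq]
            exact hv.norm_le hv.mem
          rw [hD, Set.indicator_of_mem hω, hc, ← mul_pow, sq_le_sq]
          refine le_trans ?_ (le_abs_self _)
          rw [crossTerm, abs_mul, abs_two]
          linarith
        · rw [hD, Set.indicator_of_notMem hω]
          have : 0 ≤ c * nrm (wv ω T) ^ 2 := mul_nonneg (sq_nonneg _) (sq_nonneg _)
          simpa using this
      have e6 : p.stoppedCross ζ a ω (T + 1) = p.stoppedCross ζ a ω T + D :=
        Finset.sum_range_succ _ _
      have e7 : p.stoppedCross ζ a (flipOn (noiseAt n d T) ω) (T + 1) =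
          p.stoppedCross ζ a ω T - D := by
        rw [stoppedCross, Finset.sum_range_succ, e5, ← sub_eq_add_neg]
        congr 1
      have hc0 : 0 ≤ c := sq_nonneg _
      rw [e6, e7, ← ENNReal.ofReal_mul hc0, ← ENNReal.ofReal_add (sq_nonneg _)
        (mul_nonneg hc0 (sq_nonneg _)), ← ENNReal.ofReal_add (sq_nonneg _) (sq_nonneg _),
        show (2 : ℝ≥0∞) = ENNReal.ofReal 2 by simp, ← ENNReal.ofReal_mul zero_le_two]
      refine ENNReal.ofReal_le_ofReal ?_
      linarith [sq_nonneg D]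
    refine hstep.trans ?_
    rw [lintegral_add_left hmT, lintegral_const_mul _ hw, lintegral_nrm_wv_sq,
      ← ENNReal.ofReal_mul (sq_nonneg _)]
    refine (add_le_add ih le_rfl).trans ?_
    rw [← ENNReal.ofReal_add (by positivity) (by positivity)]
    refine ENNReal.ofReal_le_ofReal (le_of_eq ?_)
    push_cast
    ring

/-- Chebyshev's inequality for the first martingale. -/
lemma law_stoppedCross_ge_le (hv : p.Valid) (ζ a : ℝ) (T : ℕ) {x : ℝ}
    (hx : 0 < x) : p.law {ω | x ≤ p.stoppedCross ζ a ω T} ≤ ENNReal.ofReal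
      (T * ((2 * (‖riccati p.Q p.R p.Θs‖ * (p.S * ζ))) ^ 2 * (n * p.σ ^ 2)) / x ^ 2) := by
  have h1 := meas_ge_le_lintegral_div (μ := p.law)
    ((measurable_stoppedCross hv.meas ζ a T).pow_const 2).ennreal_ofReal.aemeasurable
    (ε := ENNReal.ofReal (x ^ 2)) (by simpa using hx.ne') ENNReal.ofReal_ne_top
  rw [ENNReal.ofReal_div_of_pos (by positivity)]
  refine le_trans (measure_mono fun ω hω => ?_)
    (h1.trans (by gcongr; exact lintegral_stoppedCross_sq_le hv ζ a T))
  exact ENNReal.ofReal_le_ofReal (pow_le_pow_left₀ hx.le hω 2)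

/-! #### The second martingale -/

lemma integrable_w_pow (p : Setup n d) (t : ℕ) (r : Fin n) (k : ℕ) :
    Integrable (fun ω : NoiseIdx n d → ℝ => ω (.w t r) ^ k) p.law ∧
      ∫ ω, ω (.w t r) ^ k ∂p.law = ∫ x, x ^ k ∂(gaussianReal 0 (Real.toNNReal (p.σ ^ 2))) := by
  have hm := measurePreserving_eval_infinitePi
    (fun a : NoiseIdx n d => gaussianReal 0 (noiseVar p.κ p.σ a)) (.w t r)
  have hi : Integrable (fun x : ℝ => x ^ k) (gaussianReal 0 (Real.toNNReal (p.σ ^ 2))) := by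
    have h := (memLp_id_gaussianReal (μ := 0) (v := Real.toNNReal (p.σ ^ 2)) k).integrable_norm_pow'
    refine (integrable_norm_iff (by fun_prop)).1 ?_
    simpa [norm_pow] using h
  refine ⟨hm.integrable_comp_of_integrable hi, ?_⟩
  have h1 : ∫ x, x ^ k ∂(p.law.map fun ω => ω (.w t r)) = ∫ ω, ω (.w t r) ^ k ∂p.law :=
    integral_map hm.measurable.aemeasurable (by fun_prop)
  rw [← h1]
  exact congrArg (fun ν : Measure ℝ => ∫ x, x ^ k ∂ν) hm.map_eq

/-- The fourth moment of `N(0, σ²)`. -/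
noncomputable def fourthMoment (σ : ℝ) : ℝ :=
  ∫ x, x ^ 4 ∂(gaussianReal 0 (Real.toNNReal (σ ^ 2)))

lemma integral_qf_wv (p : Setup n d) (P : Matrix (Fin n) (Fin n) ℝ) (t : ℕ) :
    Integrable (fun ω => qf P (wv ω t)) p.law ∧
      ∫ ω, qf P (wv ω t) ∂p.law = p.σ ^ 2 * P.trace := by
  have hL : ∀ i, MemLp (fun ω : NoiseIdx n d → ℝ => ω (.w t i)) 2 p.law := fun i =>
    (memLp_two_iff_integrable_sq (measurable_pi_apply (NoiseIdx.w t i)).aestronglyMeasurable).2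
      (p.integrable_w_pow t i 2).1
  refine integral_qf_of_cov (fun i j => (hL i).integrable_mul (hL j)) (fun i j => ?_) P
  by_cases hij : i = j
  · subst hij
    have h := (p.integrable_w_pow t i 2).2
    rw [integral_sq_gaussianReal, Real.coe_toNNReal _ (sq_nonneg _)] at h
    simp only [if_true, ← pow_two]
    exact h
  · rw [if_neg hij]
    refine integral_eq_zero_of_measurePreserving (p.measurePreserving_flip {.w t i})
      (by fun_prop) fun ω => ?_
    have h1 : flipOn {NoiseIdx.w t i} ω (.w t i) = -ω (.w t i) := flipOn_of_mem rfl ω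
    have h2 : flipOn {NoiseIdx.w t i} ω (.w t j) = ω (.w t j) := flipOn_of_notMem (by
      simpa using Ne.symm hij) ω
    simp only [h1, h2, neg_mul]

lemma memLp_qf_wv (p : Setup n d) (P : Matrix (Fin n) (Fin n) ℝ) (t : ℕ) :
    MemLp (fun ω => qf P (wv ω t)) 2 p.law ∧
      ∫ ω, qf P (wv ω t) ^ 2 ∂p.law ≤ ‖P‖ ^ 2 * (n * (n * fourthMoment p.σ)) := by
  have hle : ∀ ω : NoiseIdx n d → ℝ, qf P (wv ω t) ^ 2 ≤
      ‖P‖ ^ 2 * (n * ∑ r, ω (.w t r) ^ 4) := by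
    intro ω
    have h1 : qf P (wv ω t) ^ 2 ≤ (‖P‖ * nrm (wv ω t) ^ 2) ^ 2 := by
      rw [sq_le_sq]
      exact (abs_qf_le _ _).trans (le_abs_self _)
    have h2 : nrm (wv ω t) ^ 2 = ∑ r, ω (.w t r) ^ 2 := by
      rw [nrm_sq, dotProduct]
      simp only [wv, pow_two]
    have h3 := sq_sum_le_card_mul_sum_sq (s := (Finset.univ : Finset (Fin n)))
      (f := fun r => ω (.w t r) ^ 2)
    simp only [← pow_mul, Finset.card_univ, Fintype.card_fin] at h3
    rw [mul_pow, h2] at h1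
    exact h1.trans (mul_le_mul_of_nonneg_left h3 (sq_nonneg _))
  have hi : Integrable (fun ω : NoiseIdx n d → ℝ => ‖P‖ ^ 2 * (n * ∑ r, ω (.w t r) ^ 4)) p.law :=
    ((integrable_finsetSum _ fun r _ => (p.integrable_w_pow t r 4).1).const_mul _).const_mul _
  have hm : Measurable fun ω : NoiseIdx n d → ℝ => qf P (wv ω t) :=
    measurable_qf P (measurable_wv t)
  have hsq : Integrable (fun ω : NoiseIdx n d → ℝ => qf P (wv ω t) ^ 2) p.law := by
    refine hi.mono' (hm.pow_const 2).aestronglyMeasurable (ae_of_all _ fun ω => ?_)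
    rw [Real.norm_of_nonneg (sq_nonneg _)]
    exact hle ω
  refine ⟨(memLp_two_iff_integrable_sq hm.aestronglyMeasurable).2 hsq,
    (integral_mono hsq hi hle).trans (le_of_eq ?_)⟩
  rw [integral_const_mul, integral_const_mul,
    integral_finsetSum _ fun r _ => (p.integrable_w_pow t r 4).1]
  simp only [(p.integrable_w_pow t _ 4).2, Finset.sum_const, Finset.card_univ, Fintype.card_fin,
    nsmul_eq_mul]
  rfl

/-- Chebyshev's inequality for the second martingale, a sum of independent variables. -/
lemma law_sum_noiseTerm_ge_le (p : Setup n d) (T : ℕ) {x : ℝ} (hx : 0 < x) :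
    p.law {ω | x ≤ ∑ t ∈ Finset.range T, p.noiseTerm ω t} ≤ ENNReal.ofReal
      (T * (‖riccati p.Q p.R p.Θs‖ ^ 2 * (n * (n * fourthMoment p.σ))) / x ^ 2) := by
  set P := riccati p.Q p.R p.Θs with hP
  have hmem : ∀ t, MemLp (fun ω => qf P (wv ω t)) 2 p.law := fun t => (p.memLp_qf_wv P t).1
  have hsum : MemLp (∑ t ∈ Finset.range T, fun ω => qf P (wv ω t)) 2 p.law :=
    memLp_finsetSum' _ fun t _ => hmem t
  have hind : Set.Pairwise (Finset.range T : Set ℕ) fun s t =>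
      IndepFun (fun ω : NoiseIdx n d → ℝ => qf P (wv ω s)) (fun ω => qf P (wv ω t)) p.law := by
    intro s _ t _ hst
    have hd : Disjoint (noiseAt n d s) (noiseAt n d t) := by
      rw [Set.disjoint_left]
      rintro _ ⟨r, rfl⟩ ⟨r', h⟩
      simp only [NoiseIdx.w.injEq] at h
      exact hst h.1.symm
    refine indepFun_of_dependsOn hd (measurable_qf P (measurable_wv s))
      (measurable_qf P (measurable_wv t)) ?_ ?_
    · intro ω ω' h
      have := dependsOn_wv s h
      simp only at this ⊢
      rw [this]
    · intro ω ω' h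
      have := dependsOn_wv t h
      simp only at this ⊢
      rw [this]
  have hvar : variance (∑ t ∈ Finset.range T, fun ω => qf P (wv ω t)) p.law ≤
      T * (‖P‖ ^ 2 * (n * (n * fourthMoment p.σ))) := by
    rw [IndepFun.variance_sum (fun t _ => hmem t) hind]
    calc ∑ t ∈ Finset.range T, variance (fun ω => qf P (wv ω t)) p.law
        ≤ ∑ _t ∈ Finset.range T, ‖P‖ ^ 2 * (n * (n * fourthMoment p.σ)) := by
          refine Finset.sum_le_sum fun t _ => ?_
          exact (variance_le_expectation_sq (hmem t).1).trans (p.memLp_qf_wv P t).2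
      _ = _ := by simp
  have hmean : ∫ ω, (∑ t ∈ Finset.range T, fun ω => qf P (wv ω t)) ω ∂p.law =
      T * (p.σ ^ 2 * P.trace) := by
    simp only [Finset.sum_apply]
    rw [integral_finsetSum _ fun t _ => (p.integral_qf_wv P t).1]
    simp [(p.integral_qf_wv P _).2]
  have hcheb := meas_ge_le_variance_div_sq hsum hx
  refine le_trans (measure_mono fun ω hω => ?_)
    (hcheb.trans (ENNReal.ofReal_le_ofReal (by gcongr)))
  have hω' : x ≤ ∑ t ∈ Finset.range T, (qf P (wv ω t) - p.σ ^ 2 * P.trace) := hω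
  rw [Finset.sum_sub_distrib] at hω'
  rw [Set.mem_ofPred_eq, hmean, Finset.sum_apply]
  refine le_trans ?_ (le_abs_self _)
  simpa using hω'

end Setup

/-! ### Exploration -/

/-- Anti-concentration by reflection: if changing the signs of the coordinates in `A` moves `F` so
much that `y ≤ F + F ∘ flip` on an event `E` independent of the weight `H` and of `y`, then the
`H`-weighted mean of `min 1 F` is at least a fixed fraction of that of `min 1 y`. -/
lemma mul_lintegral_le_of_flip {ι : Type*} {v : ι → ℝ≥0} {I J A : Set ι} (hIJ : Disjoint I J)
    (hIA : Disjoint I A) {H : (ι → ℝ) → ℝ≥0∞} (hH : Measurable H) (hHI : DependsOn H I)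
    {E : Set (ι → ℝ)} (hE : MeasurableSet E) (hEJ : DependsOn (fun ω => ω ∈ E) J)
    {F y : (ι → ℝ) → ℝ} (hF : Measurable F) (hy : Measurable y)
    (hyI : DependsOn y I) (hF0 : ∀ ω, 0 ≤ F ω)
    (h : ∀ ω ∈ E, H ω ≠ 0 → y ω ≤ F ω + F (flipOn A ω)) :
    (Measure.infinitePi fun i => gaussianReal 0 (v i)) E *
      ∫⁻ ω, H ω * ENNReal.ofReal (min 1 (y ω)) ∂(Measure.infinitePi fun i => gaussianReal 0 (v i)) ≤
      2 * ∫⁻ ω, H ω * ENNReal.ofReal (min 1 (F ω))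
        ∂(Measure.infinitePi fun i => gaussianReal 0 (v i)) := by
  classical
  have hm : ∀ {f : (ι → ℝ) → ℝ}, Measurable f →
      Measurable fun ω => H ω * ENNReal.ofReal (min 1 (f ω)) := fun hf =>
    hH.mul (measurable_const.min hf).ennreal_ofReal
  rw [mul_comm, ← lintegral_indicator_one hE, ← lintegral_mul_of_dependsOn hIJ (hm hy)
    (measurable_one.indicator hE)]
  · refine lintegral_le_two_mul_of_measurePreserving (measurePreserving_flipOn A) (hm hF)
      fun ω => ?_
    have eH : H (flipOn A ω) = H ω := comp_flipOn_of_dependsOn hHI hIA ω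
    by_cases hω : ω ∈ E
    · rw [Set.indicator_of_mem hω, Pi.one_apply, mul_one, eH]
      by_cases hH0 : H ω = 0
      · simp [hH0]
      rw [← mul_add, ← ENNReal.ofReal_add (le_min zero_le_one (hF0 _))
        (le_min zero_le_one (hF0 _))]
      refine mul_le_mul_right (α := ℝ≥0∞) (ENNReal.ofReal_le_ofReal ?_) _
      have h1 := h ω hω hH0
      have h2 := hF0 ω
      have h3 := hF0 (flipOn A ω)
      rcases le_total 1 (F ω) with h4 | h4
      · rw [min_eq_left h4]
        linarith [min_le_left 1 (y ω), le_min zero_le_one h3]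
      · rw [min_eq_right h4]
        rcases le_total 1 (F (flipOn A ω)) with h5 | h5
        · rw [min_eq_left h5]
          linarith [min_le_left 1 (y ω)]
        · rw [min_eq_right h5]
          exact (min_le_right _ _).trans h1
    · rw [Set.indicator_of_notMem hω, mul_zero]
      exact zero_le
  · intro ω ω' hω
    simp only [hHI hω, hyI hω]
  · intro ω ω' hω
    have := hEJ hω
    simp only at this
    simp only [Set.indicator, Pi.one_apply]
    exact if_congr (iff_of_eq this) rfl rfl

namespace Setup

variable {n d : ℕ} {p : Setup n d}

/-- The direction in which `z_{t+1}` is moved by the `q`-th coordinate of `(w_t, ν_{t+1})`, when the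
gain is `K`. -/
def noiseDir (K : Matrix (Fin d) (Fin n) ℝ) : Fin n ⊕ Fin d → Fin n ⊕ Fin d → ℝ
  | .inl i => Sum.elim (Pi.single i 1) (K *ᵥ Pi.single i 1)
  | .inr j => Sum.elim 0 (Pi.single j 1)

lemma wv_flip_single (ω : NoiseIdx n d → ℝ) (t : ℕ) (i : Fin n) :
    wv (flipOn {.w t i} ω) t = wv ω t - (2 * ω (.w t i)) • Pi.single i 1 := by
  funext r
  by_cases h : r = i
  · subst h
    have : flipOn {NoiseIdx.w t r} ω (.w t r) = -ω (.w t r) := flipOn_of_mem rfl ω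
    simp [wv, this]
    ring
  · have : flipOn {NoiseIdx.w t i} ω (.w t r) = ω (.w t r) :=
      flipOn_of_notMem (by simpa using h) ω
    simp [wv, this, h]

lemma disjoint_past_w {τ t b c : ℕ} (i : Fin n) :
    Disjoint (past n d τ t b c) {NoiseIdx.w t i} :=
  Set.disjoint_singleton_right.2 fun h => lt_irrefl t h

lemma disjoint_past_ν {τ a t c : ℕ} (j : Fin d) :
    Disjoint (past n d τ a t c) {NoiseIdx.ν t j} :=
  Set.disjoint_singleton_right.2 fun h => lt_irrefl t h

lemma nuv_flip_w (ω : NoiseIdx n d → ℝ) (s t : ℕ) (i : Fin n) :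
    p.nuv (flipOn {.w t i} ω) s = p.nuv ω s := by
  unfold nuv
  split_ifs
  · funext r
    exact flipOn_of_notMem (by simp) ω
  · rfl

/-- The sign of one coordinate of `w_t` moves `z_{t+1}` along a known direction, as the model does
not change between `t` and `t + 1`. -/
lemma Z_flip_w (ω : NoiseIdx n d → ℝ) {t : ℕ} (ht : ¬p.τ₀ ∣ t + 1) (i : Fin n) :
    p.Z (flipOn {.w t i} ω) (t + 1) = p.Z ω (t + 1) -
      (2 * ω (.w t i)) • noiseDir (p.gainM (p.mdl ω t)) (.inl i) := by
  have e1 : p.mdl (flipOn {.w t i} ω) t = p.mdl ω t :=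
    comp_flipOn_of_dependsOn (p.dependsOn_mdl t) (disjoint_past_w i) ω
  have e2 : p.Z (flipOn {.w t i} ω) t = p.Z ω t :=
    comp_flipOn_of_dependsOn (p.dependsOn_Z t) (disjoint_past_w i) ω
  have e3 : p.X (flipOn {.w t i} ω) (t + 1) =
      p.X ω (t + 1) - (2 * ω (.w t i)) • Pi.single i 1 := by
    rw [X_succ, X_succ, e2, wv_flip_single, add_sub_assoc]
  rw [Z_eq, Z_eq, U_eq, U_eq, mdl_succ_of_not_dvd _ _ _ ht, mdl_succ_of_not_dvd _ _ _ ht, e1, e3,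
    nuv_flip_w, mulVec_sub, mulVec_smul]
  funext r
  rcases r with r | r
  · simp [noiseDir]
  · simp [noiseDir]; ring

/-- The sign of one coordinate of `ν_{t+1}` moves `z_{t+1}` along a known direction. -/
lemma Z_flip_ν (ω : NoiseIdx n d → ℝ) {t : ℕ} (ht : ¬p.τ₀ ∣ t + 1) (hT : ((t + 1 : ℕ) : ℝ) ≤ p.Tw)
    (j : Fin d) :
    p.Z (flipOn {.ν (t + 1) j} ω) (t + 1) = p.Z ω (t + 1) -
      (2 * ω (.ν (t + 1) j)) • noiseDir (p.gainM (p.mdl ω t)) (.inr j) := by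
  have e1 : p.mdl (flipOn {.ν (t + 1) j} ω) t = p.mdl ω t :=
    comp_flipOn_of_dependsOn (p.dependsOn_mdl t) (disjoint_past_ν j) ω
  have e2 : p.X (flipOn {.ν (t + 1) j} ω) (t + 1) = p.X ω (t + 1) :=
    comp_flipOn_of_dependsOn (p.dependsOn_X (t + 1)) (disjoint_past_ν j) ω
  have e3 : p.nuv (flipOn {.ν (t + 1) j} ω) (t + 1) = p.nuv ω (t + 1) -
      (2 * ω (.ν (t + 1) j)) • Pi.single j 1 := by
    simp only [nuv, if_pos hT]
    funext r
    by_cases h : r = j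
    · subst h
      have : flipOn {NoiseIdx.ν (t + 1) r} ω (.ν (t + 1) r) = -ω (.ν (t + 1) r) :=
        flipOn_of_mem rfl ω
      simp [this]
      ring
    · have : flipOn {NoiseIdx.ν (t + 1) j} ω (.ν (t + 1) r) = ω (.ν (t + 1) r) :=
        flipOn_of_notMem (by simpa using h) ω
      simp [this, h]
  rw [Z_eq, Z_eq, U_eq, U_eq, mdl_succ_of_not_dvd _ _ _ ht, mdl_succ_of_not_dvd _ _ _ ht, e1, e2, e3]
  funext r
  rcases r with r | r
  · simp [noiseDir]
  · change _ = _ - (2 * ω (.ν (t + 1) j)) * Pi.single (M := fun _ => ℝ) j 1 r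
    simp only [Sum.elim_inr, Pi.add_apply, Pi.sub_apply, Pi.smul_apply, smul_eq_mul]
    ring

lemma Valid.norm_gainM_le (hv : p.Valid) (Θ : Sys n d) : ‖p.gainM Θ‖ ≤ p.κ := by
  rw [gainM]
  split_ifs with h
  · exact (hv.stab Θ h).1
  · rw [norm_zero]; linarith [hv.κ]

/-- The relative decrease of `tr V⁻¹` that the observation `z_t` brings, up to constants. -/
noncomputable def infoGain (p : Setup n d) (ω : NoiseIdx n d → ℝ) (t : ℕ) : ℝ :=
  nrm ((p.V ω t)⁻¹ *ᵥ p.Z ω t) ^ 2 / (p.V ω t)⁻¹.trace ^ 2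

lemma infoGain_nonneg (ω : NoiseIdx n d → ℝ) (t : ℕ) : 0 ≤ p.infoGain ω t :=
  div_nonneg (sq_nonneg _) (sq_nonneg _)

lemma measurable_infoGain (h : p.MeasurableSetup) (t : ℕ) : Measurable fun ω => p.infoGain ω t :=
  ((measurable_nrm (measurable_matrix_mulVec (measurable_matrix_inv (h.V t)) (h.Z t))).pow_const
    2).div ((measurable_matrix_trace (measurable_matrix_inv (h.V t))).pow_const 2)

lemma dependsOn_infoGain (p : Setup n d) (t : ℕ) :
    DependsOn (fun ω => p.infoGain ω t) (past n d p.τ₀ t (t + 1) (t + 1)) := by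
  intro ω ω' h
  have h1 := p.dependsOn_Z t h
  have h2 := p.dependsOn_V t fun i hi => h i (past_mono le_rfl t.le_succ t.le_succ hi)
  simp only at h1 h2
  simp only [infoGain, h1, h2]

/-- Some noise direction is not much shortened by `G`, relative to the trace of `G`. -/
lemma trace_le_sum_noiseDir (G : Matrix (Fin n ⊕ Fin d) (Fin n ⊕ Fin d) ℝ)
    {K : Matrix (Fin d) (Fin n) ℝ} {κ : ℝ} (hK : ‖K‖ ≤ κ) :
    G.trace ≤ (1 + n * κ) * ∑ q, nrm (G *ᵥ noiseDir K q) := by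
  have hκ : 0 ≤ κ := (norm_nonneg _).trans hK
  have hdiag : G.trace ≤ ∑ q, nrm (G *ᵥ Pi.single q 1) := by
    refine Finset.sum_le_sum fun q _ => ?_
    have := (le_abs_self _).trans (abs_apply_le (G *ᵥ Pi.single q 1) q)
    simpa using this
  have hinr : ∀ j : Fin d, noiseDir K (.inr j) = Pi.single (.inr j) 1 := fun j => by
    funext r
    rcases r with r | r <;> simp [noiseDir, Pi.single_apply]
  set A := ∑ j : Fin d, nrm (G *ᵥ noiseDir K (.inr j)) with hA
  have hinl : ∀ i : Fin n, nrm (G *ᵥ Pi.single (.inl i) 1) ≤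
      nrm (G *ᵥ noiseDir K (.inl i)) + κ * A := fun i => by
    have e : (Pi.single (.inl i) 1 : Fin n ⊕ Fin d → ℝ) =
        noiseDir K (.inl i) - ∑ j : Fin d, K j i • noiseDir K (.inr j) := by
      funext r
      rcases r with r | r
      · simp [noiseDir, Finset.sum_apply, Pi.single_apply]
      · simp [noiseDir, Finset.sum_apply, Pi.single_apply]
    rw [e, mulVec_sub, mulVec_sum]
    refine (nrm_sub_le _ _).trans (add_le_add le_rfl ((nrm_sum_le _ _).trans ?_))
    rw [hA, Finset.mul_sum]
    refine Finset.sum_le_sum fun j _ => ?_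
    rw [mulVec_smul, nrm_smul]
    refine mul_le_mul_of_nonneg_right ?_ (nrm_nonneg _)
    have h1 := abs_apply_le (K *ᵥ Pi.single i 1) j
    have h2 := nrm_mulVec_le K (Pi.single i 1)
    have h3 : nrm (Pi.single i (1 : ℝ) : Fin n → ℝ) = 1 := by simp [nrm]
    rw [h3, mul_one] at h2
    simp only [mulVec_single_one] at h1
    simp only [mulVec_single_one] at h2
    exact h1.trans (h2.trans hK)
  rw [Fintype.sum_sum_type] at hdiag ⊢
  simp only [← hinr] at hdiag
  rw [← hA] at hdiag ⊢
  have h1 := Finset.sum_le_sum fun i (_ : i ∈ Finset.univ) => hinl i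
  rw [Finset.sum_add_distrib, Finset.sum_const, Finset.card_univ, Fintype.card_fin,
    nsmul_eq_mul] at h1
  have h2 : 0 ≤ ∑ i : Fin n, nrm (G *ᵥ noiseDir K (.inl i)) :=
    Finset.sum_nonneg fun _ _ => nrm_nonneg _
  have h3 : 0 ≤ (n : ℝ) * κ * ∑ i : Fin n, nrm (G *ᵥ noiseDir K (.inl i)) := by positivity
  linarith

/-- The probability that a Gaussian variable is at least `1` in absolute value. -/
noncomputable def tailProb (v : ℝ≥0) : ℝ≥0∞ := gaussianReal 0 v {x | 1 ≤ |x|}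

lemma tailProb_pos {v : ℝ≥0} (hv : v ≠ 0) : 0 < tailProb v := by
  refine lt_of_lt_of_le (gaussianReal_pos_of_isOpen hv (isOpen_Ioi (a := 1)) ⟨2, by norm_num⟩)
    (measure_mono fun x hx => ?_)
  exact (le_of_lt hx).trans (le_abs_self x)

lemma law_one_le_abs (p : Setup n d) (a : NoiseIdx n d) :
    p.law {ω | 1 ≤ |ω a|} = tailProb (noiseVar p.κ p.σ a) := by
  have hm := measurePreserving_eval_infinitePi
    (fun a : NoiseIdx n d => gaussianReal 0 (noiseVar p.κ p.σ a)) a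
  have hs : MeasurableSet {x : ℝ | 1 ≤ |x|} := measurableSet_le measurable_const (by fun_prop)
  exact hm.measure_preimage hs.nullMeasurableSet

/-- Half the sum of the squares of two vectors with a given difference. -/
lemma sq_mul_le_of_sub_eq {ι : Type*} [Fintype ι] [DecidableEq ι] {x y v : ι → ℝ} {c : ℝ}
    (h : y = x - (2 * c) • v) : c ^ 2 * nrm v ^ 2 ≤ nrm x ^ 2 + nrm y ^ 2 := by
  have e : (2 * c) • v = x - y := by rw [h]; abel
  have h1 : nrm ((2 * c) • v) ≤ nrm x + nrm y := e ▸ nrm_sub_le x y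
  rw [nrm_smul] at h1
  have h2 := pow_le_pow_left₀ (mul_nonneg (abs_nonneg _) (nrm_nonneg v)) h1 2
  rw [mul_pow, sq_abs] at h2
  nlinarith [sq_nonneg (nrm x - nrm y), mul_nonneg (sq_nonneg c) (sq_nonneg (nrm v))]

/-- In an exploration step the expected information is bounded below, whatever happened before. -/
lemma exists_exploration (n d : ℕ) {κ σ : ℝ} (hn : 1 ≤ n) (hκ : 1 ≤ κ) (hσ : 0 < σ) :
    ∃ c : ℝ, 0 < c ∧ c ≤ 1 ∧ ∀ p : Setup n d, p.Valid → p.κ = κ → p.σ = σ → ∀ t : ℕ, p.τ₀ ∣ t →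
      ((t + 1 : ℕ) : ℝ) ≤ p.Tw → ∀ H : (NoiseIdx n d → ℝ) → ℝ≥0∞, Measurable H →
      DependsOn H (past n d p.τ₀ t (t + 1) (t + 1)) →
      ENNReal.ofReal c * ∫⁻ ω, H ω ∂p.law ≤
        ∫⁻ ω, H ω * ENNReal.ofReal (min 1 (p.infoGain ω (t + 1))) ∂p.law := by
  set v₁ := Real.toNNReal (σ ^ 2) with hv₁
  set v₂ := Real.toNNReal (2 * κ ^ 2 * σ ^ 2) with hv₂
  have h₁ : v₁ ≠ 0 := by rw [hv₁, Ne, Real.toNNReal_eq_zero, not_le]; positivity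
  have h₂ : v₂ ≠ 0 := by rw [hv₂, Ne, Real.toNNReal_eq_zero, not_le]; positivity
  set π := min (tailProb v₁) (tailProb v₂) with hπ
  have hπ0 : 0 < π := lt_min (tailProb_pos h₁) (tailProb_pos h₂)
  have hπ1 : π ≤ 1 := (min_le_left _ _).trans prob_le_one
  have hπt : π ≠ ∞ := ne_top_of_le_ne_top ENNReal.one_ne_top hπ1
  have hn' : (1 : ℝ) ≤ n := by exact_mod_cast hn
  set c₁ : ℝ := (1 / ((1 + n * κ) * (n + d))) ^ 2 with hc₁
  have hc₁0 : 0 < c₁ := by positivity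
  have hc₁1 : c₁ ≤ 1 := by
    have h0 : 1 ≤ (1 + n * κ) * (n + d : ℝ) := by
      have : (0 : ℝ) ≤ d := Nat.cast_nonneg d
      have h1 : 0 ≤ (n : ℝ) * κ := by positivity
      exact one_le_mul_of_one_le_of_one_le (by linarith) (by linarith)
    exact pow_le_one₀ (by positivity) ((div_le_one (by positivity)).2 h0)
  have hπr : 0 < π.toReal := ENNReal.toReal_pos hπ0.ne' hπt
  have hπr1 : π.toReal ≤ 1 := by
    simpa using ENNReal.toReal_mono ENNReal.one_ne_top hπ1
  refine ⟨π.toReal * c₁ / (2 * (n + d)), by positivity, ?_, ?_⟩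
  · rw [div_le_one (by positivity)]
    have : (0 : ℝ) ≤ d := Nat.cast_nonneg d
    nlinarith
  intro p hv hpκ hpσ t ht hT H hH hHd
  have hτ3 := hv.three_le_τ₀
  have ht' : ¬p.τ₀ ∣ t + 1 := by
    intro h
    have := (Nat.dvd_add_right ht).1 h
    exact absurd (Nat.le_of_dvd one_pos this) (by omega)
  have hm := hv.meas
  have hμ := hm.μ_pos
  let G : (NoiseIdx n d → ℝ) → Matrix (Fin n ⊕ Fin d) (Fin n ⊕ Fin d) ℝ :=
    fun ω => (p.V ω (t + 1))⁻¹
  have hGm : Measurable G := measurable_matrix_inv (hm.V (t + 1))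
  have hGd : DependsOn G (past n d p.τ₀ t (t + 1) (t + 1)) := by
    intro ω ω' h
    have := p.dependsOn_V_succ t h
    simp only at this
    simp only [G, this]
  let K : (NoiseIdx n d → ℝ) → Matrix (Fin d) (Fin n) ℝ := fun ω => p.gainM (p.mdl ω t)
  have hKm : Measurable K := hm.gainM.comp (hm.mdl t)
  have hKd : DependsOn K (past n d p.τ₀ t (t + 1) (t + 1)) := by
    intro ω ω' h
    have := p.dependsOn_mdl t h
    simp only at this
    simp only [K, this]
  let y : Fin n ⊕ Fin d → (NoiseIdx n d → ℝ) → ℝ := fun q ω =>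
    nrm (G ω *ᵥ noiseDir (K ω) q) ^ 2 / (G ω).trace ^ 2
  have hym : ∀ q, Measurable (y q) := fun q => by
    have h1 : Measurable fun ω => noiseDir (K ω) q := by
      rcases q with i | j
      · refine measurable_pi_lambda _ fun r => ?_
        rcases r with r | r
        · exact measurable_const
        · exact (measurable_pi_apply r).comp (measurable_matrix_mulVec hKm measurable_const)
      · exact measurable_const
    exact ((measurable_nrm (measurable_matrix_mulVec hGm h1)).pow_const 2).div
      ((measurable_matrix_trace hGm).pow_const 2)
  have hyd : ∀ q, DependsOn (y q) (past n d p.τ₀ t (t + 1) (t + 1)) := fun q ω ω' h => by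
    simp only [y, hGd h, hKd h]
  -- the coordinates whose signs are changed, one for each direction of `z_{t+1}`
  let lab : Fin n ⊕ Fin d → NoiseIdx n d := Sum.elim (fun i => .w t i) (fun j => .ν (t + 1) j)
  have hdisj : ∀ q, Disjoint (past n d p.τ₀ t (t + 1) (t + 1)) {lab q} := fun q => by
    rcases q with i | j
    · exact disjoint_past_w i
    · exact disjoint_past_ν j
  have hflip : ∀ q ω, p.Z (flipOn {lab q} ω) (t + 1) =
      p.Z ω (t + 1) - (2 * ω (lab q)) • noiseDir (K ω) q := fun q ω => by
    rcases q with i | j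
    · exact Z_flip_w ω ht' i
    · exact Z_flip_ν ω ht' hT j
  have hπle : ∀ q, π ≤ p.law {ω | 1 ≤ |ω (lab q)|} := fun q => by
    rw [law_one_le_abs, hpκ, hpσ]
    rcases q with i | j
    · exact min_le_left _ _
    · exact min_le_right _ _
  have hone : ∀ q, π * ∫⁻ ω, H ω * ENNReal.ofReal (min 1 (y q ω)) ∂p.law ≤
      2 * ∫⁻ ω, H ω * ENNReal.ofReal (min 1 (p.infoGain ω (t + 1))) ∂p.law := fun q => by
    refine le_trans (mul_le_mul_left (α := ℝ≥0∞) (hπle q) _) ?_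
    refine mul_lintegral_le_of_flip (hdisj q) (hdisj q) hH hHd
      (measurableSet_le measurable_const (by fun_prop)) ?_ (measurable_infoGain hm (t + 1)) (hym q)
      (hyd q) (fun ω => infoGain_nonneg ω _) ?_
    · intro ω ω' h
      have := h (lab q) rfl
      simp only [Set.mem_ofPred_eq, this]
    · intro ω hω _
      have e1 : G (flipOn {lab q} ω) = G ω := comp_flipOn_of_dependsOn hGd (hdisj q) ω
      have e2 : (p.V (flipOn {lab q} ω) (t + 1))⁻¹ = G ω := e1
      have h1 := sq_mul_le_of_sub_eq (x := G ω *ᵥ p.Z ω (t + 1))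
        (y := G ω *ᵥ p.Z (flipOn {lab q} ω) (t + 1)) (v := G ω *ᵥ noiseDir (K ω) q)
        (c := ω (lab q)) (by rw [hflip, mulVec_sub, mulVec_smul])
      have h2 : 1 ≤ ω (lab q) ^ 2 := by
        rw [← sq_abs]; exact one_le_pow₀ hω
      simp only [infoGain, e2]
      rw [← add_div]
      refine div_le_div_of_nonneg_right (le_trans ?_ h1) (sq_nonneg _)
      exact le_mul_of_one_le_left (sq_nonneg _) h2
  -- some direction has a fixed share of the trace
  have hlow : ∀ ω, ENNReal.ofReal c₁ ≤ ∑ q, ENNReal.ofReal (min 1 (y q ω)) := fun ω => by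
    have htr : 0 < (G ω).trace := by
      have : Nonempty (Fin n ⊕ Fin d) := ⟨.inl ⟨0, hn⟩⟩
      exact trace_inv_pos (p.V_posDef ω (t + 1) hμ)
    have h1 := trace_le_sum_noiseDir (G ω) (K := K ω) (hpκ ▸ hv.norm_gainM_le (p.mdl ω t))
    obtain ⟨q, -, hq⟩ : ∃ q ∈ (Finset.univ : Finset (Fin n ⊕ Fin d)),
        (G ω).trace / ((1 + n * κ) * (n + d)) ≤ nrm (G ω *ᵥ noiseDir (K ω) q) := by
      refine Finset.exists_le_of_sum_le ⟨.inl ⟨0, hn⟩, Finset.mem_univ _⟩ ?_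
      simp only [Finset.sum_const, Finset.card_univ, Fintype.card_sum, Fintype.card_fin,
        nsmul_eq_mul]
      push_cast
      rw [← mul_div_assoc, mul_comm (1 + n * κ), mul_div_mul_left _ _ (by positivity),
        div_le_iff₀ (by positivity), mul_comm]
      exact h1
    have h2 : c₁ ≤ min 1 (y q ω) := by
      refine le_min hc₁1 ?_
      change c₁ ≤ nrm (G ω *ᵥ noiseDir (K ω) q) ^ 2 / (G ω).trace ^ 2
      rw [hc₁, ← div_pow]
      refine pow_le_pow_left₀ (by positivity) ?_ 2
      rw [le_div_iff₀ htr, one_div_mul_eq_div]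
      exact hq
    exact (ENNReal.ofReal_le_ofReal h2).trans (Finset.single_le_sum
      (f := fun q => ENNReal.ofReal (min 1 (y q ω))) (fun _ _ => zero_le) (Finset.mem_univ q))
  set R := ∫⁻ ω, H ω * ENNReal.ofReal (min 1 (p.infoGain ω (t + 1))) ∂p.law with hR
  have hsum : π * (ENNReal.ofReal c₁ * ∫⁻ ω, H ω ∂p.law) ≤ (2 * (n + d : ℕ)) * R := by
    calc π * (ENNReal.ofReal c₁ * ∫⁻ ω, H ω ∂p.law)
        = π * ∫⁻ ω, H ω * ENNReal.ofReal c₁ ∂p.law := by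
          rw [lintegral_mul_const _ hH, mul_comm (ENNReal.ofReal c₁)]
      _ ≤ π * ∫⁻ ω, ∑ q, H ω * ENNReal.ofReal (min 1 (y q ω)) ∂p.law := by
          refine mul_le_mul_right (α := ℝ≥0∞) (lintegral_mono fun ω => ?_) _
          simp only [← Finset.mul_sum]
          exact mul_le_mul_right (α := ℝ≥0∞) (hlow ω) _
      _ = ∑ q, π * ∫⁻ ω, H ω * ENNReal.ofReal (min 1 (y q ω)) ∂p.law := by
          have hmm : ∀ q, Measurable fun ω => H ω * ENNReal.ofReal (min 1 (y q ω)) := fun q =>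
            hH.mul (measurable_const.min (hym q)).ennreal_ofReal
          rw [lintegral_finsetSum _ fun q _ => hmm q, Finset.mul_sum]
      _ ≤ ∑ _q : Fin n ⊕ Fin d, 2 * R := Finset.sum_le_sum fun q _ => hone q
      _ = _ := by
          simp only [Finset.sum_const, Finset.card_univ, Fintype.card_sum, Fintype.card_fin,
            nsmul_eq_mul]
          ring
  have hD : ((2 * (n + d : ℕ) : ℝ≥0∞)) = ENNReal.ofReal (2 * (n + d)) := by
    rw [ENNReal.ofReal_mul zero_le_two]
    norm_cast
  rw [hD] at hsum
  rw [ENNReal.ofReal_div_of_pos (by positivity), ENNReal.ofReal_mul ENNReal.toReal_nonneg,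
    ENNReal.ofReal_toReal hπt, mul_comm, ← mul_div_assoc]
  refine ENNReal.div_le_of_le_mul' (le_trans (le_of_eq ?_) hsum)
  ring

end Setup

namespace Setup

variable {n d : ℕ} {p : Setup n d}

/-- The Sherman–Morrison formula for the trace. -/
lemma trace_inv_succ (hμ : 0 < p.μ) (ω : NoiseIdx n d → ℝ) (t : ℕ) :
    (p.V ω (t + 1))⁻¹.trace = (p.V ω t)⁻¹.trace -
      nrm ((p.V ω t)⁻¹ *ᵥ p.Z ω t) ^ 2 / (1 + qf (p.V ω t)⁻¹ (p.Z ω t)) := by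
  rw [V_succ, trace_inv_add_vecMulVec (p.V_posDef ω t hμ)]

lemma trace_inv_antitone (hμ : 0 < p.μ) (ω : NoiseIdx n d → ℝ) {s t : ℕ} (hst : s ≤ t) :
    (p.V ω t)⁻¹.trace ≤ (p.V ω s)⁻¹.trace := by
  induction t, hst using Nat.le_induction with
  | base => exact le_rfl
  | succ t _ ih =>
    refine le_trans ?_ ih
    rw [trace_inv_succ hμ]
    have hq := qf_nonneg (p.V_posDef ω t hμ).inv (p.Z ω t)
    have : 0 ≤ nrm ((p.V ω t)⁻¹ *ᵥ p.Z ω t) ^ 2 / (1 + qf (p.V ω t)⁻¹ (p.Z ω t)) := by positivity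
    linarith

lemma trace_inv_V_pos (hn : 1 ≤ n) (hμ : 0 < p.μ) (ω : NoiseIdx n d → ℝ) (t : ℕ) :
    0 < (p.V ω t)⁻¹.trace := by
  have : Nonempty (Fin n ⊕ Fin d) := ⟨.inl ⟨0, hn⟩⟩
  exact trace_inv_pos (p.V_posDef ω t hμ)

/-- Information makes `1 / tr V⁻¹` or `log det V` grow. -/
lemma sum_infoGain_le (hn : 1 ≤ n) (hμ : 0 < p.μ) (ω : NoiseIdx n d → ℝ) (t : ℕ) :
    ∑ s ∈ Finset.range t, min 1 (p.infoGain ω s) ≤ 2 * ((p.V ω t)⁻¹.trace⁻¹ +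
      (Real.log (p.V ω t).det - Real.log (p.V ω 0).det)) := by
  induction t with
  | zero =>
    have := trace_inv_V_pos hn hμ ω 0
    simp only [Finset.range_zero, Finset.sum_empty, sub_self, add_zero]
    positivity
  | succ t ih =>
    rw [Finset.sum_range_succ, p.log_det_succ hμ]
    have hq := qf_nonneg (p.V_posDef ω t hμ).inv (p.Z ω t)
    have hΦ := trace_inv_V_pos hn hμ ω t
    have hΦ' := trace_inv_V_pos hn hμ ω (t + 1)
    have hle := trace_inv_antitone hμ ω t.le_succ
    have hinv : (p.V ω t)⁻¹.trace⁻¹ ≤ (p.V ω (t + 1))⁻¹.trace⁻¹ := inv_anti₀ hΦ' hle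
    have hlog := p.log_one_add_qf_nonneg hμ ω t
    suffices h : min 1 (p.infoGain ω t) ≤ 2 * ((p.V ω (t + 1))⁻¹.trace⁻¹ - (p.V ω t)⁻¹.trace⁻¹ +
        Real.log (1 + qf (p.V ω t)⁻¹ (p.Z ω t))) by linarith
    -- a large `zᵀ V⁻¹ z` doubles the determinant; a small one leaves the decrease of the trace
    -- intact
    rcases le_total 1 (qf (p.V ω t)⁻¹ (p.Z ω t)) with h1 | h1
    · have h2 : Real.log 2 ≤ Real.log (1 + qf (p.V ω t)⁻¹ (p.Z ω t)) :=
        Real.log_le_log two_pos (by linarith)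
      have := Real.log_two_gt_d9
      linarith [min_le_left 1 (p.infoGain ω t)]
    · set Φ := (p.V ω t)⁻¹.trace with hΦd
      set Φ' := (p.V ω (t + 1))⁻¹.trace with hΦd'
      set D := nrm ((p.V ω t)⁻¹ *ᵥ p.Z ω t) ^ 2 with hD
      set q := qf (p.V ω t)⁻¹ (p.Z ω t) with hqd
      have hD0 : 0 ≤ D := sq_nonneg _
      have e : Φ' = Φ - D / (1 + q) := trace_inv_succ hμ ω t
      have h2 : D / 2 ≤ Φ - Φ' := by
        rw [e, sub_sub_cancel]
        exact div_le_div_of_nonneg_left hD0 (by positivity) (by linarith)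
      have h3 : D / 2 / Φ ^ 2 ≤ Φ'⁻¹ - Φ⁻¹ := by
        rw [inv_sub_inv hΦ'.ne' hΦ.ne']
        refine div_le_div₀ (by linarith) h2 (by positivity) ?_
        rw [pow_two]
        exact mul_le_mul_of_nonneg_right hle hΦ.le
      have h4 : p.infoGain ω t = 2 * (D / 2 / Φ ^ 2) := by
        rw [infoGain, ← hD, ← hΦd]; ring
      have := min_le_right 1 (p.infoGain ω t)
      linarith

/-- The information collected in the steps `τ₀ j + 1`, `j < k`. -/
noncomputable def epochInfo (p : Setup n d) (ω : NoiseIdx n d → ℝ) (k : ℕ) : ℝ :=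
  ∑ j ∈ Finset.range k, min 1 (p.infoGain ω (j * p.τ₀ + 1))

lemma epochInfo_le (hv : p.Valid) (ω : NoiseIdx n d → ℝ) (k : ℕ) :
    p.epochInfo ω k ≤ ∑ s ∈ Finset.range (k * p.τ₀), min 1 (p.infoGain ω s) := by
  have hτ := hv.three_le_τ₀
  have hinj : Function.Injective fun j => j * p.τ₀ + 1 := fun i j h => by
    have : i * p.τ₀ = j * p.τ₀ := by simpa using h
    exact Nat.eq_of_mul_eq_mul_right (by omega) this
  have e : p.epochInfo ω k = ∑ s ∈ (Finset.range k).map ⟨fun j => j * p.τ₀ + 1, hinj⟩,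
      min 1 (p.infoGain ω s) := by rw [Finset.sum_map]; rfl
  rw [e]
  refine Finset.sum_le_sum_of_subset_of_nonneg ?_ fun s _ _ =>
    le_min zero_le_one (infoGain_nonneg ω s)
  intro s hs
  obtain ⟨j, hj, rfl⟩ := Finset.mem_map.1 hs
  have h1 := Finset.mem_range.1 hj
  have h2 : (j + 1) * p.τ₀ ≤ k * p.τ₀ := Nat.mul_le_mul_right _ h1
  rw [add_mul, one_mul] at h2
  simp only [Function.Embedding.coeFn_mk, Finset.mem_range]
  omega

lemma measurable_epochInfo (h : p.MeasurableSetup) (k : ℕ) :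
    Measurable fun ω => p.epochInfo ω k :=
  Finset.measurable_sum _ fun _ _ => measurable_const.min (measurable_infoGain h _)

lemma dependsOn_epochInfo (hv : p.Valid) (k : ℕ) : DependsOn (fun ω => p.epochInfo ω k)
    (past n d p.τ₀ (k * p.τ₀) (k * p.τ₀ + 1) (k * p.τ₀ + 1)) := by
  intro ω ω' h
  refine Finset.sum_congr rfl fun j hj => ?_
  have hτ := hv.three_le_τ₀
  have h1 := Finset.mem_range.1 hj
  have h2 : (j + 1) * p.τ₀ ≤ k * p.τ₀ := Nat.mul_le_mul_right _ h1
  rw [add_mul, one_mul] at h2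
  have := p.dependsOn_infoGain (j * p.τ₀ + 1) fun i hi =>
    h i (past_mono (by omega) (by omega) (by omega) hi)
  simp only at this
  rw [this]

lemma exp_neg_le_one_sub_half {y : ℝ} (h0 : 0 ≤ y) (h1 : y ≤ 1) :
    Real.exp (-y) ≤ 1 - y / 2 := by
  have h2 := Real.add_one_le_exp y
  have h3 : Real.exp (-y) * Real.exp y = 1 := by rw [← Real.exp_add]; simp
  have h4 := Real.exp_pos (-y)
  nlinarith [Real.quadratic_le_exp_of_nonneg h0]

/-- The exploration phase collects information at a constant rate, up to an exponentially small
probability. -/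
lemma exists_law_epochInfo_le (n d : ℕ) {κ σ : ℝ} (hn : 1 ≤ n) (hκ : 1 ≤ κ) (hσ : 0 < σ) :
    ∃ c : ℝ, 0 < c ∧ ∀ p : Setup n d, p.Valid → p.κ = κ → p.σ = σ → ∀ k : ℕ,
      ((k * p.τ₀ : ℕ) : ℝ) ≤ p.Tw →
      p.law {ω | p.epochInfo ω k ≤ c * k} ≤ ENNReal.ofReal (Real.exp (-(c * k))) := by
  obtain ⟨c, hc, hc1, hexp⟩ := exists_exploration n d hn hκ hσ
  refine ⟨c / 4, by positivity, fun p hv hpκ hpσ k hk => ?_⟩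
  have hτ := hv.three_le_τ₀
  have hm := hv.meas
  have hmeas : ∀ k, Measurable fun ω => ENNReal.ofReal (Real.exp (-p.epochInfo ω k)) := fun k =>
    (measurable_epochInfo hm k).neg.exp.ennreal_ofReal
  -- the exponential moment of the collected information decays at a constant rate
  have hind : ∀ j ≤ k, ∫⁻ ω, ENNReal.ofReal (Real.exp (-p.epochInfo ω j)) ∂p.law ≤
      ENNReal.ofReal (Real.exp (-(c / 2 * j))) := by
    intro j
    induction j with
    | zero => intro _; simp [epochInfo]
    | succ j ih =>
      intro hj
      set I := ∫⁻ ω, ENNReal.ofReal (Real.exp (-p.epochInfo ω j)) ∂p.law with hI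
      have hI1 := ih (by omega)
      have hIt : I ≠ ∞ := ne_top_of_le_ne_top ENNReal.ofReal_ne_top hI1
      have hle : (j + 1) * p.τ₀ ≤ k * p.τ₀ := Nat.mul_le_mul_right _ hj
      have hle' : j * p.τ₀ + 1 ≤ k * p.τ₀ := by rw [add_mul, one_mul] at hle; omega
      have hT : ((j * p.τ₀ + 1 : ℕ) : ℝ) ≤ p.Tw := le_trans (by exact_mod_cast hle') hk
      have h1 := hexp p hv hpκ hpσ (j * p.τ₀) (Dvd.intro_left j rfl) hT
        (fun ω => ENNReal.ofReal (Real.exp (-p.epochInfo ω j))) (hmeas j) (by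
          intro ω ω' h
          have := dependsOn_epochInfo hv j h
          simp only at this
          simp only [this])
      rw [← hI] at h1
      have hsplit : ∀ ω, ENNReal.ofReal (Real.exp (-p.epochInfo ω (j + 1))) +
          ENNReal.ofReal (1 / 2) * (ENNReal.ofReal (Real.exp (-p.epochInfo ω j)) *
            ENNReal.ofReal (min 1 (p.infoGain ω (j * p.τ₀ + 1)))) ≤
          ENNReal.ofReal (Real.exp (-p.epochInfo ω j)) := by
        intro ω
        have h0 : 0 ≤ min 1 (p.infoGain ω (j * p.τ₀ + 1)) :=
          le_min zero_le_one (infoGain_nonneg ω _)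
        rw [← ENNReal.ofReal_mul (Real.exp_pos _).le, ← ENNReal.ofReal_mul (by norm_num),
          ← ENNReal.ofReal_add (Real.exp_pos _).le (by positivity)]
        refine ENNReal.ofReal_le_ofReal ?_
        have h2 := exp_neg_le_one_sub_half h0 (min_le_left _ _)
        have e : p.epochInfo ω (j + 1) =
            p.epochInfo ω j + min 1 (p.infoGain ω (j * p.τ₀ + 1)) := Finset.sum_range_succ _ _
        rw [e, neg_add, Real.exp_add]
        nlinarith [Real.exp_pos (-p.epochInfo ω j)]
      have h2 := lintegral_mono (μ := p.law) hsplit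
      rw [lintegral_add_left (hmeas (j + 1)), lintegral_const_mul' _ _ ENNReal.ofReal_ne_top,
        ← hI] at h2
      have h3 : (∫⁻ ω, ENNReal.ofReal (Real.exp (-p.epochInfo ω (j + 1))) ∂p.law) +
          ENNReal.ofReal (1 / 2) * (ENNReal.ofReal c * I) ≤
          ENNReal.ofReal (1 - c / 2) * I + ENNReal.ofReal (1 / 2) * (ENNReal.ofReal c * I) := by
        refine (add_le_add_right (mul_le_mul_right (α := ℝ≥0∞) h1 _) _).trans (h2.trans ?_)
        rw [← mul_assoc, ← ENNReal.ofReal_mul (by norm_num), ← add_mul,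
          ← ENNReal.ofReal_add (by linarith) (by positivity)]
        have : 1 - c / 2 + 1 / 2 * c = 1 := by ring
        rw [this, ENNReal.ofReal_one, one_mul]
      have h4 := (ENNReal.add_le_add_iff_right (ENNReal.mul_ne_top ENNReal.ofReal_ne_top
        (ENNReal.mul_ne_top ENNReal.ofReal_ne_top hIt))).1 h3
      refine h4.trans ((mul_le_mul' (ENNReal.ofReal_le_ofReal (Real.one_sub_le_exp_neg (c / 2)))
        hI1).trans ?_)
      rw [← ENNReal.ofReal_mul (Real.exp_pos _).le, ← Real.exp_add]
      refine ENNReal.ofReal_le_ofReal (Real.exp_le_exp.2 (le_of_eq ?_))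
      push_cast
      ring
  have hε : ENNReal.ofReal (Real.exp (-(c / 4 * k))) ≠ 0 := by
    simpa using Real.exp_pos _
  have h1 := meas_ge_le_lintegral_div (μ := p.law) (hmeas k).aemeasurable hε ENNReal.ofReal_ne_top
  refine (measure_mono fun ω hω => ?_).trans (h1.trans ?_)
  · exact ENNReal.ofReal_le_ofReal (Real.exp_le_exp.2 (neg_le_neg hω))
  · refine ENNReal.div_le_of_le_mul ((hind k le_rfl).trans (le_of_eq ?_))
    rw [← ENNReal.ofReal_mul (Real.exp_pos _).le, ← Real.exp_add]
    ring_nf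

/-- Enough information makes `tr V⁻¹` small. -/
lemma trace_inv_le_of_epochInfo (hv : p.Valid) {ω : NoiseIdx n d → ℝ} {ζ x : ℝ} {k t T : ℕ}
    (hkt : k * p.τ₀ ≤ t) (htT : t ≤ T) (hZ : ∀ s < t, nrm (p.Z ω s) ≤ ζ)
    (hx : 0 < x) (h : 2 * (x + p.potential T ζ) ≤ p.epochInfo ω k) :
    (p.V ω t)⁻¹.trace ≤ x⁻¹ := by
  have hμ := hv.meas.μ_pos
  have h1 := epochInfo_le hv ω k
  have h2 := sum_infoGain_le hv.one_le_n hμ ω (k * p.τ₀)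
  have h3 := p.log_det_sub_le hv.one_le_n hμ ω (k * p.τ₀) fun s hs => hZ s (by omega)
  have h4 := p.potential_mono hv.one_le_n hμ (hkt.trans htT) ζ
  have h5 := trace_inv_V_pos hv.one_le_n hμ ω (k * p.τ₀)
  refine (trace_inv_antitone hμ ω hkt).trans ?_
  rw [le_inv_comm₀ h5 hx]
  linarith

end Setup

/-! ### Self-exploration by sampling -/

/-- A rank-one change `u gᵀ` of the model, near `Θ₀`, makes the noise visible in the direction `u`
under at least one of the two optimal gains. -/
def SelfExploring {n d : ℕ} (Q : Matrix (Fin n) (Fin n) ℝ) (R : Matrix (Fin d) (Fin d) ℝ)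
    (κ γ S : ℝ) (Θ₀ : Sys n d) (r c : ℝ) : Prop :=
  ∀ Θ₁ Θ₂ : Sys n d, IsStabilizable Q R κ γ Θ₁ → IsStabilizable Q R κ γ Θ₂ →
    ‖Θ₁‖ ≤ S → ‖Θ₂‖ ≤ S → ‖Θ₂ - Θ₀‖ ≤ r →
    ∀ (u : Fin n ⊕ Fin d → ℝ) (g : Fin n → ℝ), Θ₂ - Θ₁ = vecMulVec u g → nrm g * nrm u ≤ 1 →
    c * (nrm g * nrm u ^ 2) ≤
      nrm (u ∘ Sum.inl + (u ∘ Sum.inr) ᵥ* gain Q R Θ₁) +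
      nrm (u ∘ Sum.inl + (u ∘ Sum.inr) ᵥ* gain Q R Θ₂)

namespace Setup

variable {n d : ℕ} {p : Setup n d}

/-- The part of `w` along `u` that is seen in `z = (w, K w)` is given by the vector `u₁ + Kᵀ u₂`. -/
lemma dot_noiseDir_inl (K : Matrix (Fin d) (Fin n) ℝ) (u : Fin n ⊕ Fin d → ℝ) (i : Fin n) :
    u ⬝ᵥ noiseDir K (.inl i) = (u ∘ Sum.inl + (u ∘ Sum.inr) ᵥ* K) i := by
  have h1 : u ⬝ᵥ noiseDir K (.inl i) = ∑ j, u (.inl j) * (Pi.single i 1 : Fin n → ℝ) j +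
      ∑ j, u (.inr j) * (K *ᵥ Pi.single i 1) j := by
    rw [dotProduct, Fintype.sum_sum_type]
    rfl
  rw [h1]
  simp [Pi.single_apply, vecMul, dotProduct]

lemma nrm_sq_le_sum_noiseDir {V : Matrix (Fin n ⊕ Fin d) (Fin n ⊕ Fin d) ℝ} (hV : V.PosDef)
    (K : Matrix (Fin d) (Fin n) ℝ) (r : Fin n ⊕ Fin d) :
    nrm ((invSqrt V *ᵥ Pi.single r 1) ∘ Sum.inl + ((invSqrt V *ᵥ Pi.single r 1) ∘ Sum.inr) ᵥ* K) ^ 2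
      ≤ ∑ i, qf V⁻¹ (noiseDir K (.inl i)) := by
  rw [nrm_sq, dotProduct]
  refine Finset.sum_le_sum fun i _ => ?_
  rw [← dot_noiseDir_inl, ← pow_two, qf_inv_eq_nrm hV]
  have e : (invSqrt V *ᵥ Pi.single r 1) ⬝ᵥ noiseDir K (.inl i) =
      (invSqrt V *ᵥ noiseDir K (.inl i)) r := by
    rw [dotProduct_comm, dot_mulVec_comm (transpose_invSqrt V), single_one_dotProduct]
  rw [e]
  exact sq_apply_le _ r

/-- The first candidate is used if it is admissible. -/
lemma sample_of_mem {V : Matrix (Fin n ⊕ Fin d) (Fin n ⊕ Fin d) ℝ} {Y : Sys n d} {η : ℕ → Sys n d}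
    (h : p.candidate V Y (η 0) ∈ p.M) : p.sample V Y η = p.candidate V Y (η 0) := by
  have : sInf {j | p.candidate V Y (η j) ∈ p.M} = 0 := Nat.sInf_eq_zero.2 (Or.inl h)
  rw [sample, this]

/-- The run has been good before time `t` and the estimate at time `t` is accurate. -/
def Accurate (p : Setup n d) (ζ a φ : ℝ) (t : ℕ) : Set (NoiseIdx n d → ℝ) :=
  {ω | (∀ s < t, nrm (p.Z ω s) ≤ ζ) ∧ p.conf ω t ≤ a ∧ (p.V ω t)⁻¹.trace ≤ φ}

lemma measurableSet_Accurate (h : p.MeasurableSetup) (ζ a φ : ℝ) (t : ℕ) :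
    MeasurableSet (p.Accurate ζ a φ t) := by
  have : p.Accurate ζ a φ t = (⋂ s ∈ Set.Iio t, {ω | nrm (p.Z ω s) ≤ ζ}) ∩
      ({ω | p.conf ω t ≤ a} ∩ {ω | (p.V ω t)⁻¹.trace ≤ φ}) := by
    ext ω
    simp [Accurate]
  rw [this]
  exact (MeasurableSet.biInter (Set.to_countable _) fun s _ =>
    measurableSet_le (measurable_nrm (h.Z s)) measurable_const).inter
    ((measurableSet_le (h.conf t) measurable_const).inter (measurableSet_le
      (measurable_matrix_trace (measurable_matrix_inv (h.V t))) measurable_const))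

lemma dependsOn_Accurate (p : Setup n d) (ζ a φ : ℝ) (t : ℕ) :
    DependsOn (fun ω => ω ∈ p.Accurate ζ a φ t) (past n d p.τ₀ t t t) := by
  intro ω ω' h
  have h1 := p.dependsOn_conf t h
  have h2 := p.dependsOn_V t h
  simp only at h1 h2
  have h3 : ∀ s < t, p.Z ω s = p.Z ω' s := fun s hs =>
    p.dependsOn_Z s fun i hi => h i (past_mono hs.le hs hs hi)
  refine propext (and_congr (forall₂_congr fun s hs => by rw [h3 s hs]) ?_)
  rw [h1, h2]

/-- The size of the noise, as seen through `V⁻¹` after it has passed through the gain in use. -/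
noncomputable def visibility (p : Setup n d) (ω : NoiseIdx n d → ℝ) (t : ℕ) : ℝ :=
  ∑ i, qf (p.V ω t)⁻¹ (noiseDir (p.gainM (p.mdl ω t)) (.inl i))

lemma measurable_noiseDir_gain (h : p.MeasurableSetup) (t : ℕ) (q : Fin n ⊕ Fin d) :
    Measurable fun ω => noiseDir (p.gainM (p.mdl ω t)) q := by
  rcases q with i | j
  · refine measurable_pi_lambda _ fun r => ?_
    rcases r with r | r
    · exact measurable_const
    · exact (measurable_pi_apply r).comp
        (measurable_matrix_mulVec (h.gainM.comp (h.mdl t)) measurable_const)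
  · exact measurable_const

lemma measurable_visibility (h : p.MeasurableSetup) (t : ℕ) :
    Measurable fun ω => p.visibility ω t :=
  Finset.measurable_sum _ fun _ _ => measurable_matrix_qf (measurable_matrix_inv (h.V t))
    (measurable_noiseDir_gain h t _)

/-- The sign of one entry of the first noise matrix changes that matrix by rank one. -/
lemma etaM_flip (ω : NoiseIdx n d → ℝ) (k : ℕ) (r : Fin n ⊕ Fin d) (c : Fin n) :
    etaM (flipOn {.η k 0 r c} ω) k 0 = etaM ω k 0 +
      vecMulVec (Pi.single r 1) (Pi.single c (-(2 * ω (.η k 0 r c)))) := by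
  ext r' c'
  have e1 : etaM (flipOn {.η k 0 r c} ω) k 0 r' c' = flipOn {.η k 0 r c} ω (.η k 0 r' c') := rfl
  have e2 : etaM ω k 0 r' c' = ω (.η k 0 r' c') := rfl
  rw [Matrix.add_apply, e1, e2, vecMulVec_apply]
  by_cases h : r' = r ∧ c' = c
  · obtain ⟨rfl, rfl⟩ := h
    have h0 : flipOn {NoiseIdx.η k 0 r' c'} ω (.η k 0 r' c') = -ω (.η k 0 r' c') :=
      flipOn_of_mem rfl ω
    rw [h0, Pi.single_eq_same, Pi.single_eq_same]
    ring
  · rw [flipOn_of_notMem]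
    · rcases not_and_or.1 h with h | h
      · rw [Pi.single_eq_of_ne h]; ring
      · rw [Pi.single_eq_of_ne h]; ring
    · intro h'
      simp only [Set.mem_singleton_iff, NoiseIdx.η.injEq, true_and] at h'
      exact h h'

/-- The flip of one entry of the first sampling matrix makes the noise visible. -/
lemma le_visibility_add_flip (hv : p.Valid) {r c ζ a φ ρ : ℝ} {T k : ℕ}
    (hse : SelfExploring p.Q p.R p.κ p.γ p.S p.Θs r c) (hc : 0 ≤ c) (hr : 0 ≤ r)
    (hball : ∀ Θ : Sys n d, fsq (Θ - p.Θs) ≤ r ^ 2 → Θ ∈ p.M)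
    (hρ : 2 * a + 2 * p.μ * p.S ^ 2 ≤ ρ ^ 2 * (p.μ * p.S ^ 2))
    (hφr : φ * (p.betaSq ζ T * (2 * ((n + d) * n) + 2 * ρ ^ 2)) ≤ r ^ 2)
    (hφ1 : 4 * (p.betaSq ζ T * φ) ≤ 1) (hkT : k * p.τ₀ ≤ T) {ω : NoiseIdx n d → ℝ}
    (hω : ω ∈ p.Accurate ζ a φ (k * p.τ₀))
    (hη : ∀ r' s', |ω (.η k 0 r' s') - 1 / 2| < 1 / 4) (i : Fin n ⊕ Fin d) (s : Fin n) :
    c ^ 2 / 8 * (p.β (p.V ω (k * p.τ₀)) ^ 2 * ((p.V ω (k * p.τ₀))⁻¹ i i) ^ 2) ≤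
      p.visibility ω (k * p.τ₀) + p.visibility (flipOn {.η k 0 i s} ω) (k * p.τ₀) := by
  set t := k * p.τ₀ with ht
  set ω' := flipOn {.η k 0 i s} ω with hω'
  have hτ : 0 < p.τ₀ := by linarith [hv.three_le_τ₀]
  have hμ := hv.meas.μ_pos
  set V := p.V ω t with hVd
  set Y := p.Y ω t with hYd
  have hV : V.PosDef := p.V_posDef ω t hμ
  have hβ := hv.β_pos V
  have hdisj : Disjoint (past n d p.τ₀ t t t) {NoiseIdx.η k 0 i s} :=
    Set.disjoint_singleton_right.2 fun h => lt_irrefl (k * p.τ₀) h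
  have eV : p.V ω' t = V := comp_flipOn_of_dependsOn (p.dependsOn_V t) hdisj ω
  have eY : p.Y ω' t = Y := comp_flipOn_of_dependsOn (p.dependsOn_Y t) hdisj ω
  obtain ⟨hZ, hconf, hΦ⟩ := hω
  have hβ2 := hv.β_sq_le hkT hZ
  have hcen := hv.fsq_center_le hconf hρ
  have hb0 := hv.betaSq_nonneg ζ T
  have hΦ0 := trace_inv_V_pos hv.one_le_n hμ ω t
  -- noise matrices of moderate size give models near the true system
  have hacc : ∀ η : Sys n d, (∀ r' s', |η r' s'| ≤ 1) →
      fsq (p.candidate V Y η - p.Θs) ≤ r ^ 2 := by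
    intro η hη1
    refine (fsq_le_trace_inv_mul_wf hV _).trans (le_trans ?_ hφr)
    rw [p.wf_candidate_sub hV hβ.ne']
    have h1 : fsq η ≤ (n + d) * n := by simpa using fsq_le_of_abs_le η hη1
    have h2 : fsq (η - p.center V Y) ≤ 2 * ((n + d) * n) + 2 * ρ ^ 2 :=
      (fsq_sub_le _ _).trans (by linarith)
    exact mul_le_mul hΦ (mul_le_mul hβ2 h2 (fsq_nonneg _) hb0)
      (mul_nonneg (sq_nonneg _) (fsq_nonneg _)) (hΦ0.le.trans hΦ)
  have hη1 : ∀ r' s', |etaM ω k 0 r' s'| ≤ 1 := fun r' s' => by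
    have h1 := abs_lt.1 (hη r' s')
    exact abs_le.2 ⟨by change _ ≤ ω _; linarith, by change ω _ ≤ _; linarith⟩
  have hη2 : ∀ r' s', |etaM ω' k 0 r' s'| ≤ 1 := fun r' s' => by
    refine le_trans (le_of_eq ?_) (hη1 r' s')
    change |flipOn _ ω _| = |ω _|
    by_cases h : (NoiseIdx.η k 0 r' s' : NoiseIdx n d) ∈ ({.η k 0 i s} : Set (NoiseIdx n d))
    · rw [flipOn_of_mem h, abs_neg]
    · rw [flipOn_of_notMem h]
  -- the first candidate is accepted both before and after the sign change
  have hm : p.mdl ω t = p.candidate V Y (etaM ω k 0) ∧ p.mdl ω t ∈ p.M := by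
    have h1 := hball _ (hacc _ hη1)
    have h2 : p.mdl ω t = p.candidate V Y (etaM ω k 0) := by
      rw [p.mdl_of_dvd ω t (Dvd.intro_left k rfl), ht, Nat.mul_div_cancel _ hτ]
      exact sample_of_mem (η := fun j => etaM ω k j) h1
    exact ⟨h2, h2 ▸ h1⟩
  have hm' : p.mdl ω' t = p.candidate V Y (etaM ω' k 0) ∧ p.mdl ω' t ∈ p.M := by
    have h1 := hball _ (hacc _ hη2)
    have h2 : p.mdl ω' t = p.candidate V Y (etaM ω' k 0) := by
      rw [p.mdl_of_dvd ω' t (Dvd.intro_left k rfl), eV, eY, ht, Nat.mul_div_cancel _ hτ]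
      exact sample_of_mem (η := fun j => etaM ω' k j) h1
    exact ⟨h2, h2 ▸ h1⟩
  set x := ω (.η k 0 i s) with hx
  set u := invSqrt V *ᵥ Pi.single i 1 with hu
  set g : Fin n → ℝ := p.β V • Pi.single s (-(2 * x)) with hg
  -- the two models differ by rank one, and self-exploration applies
  have hdiff : p.mdl ω' t - p.mdl ω t = vecMulVec u g := by
    rw [hm.1, hm'.1, etaM_flip, candidate, candidate, Matrix.mul_add, mul_vecMulVec, smul_add,
      hg, vecMulVec_smul, ← hu]
    rw [add_sub_add_left_eq_sub, add_sub_cancel_left]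
  have hx1 := abs_lt.1 (hη i s)
  have hng : nrm g = p.β V * (2 * x) := by
    have h1 : nrm (Pi.single s (-(2 * x)) : Fin n → ℝ) = 2 * x := by
      have : nrm (Pi.single s (-(2 * x)) : Fin n → ℝ) ^ 2 = (2 * x) ^ 2 := by
        rw [nrm_sq, single_dotProduct, Pi.single_eq_same]; ring
      have h2 := abs_eq_abs.2 (sq_eq_sq_iff_eq_or_eq_neg.1 this)
      rwa [abs_of_nonneg (nrm_nonneg _), abs_of_nonneg (by linarith)] at h2
    rw [hg, nrm_smul, abs_of_pos hβ, h1]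
  have hnu : nrm u ^ 2 = V⁻¹ i i := by rw [hu, ← qf_inv_eq_nrm hV, qf_single]
  have hii : V⁻¹ i i ≤ φ := by
    refine le_trans ?_ hΦ
    refine Finset.single_le_sum (f := fun q => V⁻¹ q q) (fun q _ => ?_) (Finset.mem_univ i)
    rw [← qf_single V⁻¹ q]
    exact qf_nonneg hV.inv _
  have hgu : nrm g * nrm u ≤ 1 := by
    refine le_of_sq_le_sq ?_ zero_le_one
    have hx2 : (2 * x) ^ 2 ≤ 4 := by nlinarith
    have h0 : 0 ≤ V⁻¹ i i := hnu ▸ sq_nonneg _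
    have hφ0 : 0 ≤ φ := hΦ0.le.trans hΦ
    calc (nrm g * nrm u) ^ 2 = p.β V ^ 2 * V⁻¹ i i * (2 * x) ^ 2 := by
          rw [mul_pow, hnu, hng]; ring
      _ ≤ p.betaSq ζ T * φ * 4 := by gcongr
      _ ≤ 1 ^ 2 := by linarith
  have key := hse (p.mdl ω t) (p.mdl ω' t) (hv.stab _ hm.2) (hv.stab _ hm'.2) (hv.norm_le hm.2)
    (hv.norm_le hm'.2) (le_of_sq_le_sq ((norm_sq_le_fsq _).trans (hm'.1 ▸ hacc _ hη2)) hr) u g hdiff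
    hgu
  have h1 := nrm_sq_le_sum_noiseDir hV (gain p.Q p.R (p.mdl ω t)) i
  have h2 := nrm_sq_le_sum_noiseDir hV (gain p.Q p.R (p.mdl ω' t)) i
  have e1 : p.visibility ω t = ∑ j, qf V⁻¹ (noiseDir (gain p.Q p.R (p.mdl ω t)) (.inl j)) := by
    rw [visibility, gainM, if_pos hm.2]
  have e2 : p.visibility ω' t = ∑ j, qf V⁻¹ (noiseDir (gain p.Q p.R (p.mdl ω' t)) (.inl j)) := by
    rw [visibility, gainM, if_pos hm'.2, eV]
  rw [← hu, ← e1] at h1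
  rw [← hu, ← e2] at h2
  have hlow : c * (p.β V * (1 / 2) * V⁻¹ i i) ≤ c * (nrm g * nrm u ^ 2) := by
    have h0 : 0 ≤ V⁻¹ i i := hnu ▸ sq_nonneg _
    rw [hnu, hng]
    gcongr
    linarith
  have h0 : 0 ≤ c * (p.β V * (1 / 2) * V⁻¹ i i) := by
    have h0 : 0 ≤ V⁻¹ i i := hnu ▸ sq_nonneg _
    positivity
  have hsq := pow_le_pow_left₀ h0 (hlow.trans key) 2
  have h3 := add_sq_le (a := nrm (u ∘ Sum.inl + (u ∘ Sum.inr) ᵥ* gain p.Q p.R (p.mdl ω t)))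
    (b := nrm (u ∘ Sum.inl + (u ∘ Sum.inr) ᵥ* gain p.Q p.R (p.mdl ω' t)))
  have e3 : c ^ 2 / 8 * (p.β V ^ 2 * (V⁻¹ i i) ^ 2) =
      (c * (p.β V * (1 / 2) * V⁻¹ i i)) ^ 2 / 2 := by ring
  rw [e3]
  linarith

end Setup

lemma ofReal_min_one_sum_le {α : Type*} (s : Finset α) {f : α → ℝ} (hf : ∀ a, 0 ≤ f a) :
    ENNReal.ofReal (min 1 (∑ a ∈ s, f a)) ≤ ∑ a ∈ s, ENNReal.ofReal (min 1 (f a)) := by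
  rw [← ENNReal.ofReal_sum_of_nonneg fun a _ => le_min zero_le_one (hf a)]
  refine ENNReal.ofReal_le_ofReal ?_
  have h0 : 0 ≤ ∑ a ∈ s, min 1 (f a) := Finset.sum_nonneg fun a _ => le_min zero_le_one (hf a)
  by_cases h : ∀ a ∈ s, f a ≤ 1
  · refine (min_le_right _ _).trans (Finset.sum_le_sum fun a ha => ?_)
    rw [min_eq_right (h a ha)]
  · push Not at h
    obtain ⟨a, ha, h1⟩ := h
    refine (min_le_left _ _).trans ((min_eq_left h1.le).symm.le.trans ?_)
    exact Finset.single_le_sum (f := fun a => min 1 (f a))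
      (fun a _ => le_min zero_le_one (hf a)) ha

namespace Setup

variable {n d : ℕ} {p : Setup n d}

/-- The constants that make sampling informative near the true system. -/
structure SamplingConstants (p : Setup n d) (r c ζ a φ ρ : ℝ) (T : ℕ) : Prop where
  selfExploring : SelfExploring p.Q p.R p.κ p.γ p.S p.Θs r c
  c_pos : 0 < c
  c_le : c ≤ 1
  r_nonneg : 0 ≤ r
  ball : ∀ Θ : Sys n d, fsq (Θ - p.Θs) ≤ r ^ 2 → Θ ∈ p.M
  le_ρ : 2 * a + 2 * p.μ * p.S ^ 2 ≤ ρ ^ 2 * (p.μ * p.S ^ 2)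
  le_r : φ * (p.betaSq ζ T * (2 * ((n + d) * n) + 2 * ρ ^ 2)) ≤ r ^ 2
  le_one : 4 * (p.betaSq ζ T * φ) ≤ 1
  φ_le : φ ≤ 1

variable {r c ζ a φ ρ : ℝ} {T : ℕ}

lemma measurable_indicator_Accurate (h : p.MeasurableSetup) (ζ a φ : ℝ) (t : ℕ) :
    Measurable ((p.Accurate ζ a φ t).indicator (1 : (NoiseIdx n d → ℝ) → ℝ≥0∞)) :=
  measurable_one.indicator (measurableSet_Accurate h ζ a φ t)

lemma dependsOn_indicator_Accurate (p : Setup n d) (ζ a φ : ℝ) (t : ℕ) :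
    DependsOn ((p.Accurate ζ a φ t).indicator (1 : (NoiseIdx n d → ℝ) → ℝ≥0∞))
      (past n d p.τ₀ t t t) := by
  classical
  intro ω ω' h
  have := p.dependsOn_Accurate ζ a φ t h
  simp only at this
  simp only [Set.indicator, Pi.one_apply]
  exact if_congr (iff_of_eq this) rfl rfl

lemma visibility_nonneg (hμ : 0 < p.μ) (ω : NoiseIdx n d → ℝ) (t : ℕ) : 0 ≤ p.visibility ω t :=
  Finset.sum_nonneg fun _ _ => qf_nonneg (p.V_posDef ω t hμ).inv _

/-- The squared size of the random perturbation of the model, in the worst direction. -/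
noncomputable def perturbation (p : Setup n d) (ω : NoiseIdx n d → ℝ) (t : ℕ) : ℝ :=
  p.β (p.V ω t) ^ 2 * (p.V ω t)⁻¹.trace ^ 2

/-- Sampling makes the noise visible in proportion to the perturbation of the model. -/
lemma hitProb_mul_lintegral_perturbation_le (hv : p.Valid)
    (hs : p.SamplingConstants r c ζ a φ ρ T) {k : ℕ} (hkT : k * p.τ₀ ≤ T) :
    hitProb (1 / 4) (fun (_ : Fin n ⊕ Fin d) (_ : Fin n) => (1 / 2 : ℝ)) *
      ∫⁻ ω, (p.Accurate ζ a φ (k * p.τ₀)).indicator 1 ω * ENNReal.ofReal (min 1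
        (c ^ 2 / 8 / (n + d) ^ 2 * p.perturbation ω (k * p.τ₀))) ∂p.law ≤
    2 * (n + d : ℕ) * ∫⁻ ω, (p.Accurate ζ a φ (k * p.τ₀)).indicator 1 ω *
      ENNReal.ofReal (min 1 (p.visibility ω (k * p.τ₀))) ∂p.law := by
  set t := k * p.τ₀ with ht
  have hm := hv.meas
  have hμ := hm.μ_pos
  set H := (p.Accurate ζ a φ t).indicator (1 : (NoiseIdx n d → ℝ) → ℝ≥0∞) with hH
  have hHm : Measurable H := measurable_indicator_Accurate hm ζ a φ t
  have hHd := p.dependsOn_indicator_Accurate ζ a φ t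
  set E : Set (NoiseIdx n d → ℝ) := {ω | ∀ r' s', |ω (.η k 0 r' s') - 1 / 2| < 1 / 4} with hE
  have hEm : MeasurableSet E := by
    rw [hE]
    simp only [Set.ofPred_forall]
    exact MeasurableSet.iInter fun r => MeasurableSet.iInter fun s =>
      measurableSet_lt (by fun_prop) measurable_const
  let J : Set (NoiseIdx n d) := {b | ∃ r s, b = .η k 0 r s}
  have hIJ : Disjoint (past n d p.τ₀ t t t) J := by
    rw [Set.disjoint_right]
    rintro _ ⟨r, s, rfl⟩ h
    exact lt_irrefl (k * p.τ₀) h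
  have hEJ : DependsOn (fun ω => ω ∈ E) J := by
    intro ω ω' h
    refine propext (forall₂_congr fun r s => ?_)
    rw [h _ ⟨r, s, rfl⟩]
  let s : Fin n := ⟨0, hv.one_le_n⟩
  let y : Fin n ⊕ Fin d → (NoiseIdx n d → ℝ) → ℝ := fun i ω =>
    c ^ 2 / 8 * (p.β (p.V ω t) ^ 2 * ((p.V ω t)⁻¹ i i) ^ 2)
  have hym : ∀ i, Measurable (y i) := fun i =>
    (((measurable_β p (hm.V t)).pow_const 2).mul
      ((measurable_entry (measurable_matrix_inv (hm.V t)) i i).pow_const 2)).const_mul _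
  have hyd : ∀ i, DependsOn (y i) (past n d p.τ₀ t t t) := fun i ω ω' h => by
    have := p.dependsOn_V t h
    simp only at this
    simp only [y, this]
  have hone : ∀ i, hitProb (1 / 4) (fun (_ : Fin n ⊕ Fin d) (_ : Fin n) => (1 / 2 : ℝ)) *
      ∫⁻ ω, H ω * ENNReal.ofReal (min 1 (y i ω)) ∂p.law ≤
      2 * ∫⁻ ω, H ω * ENNReal.ofReal (min 1 (p.visibility ω t)) ∂p.law := fun i => by
    rw [← p.law_hit (1 / 4) (fun _ _ => 1 / 2) k 0]
    refine mul_lintegral_le_of_flip (J := J) (A := {.η k 0 i s}) hIJ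
      (Set.disjoint_singleton_right.2 fun h => lt_irrefl (k * p.τ₀) h) hHm hHd hEm hEJ
      (measurable_visibility hm t) (hym i) (hyd i) (visibility_nonneg hμ · t) ?_
    intro ω hω hH0
    have hA : ω ∈ p.Accurate ζ a φ t := by
      by_contra h
      exact hH0 (Set.indicator_of_notMem h _)
    exact le_visibility_add_flip hv hs.selfExploring hs.c_pos.le hs.r_nonneg hs.ball hs.le_ρ
      hs.le_r hs.le_one hkT hA hω i s
  have hlow : ∀ ω, ENNReal.ofReal (min 1 (c ^ 2 / 8 / (n + d) ^ 2 * p.perturbation ω t)) ≤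
      ∑ i, ENNReal.ofReal (min 1 (y i ω)) := fun ω => by
    have hn : (1 : ℝ) ≤ n := by exact_mod_cast hv.one_le_n
    obtain ⟨i, -, hi⟩ : ∃ i ∈ (Finset.univ : Finset (Fin n ⊕ Fin d)),
        (p.V ω t)⁻¹.trace / (n + d) ≤ (p.V ω t)⁻¹ i i := by
      refine Finset.exists_le_of_sum_le ⟨.inl s, Finset.mem_univ _⟩ ?_
      simp only [Finset.sum_const, Finset.card_univ, Fintype.card_sum, Fintype.card_fin,
        nsmul_eq_mul]
      push_cast
      rw [mul_div_cancel₀ _ (by positivity)]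
      exact le_rfl
    have h1 : c ^ 2 / 8 / (n + d) ^ 2 * p.perturbation ω t ≤ y i ω := by
      have h0 : 0 ≤ (p.V ω t)⁻¹.trace / (n + d) :=
        div_nonneg (trace_inv_V_pos hv.one_le_n hμ ω t).le (by positivity)
      have h2 := pow_le_pow_left₀ h0 hi 2
      calc c ^ 2 / 8 / (n + d) ^ 2 * p.perturbation ω t = c ^ 2 / 8 * (p.β (p.V ω t) ^ 2 *
            ((p.V ω t)⁻¹.trace / (n + d)) ^ 2) := by rw [perturbation]; field_simp
        _ ≤ y i ω := by
          simp only [y]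
          gcongr
    exact (ENNReal.ofReal_le_ofReal (min_le_min_left 1 h1)).trans (Finset.single_le_sum
      (f := fun i => ENNReal.ofReal (min 1 (y i ω))) (fun _ _ => zero_le) (Finset.mem_univ i))
  calc _ ≤ hitProb (1 / 4) (fun (_ : Fin n ⊕ Fin d) (_ : Fin n) => (1 / 2 : ℝ)) *
        ∫⁻ ω, ∑ i, H ω * ENNReal.ofReal (min 1 (y i ω)) ∂p.law := by
        refine mul_le_mul_right (α := ℝ≥0∞) (lintegral_mono fun ω => ?_) _
        simp only [← Finset.mul_sum]
        exact mul_le_mul_right (α := ℝ≥0∞) (hlow ω) _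
    _ = ∑ i, hitProb (1 / 4) (fun (_ : Fin n ⊕ Fin d) (_ : Fin n) => (1 / 2 : ℝ)) *
        ∫⁻ ω, H ω * ENNReal.ofReal (min 1 (y i ω)) ∂p.law := by
        have hmm : ∀ i, Measurable fun ω => H ω * ENNReal.ofReal (min 1 (y i ω)) := fun i =>
          hHm.mul (measurable_const.min (hym i)).ennreal_ofReal
        rw [lintegral_finsetSum _ fun i _ => hmm i, Finset.mul_sum]
    _ ≤ ∑ _i : Fin n ⊕ Fin d, 2 * ∫⁻ ω, H ω * ENNReal.ofReal (min 1 (p.visibility ω t)) ∂p.law :=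
        Finset.sum_le_sum fun i _ => hone i
    _ = _ := by
        simp only [Finset.sum_const, Finset.card_univ, Fintype.card_sum, Fintype.card_fin,
          nsmul_eq_mul]
        ring

/-- Visible noise is seen in the next observation. -/
lemma tailProb_mul_lintegral_visibility_le (hv : p.Valid) (ζ a φ : ℝ) {t : ℕ} (ht : p.τ₀ ∣ t) :
    tailProb (Real.toNNReal (p.σ ^ 2)) * ∫⁻ ω, (p.Accurate ζ a φ t).indicator 1 ω *
      ENNReal.ofReal (min 1 (p.visibility ω t)) ∂p.law ≤
    2 * (n : ℕ) * ∫⁻ ω, (p.Accurate ζ a φ t).indicator 1 ω *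
      ENNReal.ofReal (min 1 (qf (p.V ω t)⁻¹ (p.Z ω (t + 1)))) ∂p.law := by
  have hτ3 := hv.three_le_τ₀
  have ht' : ¬p.τ₀ ∣ t + 1 := by
    intro h
    have := (Nat.dvd_add_right ht).1 h
    exact absurd (Nat.le_of_dvd one_pos this) (by omega)
  have hm := hv.meas
  have hμ := hm.μ_pos
  set H := (p.Accurate ζ a φ t).indicator (1 : (NoiseIdx n d → ℝ) → ℝ≥0∞) with hH
  have hHm : Measurable H := measurable_indicator_Accurate hm ζ a φ t
  have hpast : past n d p.τ₀ t t t ⊆ past n d p.τ₀ t (t + 1) (t + 1) :=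
    past_mono le_rfl t.le_succ t.le_succ
  have hHd : DependsOn H (past n d p.τ₀ t (t + 1) (t + 1)) := fun ω ω' h =>
    p.dependsOn_indicator_Accurate ζ a φ t fun i hi => h i (hpast hi)
  let y : Fin n → (NoiseIdx n d → ℝ) → ℝ := fun i ω =>
    qf (p.V ω t)⁻¹ (noiseDir (p.gainM (p.mdl ω t)) (.inl i))
  have hym : ∀ i, Measurable (y i) := fun i =>
    measurable_matrix_qf (measurable_matrix_inv (hm.V t)) (measurable_noiseDir_gain hm t _)
  have hyd : ∀ i, DependsOn (y i) (past n d p.τ₀ t (t + 1) (t + 1)) := fun i ω ω' h => by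
    have h1 := p.dependsOn_V t fun i hi => h i (hpast hi)
    have h2 := p.dependsOn_mdl t h
    simp only at h1 h2
    simp only [y, h1, h2]
  have hone : ∀ i, tailProb (Real.toNNReal (p.σ ^ 2)) *
      ∫⁻ ω, H ω * ENNReal.ofReal (min 1 (y i ω)) ∂p.law ≤
      2 * ∫⁻ ω, H ω * ENNReal.ofReal (min 1 (qf (p.V ω t)⁻¹ (p.Z ω (t + 1)))) ∂p.law := fun i => by
    have e : tailProb (Real.toNNReal (p.σ ^ 2)) = p.law {ω | 1 ≤ |ω (.w t i)|} :=
      (p.law_one_le_abs (.w t i)).symm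
    rw [e]
    refine mul_lintegral_le_of_flip (J := {.w t i}) (A := {.w t i}) (disjoint_past_w i)
      (disjoint_past_w i) hHm hHd (measurableSet_le measurable_const (by fun_prop)) ?_
      (measurable_matrix_qf (measurable_matrix_inv (hm.V t)) (hm.Z (t + 1))) (hym i) (hyd i)
      (fun ω => qf_nonneg (p.V_posDef ω t hμ).inv _) ?_
    · intro ω ω' h
      have := h (.w t i) rfl
      simp only [Set.mem_ofPred_eq, this]
    · intro ω hω _
      have hV := p.V_posDef ω t hμ
      have e1 : p.V (flipOn {.w t i} ω) t = p.V ω t :=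
        comp_flipOn_of_dependsOn (p.dependsOn_V t) (disjoint_past_w i) ω
      simp only [e1, y, qf_inv_eq_nrm hV]
      have h1 := sq_mul_le_of_sub_eq (x := invSqrt (p.V ω t) *ᵥ p.Z ω (t + 1))
        (y := invSqrt (p.V ω t) *ᵥ p.Z (flipOn {.w t i} ω) (t + 1))
        (v := invSqrt (p.V ω t) *ᵥ noiseDir (p.gainM (p.mdl ω t)) (.inl i))
        (c := ω (.w t i)) (by rw [Z_flip_w ω ht' i, mulVec_sub, mulVec_smul])
      have h2 : 1 ≤ ω (.w t i) ^ 2 := by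
        rw [← sq_abs]; exact one_le_pow₀ hω
      exact (le_mul_of_one_le_left (sq_nonneg _) h2).trans h1
  calc _ ≤ tailProb (Real.toNNReal (p.σ ^ 2)) *
        ∫⁻ ω, ∑ i, H ω * ENNReal.ofReal (min 1 (y i ω)) ∂p.law := by
        refine mul_le_mul_right (α := ℝ≥0∞) (lintegral_mono fun ω => ?_) _
        simp only [← Finset.mul_sum]
        exact mul_le_mul_right (α := ℝ≥0∞) (ofReal_min_one_sum_le _ fun i =>
          qf_nonneg (p.V_posDef ω t hμ).inv _) _
    _ = ∑ i, tailProb (Real.toNNReal (p.σ ^ 2)) *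
        ∫⁻ ω, H ω * ENNReal.ofReal (min 1 (y i ω)) ∂p.law := by
        have hmm : ∀ i, Measurable fun ω => H ω * ENNReal.ofReal (min 1 (y i ω)) := fun i =>
          hHm.mul (measurable_const.min (hym i)).ennreal_ofReal
        rw [lintegral_finsetSum _ fun i _ => hmm i, Finset.mul_sum]
    _ ≤ ∑ _i : Fin n, 2 * ∫⁻ ω, H ω *
        ENNReal.ofReal (min 1 (qf (p.V ω t)⁻¹ (p.Z ω (t + 1)))) ∂p.law :=
        Finset.sum_le_sum fun i _ => hone i
    _ = _ := by
        simp only [Finset.sum_const, Finset.card_univ, Fintype.card_fin, nsmul_eq_mul]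
        ring

/-- The observation `z_{t+1}` increases `log det V` at least as much as if `z_t` were absent. -/
lemma log_one_add_qf_le (hμ : 0 < p.μ) (ω : NoiseIdx n d → ℝ) (t : ℕ) :
    Real.log (1 + qf (p.V ω t)⁻¹ (p.Z ω (t + 1))) ≤
      Real.log (p.V ω (t + 2)).det - Real.log (p.V ω t).det := by
  have hV := p.V_posDef ω t hμ
  have hW := posDef_add_vecMulVec hV (p.Z ω (t + 1))
  have hq := qf_nonneg hV.inv (p.Z ω (t + 1))
  have hq' := qf_nonneg hW.inv (p.Z ω t)
  have e : p.V ω (t + 2) = p.V ω t + vecMulVec (p.Z ω (t + 1)) (p.Z ω (t + 1)) +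
      vecMulVec (p.Z ω t) (p.Z ω t) := by
    rw [V_succ, V_succ]; abel
  rw [e, det_add_vecMulVec hW, det_add_vecMulVec hV, Real.log_mul (by
    have := hV.det_pos; positivity) (by positivity), Real.log_mul hV.det_pos.ne' (by positivity)]
  have := Real.log_nonneg (show 1 ≤ 1 + qf (p.V ω t + vecMulVec (p.Z ω (t + 1))
    (p.Z ω (t + 1)))⁻¹ (p.Z ω t) by linarith)
  linarith

lemma log_det_mono (hμ : 0 < p.μ) (ω : NoiseIdx n d → ℝ) {s t : ℕ} (hst : s ≤ t) :
    Real.log (p.V ω s).det ≤ Real.log (p.V ω t).det := by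
  induction t, hst using Nat.le_induction with
  | base => exact le_rfl
  | succ t _ ih =>
    rw [p.log_det_succ hμ]
    linarith [p.log_one_add_qf_nonneg hμ ω t]

lemma min_one_le_two_mul_log {x : ℝ} (hx : 0 ≤ x) : min 1 x ≤ 2 * Real.log (1 + x) := by
  rcases le_total 1 x with h | h
  · have h1 : Real.log 2 ≤ Real.log (1 + x) := Real.log_le_log two_pos (by linarith)
    have := Real.log_two_gt_d9
    linarith [min_le_left 1 x]
  · have h1 := Real.one_sub_inv_le_log_of_pos (show 0 < 1 + x by linarith)
    have h2 : x / 2 ≤ 1 - (1 + x)⁻¹ := by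
      have e : 1 - (1 + x)⁻¹ = x / (1 + x) := by field_simp; ring
      rw [e]
      exact div_le_div_of_nonneg_left hx (by positivity) (by linarith)
    linarith [min_le_right 1 x]

lemma sum_min_one_le (hv : p.Valid) (ω : NoiseIdx n d → ℝ) (k : ℕ) :
    ∑ j ∈ Finset.range k, min 1 (qf (p.V ω (j * p.τ₀))⁻¹ (p.Z ω (j * p.τ₀ + 1))) ≤
      2 * (Real.log (p.V ω (k * p.τ₀)).det - Real.log (p.V ω 0).det) := by
  have hμ := hv.meas.μ_pos
  induction k with
  | zero => simp
  | succ k ih =>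
    rw [Finset.sum_range_succ]
    have h1 := min_one_le_two_mul_log
      (qf_nonneg (p.V_posDef ω (k * p.τ₀) hμ).inv (p.Z ω (k * p.τ₀ + 1)))
    have h2 := log_one_add_qf_le hμ ω (k * p.τ₀)
    have h3 := log_det_mono hμ ω (s := k * p.τ₀ + 2) (t := (k + 1) * p.τ₀) (by
      have := hv.three_le_τ₀
      rw [add_mul, one_mul]; omega)
    linarith

/-- The elliptical potential lemma for the second observations of the epochs. -/
lemma sum_indicator_Accurate_le (hv : p.Valid) (ζ a φ : ℝ) (ω : NoiseIdx n d → ℝ) {k T : ℕ}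
    (hk : ∀ j < k, j * p.τ₀ ≤ T) :
    ∑ j ∈ Finset.range k, (p.Accurate ζ a φ (j * p.τ₀)).indicator (fun ω =>
      min 1 (qf (p.V ω (j * p.τ₀))⁻¹ (p.Z ω (j * p.τ₀ + 1)))) ω ≤ 2 * p.potential T ζ + 1 := by
  have hμ := hv.meas.μ_pos
  induction k with
  | zero =>
    have := p.potential_nonneg hv.one_le_n hμ T ζ
    simp only [Finset.range_zero, Finset.sum_empty]
    linarith
  | succ k ih =>
    rw [Finset.sum_range_succ]
    by_cases h : ω ∈ p.Accurate ζ a φ (k * p.τ₀)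
    · rw [Set.indicator_of_mem h]
      have h1 : ∑ j ∈ Finset.range k, (p.Accurate ζ a φ (j * p.τ₀)).indicator (fun ω =>
          min 1 (qf (p.V ω (j * p.τ₀))⁻¹ (p.Z ω (j * p.τ₀ + 1)))) ω ≤
          ∑ j ∈ Finset.range k, min 1 (qf (p.V ω (j * p.τ₀))⁻¹ (p.Z ω (j * p.τ₀ + 1))) :=
        Finset.sum_le_sum fun j _ => Set.indicator_le_self' (fun ω _ =>
          le_min zero_le_one (qf_nonneg (p.V_posDef ω (j * p.τ₀) hμ).inv _)) ω
      have h2 := sum_min_one_le hv ω k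
      have h3 := p.log_det_sub_le hv.one_le_n hμ ω (k * p.τ₀) h.1
      have h4 := p.potential_mono hv.one_le_n hμ (hk k k.lt_succ_self) ζ
      linarith [min_le_left 1 (qf (p.V ω (k * p.τ₀))⁻¹ (p.Z ω (k * p.τ₀ + 1)))]
    · rw [Set.indicator_of_notMem h, add_zero]
      exact ih fun j hj => hk j (by omega)

lemma ofReal_indicator {Ω : Type*} (A : Set Ω) (f : Ω → ℝ) (ω : Ω) :
    ENNReal.ofReal (A.indicator f ω) = A.indicator (1 : Ω → ℝ≥0∞) ω * ENNReal.ofReal (f ω) := by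
  by_cases h : ω ∈ A
  · rw [Set.indicator_of_mem h, Set.indicator_of_mem h, Pi.one_apply, one_mul]
  · rw [Set.indicator_of_notMem h, Set.indicator_of_notMem h, ENNReal.ofReal_zero, zero_mul]

lemma perturbation_le (hv : p.Valid) (hs : p.SamplingConstants r c ζ a φ ρ T) {t : ℕ}
    (htT : t ≤ T) {ω : NoiseIdx n d → ℝ} (hω : ω ∈ p.Accurate ζ a φ t) :
    p.perturbation ω t ≤ 1 := by
  obtain ⟨hZ, -, hΦ⟩ := hω
  have hβ2 := hv.β_sq_le htT hZ
  have hΦ0 := trace_inv_V_pos hv.one_le_n hv.meas.μ_pos ω t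
  have hφ0 := hΦ0.le.trans hΦ
  have hb := hv.betaSq_nonneg ζ T
  calc p.perturbation ω t ≤ p.betaSq ζ T * φ ^ 2 := by
        rw [perturbation]; gcongr
    _ = p.betaSq ζ T * φ * φ := by ring
    _ ≤ p.betaSq ζ T * φ * 1 := by gcongr; exact hs.φ_le
    _ ≤ 1 := by linarith [hs.le_one, mul_nonneg hb hφ0]

/-- The chain from the perturbation of the model to the visibility of the noise and on to the next
observation. -/
lemma mul_lintegral_trace_sq_le (hv : p.Valid) (hs : p.SamplingConstants r c ζ a φ ρ T) {k : ℕ}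
    (hkT : k * p.τ₀ ≤ T) :
    hitProb (1 / 4) (fun (_ : Fin n ⊕ Fin d) (_ : Fin n) => (1 / 2 : ℝ)) *
      tailProb (Real.toNNReal (p.σ ^ 2)) * ENNReal.ofReal (c ^ 2 / 8 / (n + d) ^ 2) *
      ∫⁻ ω, ENNReal.ofReal ((p.Accurate ζ a φ (k * p.τ₀)).indicator (fun ω =>
        p.μ * p.S ^ 2 * (p.V ω (k * p.τ₀))⁻¹.trace ^ 2) ω) ∂p.law ≤
    4 * n * (n + d : ℕ) * ∫⁻ ω, ENNReal.ofReal ((p.Accurate ζ a φ (k * p.τ₀)).indicator (fun ω =>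
      min 1 (qf (p.V ω (k * p.τ₀))⁻¹ (p.Z ω (k * p.τ₀ + 1)))) ω) ∂p.law := by
  set t := k * p.τ₀ with ht
  have h1 := hitProb_mul_lintegral_perturbation_le hv hs hkT
  have h2 := tailProb_mul_lintegral_visibility_le hv ζ a φ (Dvd.intro_left k rfl : p.τ₀ ∣ t)
  rw [← ht] at h1
  simp only [ofReal_indicator]
  set hp := hitProb (1 / 4) (fun (_ : Fin n ⊕ Fin d) (_ : Fin n) => (1 / 2 : ℝ)) with hhp
  set tp := tailProb (Real.toNNReal (p.σ ^ 2)) with htp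
  set R := ∫⁻ ω, (p.Accurate ζ a φ t).indicator (1 : (NoiseIdx n d → ℝ) → ℝ≥0∞) ω *
      ENNReal.ofReal (min 1 (qf (p.V ω t)⁻¹ (p.Z ω (t + 1)))) ∂p.law with hR
  set W := ∫⁻ ω, (p.Accurate ζ a φ t).indicator (1 : (NoiseIdx n d → ℝ) → ℝ≥0∞) ω *
      ENNReal.ofReal (min 1 (p.visibility ω t)) ∂p.law with hW
  have hn : (1 : ℝ) ≤ n := by exact_mod_cast hv.one_le_n
  have hd : (0 : ℝ) ≤ d := Nat.cast_nonneg d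
  have hc2 : c ^ 2 / 8 / (n + d) ^ 2 ≤ 1 := by
    rw [div_div, div_le_one (by positivity)]
    have h3 : c ^ 2 ≤ 1 := pow_le_one₀ hs.c_pos.le hs.c_le
    have h4 : 1 ≤ (n + d : ℝ) ^ 2 := one_le_pow₀ (by linarith)
    linarith
  have hle : ENNReal.ofReal (c ^ 2 / 8 / (n + d) ^ 2) *
      ∫⁻ ω, (p.Accurate ζ a φ t).indicator (1 : (NoiseIdx n d → ℝ) → ℝ≥0∞) ω *
        ENNReal.ofReal (p.μ * p.S ^ 2 * (p.V ω t)⁻¹.trace ^ 2) ∂p.law ≤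
      ∫⁻ ω, (p.Accurate ζ a φ t).indicator (1 : (NoiseIdx n d → ℝ) → ℝ≥0∞) ω *
        ENNReal.ofReal (min 1 (c ^ 2 / 8 / (n + d) ^ 2 * p.perturbation ω t)) ∂p.law := by
    rw [← lintegral_const_mul' _ _ ENNReal.ofReal_ne_top]
    refine lintegral_mono fun ω => ?_
    by_cases h : ω ∈ p.Accurate ζ a φ t
    · rw [Set.indicator_of_mem h, Pi.one_apply, one_mul, one_mul,
        ← ENNReal.ofReal_mul (by positivity)]
      refine ENNReal.ofReal_le_ofReal (le_min ?_ ?_)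
      · have h5 := perturbation_le hv hs hkT h
        have h6 : p.μ * p.S ^ 2 * (p.V ω t)⁻¹.trace ^ 2 ≤ p.perturbation ω t :=
          mul_le_mul_of_nonneg_right (hv.mul_le_β_sq _) (sq_nonneg _)
        have h7 : 0 ≤ p.μ * p.S ^ 2 * (p.V ω t)⁻¹.trace ^ 2 := by
          have := hv.meas.μ_pos
          positivity
        exact mul_le_one₀ hc2 h7 (h6.trans h5)
      · exact mul_le_mul_of_nonneg_left
          (mul_le_mul_of_nonneg_right (hv.mul_le_β_sq _) (sq_nonneg _)) (by positivity)
    · rw [Set.indicator_of_notMem h, zero_mul, mul_zero]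
      exact zero_le
  calc _ ≤ hp * tp * ∫⁻ ω, (p.Accurate ζ a φ t).indicator (1 : (NoiseIdx n d → ℝ) → ℝ≥0∞) ω *
        ENNReal.ofReal (min 1 (c ^ 2 / 8 / (n + d) ^ 2 * p.perturbation ω t)) ∂p.law := by
        rw [mul_assoc]
        exact mul_le_mul_right (α := ℝ≥0∞) hle _
    _ ≤ tp * (2 * (n + d : ℕ) * W) := by
        rw [mul_comm hp, mul_assoc]
        exact mul_le_mul_right (α := ℝ≥0∞) h1 _
    _ = 2 * (n + d : ℕ) * (tp * W) := by ring
    _ ≤ 2 * (n + d : ℕ) * (2 * n * R) := mul_le_mul_right (α := ℝ≥0∞) h2 _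
    _ = _ := by ring

/-- In the accurate epochs the squares of `tr V⁻¹` have a small sum. -/
lemma exists_law_sum_trace_sq_ge_le (n d : ℕ) {σ c : ℝ} (hn : 1 ≤ n) (hσ : 0 < σ) (hc : 0 < c) :
    ∃ C > 0, ∀ p : Setup n d, p.Valid → p.σ = σ → ∀ (r ζ a φ ρ : ℝ) (T : ℕ),
      p.SamplingConstants r c ζ a φ ρ T → ∀ k : ℕ, (∀ j < k, j * p.τ₀ ≤ T) → ∀ x > 0,
      p.law {ω | x ≤ ∑ j ∈ Finset.range k, (p.Accurate ζ a φ (j * p.τ₀)).indicator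
        (fun ω => p.μ * p.S ^ 2 * (p.V ω (j * p.τ₀))⁻¹.trace ^ 2) ω} ≤
      ENNReal.ofReal (C * (2 * p.potential T ζ + 1) / x) := by
  set hp := hitProb (1 / 4) (fun (_ : Fin n ⊕ Fin d) (_ : Fin n) => (1 / 2 : ℝ)) with hhp
  set tp := tailProb (Real.toNNReal (σ ^ 2)) with htp
  have hn' : (1 : ℝ) ≤ n := by exact_mod_cast hn
  have hp0 : 0 < hp := hitProb_pos (by norm_num) _
  have tp0 : 0 < tp := tailProb_pos (by
    rw [Ne, Real.toNNReal_eq_zero, not_le]; positivity)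
  have hpt : hp ≠ ∞ := ne_top_of_le_ne_top ENNReal.one_ne_top (hitProb_le_one _ _)
  have tpt : tp ≠ ∞ := ne_top_of_le_ne_top ENNReal.one_ne_top prob_le_one
  set e : ℝ≥0∞ := hp * tp * ENNReal.ofReal (c ^ 2 / 8 / (n + d) ^ 2) with he
  have e0 : e ≠ 0 := by
    refine mul_ne_zero (mul_ne_zero hp0.ne' tp0.ne') ?_
    rw [Ne, ENNReal.ofReal_eq_zero, not_le]
    positivity
  have et : e ≠ ∞ := ENNReal.mul_ne_top (ENNReal.mul_ne_top hpt tpt) ENNReal.ofReal_ne_top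
  set N : ℝ≥0∞ := 4 * n * (n + d : ℕ) with hN
  have hN0 : N ≠ 0 := by
    refine mul_ne_zero (mul_ne_zero (by norm_num) ?_) ?_
    · exact_mod_cast (by omega : n ≠ 0)
    · exact_mod_cast (by omega : n + d ≠ 0)
  have hNt : N ≠ ∞ := ENNReal.mul_ne_top (ENNReal.mul_ne_top (by norm_num)
    (ENNReal.natCast_ne_top n)) (ENNReal.natCast_ne_top _)
  have hNe : N / e ≠ ∞ := ENNReal.div_ne_top hNt e0
  refine ⟨(N / e).toReal, ENNReal.toReal_pos (ENNReal.div_pos hN0 et).ne' hNe, ?_⟩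
  intro p hv hpσ r ζ a φ ρ T hs k hk x hx
  have hm := hv.meas
  have hμ := hm.μ_pos
  set A : ℕ → (NoiseIdx n d → ℝ) → ℝ := fun j => (p.Accurate ζ a φ (j * p.τ₀)).indicator
    (fun ω => p.μ * p.S ^ 2 * (p.V ω (j * p.τ₀))⁻¹.trace ^ 2) with hA
  set B : ℕ → (NoiseIdx n d → ℝ) → ℝ := fun j => (p.Accurate ζ a φ (j * p.τ₀)).indicator
    (fun ω => min 1 (qf (p.V ω (j * p.τ₀))⁻¹ (p.Z ω (j * p.τ₀ + 1)))) with hB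
  have hA0 : ∀ j ω, 0 ≤ A j ω := fun j ω => Set.indicator_nonneg (fun ω _ => by positivity) ω
  have hB0 : ∀ j ω, 0 ≤ B j ω := fun j ω => Set.indicator_nonneg (fun ω _ =>
    le_min zero_le_one (qf_nonneg (p.V_posDef ω _ hμ).inv _)) ω
  have hAm : ∀ j, Measurable (A j) := fun j =>
    (((measurable_matrix_trace (measurable_matrix_inv (hm.V _))).pow_const 2).const_mul _).indicator
      (measurableSet_Accurate hm ζ a φ _)
  have hBm : ∀ j, Measurable (B j) := fun j =>
    (measurable_const.min (measurable_matrix_qf (measurable_matrix_inv (hm.V _)) (hm.Z _))).indicator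
      (measurableSet_Accurate hm ζ a φ _)
  have hone : ∀ j ∈ Finset.range k, e * ∫⁻ ω, ENNReal.ofReal (A j ω) ∂p.law ≤
      N * ∫⁻ ω, ENNReal.ofReal (B j ω) ∂p.law := fun j hj => by
    have := mul_lintegral_trace_sq_le hv hs (hk j (Finset.mem_range.1 hj))
    rw [hpσ] at this
    exact this
  have hsum : e * ∫⁻ ω, ENNReal.ofReal (∑ j ∈ Finset.range k, A j ω) ∂p.law ≤
      N * ENNReal.ofReal (2 * p.potential T ζ + 1) := by
    calc _ = ∑ j ∈ Finset.range k, e * ∫⁻ ω, ENNReal.ofReal (A j ω) ∂p.law := by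
          rw [← Finset.mul_sum, ← lintegral_finsetSum _ fun j _ => (hAm j).ennreal_ofReal]
          congr 1
          refine lintegral_congr fun ω => ?_
          rw [ENNReal.ofReal_sum_of_nonneg fun j _ => hA0 j ω]
      _ ≤ ∑ j ∈ Finset.range k, N * ∫⁻ ω, ENNReal.ofReal (B j ω) ∂p.law :=
          Finset.sum_le_sum hone
      _ = N * ∫⁻ ω, ENNReal.ofReal (∑ j ∈ Finset.range k, B j ω) ∂p.law := by
          rw [← Finset.mul_sum, ← lintegral_finsetSum _ fun j _ => (hBm j).ennreal_ofReal]
          congr 1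
          refine lintegral_congr fun ω => ?_
          rw [ENNReal.ofReal_sum_of_nonneg fun j _ => hB0 j ω]
      _ ≤ N * ∫⁻ _, ENNReal.ofReal (2 * p.potential T ζ + 1) ∂p.law := by
          refine mul_le_mul_right (α := ℝ≥0∞) (lintegral_mono fun ω => ?_) _
          exact ENNReal.ofReal_le_ofReal (sum_indicator_Accurate_le hv ζ a φ ω hk)
      _ = _ := by rw [lintegral_const, measure_univ, mul_one]
  have h1 := meas_ge_le_lintegral_div (μ := p.law)
    (Finset.measurable_sum _ fun j _ => hAm j : Measurable fun ω =>
      ∑ j ∈ Finset.range k, A j ω).ennreal_ofReal.aemeasurable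
    (ε := ENNReal.ofReal x) (by simpa using hx) ENNReal.ofReal_ne_top
  rw [ENNReal.ofReal_div_of_pos hx, ENNReal.ofReal_mul ENNReal.toReal_nonneg,
    ENNReal.ofReal_toReal hNe]
  refine (measure_mono fun ω hω => ENNReal.ofReal_le_ofReal hω).trans (h1.trans ?_)
  refine ENNReal.div_le_div_right ?_ _
  rw [ENNReal.div_eq_inv_mul, mul_assoc, ← ENNReal.div_eq_inv_mul,
    ENNReal.le_div_iff_mul_le (Or.inl e0) (Or.inl et), mul_comm]
  exact hsum

end Setup

/-! ### The regret of a typical run -/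

lemma sum_range_mul_div {τ : ℕ} (hτ : 0 < τ) (f : ℕ → ℝ) (k : ℕ) :
    ∑ t ∈ Finset.range (k * τ), f (t / τ) = τ * ∑ j ∈ Finset.range k, f j := by
  induction k with
  | zero => simp
  | succ k ih =>
    rw [add_mul, one_mul, Finset.sum_range_add, ih, Finset.sum_range_succ, mul_add]
    congr 1
    have : ∀ i ∈ Finset.range τ, f ((k * τ + i) / τ) = f k := fun i hi => by
      rw [mul_comm, Nat.mul_add_div hτ, Nat.div_eq_of_lt (Finset.mem_range.1 hi), add_zero]
    rw [Finset.sum_congr rfl this, Finset.sum_const, Finset.card_range, nsmul_eq_mul]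

lemma sum_range_div_le {τ : ℕ} (hτ : 0 < τ) {f : ℕ → ℝ} (hf : ∀ j, 0 ≤ f j) (T : ℕ) :
    ∑ t ∈ Finset.range (T + 1), f (t / τ) ≤ τ * ∑ j ∈ Finset.range (T / τ + 1), f j := by
  rw [← sum_range_mul_div hτ]
  refine Finset.sum_le_sum_of_subset_of_nonneg ?_ fun _ _ _ => hf _
  refine Finset.range_subset_range.2 ?_
  rw [mul_comm]
  exact Nat.lt_mul_div_succ T hτ

namespace Setup

variable {n d : ℕ} {p : Setup n d}

lemma nrm_X_le (ω : NoiseIdx n d → ℝ) (t : ℕ) : nrm (p.X ω t) ≤ nrm (p.Z ω t) := by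
  refine Real.sqrt_le_sqrt ?_
  rw [Z_eq, dotProduct, dotProduct, Fintype.sum_sum_type]
  exact le_add_of_nonneg_right (Finset.sum_nonneg fun _ _ => mul_self_nonneg _)

lemma nrm_U_le (ω : NoiseIdx n d → ℝ) (t : ℕ) : nrm (p.U ω t) ≤ nrm (p.Z ω t) := by
  refine Real.sqrt_le_sqrt ?_
  rw [Z_eq, dotProduct, dotProduct, Fintype.sum_sum_type]
  exact le_add_of_nonneg_left (Finset.sum_nonneg fun _ _ => mul_self_nonneg _)

/-- The value of `tr V⁻¹` at the beginning of the epoch of `t`, once exploration has ended. -/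
noncomputable def uncertainty (p : Setup n d) (ω : NoiseIdx n d → ℝ) (t : ℕ) : ℝ :=
  if (t : ℝ) ≤ p.Tw then 0 else (p.V ω (t / p.τ₀ * p.τ₀))⁻¹.trace

lemma uncertainty_nonneg (hv : p.Valid) (ω : NoiseIdx n d → ℝ) (t : ℕ) :
    0 ≤ p.uncertainty ω t := by
  unfold uncertainty
  split_ifs
  · exact le_rfl
  · exact (trace_inv_V_pos hv.one_le_n hv.meas.μ_pos ω _).le

variable {r C a L b ζ ρ ε Λ g : ℝ} {T : ℕ} {N : Set ((Fin n ⊕ Fin d) → Fin n → ℝ)}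
  {ω : NoiseIdx n d → ℝ}

/-- The deviation from the optimal input is of the order of one in the exploration phase, and of the
order of the error of the model afterwards. -/
lemma nrm_U_sub_sq_le (hv : p.Valid) (hΛ : 0 ≤ Λ)
    (hlip : ∀ Θ ∈ p.M, ‖gain p.Q p.R Θ - gain p.Q p.R p.Θs‖ ≤ Λ * ‖Θ - p.Θs‖) {t : ℕ}
    (hM : p.mdl ω t ∈ p.M) (hZ : nrm (p.Z ω t) ≤ ζ)
    (hwf : wf (p.V ω (t / p.τ₀ * p.τ₀)) (p.mdl ω t - p.Θs) ≤ b ^ 2) :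
    nrm (p.U ω t - gain p.Q p.R p.Θs *ᵥ p.X ω t) ^ 2 ≤
      (if (t : ℝ) ≤ p.Tw then ((1 + p.κ) * ζ) ^ 2 else 0) +
        (Λ * ζ * b) ^ 2 * p.uncertainty ω t := by
  have hX := (nrm_X_le ω t).trans hZ
  have hU := (nrm_U_le ω t).trans hZ
  have hX0 := nrm_nonneg (p.X ω t)
  have hζ : 0 ≤ ζ := hX0.trans hX
  by_cases ht : (t : ℝ) ≤ p.Tw
  · rw [if_pos ht, uncertainty, if_pos ht, mul_zero, add_zero]
    refine pow_le_pow_left₀ (nrm_nonneg _) ((nrm_sub_le _ _).trans ?_) 2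
    have h1 := nrm_mulVec_le (gain p.Q p.R p.Θs) (p.X ω t)
    have h2 : ‖gain p.Q p.R p.Θs‖ * nrm (p.X ω t) ≤ p.κ * ζ :=
      mul_le_mul (hv.stab _ hv.mem).1 hX hX0 (by linarith [hv.κ])
    linarith
  · rw [if_neg ht, uncertainty, if_neg ht, zero_add]
    have e : p.U ω t - gain p.Q p.R p.Θs *ᵥ p.X ω t =
        (gain p.Q p.R (p.mdl ω t) - gain p.Q p.R p.Θs) *ᵥ p.X ω t := by
      rw [U_eq, gainM, if_pos hM, nuv, if_neg ht, add_zero, sub_mulVec]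
    have hV := p.V_posDef ω (t / p.τ₀ * p.τ₀) hv.meas.μ_pos
    have hΦ := trace_inv_V_pos hv.one_le_n hv.meas.μ_pos ω (t / p.τ₀ * p.τ₀)
    have h1 : ‖p.mdl ω t - p.Θs‖ ^ 2 ≤ (p.V ω (t / p.τ₀ * p.τ₀))⁻¹.trace * b ^ 2 :=
      (norm_sq_le_fsq _).trans ((fsq_le_trace_inv_mul_wf hV _).trans
        (mul_le_mul_of_nonneg_left hwf hΦ.le))
    have h2 : nrm (p.U ω t - gain p.Q p.R p.Θs *ᵥ p.X ω t) ≤ Λ * ‖p.mdl ω t - p.Θs‖ * ζ := by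
      rw [e]
      exact (nrm_mulVec_le _ _).trans (mul_le_mul (hlip _ hM) hX hX0 (by positivity))
    calc nrm (p.U ω t - gain p.Q p.R p.Θs *ᵥ p.X ω t) ^ 2
        ≤ (Λ * ‖p.mdl ω t - p.Θs‖ * ζ) ^ 2 := pow_le_pow_left₀ (nrm_nonneg _) h2 2
      _ = (Λ * ζ) ^ 2 * ‖p.mdl ω t - p.Θs‖ ^ 2 := by ring
      _ ≤ (Λ * ζ) ^ 2 * ((p.V ω (t / p.τ₀ * p.τ₀))⁻¹.trace * b ^ 2) := by gcongr
      _ = _ := by ring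

lemma card_filter_le_add_one {x : ℝ} (hx : 0 ≤ x) (T : ℕ) :
    (((Finset.range T).filter fun t : ℕ => (t : ℝ) ≤ x).card : ℝ) ≤ x + 1 := by
  have h : (Finset.range T).filter (fun t : ℕ => (t : ℝ) ≤ x) ⊆ Finset.range (⌊x⌋₊ + 1) := by
    intro t ht
    exact Finset.mem_range.2 (Nat.lt_succ_of_le (Nat.le_floor (Finset.mem_filter.1 ht).2))
  have h1 := Finset.card_le_card h
  rw [Finset.card_range] at h1
  calc (((Finset.range T).filter fun t : ℕ => (t : ℝ) ≤ x).card : ℝ) ≤ (⌊x⌋₊ + 1 : ℕ) := by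
        exact_mod_cast h1
    _ ≤ x + 1 := by push_cast; linarith [Nat.floor_le hx]

/-- The regret in terms of the length of the exploration phase and of the later uncertainty. -/
lemma Constants.regret_le (hc : p.Constants r C a L b ζ ρ ε T) (hv : p.Valid)
    (hN : ∀ η : Sys n d, fsq η ≤ ρ ^ 2 → ∃ c ∈ N, ∀ r s, |η r s - c r s| < ε)
    (hL : ω ∈ NoiseLE n d T L) (hH : ω ∈ Hits n d T ε N) (hs : p.stoppedConf ζ a ω T ≤ a)
    (hQ : p.Q.PosDef) (hR : p.R.PosDef) {α : ℝ} (hα : 0 < α)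
    (hQα : ∀ x, α * nrm x ^ 2 ≤ qf p.Q x) (hΛ : 0 ≤ Λ)
    (hlip : ∀ Θ ∈ p.M, ‖gain p.Q p.R Θ - gain p.Q p.R p.Θs‖ ≤ Λ * ‖Θ - p.Θs‖)
    (hg : ‖p.R + p.Θs.Bᵀ * riccati p.Q p.R p.Θs * p.Θs.B‖ ≤ g) (hTw : 0 ≤ p.Tw) {x : ℝ}
    (hx : p.stoppedCross ζ a ω (T + 1) ≤ x)
    (hx' : ∑ t ∈ Finset.range (T + 1), p.noiseTerm ω t ≤ x) :
    p.regret ω T ≤ 2 * x + g * (((1 + p.κ) * ζ) ^ 2 * (p.Tw + 1) +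
      (Λ * ζ * b) ^ 2 * ∑ t ∈ Finset.range (T + 1), p.uncertainty ω t) := by
  have hgood := hc.good hv hN hL hH hs
  have hM : ∀ t ≤ T, p.mdl ω t ∈ p.M := fun t ht => (hgood t ht t le_rfl).1
  have h1 := Setup.regret_le hv hQ hR hα hQα hM
  have hg0 : 0 ≤ g := (norm_nonneg _).trans hg
  have h2 : ∑ t ∈ Finset.range (T + 1), p.crossTerm ω t = p.stoppedCross ζ a ω (T + 1) :=
    Finset.sum_congr rfl fun t ht =>
      (Set.indicator_of_mem (f := fun ω => p.crossTerm ω t)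
        (hgood t (Nat.lt_succ_iff.1 (Finset.mem_range.1 ht)))).symm
  have h3 : ∑ t ∈ Finset.range (T + 1), qf (p.R + p.Θs.Bᵀ * riccati p.Q p.R p.Θs * p.Θs.B)
      (p.U ω t - gain p.Q p.R p.Θs *ᵥ p.X ω t) ≤ ∑ t ∈ Finset.range (T + 1),
        g * ((if (t : ℝ) ≤ p.Tw then ((1 + p.κ) * ζ) ^ 2 else 0) +
          (Λ * ζ * b) ^ 2 * p.uncertainty ω t) := by
    refine Finset.sum_le_sum fun t ht => (qf_le _ _).trans ?_
    have htT := Nat.lt_succ_iff.1 (Finset.mem_range.1 ht)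
    exact mul_le_mul hg (nrm_U_sub_sq_le hv hΛ hlip (hM t htT) (hgood t htT t le_rfl).2.1
      (hc.wf_mdl_sub_le hv hN hL hH hs htT)) (sq_nonneg _) hg0
  have h4 : ∑ t ∈ Finset.range (T + 1), (if (t : ℝ) ≤ p.Tw then ((1 + p.κ) * ζ) ^ 2 else 0) ≤
      ((1 + p.κ) * ζ) ^ 2 * (p.Tw + 1) := by
    rw [← Finset.sum_filter, Finset.sum_const, nsmul_eq_mul, mul_comm]
    exact mul_le_mul_of_nonneg_left (card_filter_le_add_one hTw _) (sq_nonneg _)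
  rw [← Finset.mul_sum, Finset.sum_add_distrib, ← Finset.mul_sum] at h3
  have h5 := mul_le_mul_of_nonneg_left (add_le_add_left h4
    ((Λ * ζ * b) ^ 2 * ∑ t ∈ Finset.range (T + 1), p.uncertainty ω t)) hg0
  linarith

/-- After exploration `tr V⁻¹` stays small. -/
lemma trace_inv_le_of_exploration (hv : p.Valid) {φ : ℝ} {k t : ℕ} (hkt : k * p.τ₀ ≤ t)
    (htT : t ≤ T) (hZ : ∀ s ≤ T, nrm (p.Z ω s) ≤ ζ) (hφ : 0 < φ)
    (h : 2 * (φ⁻¹ + p.potential T ζ) ≤ p.epochInfo ω k) : (p.V ω t)⁻¹.trace ≤ φ := by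
  have := trace_inv_le_of_epochInfo hv hkt htT (fun s hs => hZ s (by omega)) (inv_pos.2 hφ) h
  rwa [inv_inv] at this

/-- An epoch that meets the time after exploration starts after the first `k` epochs. -/
lemma le_div_mul_of_lt (hv : p.Valid) {k t : ℕ} (hk : ((k * p.τ₀ : ℕ) : ℝ) ≤ p.Tw)
    (ht : ¬(t : ℝ) ≤ p.Tw) : k ≤ t / p.τ₀ := by
  have hτ : 0 < p.τ₀ := by linarith [hv.three_le_τ₀]
  rw [Nat.le_div_iff_mul_le hτ]
  have : ((k * p.τ₀ : ℕ) : ℝ) ≤ t := hk.trans (not_le.1 ht).le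
  exact_mod_cast this

/-- After an exploration that brings `tr V⁻¹` to `φ`, the uncertainty is at most `φ`. -/
lemma sum_uncertainty_le (hv : p.Valid) {φ : ℝ} {k : ℕ} (hk : ((k * p.τ₀ : ℕ) : ℝ) ≤ p.Tw)
    (hZ : ∀ s ≤ T, nrm (p.Z ω s) ≤ ζ) (hφ : 0 < φ)
    (h : 2 * (φ⁻¹ + p.potential T ζ) ≤ p.epochInfo ω k) :
    ∑ t ∈ Finset.range (T + 1), p.uncertainty ω t ≤ (T + 1) * φ := by
  have : ∀ t ∈ Finset.range (T + 1), p.uncertainty ω t ≤ φ := fun t ht => by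
    unfold uncertainty
    split_ifs with htw
    · exact hφ.le
    · have h1 := le_div_mul_of_lt hv hk htw
      refine trace_inv_le_of_exploration hv (Nat.mul_le_mul_right _ h1) ?_ hZ hφ h
      exact (Nat.div_mul_le_self t _).trans (Nat.lt_succ_iff.1 (Finset.mem_range.1 ht))
  simpa using Finset.sum_le_card_nsmul _ _ _ this

/-- By the Cauchy–Schwarz inequality, the sum of the uncertainties is controlled by the squares of
`tr V⁻¹` in the accurate epochs. -/
lemma sum_uncertainty_le_sqrt (hv : p.Valid) {φ y : ℝ} {k : ℕ}
    (hk : ((k * p.τ₀ : ℕ) : ℝ) ≤ p.Tw) (hZ : ∀ s ≤ T, nrm (p.Z ω s) ≤ ζ)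
    (hconf : ∀ s ≤ T, p.conf ω s ≤ a) (hφ : 0 < φ)
    (h : 2 * (φ⁻¹ + p.potential T ζ) ≤ p.epochInfo ω k)
    (hy : ∑ j ∈ Finset.range (T / p.τ₀ + 1), (p.Accurate ζ a φ (j * p.τ₀)).indicator
        (fun ω => p.μ * p.S ^ 2 * (p.V ω (j * p.τ₀))⁻¹.trace ^ 2) ω ≤ y) :
    ∑ t ∈ Finset.range (T + 1), p.uncertainty ω t ≤
      √((T + 1) * (p.τ₀ * (y / (p.μ * p.S ^ 2)))) := by
  have hτ : 0 < p.τ₀ := by linarith [hv.three_le_τ₀]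
  have hμS : 0 < p.μ * p.S ^ 2 := mul_pos hv.meas.μ_pos (pow_pos hv.S_pos 2)
  refine Real.le_sqrt_of_sq_le ?_
  refine (sq_sum_le_card_mul_sum_sq).trans ?_
  rw [Finset.card_range]
  push_cast
  refine mul_le_mul_of_nonneg_left ?_ (by positivity)
  set f : ℕ → ℝ := fun j => (p.Accurate ζ a φ (j * p.τ₀)).indicator
    (fun ω => (p.V ω (j * p.τ₀))⁻¹.trace ^ 2) ω with hf
  have hf0 : ∀ j, 0 ≤ f j := fun j => Set.indicator_nonneg (fun ω _ => sq_nonneg _) ω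
  have h1 : ∀ t ∈ Finset.range (T + 1), p.uncertainty ω t ^ 2 ≤ f (t / p.τ₀) := fun t ht => by
    unfold uncertainty
    split_ifs with htw
    · rw [zero_pow two_ne_zero]
      exact hf0 _
    · have h2 := le_div_mul_of_lt hv hk htw
      have h3 : t / p.τ₀ * p.τ₀ ≤ T :=
        (Nat.div_mul_le_self t _).trans (Nat.lt_succ_iff.1 (Finset.mem_range.1 ht))
      simp only [hf]
      rw [Set.indicator_of_mem]
      exact ⟨fun s hs => hZ s (by omega), hconf _ h3,
        trace_inv_le_of_exploration hv (Nat.mul_le_mul_right _ h2) h3 hZ hφ h⟩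
  refine (Finset.sum_le_sum h1).trans ((sum_range_div_le hτ hf0 T).trans ?_)
  refine mul_le_mul_of_nonneg_left ?_ (by positivity)
  rw [le_div_iff₀ hμS, mul_comm, Finset.mul_sum]
  refine le_trans (Finset.sum_le_sum fun j _ => le_of_eq ?_) hy
  by_cases hA : ω ∈ p.Accurate ζ a φ (j * p.τ₀)
  · simp only [hf]
    rw [Set.indicator_of_mem hA, Set.indicator_of_mem hA]
  · simp only [hf]
    rw [Set.indicator_of_notMem hA, Set.indicator_of_notMem hA, mul_zero]

end Setup

/-! ### Reduction to the product space of the noise -/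

instance countable_noiseIdx (n d : ℕ) : Countable (NoiseIdx n d) := by
  let f : NoiseIdx n d → (ℕ × Fin n) ⊕ (ℕ × Fin d) ⊕ (ℕ × ℕ × (Fin n ⊕ Fin d) × Fin n)
    | .w t r => .inl (t, r)
    | .ν t r => .inr (.inl (t, r))
    | .η i j r s => .inr (.inr (i, j, r, s))
  refine Function.Injective.countable (f := f) ?_
  rintro (⟨t, r⟩ | ⟨t, r⟩ | ⟨i, j, r, s⟩) (⟨t', r'⟩ | ⟨t', r'⟩ | ⟨i', j', r', s'⟩) h <;>
    simp_all [f]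

/-- The joint law of the noise variables is the product of their laws. -/
lemma IsNoise.map_eq {n d : ℕ} {κ σ : ℝ} {Ω : Type*} [MeasurableSpace Ω] {P : Measure Ω}
    {ξ : NoiseIdx n d → Ω → ℝ} (h : IsNoise κ σ P ξ) :
    P.map (fun ω a => ξ a ω) = Measure.infinitePi fun a => gaussianReal 0 (noiseVar κ σ a) := by
  rw [h.indep.map_fun_eq_infinitePi_map₀' fun a => (h.law a).aemeasurable]
  congr 1
  exact funext fun a => (h.law a).map_eq

/-- It suffices to bound the regret outside an event of small probability in the product space. -/
lemma regretLE_of_law {n d : ℕ} {Q : Matrix (Fin n) (Fin n) ℝ} {R : Matrix (Fin d) (Fin d) ℝ}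
    {M : Set (Sys n d)} {κ γ S σ : ℝ} {Θs : Sys n d} {δ : ℝ} {T : ℕ} {Tw b : ℝ}
    (B : Set (NoiseIdx n d → ℝ)) (hδ : 0 ≤ δ)
    (hB : (tsac Q R M κ γ S σ Θs δ T Tw).law Bᶜ ≤ ENNReal.ofReal (10 * δ))
    (h : ∀ ω ∈ B, (tsac Q R M κ γ S σ Θs δ T Tw).regret ω T ≤ b) :
    RegretLE Q R M κ γ S σ Θs δ T Tw b := by
  intro Ω _ P _ ξ hξ
  set p := tsac Q R M κ γ S σ Θs δ T Tw with hp
  have hmap : P.map (fun ω a => ξ a ω) = p.law := hξ.map_eq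
  have hae : AEMeasurable (fun ω a => ξ a ω) P :=
    aemeasurable_pi_iff.2 fun a => (hξ.law a).aemeasurable
  -- `B` need not be measurable, so its complement is enlarged to a measurable set
  set F := toMeasurable p.law Bᶜ with hF
  have hFm : MeasurableSet F := measurableSet_toMeasurable _ _
  have h1 : P ((fun ω a => ξ a ω) ⁻¹' Fᶜ) = p.law Fᶜ := by
    rw [← hmap, Measure.map_apply_of_aemeasurable hae hFm.compl]
  have h2 : p.law Fᶜ = 1 - p.law Bᶜ := by
    rw [prob_compl_eq_one_sub hFm, hF, measure_toMeasurable]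
  calc ENNReal.ofReal (1 - 10 * δ) = 1 - ENNReal.ofReal (10 * δ) := by
        rw [ENNReal.ofReal_sub _ (by positivity), ENNReal.ofReal_one]
    _ ≤ 1 - p.law Bᶜ := tsub_le_tsub_left hB 1
    _ = P ((fun ω a => ξ a ω) ⁻¹' Fᶜ) := by rw [h1, h2]
    _ ≤ _ := measure_mono fun ω hω => h _ (by
        by_contra hn
        exact hω (subset_toMeasurable _ _ hn))

/-! ### Consequences of the standing assumptions -/

lemma frob_sq {n d : ℕ} (Θ : Sys n d) : Θ.frob ^ 2 = fsq Θ := by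
  have e : (Θᵀ * Θ).trace = fsq Θ := by
    rw [fsq_eq_sum_dot]
    rfl
  rw [Sys.frob, e, Real.sq_sqrt (fsq_nonneg Θ)]

lemma mul_nrm_sq_le_of_posDef_sub {n : ℕ} {Q : Matrix (Fin n) (Fin n) ℝ} {α : ℝ}
    (h : (Q - α • (1 : Matrix (Fin n) (Fin n) ℝ)).PosDef) (x : Fin n → ℝ) :
    α * nrm x ^ 2 ≤ qf Q x := by
  have h1 := qf_nonneg h x
  rw [qf, sub_mulVec, smul_mulVec, one_mulVec, dotProduct_sub, dotProduct_smul, ← nrm_sq,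
    smul_eq_mul] at h1
  exact sub_nonneg.1 h1

namespace Admissible

variable {n d : ℕ} {κ γ αlo αhi S : ℝ} {Q : Matrix (Fin n) (Fin n) ℝ}
  {R : Matrix (Fin d) (Fin d) ℝ} {M : Set (Sys n d)} {Θs : Sys n d}

lemma exists_ball (h : Admissible κ γ αlo αhi S Q R M Θs) :
    ∃ r > 0, ∀ Θ : Sys n d, fsq (Θ - Θs) ≤ r ^ 2 → Θ ∈ M := by
  obtain ⟨r, hr, hb⟩ := Metric.mem_nhds_iff.1 (mem_interior_iff_mem_nhds.1 h.mem)
  refine ⟨r / 2, by positivity, fun Θ hΘ => hb ?_⟩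
  rw [Metric.mem_ball, dist_eq_norm]
  have h1 := le_of_sq_le_sq ((norm_sq_le_fsq _).trans hΘ) (by positivity)
  linarith

lemma fsq_le (h : Admissible κ γ αlo αhi S Q R M Θs) {Θ : Sys n d} (hΘ : Θ ∈ M) :
    fsq Θ ≤ S ^ 2 := by
  rw [← frob_sq]
  exact pow_le_pow_left₀ (Real.sqrt_nonneg _) (h.bounded Θ hΘ) 2

/-- A set with an interior point contains a system other than `0`. -/
lemma S_pos (h : Admissible κ γ αlo αhi S Q R M Θs) (hn : 1 ≤ n) : 0 < S := by
  by_contra! hS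
  obtain ⟨r, hr, hb⟩ := h.exists_ball
  have hn' : (1 : ℝ) ≤ n := by exact_mod_cast hn
  have hzero : ∀ Θ ∈ M, ∀ i j, Θ i j = 0 := fun Θ hΘ i j => by
    have h1 : Θ.frob = 0 := le_antisymm ((h.bounded Θ hΘ).trans hS) (Real.sqrt_nonneg _)
    have h2 : fsq Θ = 0 := by rw [← frob_sq, h1]; norm_num
    have h3 := norm_sq_le_fsq Θ
    rw [h2] at h3
    have h4 : ‖Θ‖ = 0 := by nlinarith [norm_nonneg Θ]
    rw [norm_eq_zero.1 h4]
    rfl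
  -- shift all entries of `Θs` by `e`: both systems lie in `M`, but they differ
  set e := r / ((n + d) * n) with he
  have hD : (1 : ℝ) ≤ (n + d) * n := by nlinarith [Nat.cast_nonneg (α := ℝ) d]
  have he0 : 0 < e := by positivity
  have h1 := hzero _ (hb Θs (by simpa [fsq] using sq_nonneg r)) (.inl ⟨0, hn⟩) ⟨0, hn⟩
  have h2 := hzero _ (hb (Θs + Matrix.of fun _ _ => e) (by
    rw [add_sub_cancel_left]
    refine (Setup.fsq_le_of_abs_le _ (c := e) fun i j => ?_).trans ?_
    · simp [abs_of_pos he0]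
    · rw [he, div_pow, ← mul_div_assoc, div_le_iff₀ (by positivity)]
      nlinarith [mul_nonneg (sq_nonneg r) (by positivity : (0 : ℝ) ≤ (n + d) * n)]))
    (.inl ⟨0, hn⟩) ⟨0, hn⟩
  rw [Matrix.add_apply, h1, zero_add, Matrix.of_apply] at h2
  exact he0.ne' h2

lemma norm_le (h : Admissible κ γ αlo αhi S Q R M Θs) (hS : 0 ≤ S) {Θ : Sys n d} (hΘ : Θ ∈ M) :
    ‖Θ‖ ≤ S :=
  le_of_sq_le_sq ((norm_sq_le_fsq Θ).trans (h.fsq_le hΘ)) hS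

lemma exists_lipschitz (h : Admissible κ γ αlo αhi S Q R M Θs) (hn : 1 ≤ n) (hκ : 1 ≤ κ)
    (hγ : 0 < γ) (hγ' : γ ≤ 1) (hα : 0 < αlo) :
    ∃ Λ > 0, ∀ Θ₁ ∈ M, ∀ Θ₂ ∈ M, ‖gain Q R Θ₁ - gain Q R Θ₂‖ ≤ Λ * ‖Θ₁ - Θ₂‖ := by
  have hS := (h.S_pos hn).le
  obtain ⟨Λ, hΛ, hlip⟩ := exists_lipschitz_gain (n := n) h.Q_posDef h.R_posDef hκ hγ hγ' hα
    (mul_nrm_sq_le_of_posDef_sub h.lt_R) hS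
  exact ⟨Λ, hΛ, fun Θ₁ h₁ Θ₂ h₂ => (hlip Θ₁ Θ₂ (h.stabilizable _ h₁) (h.stabilizable _ h₂)
    (h.norm_le hS h₁) (h.norm_le hS h₂)).1⟩

lemma mem_M (h : Admissible κ γ αlo αhi S Q R M Θs) : Θs ∈ M := interior_subset h.mem

lemma valid (h : Admissible κ γ αlo αhi S Q R M Θs) (hn : 1 ≤ n) (hκ : 1 ≤ κ)
    (hγ : 0 < γ) (hγ' : γ ≤ 1) (hα : 0 < αlo) {σ δ : ℝ} (hσ : 0 < σ) (hδ : 0 < δ) (hδ' : δ < 1)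
    {T : ℕ} {Tw : ℝ} (hμ : 0 < (tsac Q R M κ γ S σ Θs δ T Tw).μ) :
    (tsac Q R M κ γ S σ Θs δ T Tw).Valid where
  one_le_n := hn
  κ := hκ
  γ_pos := hγ
  γ_le := hγ'
  σ_pos := hσ
  δ_pos := hδ
  δ_lt := hδ'
  S_pos := h.S_pos hn
  stab := h.stabilizable
  fsq_le := fun _ hΘ => h.fsq_le hΘ
  mem := h.mem_M
  meas :=
    { M := h.measurable_M
      gainM := by
        classical
        obtain ⟨Λ, hΛ, hlip⟩ := h.exists_lipschitz hn hκ hγ hγ' hα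
        have hc : ContinuousOn (gain Q R) M := by
          refine LipschitzOnWith.continuousOn (K := Real.toNNReal Λ)
            (LipschitzOnWith.of_dist_le_mul fun Θ₁ h₁ Θ₂ h₂ => ?_)
          rw [dist_eq_norm, dist_eq_norm, Real.coe_toNNReal Λ hΛ.le]
          exact hlip Θ₁ h₁ Θ₂ h₂
        exact hc.measurable_piecewise continuousOn_const h.measurable_M
      μ_pos := hμ }

end Admissible

/-! ### Constants for large horizons -/

lemma tendsto_log_natCast : Tendsto (fun T : ℕ => Real.log T) atTop atTop :=
  Real.tendsto_log_atTop.comp tendsto_natCast_atTop_atTop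

lemma eventually_log_pow_le (k : ℕ) : ∀ᶠ T : ℕ in atTop, Real.log T ^ k ≤ T := by
  have h := (Real.isLittleO_pow_log_id_atTop (n := k)).comp_tendsto
    (tendsto_natCast_atTop_atTop (R := ℝ))
  filter_upwards [h.bound one_pos] with T hT
  simp only [Function.comp, id, one_mul, Real.norm_eq_abs] at hT
  rw [abs_of_nonneg (Nat.cast_nonneg T : (0:ℝ) ≤ T)] at hT
  exact (le_abs_self _).trans hT

/-- The regularizer is of the order of `log T`. -/
lemma exists_regularizer_bounds {n : ℕ} {κ γ σ δ : ℝ} (hn : 1 ≤ n) (hκ : 1 ≤ κ) (hγ : 0 < γ)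
    (hσ : 0 < σ) (hδ : 0 < δ) (hδ' : δ < 1) {Tw : ℕ → ℝ} (hTw : ∀ᶠ T in atTop, 0 ≤ Tw T)
    (hTw' : ∀ᶠ T : ℕ in atTop, Tw T ≤ T / 2) :
    ∃ m₁ > 0, ∃ m₂ > 0, ∀ᶠ T : ℕ in atTop,
      m₁ * Real.log T ≤ (1 + κ ^ 2) * stateBound n κ γ σ δ T (Tw T) ^ 2 ∧
      (1 + κ ^ 2) * stateBound n κ γ σ δ T (Tw T) ^ 2 ≤ m₂ * Real.log T := by
  have hn' : (1 : ℝ) ≤ n := by exact_mod_cast hn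
  set c := (1 + κ ^ 2) * (((12 * κ ^ 2 + 2 * κ * √2) * γ⁻¹ * σ) ^ 2 * (2 * n)) with hc
  have hc0 : 0 < c := by positivity
  refine ⟨c / 2, by positivity, c * 2, by positivity, ?_⟩
  filter_upwards [hTw, hTw', tendsto_log_natCast.eventually_ge_atTop (2 * Real.log 2),
    tendsto_log_natCast.eventually_ge_atTop (Real.log (n / δ)), eventually_ge_atTop 1]
    with T h0 h1 h2 h3 hT
  have hT' : (1 : ℝ) ≤ T := by exact_mod_cast hT
  have hlow : Real.log T / 2 ≤ Real.log (n * (T - Tw T) / δ) := by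
    have h4 : (T : ℝ) / 2 ≤ n * (T - Tw T) / δ := by
      rw [le_div_iff₀ hδ]
      have : (T : ℝ) / 2 ≤ n * (T - Tw T) := by nlinarith
      nlinarith
    have h5 := Real.log_le_log (by positivity) h4
    rw [Real.log_div (by positivity) two_ne_zero] at h5
    linarith
  have hup : Real.log (n * (T - Tw T) / δ) ≤ 2 * Real.log T := by
    have h4 : n * (T - Tw T) / δ ≤ n / δ * T := by
      rw [div_mul_eq_mul_div]
      gcongr
      linarith
    have hpos : 0 < n * (T - Tw T) / δ := by
      have : 0 < (T : ℝ) - Tw T := by linarith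
      positivity
    have h5 := Real.log_le_log hpos h4
    rw [Real.log_mul (by positivity) (by positivity)] at h5
    linarith
  have hl0 : 0 ≤ Real.log T := Real.log_nonneg hT'
  have e : (1 + κ ^ 2) * stateBound n κ γ σ δ T (Tw T) ^ 2 =
      c * Real.log (n * (T - Tw T) / δ) := by
    rw [stateBound, mul_pow, Real.sq_sqrt (by
      have : 0 ≤ Real.log (n * (T - Tw T) / δ) := by linarith
      positivity), hc]
    ring
  rw [e]
  constructor <;> nlinarith

namespace Setup

variable {n d : ℕ} {p : Setup n d}

/-- The logarithm of the determinant of `V_T` is of the order of `log T`. -/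
lemma potential_le {T : ℕ} {ζ : ℝ} (hn : 1 ≤ n) (hμ : 1 ≤ p.μ) (hT : 2 ≤ T) (hD : n + d ≤ T)
    (hζ : ζ ^ 2 ≤ T) : p.potential T ζ ≤ (n + d) * (4 * Real.log T) := by
  have hT' : (2 : ℝ) ≤ T := by exact_mod_cast hT
  have hD' : (n + d : ℝ) ≤ T := by exact_mod_cast hD
  have hn' : (1 : ℝ) ≤ n := by exact_mod_cast hn
  have h1 : T * ζ ^ 2 / p.μ ≤ T ^ 2 := by
    refine (div_le_self (by positivity) hμ).trans ?_
    rw [pow_two (T : ℝ)]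
    gcongr
  have h2 : (n + d) + T * ζ ^ 2 / p.μ ≤ (T : ℝ) ^ 4 := by
    have h3 : (T : ℝ) ^ 4 = T ^ 2 * T ^ 2 := by ring
    have h4 : (4 : ℝ) ≤ T ^ 2 := by nlinarith
    nlinarith
  have h3 : 0 ≤ T * ζ ^ 2 / p.μ := by positivity
  refine mul_le_mul_of_nonneg_left ?_ (by positivity)
  refine (Real.log_le_log (by positivity) h2).trans (le_of_eq ?_)
  rw [Real.log_pow]
  norm_num

lemma betaSq_le {T : ℕ} {ζ m : ℝ} (hS : 0 < p.S) (hpot : p.potential T ζ ≤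
    (n + d) * (4 * Real.log T)) (hm : p.μ ≤ m * Real.log T) (hδ : Real.log (1 / p.δ) ≤ Real.log T) :
    p.betaSq ζ T ≤ (4 * n * p.σ ^ 2 * (2 * (n + d) + 1) + 2 * m * p.S ^ 2) * Real.log T := by
  have h1 : p.μ * p.S ^ 2 ≤ m * Real.log T * p.S ^ 2 := by gcongr
  have h2 : p.σ ^ 2 * (2 * n * (p.potential T ζ / 2 + Real.log (1 / p.δ))) ≤
      p.σ ^ 2 * (2 * n * ((n + d) * (4 * Real.log T) / 2 + Real.log T)) := by gcongr
  calc p.betaSq ζ T = 2 * (p.σ ^ 2 * (2 * n * (p.potential T ζ / 2 + Real.log (1 / p.δ)))) +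
        2 * (p.μ * p.S ^ 2) := rfl
    _ ≤ 2 * (p.σ ^ 2 * (2 * n * ((n + d) * (4 * Real.log T) / 2 + Real.log T))) +
        2 * (m * Real.log T * p.S ^ 2) := by linarith
    _ = _ := by ring

end Setup

/-- The parameters with which the run is controlled at a large horizon `T`: `‖z_t‖ ≤ (log T)³`, the
self-normalized noise is at most `A log T`, the weighted error of the models is at most
`(log T)²`. -/
structure LargeHorizon {n d : ℕ} (p : Setup n d) (r C A B ρ ε : ℝ) (T : ℕ) : Prop where
  valid : p.Valid
  constants : p.Constants r C (A * Real.log T) (Real.log T) (Real.log T ^ 2) (Real.log T ^ 3) ρ ε T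
  potential_le : p.potential T (Real.log T ^ 3) ≤ (n + d) * (4 * Real.log T)
  betaSq_le : p.betaSq (Real.log T ^ 3) T ≤ B * Real.log T
  conf_le : n * p.σ ^ 2 * p.potential T (Real.log T ^ 3) / (A * Real.log T) ≤ p.δ
  one_le_log : 1 ≤ Real.log T
  one_le_μS : 1 ≤ p.μ * p.S ^ 2

set_option maxHeartbeats 1000000 in
/-- Each constant that depends on the data is smaller than a power of `log T` for large `T`. -/
lemma Admissible.exists_largeHorizon {n d : ℕ} {κ γ αlo αhi S : ℝ} {Q : Matrix (Fin n) (Fin n) ℝ}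
    {R : Matrix (Fin d) (Fin d) ℝ} {M : Set (Sys n d)} {Θs : Sys n d}
    (h : Admissible κ γ αlo αhi S Q R M Θs) (hn : 1 ≤ n) (hκ : 1 ≤ κ)
    (hγ : 0 < γ) (hγ' : γ ≤ 1) (hα : 0 < αlo) {σ δ : ℝ} (hσ : 0 < σ) (hδ : 0 < δ) (hδ' : δ < 1)
    {Tw : ℕ → ℝ} (hTw : ∀ᶠ T in atTop, 0 ≤ Tw T) (hTw' : ∀ᶠ T : ℕ in atTop, Tw T ≤ T / 2) :
    ∃ r > 0, ∃ C A B ρ ε : ℝ, 0 < A ∧ 0 < B ∧ 0 < ε ∧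
      (∀ Θ : Sys n d, fsq (Θ - Θs) ≤ r ^ 2 → Θ ∈ M) ∧ ∀ᶠ T : ℕ in atTop,
        LargeHorizon (tsac Q R M κ γ S σ Θs δ T (Tw T)) r C A B ρ ε T := by
  have hS := h.S_pos hn
  have hn' : (1 : ℝ) ≤ n := by exact_mod_cast hn
  have hd' : (0 : ℝ) ≤ d := Nat.cast_nonneg d
  obtain ⟨r, hr, hball⟩ := h.exists_ball
  obtain ⟨m₁, hm₁, m₂, hm₂, hμ⟩ := exists_regularizer_bounds (n := n) hn hκ hγ hσ hδ hδ' hTw hTw'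
  have hvalid : ∀ᶠ T : ℕ in atTop, (tsac Q R M κ γ S σ Θs δ T (Tw T)).Valid := by
    filter_upwards [hμ, tendsto_log_natCast.eventually_gt_atTop 0] with T h1 h2
    exact h.valid hn hκ hγ hγ' hα hσ hδ hδ' (lt_of_lt_of_le (by positivity) h1.1)
  obtain ⟨T₀, hv₀⟩ := hvalid.exists
  obtain ⟨C, hC, hstate⟩ := exists_stateBound (Q := Q) (R := R) hκ hγ hγ' hS.le
    (by linarith [hv₀.three_le_τ₀] : 0 < (tsac Q R M κ γ S σ Θs δ T₀ (Tw T₀)).τ₀) hv₀.contraction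
  set D : ℝ := n + d with hD
  have hD1 : 1 ≤ D := by linarith
  -- `A` makes the failure probability of the confidence bound at most `δ`; `ρ` and `ε` do not
  -- depend on `T`, because `β²`, `μ` and the noise bound are all of the order of `log T`
  set A : ℝ := 4 * n * σ ^ 2 * D / δ with hA
  have hA0 : 0 < A := by positivity
  set B : ℝ := 4 * n * σ ^ 2 * (2 * D + 1) + 2 * m₂ * S ^ 2 with hB
  have hB0 : 0 < B := by positivity
  set ρ : ℝ := √((2 * A / m₁ + 2 * S ^ 2) / S ^ 2) with hρ
  set ε : ℝ := √(r ^ 2 * m₁ / (4 * D ^ 2 * n * B)) with hε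
  have hε0 : 0 < ε := Real.sqrt_pos.2 (by positivity)
  refine ⟨r, hr, C, A, B, ρ, ε, hA0, hB0, hε0, hball, ?_⟩
  filter_upwards [hμ, hvalid, eventually_log_pow_le 6, eventually_ge_atTop 2,
    eventually_ge_atTop (n + d), tendsto_log_natCast.eventually_ge_atTop 1,
    tendsto_log_natCast.eventually_ge_atTop (1 / m₁),
    tendsto_log_natCast.eventually_ge_atTop (1 / (m₁ * S ^ 2)),
    tendsto_log_natCast.eventually_ge_atTop (Real.log (1 / δ)),
    tendsto_log_natCast.eventually_ge_atTop (2 * B * (D * n) + 4 * A + 4 * m₂ * S ^ 2),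
    tendsto_log_natCast.eventually_ge_atTop (C * (1 + D))]
    with T hμ hv h6 hT2 hTD hl1 hlm hlmS hlδ hlb hlζ
  set ℓ := Real.log T with hℓ
  have hℓ0 : 0 < ℓ := by linarith
  set p := tsac Q R M κ γ S σ Θs δ T (Tw T) with hp
  have hμ1 : m₁ * ℓ ≤ p.μ := hμ.1
  have hμ2 : p.μ ≤ m₂ * ℓ := hμ.2
  have hμ0 : 0 < p.μ := hv.meas.μ_pos
  have hone : 1 ≤ p.μ := by
    rw [div_le_iff₀ hm₁] at hlm
    linarith
  have hone' : 1 ≤ p.μ * p.S ^ 2 := by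
    rw [div_le_iff₀ (by positivity)] at hlmS
    have : m₁ * ℓ * S ^ 2 ≤ p.μ * S ^ 2 := by gcongr
    change 1 ≤ p.μ * S ^ 2
    linarith
  have hpot : p.potential T (ℓ ^ 3) ≤ (n + d) * (4 * ℓ) :=
    Setup.potential_le hn hone hT2 hTD (by rw [← pow_mul]; exact h6)
  have hbeta : p.betaSq (ℓ ^ 3) T ≤ B * ℓ := Setup.betaSq_le (p := p) hS hpot hμ2 hlδ
  have h2a : 2 * (A * ℓ) + 2 * p.μ * S ^ 2 ≤ 2 * (A * ℓ) + 2 * (m₂ * ℓ) * S ^ 2 := by gcongr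
  have hsq1 : ℓ ≤ ℓ ^ 2 := le_self_pow₀ hl1 two_ne_zero
  have hsq2 : ℓ ^ 2 ≤ ℓ ^ 3 := pow_le_pow_right₀ hl1 (by norm_num)
  refine ⟨hv, ⟨hball, hstate, hℓ0.le, by positivity, ?_, ?_, ?_, ?_⟩, hpot, hbeta, ?_, hl1, hone'⟩
  · change 2 * (A * ℓ) + 2 * p.μ * S ^ 2 ≤ ρ ^ 2 * (p.μ * S ^ 2)
    rw [hρ, Real.sq_sqrt (by positivity)]
    have h1 : A * ℓ ≤ A / m₁ * p.μ := by
      have e : A * ℓ = A / m₁ * (m₁ * ℓ) := by field_simp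
      rw [e]
      exact mul_le_mul_of_nonneg_left hμ1 (by positivity)
    have h3 : (2 * A / m₁ + 2 * S ^ 2) / S ^ 2 * (p.μ * S ^ 2) =
        2 * (A / m₁ * p.μ) + 2 * p.μ * S ^ 2 := by
      field_simp
    linarith
  · have h1 : (n + d : ℝ) / p.μ ≤ D / (m₁ * ℓ) := by gcongr
    have hε2 : ε ^ 2 = r ^ 2 * m₁ / (4 * D ^ 2 * n * B) := Real.sq_sqrt (by positivity)
    calc (n + d : ℝ) / p.μ * (p.betaSq (ℓ ^ 3) T * ((n + d) * n * (2 * ε) ^ 2))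
        ≤ D / (m₁ * ℓ) * (B * ℓ * (D * n * (2 * ε) ^ 2)) := by
          have := hv.betaSq_nonneg (ℓ ^ 3) T
          gcongr
      _ = r ^ 2 := by
          rw [mul_pow, hε2]
          field_simp
          norm_num
  · change 2 * (p.betaSq (ℓ ^ 3) T * ((n + d) * n * ℓ ^ 2)) +
      2 * (2 * (A * ℓ) + 2 * p.μ * S ^ 2) ≤ (ℓ ^ 2) ^ 2
    have h1 : p.betaSq (ℓ ^ 3) T * ((n + d) * n * ℓ ^ 2) ≤ B * ℓ * (D * n * ℓ ^ 2) := by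
      gcongr
    have h3 : (2 * B * (D * n) + 4 * A + 4 * m₂ * S ^ 2) * ℓ ^ 3 ≤ ℓ * ℓ ^ 3 := by gcongr
    have h4 : (4 * A + 4 * m₂ * S ^ 2) * ℓ ≤ (4 * A + 4 * m₂ * S ^ 2) * ℓ ^ 3 := by
      gcongr
      exact hsq1.trans hsq2
    have e1 : B * ℓ * (D * n * ℓ ^ 2) = B * (D * n) * ℓ ^ 3 := by ring
    have e2 : (ℓ ^ 2) ^ 2 = ℓ * ℓ ^ 3 := by ring
    rw [e1] at h1
    rw [e2]
    linarith
  · have h1 : C * (ℓ ^ 2 + (n + d) * ℓ) ≤ C * (1 + D) * ℓ ^ 2 := by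
      have : D * ℓ ≤ D * ℓ ^ 2 := by gcongr
      calc C * (ℓ ^ 2 + D * ℓ) ≤ C * (ℓ ^ 2 + D * ℓ ^ 2) := by gcongr
        _ = _ := by ring
    have h2 : C * (1 + D) * ℓ ^ 2 ≤ ℓ * ℓ ^ 2 := by gcongr
    have e : ℓ ^ 3 = ℓ * ℓ ^ 2 := by ring
    rw [e]
    exact h1.trans h2
  · change n * σ ^ 2 * p.potential T (ℓ ^ 3) / (A * ℓ) ≤ δ
    rw [div_le_iff₀ (by positivity)]
    calc n * σ ^ 2 * p.potential T (ℓ ^ 3) ≤ n * σ ^ 2 * (D * (4 * ℓ)) := by gcongr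
      _ = δ * (A * ℓ) := by rw [hA]; field_simp

/-! ### Typical runs -/

namespace Setup

/-- Polynomially many Gaussian variables are at most `log T`. -/
lemma eventually_law_compl_NoiseLE_le (n d : ℕ) {κ σ δ : ℝ} (hκ : 1 ≤ κ) (hσ : 0 < σ)
    (hδ : 0 < δ) : ∀ᶠ T : ℕ in atTop, ∀ p : Setup n d, p.κ = κ → p.σ = σ →
      p.law (NoiseLE n d T (Real.log T))ᶜ ≤ ENNReal.ofReal δ := by
  set v : ℝ := σ ^ 2 + 2 * κ ^ 2 * σ ^ 2 + 1 with hv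
  have hv0 : 0 < v := by positivity
  set D : ℝ := ((n + d + (n + d) * n : ℕ) : ℝ) with hD
  filter_upwards [tendsto_log_natCast.eventually_ge_atTop (8 * v),
    tendsto_natCast_atTop_atTop.eventually_ge_atTop (8 * D / δ), eventually_ge_atTop 1]
    with T h1 h2 hT p hpκ hpσ
  have hT' : (1 : ℝ) ≤ T := by exact_mod_cast hT
  have hl0 : 0 ≤ Real.log T := by linarith
  have hs := sq_nonneg σ
  have hks : 0 ≤ 2 * κ ^ 2 * σ ^ 2 := by positivity
  refine (p.law_compl_NoiseLE_le T hl0 (v := v) ?_ ?_).trans (ENNReal.ofReal_le_ofReal ?_)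
  · rintro (_ | _ | _) <;> simp only [noiseVar, hpκ, hpσ, Real.coe_toNNReal', NNReal.coe_one] <;>
      first | exact max_le (by linarith) (by linarith) | linarith
  · have hκ0 : 0 < κ := by linarith
    rintro (_ | _ | _) <;> simp only [noiseVar, hpκ, hpσ, Real.coe_toNNReal', NNReal.coe_one] <;>
      first | exact lt_max_of_lt_left (by positivity) | exact one_pos
  · have hexp : Real.exp (-Real.log T ^ 2 / (2 * v)) ≤ ((T : ℝ) ^ 4)⁻¹ := by
      rw [← Real.exp_log (by positivity : (0 : ℝ) < ((T : ℝ) ^ 4)⁻¹), Real.log_inv, Real.log_pow]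
      refine Real.exp_le_exp.2 ?_
      rw [neg_div, neg_le_neg_iff, le_div_iff₀ (by positivity)]
      push_cast
      nlinarith
    rw [div_le_iff₀ hδ] at h2
    have hDn : 0 ≤ D := Nat.cast_nonneg _
    calc (((T + 1) ^ 2 * (n + d + (n + d) * n) : ℕ) : ℝ) *
          (2 * Real.exp (-Real.log T ^ 2 / (2 * v)))
        = (T + 1) ^ 2 * D * (2 * Real.exp (-Real.log T ^ 2 / (2 * v))) := by
          rw [hD]; push_cast; ring
      _ ≤ (T + T) ^ 2 * D * (2 * ((T : ℝ) ^ 4)⁻¹) := by gcongr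
      _ = 8 * D / T ^ 2 := by field_simp; ring
      _ ≤ δ := by
          rw [div_le_iff₀ (by positivity)]
          nlinarith [mul_nonneg hδ.le (sub_nonneg.2 hT')]

/-- A fixed finite net is hit within `T` trials. -/
lemma eventually_law_compl_Hits_le (n d : ℕ) {ε : ℝ} (hε : 0 < ε)
    (N : Finset ((Fin n ⊕ Fin d) → Fin n → ℝ)) {δ : ℝ} (hδ : 0 < δ) :
    ∀ᶠ T : ℕ in atTop, ∀ p : Setup n d,
      p.law (Hits n d T ε N)ᶜ ≤ ENNReal.ofReal δ := by
  have key : ∀ c ∈ N, Tendsto (fun T : ℕ => ((T : ℝ≥0∞) + 1) * (1 - hitProb ε c) ^ T) atTop (𝓝 0) := by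
    intro c _
    set q := 1 - hitProb ε c with hq
    have hq1 : q < 1 := ENNReal.sub_lt_self ENNReal.one_ne_top one_ne_zero (hitProb_pos hε c).ne'
    have hqt : q ≠ ∞ := hq1.ne_top
    have hr1 : q.toReal < 1 := by
      rw [← ENNReal.toReal_one]
      exact (ENNReal.toReal_lt_toReal hqt ENNReal.one_ne_top).2 hq1
    have h1 := tendsto_self_mul_const_pow_of_lt_one ENNReal.toReal_nonneg hr1
    have h2 := tendsto_pow_atTop_nhds_zero_of_lt_one ENNReal.toReal_nonneg hr1
    have h3 := ENNReal.tendsto_ofReal (h1.add h2)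
    rw [add_zero, ENNReal.ofReal_zero] at h3
    refine h3.congr fun T => ?_
    rw [← add_one_mul, ENNReal.ofReal_mul (by positivity), ENNReal.ofReal_pow ENNReal.toReal_nonneg,
      ENNReal.ofReal_toReal hqt, ENNReal.ofReal_add (Nat.cast_nonneg T) zero_le_one,
      ENNReal.ofReal_natCast, ENNReal.ofReal_one]
  have hsum := tendsto_finsetSum N key
  rw [Finset.sum_const_zero] at hsum
  filter_upwards [hsum.eventually_le_const (ENNReal.ofReal_pos.2 hδ)] with T hT p
  exact (p.law_compl_Hits_le T ε N).trans hT

/-- What is used of a run with probability close to one. -/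
structure TypicalRun {n d : ℕ} (p : Setup n d) (A c g : ℝ) (T : ℕ) (ω : NoiseIdx n d → ℝ) :
    Prop where
  nrm_Z_le : ∀ s ≤ T, nrm (p.Z ω s) ≤ Real.log T ^ 3
  conf_le : ∀ s ≤ T, p.conf ω s ≤ A * Real.log T
  explored : ∃ k : ℕ, ((k * p.τ₀ : ℕ) : ℝ) ≤ p.Tw ∧
    2 * (((c * p.Tw)⁻¹)⁻¹ + p.potential T (Real.log T ^ 3)) ≤ p.epochInfo ω k
  regret_le : p.regret ω T ≤ g * (√T * Real.log T ^ 4 + Real.log T ^ 6 * (p.Tw + 1) +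
    Real.log T ^ 10 * ∑ t ∈ Finset.range (T + 1), p.uncertainty ω t)

/-- An exploration phase much longer than `log T` collects information in proportion to its length.
-/
lemma exists_law_epochInfo_lt_le (n d : ℕ) {κ σ : ℝ} (hn : 1 ≤ n) (hκ : 1 ≤ κ) (hσ : 0 < σ)
    (τ : ℕ) {Tw : ℕ → ℝ}
    (hTw : Tendsto (fun T : ℕ => Tw T / Real.log T) atTop atTop) {δ : ℝ} (hδ : 0 < δ) :
    ∃ c > 0, ∀ᶠ T : ℕ in atTop, ∀ p : Setup n d, p.Valid → p.κ = κ → p.σ = σ → p.τ₀ = τ →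
      p.Tw = Tw T → p.potential T (Real.log T ^ 3) ≤ (n + d) * (4 * Real.log T) →
      ∃ k : ℕ, ((k * p.τ₀ : ℕ) : ℝ) ≤ p.Tw ∧
        p.law {ω | p.epochInfo ω k < 2 * (c * p.Tw + p.potential T (Real.log T ^ 3))} ≤
          ENNReal.ofReal δ := by
  obtain ⟨c, hc, hlaw⟩ := exists_law_epochInfo_le n d hn hκ hσ
  rcases Nat.eq_zero_or_pos τ with rfl | hτ
  · exact ⟨1, one_pos, Eventually.of_forall fun T p hv _ _ hpτ => by
      have := hv.three_le_τ₀
      omega⟩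
  have hτ' : (0 : ℝ) < τ := by exact_mod_cast hτ
  have hn' : (1 : ℝ) ≤ n := by exact_mod_cast hn
  have hd' : (0 : ℝ) ≤ d := Nat.cast_nonneg d
  refine ⟨c / (8 * τ), by positivity, ?_⟩
  filter_upwards [hTw.eventually_ge_atTop (32 * (n + d) * τ / c), hTw.eventually_ge_atTop (2 * τ),
    tendsto_log_natCast.eventually_ge_atTop 1,
    tendsto_log_natCast.eventually_ge_atTop (Real.log (1 / δ))]
    with T h1 h2 h3 h4 p hv hpκ hpσ hpτ hpTw hpot
  set ℓ := Real.log T with hℓ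
  have hℓ0 : 0 < ℓ := by linarith
  rw [div_le_div_iff₀ hc hℓ0] at h1
  rw [le_div_iff₀ hℓ0] at h2
  have hTw2 : 2 * τ ≤ Tw T := by nlinarith
  have hTw0 : 0 ≤ Tw T := by linarith
  set k := ⌊Tw T / τ⌋₊ with hk
  have hkle : (k : ℝ) * τ ≤ Tw T := by
    rw [← le_div_iff₀ hτ']
    exact Nat.floor_le (by positivity)
  have hkge : Tw T / (2 * τ) ≤ k := by
    have h5 := Nat.lt_floor_add_one (Tw T / τ)
    have h6 : 2 ≤ Tw T / τ := by rwa [le_div_iff₀ hτ']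
    have e : Tw T / (2 * τ) = Tw T / τ / 2 := by rw [mul_comm, div_div]
    rw [e]
    linarith
  have hck : c * (Tw T / (2 * τ)) ≤ c * k := by gcongr
  have e1 : c * (Tw T / (2 * τ)) = 2 * (c / (8 * τ) * Tw T) + 2 * (c * Tw T / (8 * τ)) := by
    field_simp
    ring
  have h5 : 4 * ((n + d) * ℓ) ≤ c * Tw T / (8 * τ) := by
    rw [le_div_iff₀ (by positivity)]
    linarith
  refine ⟨k, by rw [hpτ, hpTw]; exact_mod_cast hkle, ?_⟩
  have hcT : 0 ≤ c / (8 * τ) * Tw T := by positivity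
  refine (measure_mono fun ω hω => ?_).trans ((hlaw p hv hpκ hpσ k (by
    rw [hpτ, hpTw]; exact_mod_cast hkle)).trans (ENNReal.ofReal_le_ofReal ?_))
  · change p.epochInfo ω k ≤ c * k
    have h6 : p.epochInfo ω k < 2 * (c / (8 * τ) * p.Tw + p.potential T (ℓ ^ 3)) := hω
    rw [hpTw] at h6
    linarith
  · have h6 : ℓ ≤ c * k := by nlinarith
    rw [Real.exp_neg, inv_le_comm₀ (Real.exp_pos _) hδ, ← one_div, ← Real.log_le_iff_le_exp (by positivity)]
    exact h4.trans h6

/-- The martingales are at most `√T (log T)⁴`. -/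
lemma eventually_law_martingales_le (n : ℕ) {P S σ δ : ℝ} (hδ : 0 < δ) :
    ∀ᶠ T : ℕ in atTop,
      (T + 1 : ℕ) * ((2 * (P * (S * Real.log T ^ 3))) ^ 2 * (n * σ ^ 2)) /
        (√T * Real.log T ^ 4) ^ 2 ≤ δ ∧
      (T + 1 : ℕ) * (P ^ 2 * (n * (n * fourthMoment σ))) / (√T * Real.log T ^ 4) ^ 2 ≤ δ := by
  set K₁ : ℝ := 4 * P ^ 2 * S ^ 2 * (n * σ ^ 2) with hK₁
  set K₂ : ℝ := P ^ 2 * (n * (n * fourthMoment σ)) with hK₂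
  have hK₁0 : 0 ≤ K₁ := by positivity
  filter_upwards [tendsto_log_natCast.eventually_ge_atTop 1, eventually_ge_atTop 1,
    tendsto_log_natCast.eventually_ge_atTop (2 * K₁ / δ),
    tendsto_log_natCast.eventually_ge_atTop (2 * |K₂| / δ)] with T h1 hT h2 h3
  set ℓ := Real.log T with hℓ
  have hℓ0 : 0 < ℓ := by linarith
  have hT' : (1 : ℝ) ≤ T := by exact_mod_cast hT
  have e : (√(T : ℝ) * ℓ ^ 4) ^ 2 = T * ℓ ^ 8 := by
    rw [mul_pow, Real.sq_sqrt (Nat.cast_nonneg T)]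
    ring
  rw [div_le_iff₀ hδ] at h2 h3
  rw [e, div_le_iff₀ (by positivity), div_le_iff₀ (by positivity)]
  push_cast
  have hp : (T : ℝ) + 1 ≤ T * 2 := by linarith
  constructor
  · have h4 : ℓ * ℓ ^ 6 ≤ ℓ ^ 8 := by
      calc ℓ * ℓ ^ 6 = ℓ ^ 7 := by ring
        _ ≤ ℓ ^ 8 := pow_le_pow_right₀ h1 (by norm_num)
    calc (T + 1) * ((2 * (P * (S * ℓ ^ 3))) ^ 2 * (n * σ ^ 2)) = (T + 1) * K₁ * ℓ ^ 6 := by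
          rw [hK₁]; ring
      _ ≤ (T * 2) * K₁ * ℓ ^ 6 := by gcongr
      _ = T * (2 * K₁) * ℓ ^ 6 := by ring
      _ ≤ T * (ℓ * δ) * ℓ ^ 6 := by gcongr
      _ = δ * (T * (ℓ * ℓ ^ 6)) := by ring
      _ ≤ δ * (T * ℓ ^ 8) := by gcongr
  · have h4 : ℓ ≤ ℓ ^ 8 := le_self_pow₀ h1 (by norm_num)
    calc (T + 1) * K₂ ≤ (T + 1) * |K₂| := by gcongr; exact le_abs_self _
      _ ≤ (T * 2) * |K₂| := by gcongr
      _ = T * (2 * |K₂|) := by ring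
      _ ≤ T * (ℓ * δ) := by gcongr
      _ = δ * (T * ℓ) := by ring
      _ ≤ δ * (T * ℓ ^ 8) := by gcongr

end Setup

set_option maxHeartbeats 800000 in
/-- At large horizons most runs are typical. -/
lemma Admissible.exists_typicalRun {n d : ℕ} {κ γ αlo αhi S : ℝ} {Q : Matrix (Fin n) (Fin n) ℝ}
    {R : Matrix (Fin d) (Fin d) ℝ} {M : Set (Sys n d)} {Θs : Sys n d}
    (h : Admissible κ γ αlo αhi S Q R M Θs) (hn : 1 ≤ n) (hκ : 1 ≤ κ)
    (hγ : 0 < γ) (hγ' : γ ≤ 1) (hα : 0 < αlo) {σ δ : ℝ} (hσ : 0 < σ) (hδ : 0 < δ) (hδ' : δ < 1)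
    {Tw : ℕ → ℝ} (hTw : Tendsto (fun T : ℕ => Tw T / Real.log T) atTop atTop)
    (hTw' : ∀ᶠ T : ℕ in atTop, Tw T ≤ T / 2) :
    ∃ r > 0, ∃ A B c g ρ : ℝ, 0 < B ∧ 0 < c ∧ 0 < g ∧
      (∀ Θ : Sys n d, fsq (Θ - Θs) ≤ r ^ 2 → Θ ∈ M) ∧ ∀ᶠ T : ℕ in atTop,
        (∃ C ε, LargeHorizon (tsac Q R M κ γ S σ Θs δ T (Tw T)) r C A B ρ ε T) ∧
        0 < Tw T ∧
        ∃ E : Set (NoiseIdx n d → ℝ),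
          (tsac Q R M κ γ S σ Θs δ T (Tw T)).law Eᶜ ≤ ENNReal.ofReal (6 * δ) ∧
          ∀ ω ∈ E, (tsac Q R M κ γ S σ Θs δ T (Tw T)).TypicalRun A c g T ω := by
  have hTw0 : ∀ᶠ T in atTop, 0 < Tw T := by
    filter_upwards [hTw.eventually_gt_atTop 0, tendsto_log_natCast.eventually_gt_atTop 0]
      with T h1 h2
    exact (div_pos_iff_of_pos_right h2).1 h1
  obtain ⟨r, hr, C, A, B, ρ, ε, hA, hB, hε, hball, hlarge⟩ :=
    h.exists_largeHorizon hn hκ hγ hγ' hα hσ hδ hδ' (hTw0.mono fun _ h => h.le) hTw'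
  obtain ⟨Λ, hΛ, hlip⟩ := h.exists_lipschitz hn hκ hγ hγ' hα
  obtain ⟨T₀, hT₀⟩ := hlarge.exists
  set τ := (tsac Q R M κ γ S σ Θs δ T₀ (Tw T₀)).τ₀ with hτ
  obtain ⟨c, hc, hinfo⟩ := Setup.exists_law_epochInfo_lt_le n d hn hκ hσ τ hTw hδ
  obtain ⟨N, hN⟩ := Setup.exists_net n d hε ρ
  set P := riccati Q R Θs with hP
  set g₀ := ‖R + Θs.Bᵀ * P * Θs.B‖ with hg₀
  have hg₀0 : 0 ≤ g₀ := norm_nonneg _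
  set g := 2 + g₀ * (1 + κ) ^ 2 + g₀ * Λ ^ 2 with hg
  have h1 : 0 ≤ g₀ * (1 + κ) ^ 2 := by positivity
  have h2 : 0 ≤ g₀ * Λ ^ 2 := by positivity
  refine ⟨r, hr, A, B, c, g, ρ, hB, hc, by positivity, hball, ?_⟩
  filter_upwards [hlarge, hTw0, hinfo, Setup.eventually_law_compl_NoiseLE_le n d hκ hσ hδ,
    Setup.eventually_law_compl_Hits_le n d hε N hδ,
    Setup.eventually_law_martingales_le n (P := ‖P‖) (S := S) (σ := σ) hδ]
    with T hl hTw0 hinfo hnoise hhits hmart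
  refine ⟨⟨C, ε, hl⟩, hTw0, ?_⟩
  set p := tsac Q R M κ γ S σ Θs δ T (Tw T) with hp
  have hv := hl.valid
  have hone := hl.one_le_log
  set ℓ := Real.log T with hℓ
  have hℓ0 : 0 < ℓ := by linarith
  have hTpos : 0 < T := by
    rcases Nat.eq_zero_or_pos T with rfl | h
    · simp [hℓ] at hℓ0
    · exact h
  have hT' : (0 : ℝ) < T := by exact_mod_cast hTpos
  have hx : 0 < √(T : ℝ) * ℓ ^ 4 := by positivity
  obtain ⟨k, hk, hkinfo⟩ := hinfo p hv rfl rfl rfl rfl hl.potential_le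
  set E₁ := {ω | A * ℓ < p.stoppedConf (ℓ ^ 3) (A * ℓ) ω T} with hE₁
  set E₂ := {ω | √T * ℓ ^ 4 ≤ p.stoppedCross (ℓ ^ 3) (A * ℓ) ω (T + 1)} with hE₂
  set E₃ := {ω | √T * ℓ ^ 4 ≤ ∑ t ∈ Finset.range (T + 1), p.noiseTerm ω t} with hE₃
  set E₄ := {ω | p.epochInfo ω k < 2 * (c * p.Tw + p.potential T (ℓ ^ 3))} with hE₄
  have hp₁ : p.law E₁ ≤ ENNReal.ofReal δ :=
    (Setup.law_stoppedConf_gt_le hv.meas hn (ℓ ^ 3) (by positivity) T).trans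
      (ENNReal.ofReal_le_ofReal hl.conf_le)
  have hp₂ : p.law E₂ ≤ ENNReal.ofReal δ :=
    (Setup.law_stoppedCross_ge_le hv (ℓ ^ 3) (A * ℓ) (T + 1) hx).trans
      (ENNReal.ofReal_le_ofReal hmart.1)
  have hp₃ : p.law E₃ ≤ ENNReal.ofReal δ :=
    (p.law_sum_noiseTerm_ge_le (T + 1) hx).trans (ENNReal.ofReal_le_ofReal hmart.2)
  -- six exceptional events, of probability at most `δ` each
  set F := (Setup.NoiseLE n d T ℓ)ᶜ ∪ (Setup.Hits n d T ε N)ᶜ ∪ E₁ ∪ E₂ ∪ E₃ ∪ E₄ with hF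
  have hlawF : p.law F ≤ ENNReal.ofReal (6 * δ) := by
    have e : ENNReal.ofReal (6 * δ) = ENNReal.ofReal δ + ENNReal.ofReal δ + ENNReal.ofReal δ +
        ENNReal.ofReal δ + ENNReal.ofReal δ + ENNReal.ofReal δ := by
      rw [← ENNReal.ofReal_add, ← ENNReal.ofReal_add, ← ENNReal.ofReal_add, ← ENNReal.ofReal_add,
        ← ENNReal.ofReal_add] <;> try positivity
      congr 1
      ring
    rw [e]
    refine (measure_union_le _ _).trans (add_le_add ?_ hkinfo)
    refine (measure_union_le _ _).trans (add_le_add ?_ hp₃)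
    refine (measure_union_le _ _).trans (add_le_add ?_ hp₂)
    refine (measure_union_le _ _).trans (add_le_add ?_ hp₁)
    exact (measure_union_le _ _).trans (add_le_add (hnoise p rfl rfl) (hhits p))
  refine ⟨Fᶜ, by rwa [compl_compl], fun ω hω => ?_⟩
  simp only [hF, Set.compl_union, compl_compl, Set.mem_inter_iff] at hω
  obtain ⟨⟨⟨⟨⟨hωL, hωH⟩, hω₁⟩, hω₂⟩, hω₃⟩, hω₄⟩ := hω
  have hω₁' : p.stoppedConf (ℓ ^ 3) (A * ℓ) ω T ≤ A * ℓ := not_lt.1 hω₁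
  have hω₂' : p.stoppedCross (ℓ ^ 3) (A * ℓ) ω (T + 1) ≤ √T * ℓ ^ 4 := le_of_not_ge hω₂
  have hω₃' : ∑ t ∈ Finset.range (T + 1), p.noiseTerm ω t ≤ √T * ℓ ^ 4 := le_of_not_ge hω₃
  have hgood := hl.constants.good hv (N := N) hN hωL hωH hω₁'
  refine ⟨fun s hs => (hgood s hs s le_rfl).2.1, fun s hs => (hgood s hs s le_rfl).2.2,
    ⟨k, hk, ?_⟩, ?_⟩
  · rw [inv_inv]
    exact not_lt.1 hω₄
  · have hreg := hl.constants.regret_le hv (N := N) hN hωL hωH hω₁' h.Q_posDef h.R_posDef hα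
      (mul_nrm_sq_le_of_posDef_sub h.lt_Q) hΛ.le (fun Θ hΘ => hlip Θ hΘ Θs h.mem_M) le_rfl
      hTw0.le hω₂' hω₃'
    refine hreg.trans ?_
    have hs0 : 0 ≤ ∑ t ∈ Finset.range (T + 1), p.uncertainty ω t :=
      Finset.sum_nonneg fun t _ => Setup.uncertainty_nonneg hv ω t
    set s := ∑ t ∈ Finset.range (T + 1), p.uncertainty ω t with hs
    change 2 * (√T * ℓ ^ 4) + g₀ * (((1 + κ) * ℓ ^ 3) ^ 2 * (Tw T + 1) +
      (Λ * ℓ ^ 3 * ℓ ^ 2) ^ 2 * s) ≤ g * (√T * ℓ ^ 4 + ℓ ^ 6 * (Tw T + 1) + ℓ ^ 10 * s)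
    have hy : 0 ≤ ℓ ^ 6 * (Tw T + 1) := by positivity
    have hz : 0 ≤ ℓ ^ 10 * s := by positivity
    have e : 2 * (√T * ℓ ^ 4) + g₀ * (((1 + κ) * ℓ ^ 3) ^ 2 * (Tw T + 1) +
        (Λ * ℓ ^ 3 * ℓ ^ 2) ^ 2 * s) = 2 * (√T * ℓ ^ 4) +
        g₀ * (1 + κ) ^ 2 * (ℓ ^ 6 * (Tw T + 1)) + g₀ * Λ ^ 2 * (ℓ ^ 10 * s) := by ring
    have i₁ : 2 * (√T * ℓ ^ 4) ≤ g * (√T * ℓ ^ 4) :=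
      mul_le_mul_of_nonneg_right (by linarith) hx.le
    have i₂ : g₀ * (1 + κ) ^ 2 * (ℓ ^ 6 * (Tw T + 1)) ≤ g * (ℓ ^ 6 * (Tw T + 1)) :=
      mul_le_mul_of_nonneg_right (by linarith) hy
    have i₃ : g₀ * Λ ^ 2 * (ℓ ^ 10 * s) ≤ g * (ℓ ^ 10 * s) :=
      mul_le_mul_of_nonneg_right (by linarith) hz
    rw [e]
    linarith

/-! ### The regret in terms of the length of the exploration phase -/

lemma SelfExploring.mono {n d : ℕ} {Q : Matrix (Fin n) (Fin n) ℝ} {R : Matrix (Fin d) (Fin d) ℝ}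
    {κ γ S : ℝ} {Θ₀ : Sys n d} {r r' c c' : ℝ} (h : SelfExploring Q R κ γ S Θ₀ r c) (hr : r' ≤ r)
    (hc : c' ≤ c) : SelfExploring Q R κ γ S Θ₀ r' c' :=
  fun Θ₁ Θ₂ h₁ h₂ hS₁ hS₂ hΘ u g hu hg => by
    have h0 : 0 ≤ nrm g * nrm u ^ 2 := mul_nonneg (nrm_nonneg _) (sq_nonneg _)
    exact (mul_le_mul_of_nonneg_right hc h0).trans
      (h Θ₁ Θ₂ h₁ h₂ hS₁ hS₂ (hΘ.trans hr) u g hu hg)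

/-- A non-singular optimal closed loop is self-exploring. -/
lemma SelfExploring.of_isUnit {n d : ℕ} {κ γ αlo αhi S : ℝ} {Q : Matrix (Fin n) (Fin n) ℝ}
    {R : Matrix (Fin d) (Fin d) ℝ} {M : Set (Sys n d)} {Θs : Sys n d}
    (h : Admissible κ γ αlo αhi S Q R M Θs) (hU : IsUnit (closedLoop Q R Θs)) (hn : 1 ≤ n)
    (hκ : 1 ≤ κ) (hγ : 0 < γ) (hγ' : γ ≤ 1) (hα : 0 < αlo) :
    ∃ r > 0, ∃ c > 0, SelfExploring Q R κ γ S Θs r c :=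
  exists_selfExploration h.Q_posDef h.R_posDef hκ hγ hγ' hα (mul_nrm_sq_le_of_posDef_sub h.lt_R)
    (mul_nrm_sq_le_of_posDef_sub h.lt_Q) (h.S_pos hn).le (h.stabilizable _ h.mem_M)
    (h.norm_le (h.S_pos hn).le h.mem_M) hU

namespace Admissible

variable {n d : ℕ} {κ γ αlo αhi S : ℝ} {Q : Matrix (Fin n) (Fin n) ℝ}
  {R : Matrix (Fin d) (Fin d) ℝ} {M : Set (Sys n d)} {Θs : Sys n d}

/-- The exploration makes `tr V⁻¹` of the order of `1 / Tw`. -/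
lemma exists_regretLE (h : Admissible κ γ αlo αhi S Q R M Θs) (hn : 1 ≤ n) (hκ : 1 ≤ κ)
    (hγ : 0 < γ) (hγ' : γ ≤ 1) (hα : 0 < αlo) {σ δ : ℝ} (hσ : 0 < σ) (hδ : 0 < δ) (hδ' : δ < 1)
    {Tw : ℕ → ℝ} (hTw : Tendsto (fun T : ℕ => Tw T / Real.log T) atTop atTop)
    (hTw' : ∀ᶠ T : ℕ in atTop, Tw T ≤ T / 2) :
    ∃ G > 0, ∀ᶠ T : ℕ in atTop, RegretLE Q R M κ γ S σ Θs δ T (Tw T)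
      (G * (√T * Real.log T ^ 4 + Real.log T ^ 6 * (Tw T + 1) +
        Real.log T ^ 10 * ((T + 1) / Tw T))) := by
  obtain ⟨r, -, A, B, c, g, ρ, -, hc, hg, -, hT⟩ :=
    h.exists_typicalRun hn hκ hγ hγ' hα hσ hδ hδ' hTw hTw'
  refine ⟨g * (1 + 1 / c), by positivity, ?_⟩
  filter_upwards [hT] with T hT
  obtain ⟨⟨C, ε, hl⟩, hTw0, E, hE, hrun⟩ := hT
  refine regretLE_of_law E hδ.le (hE.trans (ENNReal.ofReal_le_ofReal (by linarith)))
    fun ω hω => ?_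
  have ht := hrun ω hω
  have hℓ0 : 0 < Real.log T := by linarith [hl.one_le_log]
  obtain ⟨k, hk, hkinfo⟩ := ht.explored
  have hsum := Setup.sum_uncertainty_le hl.valid hk ht.nrm_Z_le
    (by change 0 < (c * Tw T)⁻¹; positivity) hkinfo
  have e : (T + 1) * (c * Tw T)⁻¹ = 1 / c * ((T + 1) / Tw T) := by field_simp
  refine ht.regret_le.trans ?_
  have h1 : Real.log T ^ 10 * ∑ t ∈ Finset.range (T + 1),
      (tsac Q R M κ γ S σ Θs δ T (Tw T)).uncertainty ω t ≤
        Real.log T ^ 10 * (1 / c * ((T + 1) / Tw T)) := by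
    rw [← e]
    exact mul_le_mul_of_nonneg_left hsum (by positivity)
  have h2 : 0 ≤ 1 / c * (√T * Real.log T ^ 4 + Real.log T ^ 6 * (Tw T + 1)) := by positivity
  have h3 : 0 ≤ Real.log T ^ 10 * ((T + 1) / Tw T) := by positivity
  rw [mul_assoc]
  refine mul_le_mul_of_nonneg_left ?_ hg.le
  change √T * Real.log T ^ 4 + Real.log T ^ 6 * (Tw T + 1) + _ ≤ _
  linarith

set_option maxHeartbeats 800000 in
/-- If the optimal closed loop is non-singular, then sampling itself explores, and the squares of
`tr V⁻¹` have a sum of the order of `log T`. -/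
lemma exists_regretLE_of_isUnit (h : Admissible κ γ αlo αhi S Q R M Θs)
    (hU : IsUnit (closedLoop Q R Θs)) (hn : 1 ≤ n) (hκ : 1 ≤ κ)
    (hγ : 0 < γ) (hγ' : γ ≤ 1) (hα : 0 < αlo) {σ δ : ℝ} (hσ : 0 < σ) (hδ : 0 < δ) (hδ' : δ < 1)
    {Tw : ℕ → ℝ} (hTw : Tendsto (fun T : ℕ => Tw T / Real.log T) atTop atTop)
    (hTw' : ∀ᶠ T : ℕ in atTop, Tw T ≤ T / 2) :
    ∃ G > 0, ∀ᶠ T : ℕ in atTop, RegretLE Q R M κ γ S σ Θs δ T (Tw T)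
      (G * (√T * Real.log T ^ 4 + Real.log T ^ 6 * (Tw T + 1) + Real.log T ^ 11 * √(T + 1))) := by
  obtain ⟨r₀, hr₀, c₀, hc₀, hself₀⟩ := SelfExploring.of_isUnit h hU hn hκ hγ hγ' hα
  obtain ⟨r, hr, A, B, c, g, ρ, hB, hc, hg, hball, hT⟩ :=
    h.exists_typicalRun hn hκ hγ hγ' hα hσ hδ hδ' hTw hTw'
  set r₁ := min r r₀ with hr₁
  set c₁ := min 1 c₀ with hc₁
  have hr₁0 : 0 < r₁ := lt_min hr hr₀
  have hc₁0 : 0 < c₁ := lt_min one_pos hc₀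
  have hself : SelfExploring Q R κ γ S Θs r₁ c₁ :=
    hself₀.mono (min_le_right _ _) (min_le_right _ _)
  obtain ⟨C₁, hC₁, hlaw⟩ := Setup.exists_law_sum_trace_sq_ge_le n d hn hσ hc₁0
  set τ := (tsac Q R M κ γ S σ Θs δ 0 (Tw 0)).τ₀ with hτ
  set K : ℝ := 2 * ((n + d) * n) + 2 * ρ ^ 2 with hK
  have hK0 : 0 ≤ K := by positivity
  refine ⟨g * (1 + √τ), by positivity, ?_⟩
  filter_upwards [hT, hTw.eventually_ge_atTop (B * K / (c * r₁ ^ 2)),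
    hTw.eventually_ge_atTop (4 * B / c), hTw.eventually_ge_atTop (1 / c),
    tendsto_log_natCast.eventually_ge_atTop (C₁ * (8 * (n + d) + 1) / δ)]
    with T hT hT₁ hT₂ hT₃ hT₄
  obtain ⟨⟨C, ε, hl⟩, hTw0, E, hE, hrun⟩ := hT
  set p := tsac Q R M κ γ S σ Θs δ T (Tw T) with hp
  have hv := hl.valid
  have hone := hl.one_le_log
  set ℓ := Real.log T with hℓ
  have hℓ0 : 0 < ℓ := by linarith
  set φ := (c * Tw T)⁻¹ with hφ
  have hφ0 : 0 < φ := by positivity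
  rw [div_le_div_iff₀ (by positivity) hℓ0] at hT₁
  rw [div_le_div_iff₀ hc hℓ0] at hT₂ hT₃
  have hβ := hl.betaSq_le
  have hβφ : p.betaSq (ℓ ^ 3) T * φ ≤ B * ℓ * φ := mul_le_mul_of_nonneg_right hβ hφ0.le
  have hsc : p.SamplingConstants r₁ c₁ (ℓ ^ 3) (A * ℓ) φ ρ T :=
    { selfExploring := hself
      c_pos := hc₁0
      c_le := min_le_left _ _
      r_nonneg := hr₁0.le
      ball := fun Θ hΘ => hball Θ (hΘ.trans (pow_le_pow_left₀ hr₁0.le (min_le_left _ _) 2))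
      le_ρ := hl.constants.le_ρ
      le_r := by
        calc φ * (p.betaSq (ℓ ^ 3) T * K) = p.betaSq (ℓ ^ 3) T * φ * K := by ring
          _ ≤ B * ℓ * φ * K := mul_le_mul_of_nonneg_right hβφ hK0
          _ = B * K * ℓ / (c * Tw T) := by rw [hφ, div_eq_mul_inv]; ring
          _ ≤ r₁ ^ 2 := by
            rw [div_le_iff₀ (by positivity)]
            linarith
      le_one := by
        have e : 4 * (B * ℓ * φ) = 4 * B * ℓ / (c * Tw T) := by rw [hφ, div_eq_mul_inv]; ring
        have : 4 * (B * ℓ * φ) ≤ 1 := by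
          rw [e, div_le_iff₀ (by positivity)]
          linarith
        linarith
      φ_le := by
        refine inv_le_one_of_one_le₀ ?_
        linarith }
  set F := {ω | ℓ ^ 2 ≤ ∑ j ∈ Finset.range (T / p.τ₀ + 1),
    (p.Accurate (ℓ ^ 3) (A * ℓ) φ (j * p.τ₀)).indicator
      (fun ω => p.μ * p.S ^ 2 * (p.V ω (j * p.τ₀))⁻¹.trace ^ 2) ω} with hF
  have hpF : p.law F ≤ ENNReal.ofReal δ := by
    refine (hlaw p hv rfl r₁ (ℓ ^ 3) (A * ℓ) φ ρ T hsc _ (fun j hj => ?_) (ℓ ^ 2)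
      (by positivity)).trans (ENNReal.ofReal_le_ofReal ?_)
    · exact (Nat.mul_le_mul_right _ (Nat.lt_succ_iff.1 hj)).trans (Nat.div_mul_le_self _ _)
    · rw [div_le_iff₀ hδ] at hT₄
      rw [div_le_iff₀ (by positivity)]
      have h1 : 2 * p.potential T (ℓ ^ 3) + 1 ≤ (8 * (n + d) + 1) * ℓ := by
        linarith [hl.potential_le]
      calc C₁ * (2 * p.potential T (ℓ ^ 3) + 1) ≤ C₁ * ((8 * (n + d) + 1) * ℓ) := by gcongr
        _ = C₁ * (8 * (n + d) + 1) * ℓ := by ring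
        _ ≤ ℓ * δ * ℓ := by gcongr
        _ = δ * ℓ ^ 2 := by ring
  refine regretLE_of_law (E ∩ Fᶜ) hδ.le ?_ fun ω hω => ?_
  · rw [Set.compl_inter, compl_compl]
    refine (measure_union_le _ _).trans ((add_le_add hE hpF).trans ?_)
    rw [← ENNReal.ofReal_add (by positivity) hδ.le]
    exact ENNReal.ofReal_le_ofReal (by linarith)
  have ht := hrun ω hω.1
  have hy : ∑ j ∈ Finset.range (T / p.τ₀ + 1),
      (p.Accurate (ℓ ^ 3) (A * ℓ) φ (j * p.τ₀)).indicator
        (fun ω => p.μ * p.S ^ 2 * (p.V ω (j * p.τ₀))⁻¹.trace ^ 2) ω ≤ ℓ ^ 2 := le_of_not_ge hω.2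
  obtain ⟨k, hk, hkinfo⟩ := ht.explored
  have hsum := Setup.sum_uncertainty_le_sqrt hv hk ht.nrm_Z_le ht.conf_le hφ0 hkinfo hy
  have hsum' : ∑ t ∈ Finset.range (T + 1), p.uncertainty ω t ≤ √τ * (√(T + 1) * ℓ) := by
    refine hsum.trans ?_
    have h1 : ℓ ^ 2 / (p.μ * p.S ^ 2) ≤ ℓ ^ 2 := div_le_self (by positivity) hl.one_le_μS
    calc √((T + 1) * (p.τ₀ * (ℓ ^ 2 / (p.μ * p.S ^ 2)))) ≤ √((T + 1) * (τ * ℓ ^ 2)) := by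
          change √((T + 1) * (τ * (ℓ ^ 2 / (p.μ * p.S ^ 2)))) ≤ _
          gcongr
      _ = √τ * (√(T + 1) * ℓ) := by
          rw [Real.sqrt_mul (by positivity), Real.sqrt_mul (by positivity), Real.sqrt_sq hℓ0.le]
          ring
  refine ht.regret_le.trans ?_
  have h1 : ℓ ^ 10 * ∑ t ∈ Finset.range (T + 1), p.uncertainty ω t ≤
      √τ * (ℓ ^ 11 * √(T + 1)) := by
    refine (mul_le_mul_of_nonneg_left hsum' (by positivity)).trans (le_of_eq ?_)
    ring
  have h2 : 0 ≤ √τ * (√T * ℓ ^ 4 + ℓ ^ 6 * (Tw T + 1)) := by positivity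
  have h3 : 0 ≤ ℓ ^ 11 * √(T + 1) := by positivity
  rw [mul_assoc]
  refine mul_le_mul_of_nonneg_left ?_ hg.le
  change √T * ℓ ^ 4 + ℓ ^ 6 * (Tw T + 1) + _ ≤ _
  linarith

end Admissible

/-! ### Lengths of the exploration phase -/

lemma RegretLE.mono.{u} {n d : ℕ} {Q : Matrix (Fin n) (Fin n) ℝ} {R : Matrix (Fin d) (Fin d) ℝ}
    {M : Set (Sys n d)} {κ γ S σ : ℝ} {Θs : Sys n d} {δ : ℝ} {T : ℕ} {Tw b b' : ℝ}
    (h : RegretLE.{u} Q R M κ γ S σ Θs δ T Tw b) (hb : b ≤ b') :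
    RegretLE.{u} Q R M κ γ S σ Θs δ T Tw b' :=
  fun Ω _ P _ ξ hξ => (h Ω P ξ hξ).trans (measure_mono fun _ hω => le_trans hω hb)

lemma eventually_abs_le {ε : ℕ → ℝ} (hε : Tendsto ε atTop (𝓝 0)) {e : ℝ} (he : 0 < e) :
    ∀ᶠ T in atTop, |ε T| ≤ e :=
  ((tendsto_zero_iff_abs_tendsto_zero ε).1 hε).eventually_le_const he

/-- The factor `y ^ |e|` absorbs the exponent `e` in both directions. -/
lemma rpow_one_add_bounds {y e : ℝ} (hy : 1 ≤ y) (he : |e| ≤ 1 / 2) :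
    1 ≤ y ^ |e| ∧ y ^ |e| ≤ √y ∧ y ^ (1 + e) ≤ y * y ^ |e| ∧ y ≤ y ^ (1 + e) * y ^ |e| := by
  have hy0 : 0 < y := by linarith
  refine ⟨Real.one_le_rpow hy (abs_nonneg e), ?_, ?_, ?_⟩
  · rw [Real.sqrt_eq_rpow]
    exact Real.rpow_le_rpow_of_exponent_le hy he
  · rw [← Real.rpow_one_add' hy0.le (by positivity)]
    exact Real.rpow_le_rpow_of_exponent_le hy (by linarith [le_abs_self e])
  · rw [← Real.rpow_add hy0]
    exact Real.self_le_rpow_of_one_le hy (by linarith [neg_abs_le e])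

lemma le_sqrt_of_sq_le_natCast {x : ℝ} {T : ℕ} (hx : x ^ 2 ≤ T) : x ≤ √(T : ℝ) :=
  Real.le_sqrt_of_sq_le hx

lemma eventually_le_sqrt_natCast (a : ℝ) : ∀ᶠ T : ℕ in atTop, a ≤ √(T : ℝ) :=
  (Real.tendsto_sqrt_atTop.comp tendsto_natCast_atTop_atTop).eventually_ge_atTop a

/-- The exploration phase of length about `√T`: its length, and the estimates that are used. -/
lemma eventually_sqrt_exploration {ε : ℕ → ℝ} (hε : Tendsto ε atTop (𝓝 0)) (T0 : ℝ) {c : ℝ}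
    (hc : 0 < c) : ∀ᶠ T : ℕ in atTop,
      1 ≤ (√(T : ℝ) * Real.log T) ^ |ε T| ∧
      c * Real.log T ≤ max T0 (c * (√(T : ℝ) * Real.log T) ^ (1 + ε T)) / Real.log T ∧
      max T0 (c * (√(T : ℝ) * Real.log T) ^ (1 + ε T)) ≤ T / 2 ∧
      max T0 (c * (√(T : ℝ) * Real.log T) ^ (1 + ε T)) + 1 ≤
        (1 + c) * (√(T : ℝ) * Real.log T * (√(T : ℝ) * Real.log T) ^ |ε T|) ∧
      (T + 1) / max T0 (c * (√(T : ℝ) * Real.log T) ^ (1 + ε T)) ≤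
        2 / c * (√(T : ℝ) * (√(T : ℝ) * Real.log T) ^ |ε T|) := by
  filter_upwards [eventually_abs_le hε one_half_pos, tendsto_log_natCast.eventually_ge_atTop 1,
    tendsto_log_natCast.eventually_ge_atTop (2 * c), eventually_log_pow_le 10,
    eventually_le_sqrt_natCast (2 * |T0|), eventually_le_sqrt_natCast (|T0| + 1),
    eventually_ge_atTop 1] with T hε h1 hc2 h10 hT0 hT0' hT
  set ℓ := Real.log T with hℓ
  set s := √(T : ℝ) with hs
  have hT' : (1 : ℝ) ≤ T := by exact_mod_cast hT
  have hss : s ^ 2 = T := Real.sq_sqrt (by linarith)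
  have hs1 : 1 ≤ s := Real.one_le_sqrt.2 hT'
  have hs0 : 0 < s := by linarith
  have hℓ0 : 0 < ℓ := by linarith
  have h5 : ℓ ^ 5 ≤ s := le_sqrt_of_sq_le_natCast (by rw [← pow_mul]; exact h10)
  set y := s * ℓ with hy
  have hy1 : 1 ≤ y := one_le_mul_of_one_le_of_one_le hs1 h1
  have hy0 : 0 < y := by linarith
  obtain ⟨hW1, hW2, hle, hge⟩ := rpow_one_add_bounds hy1 hε
  set W := y ^ |ε T| with hW
  set z := y ^ (1 + ε T) with hz
  have hz0 : 0 < z := Real.rpow_pos_of_pos hy0 _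
  have hry : 0 < √y := Real.sqrt_pos.2 hy0
  have hrr : √y * √y = y := Real.mul_self_sqrt hy0.le
  have hzy : √y ≤ z := by
    have h2 : y ≤ z * √y := hge.trans (by gcongr)
    nlinarith
  have hyℓ : ℓ ^ 2 ≤ √y := by
    refine Real.le_sqrt_of_sq_le ?_
    have h2 : ℓ ^ 4 ≤ ℓ ^ 5 := pow_le_pow_right₀ h1 (by norm_num)
    calc (ℓ ^ 2) ^ 2 = ℓ ^ 4 := by ring
      _ ≤ s := h2.trans h5
      _ ≤ s * ℓ := le_mul_of_one_le_right hs0.le h1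
  have hm0 : 0 < c * z := by positivity
  refine ⟨hW1, ?_, ?_, ?_, ?_⟩
  · rw [le_div_iff₀ hℓ0]
    refine le_trans ?_ (le_max_right _ _)
    calc c * ℓ * ℓ = c * ℓ ^ 2 := by ring
      _ ≤ c * z := by gcongr; exact hyℓ.trans hzy
  · refine max_le ?_ ?_
    · nlinarith [le_abs_self T0]
    · -- `(√T log T)^{3/2} ≤ T / log T`
      have h2 : y * √y * ℓ ≤ T := by
        refine le_of_sq_le_sq ?_ (by linarith)
        calc (y * √y * ℓ) ^ 2 = y ^ 2 * (√y * √y) * ℓ ^ 2 := by ring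
          _ = s ^ 3 * ℓ ^ 5 := by rw [hrr, hy]; ring
          _ ≤ s ^ 3 * s := by gcongr
          _ = (s ^ 2) ^ 2 := by ring
          _ = (T : ℝ) ^ 2 := by rw [hss]
      have h3 : z ≤ y * √y := hle.trans (by gcongr)
      have h4 : 0 ≤ y * √y := by positivity
      have h5 : c * z ≤ ℓ / 2 * (y * √y) := mul_le_mul (by linarith) h3 hz0.le (by linarith)
      linarith
  · have hyW : s ≤ y * W := (le_mul_of_one_le_right hs0.le h1).trans
      (le_mul_of_one_le_right hy0.le hW1)
    have h2 : max T0 (c * z) ≤ |T0| + c * (y * W) := max_le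
      ((le_abs_self T0).trans (le_add_of_nonneg_right (by positivity)))
      ((mul_le_mul_of_nonneg_left hle hc.le).trans (le_add_of_nonneg_left (abs_nonneg _)))
    linarith
  · have h2 : c * y ≤ max T0 (c * z) * W := by
      calc c * y ≤ c * (z * W) := by gcongr
        _ = c * z * W := by ring
        _ ≤ _ := by gcongr; exact le_max_right _ _
    rw [div_le_iff₀ (lt_max_of_lt_right hm0)]
    have h3 : s ≤ y := le_mul_of_one_le_right hs0.le h1
    calc (T + 1 : ℝ) ≤ 2 * s ^ 2 := by rw [hss]; linarith
      _ = 2 / c * s * (c * s) := by field_simp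
      _ ≤ 2 / c * s * (c * y) := by gcongr
      _ ≤ 2 / c * s * (max T0 (c * z) * W) := by gcongr
      _ = 2 / c * (s * W) * max T0 (c * z) := by ring

/-- The exploration phase of length about `log T`. -/
lemma eventually_log_exploration {ε : ℕ → ℝ} (hε : Tendsto ε atTop (𝓝 0)) (T0 : ℝ) {c : ℝ}
    (hc : 0 < c) : ∀ᶠ T : ℕ in atTop,
      c * Real.log T ^ ε T ≤ max T0 (c * Real.log T ^ (1 + ε T)) / Real.log T ∧
      max T0 (c * Real.log T ^ (1 + ε T)) ≤ T / 2 ∧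
      max T0 (c * Real.log T ^ (1 + ε T)) + 1 ≤ (1 + c) * √(T : ℝ) := by
  filter_upwards [eventually_abs_le hε one_pos, tendsto_log_natCast.eventually_ge_atTop 1,
    eventually_log_pow_le 4, eventually_le_sqrt_natCast (2 * |T0|),
    eventually_le_sqrt_natCast (|T0| + 1), eventually_le_sqrt_natCast (2 * c),
    eventually_ge_atTop 1] with T hε h1 h4 hT0 hT0' hc2 hT
  set ℓ := Real.log T with hℓ
  set s := √(T : ℝ) with hs
  have hT' : (1 : ℝ) ≤ T := by exact_mod_cast hT
  have hss : s ^ 2 = T := Real.sq_sqrt (by linarith)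
  have hs1 : 1 ≤ s := Real.one_le_sqrt.2 hT'
  have hℓ0 : 0 < ℓ := by linarith
  have h2 : ℓ ^ 2 ≤ s := le_sqrt_of_sq_le_natCast (by rw [← pow_mul]; exact h4)
  have hz : ℓ ^ (1 + ε T) ≤ s := by
    refine (Real.rpow_le_rpow_of_exponent_le h1 (y := 1 + ε T) (z := 2)
      (by linarith [le_abs_self (ε T)])).trans ?_
    rwa [Real.rpow_two]
  have hcz : c * ℓ ^ (1 + ε T) ≤ c * s := by gcongr
  refine ⟨?_, max_le ?_ ?_, ?_⟩
  · rw [le_div_iff₀ hℓ0]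
    refine le_trans (le_of_eq ?_) (le_max_right _ _)
    rw [Real.rpow_add hℓ0, Real.rpow_one]
    ring
  · nlinarith [le_abs_self T0]
  · nlinarith
  · have : max T0 (c * ℓ ^ (1 + ε T)) ≤ |T0| + c * s := max_le
      ((le_abs_self T0).trans (le_add_of_nonneg_right (by positivity)))
      (hcz.trans (le_add_of_nonneg_left (abs_nonneg _)))
    linarith

namespace Admissible

variable {n d : ℕ} {κ γ αlo αhi S : ℝ} {Q : Matrix (Fin n) (Fin n) ℝ}
  {R : Matrix (Fin d) (Fin d) ℝ} {M : Set (Sys n d)} {Θs : Sys n d}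

/-- Exploration of length about `√T`. The constant of the regret bound is absorbed in one factor
`log T`. -/
lemma eventually_regretLE_sqrt (h : Admissible κ γ αlo αhi S Q R M Θs) (hn : 1 ≤ n) (hκ : 1 ≤ κ)
    (hγ : 0 < γ) (hγ' : γ ≤ 1) (hα : 0 < αlo) {σ δ : ℝ} (hσ : 0 < σ) (hδ : 0 < δ) (hδ' : δ < 1)
    (T0 : ℝ) {c : ℝ} (hc : 0 < c) {ε : ℕ → ℝ} (hε : Tendsto ε atTop (𝓝 0)) :
    ∀ᶠ T : ℕ in atTop, RegretLE Q R M κ γ S σ Θs δ T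
      (max T0 (c * (√(T : ℝ) * Real.log T) ^ (1 + ε T)))
      (√(T * Real.log (1 / δ)) *
        (Real.log T ^ 11 * (√(T : ℝ) * Real.log T) ^ |ε T|)) := by
  have hx := eventually_sqrt_exploration hε T0 hc
  obtain ⟨G, hG, hreg⟩ := h.exists_regretLE hn hκ hγ hγ' hα hσ hδ hδ'
    (tendsto_atTop_mono' _ (hx.mono fun T hT => hT.2.1) (tendsto_log_natCast.const_mul_atTop hc))
    (hx.mono fun T hT => hT.2.2.1)
  have hL : 0 < Real.log (1 / δ) := Real.log_pos (by rw [lt_div_iff₀ hδ]; linarith)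
  filter_upwards [hreg, hx, tendsto_log_natCast.eventually_ge_atTop 1,
    tendsto_log_natCast.eventually_ge_atTop (G * (2 + c + 2 / c) / √(Real.log (1 / δ)))]
    with T hreg hx h1 hℓG
  refine hreg.mono ?_
  obtain ⟨hW, -, -, hx₁, hx₂⟩ := hx
  set ℓ := Real.log T with hℓ
  set s := √(T : ℝ) with hs
  set W := (s * ℓ) ^ |ε T| with hW'
  have hs0 : 0 ≤ s := Real.sqrt_nonneg _
  rw [div_le_iff₀ (Real.sqrt_pos.2 hL)] at hℓG
  have i₁ : s * ℓ ^ 4 ≤ s * ℓ ^ 10 * W := by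
    have : ℓ ^ 4 ≤ ℓ ^ 10 := pow_le_pow_right₀ h1 (by norm_num)
    exact (mul_le_mul_of_nonneg_left this hs0).trans (le_mul_of_one_le_right (by positivity) hW)
  have i₂ : ℓ ^ 6 * (max T0 (c * (s * ℓ) ^ (1 + ε T)) + 1) ≤ (1 + c) * (s * ℓ ^ 10 * W) := by
    have : ℓ ^ 7 ≤ ℓ ^ 10 := pow_le_pow_right₀ h1 (by norm_num)
    calc ℓ ^ 6 * (max T0 (c * (s * ℓ) ^ (1 + ε T)) + 1)
        ≤ ℓ ^ 6 * ((1 + c) * (s * ℓ * W)) := by gcongr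
      _ = (1 + c) * (s * ℓ ^ 7 * W) := by ring
      _ ≤ _ := by gcongr
  have i₃ : ℓ ^ 10 * ((T + 1) / max T0 (c * (s * ℓ) ^ (1 + ε T))) ≤
      2 / c * (s * ℓ ^ 10 * W) := by
    refine (mul_le_mul_of_nonneg_left hx₂ (by positivity)).trans (le_of_eq ?_)
    ring
  have h0 : 0 ≤ s * ℓ ^ 10 * W := by positivity
  calc G * (s * ℓ ^ 4 + ℓ ^ 6 * (max T0 (c * (s * ℓ) ^ (1 + ε T)) + 1) +
        ℓ ^ 10 * ((T + 1) / max T0 (c * (s * ℓ) ^ (1 + ε T))))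
      ≤ G * ((2 + c + 2 / c) * (s * ℓ ^ 10 * W)) := by
        refine mul_le_mul_of_nonneg_left ?_ hG.le
        linarith
    _ = G * (2 + c + 2 / c) * (s * ℓ ^ 10 * W) := by ring
    _ ≤ ℓ * √(Real.log (1 / δ)) * (s * ℓ ^ 10 * W) := mul_le_mul_of_nonneg_right hℓG h0
    _ = √(T * Real.log (1 / δ)) * (ℓ ^ 11 * W) := by
        rw [Real.sqrt_mul (Nat.cast_nonneg T)]
        ring

/-- Exploration of length about `log T`, for a non-singular optimal closed loop. -/
lemma eventually_regretLE_log (h : Admissible κ γ αlo αhi S Q R M Θs)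
    (hU : IsUnit (closedLoop Q R Θs)) (hn : 1 ≤ n) (hκ : 1 ≤ κ)
    (hγ : 0 < γ) (hγ' : γ ≤ 1) (hα : 0 < αlo) {σ δ : ℝ} (hσ : 0 < σ) (hδ : 0 < δ) (hδ' : δ < 1)
    (T0 : ℝ) {c : ℝ} (hc : 0 < c) {ε : ℕ → ℝ} (hε : Tendsto ε atTop (𝓝 0))
    (hε' : Tendsto (fun T : ℕ => Real.log T ^ ε T) atTop atTop) :
    ∀ᶠ T : ℕ in atTop, RegretLE Q R M κ γ S σ Θs δ T (max T0 (c * Real.log T ^ (1 + ε T)))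
      (√(T * Real.log (1 / δ)) * Real.log T ^ 12) := by
  have hx := eventually_log_exploration hε T0 hc
  obtain ⟨G, hG, hreg⟩ := h.exists_regretLE_of_isUnit hU hn hκ hγ hγ' hα hσ hδ hδ'
    (tendsto_atTop_mono' _ (hx.mono fun T hT => hT.1) (hε'.const_mul_atTop hc))
    (hx.mono fun T hT => hT.2.1)
  have hL : 0 < Real.log (1 / δ) := Real.log_pos (by rw [lt_div_iff₀ hδ]; linarith)
  filter_upwards [hreg, hx, tendsto_log_natCast.eventually_ge_atTop 1,
    tendsto_log_natCast.eventually_ge_atTop (G * (4 + c) / √(Real.log (1 / δ))),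
    eventually_ge_atTop 1] with T hreg hx h1 hℓG hT
  have hT' : (1 : ℝ) ≤ T := by exact_mod_cast hT
  refine hreg.mono ?_
  obtain ⟨-, -, hx₁⟩ := hx
  set ℓ := Real.log T with hℓ
  set s := √(T : ℝ) with hs
  have hs0 : 0 ≤ s := Real.sqrt_nonneg _
  rw [div_le_iff₀ (Real.sqrt_pos.2 hL)] at hℓG
  have i₁ : s * ℓ ^ 4 ≤ s * ℓ ^ 11 := by
    have : ℓ ^ 4 ≤ ℓ ^ 11 := pow_le_pow_right₀ h1 (by norm_num)
    gcongr
  have i₂ : ℓ ^ 6 * (max T0 (c * ℓ ^ (1 + ε T)) + 1) ≤ (1 + c) * (s * ℓ ^ 11) := by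
    have : ℓ ^ 6 ≤ ℓ ^ 11 := pow_le_pow_right₀ h1 (by norm_num)
    calc ℓ ^ 6 * (max T0 (c * ℓ ^ (1 + ε T)) + 1) ≤ ℓ ^ 11 * ((1 + c) * s) := by
          gcongr
      _ = _ := by ring
  have i₃ : ℓ ^ 11 * √(T + 1 : ℝ) ≤ 2 * (s * ℓ ^ 11) := by
    have h2 : √(T + 1 : ℝ) ≤ 2 * s := by
      refine Real.sqrt_le_iff.2 ⟨by positivity, ?_⟩
      rw [mul_pow, Real.sq_sqrt (by linarith)]
      linarith
    calc ℓ ^ 11 * √(T + 1 : ℝ) ≤ ℓ ^ 11 * (2 * s) := by gcongr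
      _ = _ := by ring
  have h0 : 0 ≤ s * ℓ ^ 11 := by positivity
  calc G * (s * ℓ ^ 4 + ℓ ^ 6 * (max T0 (c * ℓ ^ (1 + ε T)) + 1) + ℓ ^ 11 * √(T + 1 : ℝ))
      ≤ G * ((4 + c) * (s * ℓ ^ 11)) := by
        refine mul_le_mul_of_nonneg_left ?_ hG.le
        linarith
    _ = G * (4 + c) * (s * ℓ ^ 11) := by ring
    _ ≤ ℓ * √(Real.log (1 / δ)) * (s * ℓ ^ 11) := mul_le_mul_of_nonneg_right hℓG h0
    _ = √(T * Real.log (1 / δ)) * ℓ ^ 12 := by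
        rw [Real.sqrt_mul (Nat.cast_nonneg T)]
        ring

end Admissible

end TSAC

theorem theorem1 (κ γ αlo αhi S σ : ℝ) (hκ : 1 ≤ κ) (hγ : 0 < γ) (hγ' : γ ≤ 1)
    (hα : 0 < αlo) (hσ : 0 < σ) :
    -- general systems, exploration of length `max (T0, c (√T log T)^(1 + o(1)))`
    (∃ (C : ℝ) (k : ℕ), ∀ (n d : ℕ), 1 ≤ n → 1 ≤ d →
      ∀ (Q : Matrix (Fin n) (Fin n) ℝ) (R : Matrix (Fin d) (Fin d) ℝ)
        (M : Set (TSAC.Sys n d)) (Θs : TSAC.Sys n d),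
        TSAC.Admissible κ γ αlo αhi S Q R M Θs →
      ∀ (δ : ℝ), 0 < δ → δ < 1 → ∀ (T0 c : ℝ), 0 < c →
      ∀ (ε : ℕ → ℝ), Tendsto ε atTop (𝓝 0) →
      ∀ᶠ T : ℕ in atTop,
        TSAC.RegretLE Q R M κ γ S σ Θs δ T
          (max T0 (c * (√(T : ℝ) * Real.log T) ^ (1 + ε T)))
          (C * ((n + d : ℕ) : ℝ) ^ (n + d) * √(T * Real.log (1 / δ)) *
            (Real.log T ^ k * (√(T : ℝ) * Real.log T) ^ |ε T|))) ∧
    -- non-singular optimal closed loop, exploration of length `max (T0, c (log T)^(1 + o(1)))`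
    (∃ (C : ℝ) (m k : ℕ), ∀ (n d : ℕ), 1 ≤ n → 1 ≤ d →
      ∀ (Q : Matrix (Fin n) (Fin n) ℝ) (R : Matrix (Fin d) (Fin d) ℝ)
        (M : Set (TSAC.Sys n d)) (Θs : TSAC.Sys n d),
        TSAC.Admissible κ γ αlo αhi S Q R M Θs →
        IsUnit (TSAC.closedLoop Q R Θs) →
      ∀ (δ : ℝ), 0 < δ → δ < 1 → ∀ (T0 c : ℝ), 0 < c →
      ∀ (ε : ℕ → ℝ), Tendsto ε atTop (𝓝 0) →
        Tendsto (fun T : ℕ => Real.log T ^ ε T) atTop atTop →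
      ∀ᶠ T : ℕ in atTop,
        TSAC.RegretLE Q R M κ γ S σ Θs δ T
          (max T0 (c * Real.log T ^ (1 + ε T)))
          (C * ((n + d : ℕ) : ℝ) ^ m * √(T * Real.log (1 / δ)) * Real.log T ^ k)) := by
  -- "Large enough" `T` absorbs every constant that depends on the data into one factor `log T`, so that
  -- `C = 1` and `m = 0` will do.
  refine ⟨⟨1, 11, ?_⟩, ⟨1, 0, 12, ?_⟩⟩
  · intro n d hn _ Q R M Θs h δ hδ hδ' T0 c hc ε hε
    filter_upwards [h.eventually_regretLE_sqrt hn hκ hγ hγ' hα hσ hδ hδ' T0 hc hε,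
      TSAC.tendsto_log_natCast.eventually_ge_atTop 0] with T hT hℓ
    have h1 : (1 : ℝ) ≤ ((n + d : ℕ) : ℝ) ^ (n + d) :=
      one_le_pow₀ (by exact_mod_cast hn.trans (Nat.le_add_right n d))
    refine hT.mono ?_
    rw [one_mul, mul_assoc]
    exact le_mul_of_one_le_left (by positivity) h1
  · intro n d hn _ Q R M Θs h hU δ hδ hδ' T0 c hc ε hε hε'
    filter_upwards [h.eventually_regretLE_log hU hn hκ hγ hγ' hα hσ hδ hδ' T0 hc hε hε'] with T hT
    simpa using hT
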